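/- **Setting.** Let $\nu>0$, $\Omega\in\mathbb R$. In the channel $\mathbb T^2\times(0,1)$ ($\mathbb T=\mathbb R/\mathbb Z$) consider the vertically viscous primitive equations for the horizontal velocity $\mathcal V=(u,v)$, the vertical velocity $w$ and the pressure $p$, $$\partial_t\mathcal V+\mathcal V\cdot\nabla\mathcal V+w\,\partial_z\mathcal V-\nu\,\partial_{zz}\mathcal V+\Omega\mathcal V^\perp+\nabla p=0,\qquad \partial_z p=0,\qquad \nabla\cdot\mathcal V+\partial_z w=0,$$ with $\mathcal V|_{t=0}=\mathcal V_0$ and $(\partial_z\mathcal V,w)|_{z=0,1}=0$, where $\nabla=(\partial_x,\partial_y)$ and $\mathcal V^\perp=(-v,u)$. Extend $\mathcal V$ evenly and $w$ oddly in $z$ to the torus $\mathbb T^2\times(\mathbb R/2\mathbb Z)$; the system then holds on this torus and the boundary conditions are contained in the parities. A *solution* on $[0,T]$ is a real $\mathcal V\in L^2$, even in $z$, for which there are $w\in L^2$, odd in $z$, and an integrable $p=p(t,x,y)$ such that the equations (transport term in the form $\nabla\cdot(\mathcal V\otimes\mathcal V)+\partial_z(w\mathcal V)$) and the initial condition hold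 on the torus in the sense of distributions. For $\boldsymbol k\in2\pi\mathbb Z^2$, $k_3\in\pi\mathbb Z$ let $\hat f_{\boldsymbol k,k_3}$ be the Fourier coefficients of $f$ with respect to the normalized measure of the torus. $\mathcal S_{r,s,\tau,\eta}$ is the set of $f\in L^2$, even in $z$, with $$\|f\|_{r,s,\tau,\eta}^2=\sum_{\boldsymbol k,k_3}\Big(1+(|\boldsymbol k|^{2r}+|k_3|^{2s})e^{2\tau|\boldsymbol k|}e^{2\eta|k_3|}\Big)|\hat f_{\boldsymbol k,k_3}|^2<\infty$$ (with $0^0=1$). Put $\eta(t)=\frac{\nu}{2}t$. **Theorem.** Let $r>2$. There is a constant $C>0$ depending only on $r$ such that the following holds for all $\nu,\tau_0>0$, $\Omega\in\mathbb R$. Let $\mathcal V_0\in\mathcal S_{r,0,\tau_0,0}$ be real with $\nabla\cdot\int_0^1\mathcal V_0\,dz=0$, let $M=\|\mathcal V_0\|_{r,0,\tau_0,0}$, and let $\mathcal T>0$ be any time, not depending on $\Omega$, with $$C\Big(M\Big(\mathcal T+\sqrt{\tfrac{2\mathcal T}{\nu}}\Big)+\frac{M^2}{\nu}\mathcal T\Big)\le\frac{\tau_0}{2}.$$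 1. There are $\mathcal V\in C([0,\mathcal T];L^2)$ with $\mathcal V(0)=\mathcal V_0$ and $\tau:[0,\mathcal T]\to[\tau_0/2,\tau_0]$ such that $\mathcal V$ is a solution on $[0,\mathcal T]$ with initial value $\mathcal V_0$, $$\mathcal V\in L^\infty(0,\mathcal T;\mathcal S_{r,0,\tau(t),\eta(t)})\cap L^2(0,\mathcal T;\mathcal S_{r,1,\tau(t),\eta(t)}),$$ and, with $E(s)=\|\mathcal V(s)\|^2_{r,0,\tau(s),\eta(s)}$ and $F(s)=\|\partial_z\mathcal V(s)\|^2_{r,0,\tau(s),\eta(s)}$, for all $t\in[0,\mathcal T]$, $$\tau(t)=\tau_0-C\int_0^t\Big(E^{1/2}+F^{1/2}+\frac1\nu E\Big)ds\ \ge\ \tau_0-C\Big(M\Big(t+\sqrt{\tfrac{2t}{\nu}}\Big)+\frac{M^2}{\nu}t\Big),$$ the integral being finite. 2. $\mathcal V$ is the unique solution on $[0,\mathcal T]$ with initial value $\mathcal V_0$ in this class (for these $\tau,\eta$). 3. For every $t\in(0,\mathcal T]$, $\mathcal V(t)$ is real analytic in all spatial variables on the torus. 4. $\mathcal V$ depends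 continuously on $\mathcal V_0$: there is $K=K(r,\nu,\tau_0)$ such that if $\mathcal T$ satisfies the above condition for two initial data, then the corresponding solutions and radii $(\mathcal V_1,\tau_1)$, $(\mathcal V_2,\tau_2)$ satisfy, for all $t\in[0,\mathcal T]$, $$\|\mathcal V_1(t)-\mathcal V_2(t)\|^2_{r-\frac12,0,\,\tau_1(t)+\tau_2(t)-\tau_0,\,\eta(t)}\le K\,\|\mathcal V_1(0)-\mathcal V_2(0)\|^2_{r-\frac12,0,\tau_0,0}.$$ -/

import Mathlib

open Set Filter Topology MeasureTheory
open scoped ENNReal NNReal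

noncomputable section

namespace PrimEq

/-- A point `(x, y, z)`: two horizontal variables and the vertical one. -/
abbrev Pt := ℝ × ℝ × ℝ

/-- Horizontal velocities `(u, v)`. -/
abbrev Vel := EuclideanSpace ℝ (Fin 2)

/-- A fundamental cell of the torus `(ℝ / ℤ) × (ℝ / ℤ) × (ℝ / 2ℤ)`. The channel is the part `0 < z < 1`;
the even extension in `z` of a function on the channel is a function on this torus. A function on the
torus is represented by a function on `Pt` of which only the values in the cell matter. -/
def cell : Set Pt := Ioo (0 : ℝ) 1 ×ˢ Ioo (0 : ℝ) 1 ×ˢ Ioo (-1 : ℝ) 1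

/-- Lebesgue measure on the cell (total mass `2`). -/
def cellMeasure : Measure Pt := volume.restrict cell

/-- The space-time domain `(0, T) × cell`; a point is `(t, x, y, z)`. -/
def slabMeasure (T : ℝ) : Measure (ℝ × Pt) := volume.restrict (Ioo (0 : ℝ) T ×ˢ cell)

/-- The reflection `z ↦ -z`. -/
def reflect (q : Pt) : Pt := (q.1, q.2.1, -q.2.2)

/-- `(u, v)^⊥ = (-v, u)`. -/
def perp (a : Vel) : Vel := !₂[-(a 1), a 0]

/-! ### The spaces `S_{r,s,τ,η}` -/

/-- Length of the horizontal wave vector `2π (k₁, k₂)`. -/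
def kh (k : ℤ × ℤ × ℤ) : ℝ := 2 * Real.pi * √((k.1 : ℝ) ^ 2 + (k.2.1 : ℝ) ^ 2)

/-- Modulus of the vertical wave number `π k₃` (the vertical period is `2`). -/
def kz (k : ℤ × ℤ × ℤ) : ℝ := Real.pi * |(k.2.2 : ℝ)|

/-- Fourier coefficients with respect to the normalized measure of the torus. For an even function
they are `∫ e^{-2πi(k₁x+k₂y)} cos (π k₃ z) f` over the channel. -/
def coeff (f : Pt → ℝ) (k : ℤ × ℤ × ℤ) : ℂ :=
  (1 / 2 : ℂ) * ∫ q, Complex.exp (-Complex.I *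
    ((2 * Real.pi * k.1 * q.1 + 2 * Real.pi * k.2.1 * q.2.1 + Real.pi * k.2.2 * q.2.2 : ℝ) : ℂ)) *
      (f q : ℂ) ∂cellMeasure

/-- `|f̂_k|²` for a vector field. -/
def coeffSq (f : Pt → Vel) (k : ℤ × ℤ × ℤ) : ℝ≥0∞ :=
  ∑ i : Fin 2, ‖coeff (fun q => f q i) k‖ₑ ^ 2

/-- The multiplier `1 + (|k|^{2r} + |k₃|^{2s}) e^{2τ|k|} e^{2η|k₃|}`. -/
def weight (r : ℝ) (s : ℕ) (τ η : ℝ) (k : ℤ × ℤ × ℤ) : ℝ :=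
  1 + (kh k ^ (2 * r) + kz k ^ (2 * s)) * Real.exp (2 * τ * kh k) * Real.exp (2 * η * kz k)

/-- `‖f‖²_{r,s,τ,η}`. -/
def normSq (r : ℝ) (s : ℕ) (τ η : ℝ) (f : Pt → Vel) : ℝ≥0∞ :=
  ∑' k : ℤ × ℤ × ℤ, ENNReal.ofReal (weight r s τ η k) * coeffSq f k

/-- `‖∂_z f‖²_{r,0,τ,η}`. -/
def dzNormSq (r τ η : ℝ) (f : Pt → Vel) : ℝ≥0∞ :=
  ∑' k : ℤ × ℤ × ℤ, ENNReal.ofReal (kz k ^ 2 * weight r 0 τ η k) * coeffSq f k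

/-- `f ∈ S_{r,s,τ,η}`. -/
structure MemS (r : ℝ) (s : ℕ) (τ η : ℝ) (f : Pt → Vel) : Prop where
  memLp : MemLp f 2 cellMeasure
  even : ∀ᵐ q ∂cellMeasure, f (reflect q) = f q
  norm_lt_top : normSq r s τ η f < ⊤

/-- Initial data: elements of `S_{r,0,τ₀,0}` whose vertical mean is divergence free (in the sense of
distributions on the horizontal torus). -/
structure IsInitialDatum (r τ₀ : ℝ) (V₀ : Pt → Vel) : Prop where
  memS : MemS r 0 τ₀ 0 V₀
  div_free : ∀ ψ : ℝ × ℝ → ℝ, ContDiff ℝ (⊤ : ℕ∞) ψ →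
    (∀ x y, ψ (x + 1, y) = ψ (x, y) ∧ ψ (x, y + 1) = ψ (x, y)) →
    ∫ q, (V₀ q 0 * fderiv ℝ ψ (q.1, q.2.1) (1, 0) +
      V₀ q 1 * fderiv ℝ ψ (q.1, q.2.1) (0, 1)) ∂cellMeasure = 0

/-! ### Weak solutions -/

/-- Smooth functions of `(t, x, y, z)` that live on the torus for every `t`. -/
structure IsTest (φ : ℝ × Pt → ℝ) : Prop where
  smooth : ContDiff ℝ (⊤ : ℕ∞) φ
  periodic : ∀ t x y z, φ (t, x + 1, y, z) = φ (t, x, y, z) ∧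
    φ (t, x, y + 1, z) = φ (t, x, y, z) ∧ φ (t, x, y, z + 2) = φ (t, x, y, z)

def dt (φ : ℝ × Pt → ℝ) (p : ℝ × Pt) : ℝ := fderiv ℝ φ p (1, 0, 0, 0)

/-- `∂_x` for `j = 0` and `∂_y` for `j = 1`. -/
def dh (j : Fin 2) (φ : ℝ × Pt → ℝ) (p : ℝ × Pt) : ℝ :=
  fderiv ℝ φ p (![((0, 1, 0, 0) : ℝ × Pt), (0, 0, 1, 0)] j)

def dz (φ : ℝ × Pt → ℝ) (p : ℝ × Pt) : ℝ := fderiv ℝ φ p (0, 0, 0, 1)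

/-- `∇ · V + ∂_z w = 0` on the torus, in the sense of distributions. -/
def WeakContinuity (T : ℝ) (V : ℝ → Pt → Vel) (w : ℝ → Pt → ℝ) : Prop :=
  ∀ ψ : ℝ × Pt → ℝ, IsTest ψ →
    ∫ p : ℝ × Pt, ((∑ j : Fin 2, V p.1 p.2 j * dh j ψ p) + w p.1 p.2 * dz ψ p) ∂slabMeasure T = 0

/-- `∂_t V + V · ∇ V + w ∂_z V - ν ∂_zz V + Ω V^⊥ + ∇ P = 0`, `V(0) = V₀`, with `P` independent of `z`,
in the sense of distributions: the equation is multiplied by a test field vanishing for `t` near `T`,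
and all derivatives are moved to the test field (by `∇ · V + ∂_z w = 0`, the transport term is
`∇ · (V ⊗ V) + ∂_z (w V)`). -/
def WeakMomentum (ν Ω T : ℝ) (V₀ : Pt → Vel) (V : ℝ → Pt → Vel) (w : ℝ → Pt → ℝ)
    (P : ℝ → ℝ × ℝ → ℝ) : Prop :=
  ∀ φ : Fin 2 → ℝ × Pt → ℝ, (∀ i, IsTest (φ i)) →
    (∃ T' < T, ∀ i t q, T' ≤ t → φ i (t, q) = 0) →
    ∫ p : ℝ × Pt, (∑ i : Fin 2,
        (V p.1 p.2 i * dt (φ i) p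
          + (∑ j : Fin 2, V p.1 p.2 i * V p.1 p.2 j * dh j (φ i) p)
          + w p.1 p.2 * V p.1 p.2 i * dz (φ i) p
          + ν * V p.1 p.2 i * dz (dz (φ i)) p
          - Ω * perp (V p.1 p.2) i * φ i p
          + P p.1 (p.2.1, p.2.2.1) * dh i (φ i) p)) ∂slabMeasure T
      + ∫ q, (∑ i : Fin 2, V₀ q i * φ i (0, q)) ∂cellMeasure = 0

/-- Weak solutions on `[0, T]` of the primitive equations with initial value `V₀`. The boundary
conditions `∂_z V = 0`, `w = 0` at `z = 0, 1` are expressed by the parities: on the torus, `V` is even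
and `w` is odd in `z`. -/
structure IsWeakSolution (ν Ω T : ℝ) (V₀ : Pt → Vel) (V : ℝ → Pt → Vel) : Prop where
  memLp : MemLp (fun p : ℝ × Pt => V p.1 p.2) 2 (slabMeasure T)
  even : ∀ᵐ p ∂slabMeasure T, V p.1 (reflect p.2) = V p.1 p.2
  equations : ∃ (w : ℝ → Pt → ℝ) (P : ℝ → ℝ × ℝ → ℝ),
    MemLp (fun p : ℝ × Pt => w p.1 p.2) 2 (slabMeasure T) ∧
    (∀ᵐ p ∂slabMeasure T, w p.1 (reflect p.2) = -w p.1 p.2) ∧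
    Integrable (fun p : ℝ × Pt => P p.1 (p.2.1, p.2.2.1)) (slabMeasure T) ∧
    WeakContinuity T V w ∧ WeakMomentum ν Ω T V₀ V w P

/-! ### The class of analytic solutions -/

/-- The vertical radius of analyticity. -/
def verticalRadius (ν t : ℝ) : ℝ := ν / 2 * t

/-- `V ∈ L^∞(0,T; S_{r,0,τ(t),η(t)}) ∩ L²(0,T; S_{r,1,τ(t),η(t)})` with `η(t) = νt/2`. -/
structure InAnalyticClass (r ν T : ℝ) (τ : ℝ → ℝ) (V : ℝ → Pt → Vel) : Prop where
  memS : ∀ᵐ t ∂volume.restrict (Ioo 0 T), MemS r 0 (τ t) (verticalRadius ν t) (V t) ∧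
    MemS r 1 (τ t) (verticalRadius ν t) (V t)
  bounded : ∃ M : ℝ≥0, ∀ᵐ t ∂volume.restrict (Ioo 0 T),
    normSq r 0 (τ t) (verticalRadius ν t) (V t) ≤ M
  square_integrable : ∫⁻ t in Ioo 0 T, normSq r 1 (τ t) (verticalRadius ν t) (V t) < ⊤

/-- `V ∈ C([0,T]; L²)` with `V(0) = V₀`. -/
structure IsContinuousFrom (T : ℝ) (V₀ : Pt → Vel) (V : ℝ → Pt → Vel) : Prop where
  memLp : ∀ t ∈ Icc 0 T, MemLp (V t) 2 cellMeasure
  tendsto : ∀ t ∈ Icc 0 T,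
    Tendsto (fun s => eLpNorm (V s - V t) 2 cellMeasure) (𝓝[Icc 0 T] t) (𝓝 0)
  initial : V 0 =ᵐ[cellMeasure] V₀

/-- `E^{1/2} + F^{1/2} + E / ν` with `E = ‖f‖²_{r,0,τ,η}` and `F = ‖∂_z f‖²_{r,0,τ,η}`. -/
def lossRate (r ν τ η : ℝ) (f : Pt → Vel) : ℝ≥0∞ :=
  normSq r 0 τ η f ^ (1 / 2 : ℝ) + dzNormSq r τ η f ^ (1 / 2 : ℝ)
    + normSq r 0 τ η f / ENNReal.ofReal ν

/-- `‖V₀‖_{r,0,τ₀,0}`. -/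
def dataNorm (r τ₀ : ℝ) (V₀ : Pt → Vel) : ℝ := √(normSq r 0 τ₀ 0 V₀).toReal

/-- The a priori bound `C (M (t + √(2t/ν)) + M² t / ν)` for the loss of horizontal radius up to time `t`
for data of norm `M`. -/
def maxLoss (C ν M t : ℝ) : ℝ := C * (M * (t + √(2 * t / ν)) + M ^ 2 * t / ν)

/-- `τ` is the horizontal radius of analyticity of `V`: it solves the implicit equation
`τ(t) = τ₀ - C ∫₀ᵗ (E^{1/2} + F^{1/2} + E/ν) ds`, where `E` and `F` are taken at `V(s)` with the radii
`τ(s)`, `η(s) = νs/2`, and it stays above the explicit a priori bound and above `τ₀/2`. -/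
structure IsHorizontalRadius (C r ν τ₀ T : ℝ) (V₀ : Pt → Vel) (V : ℝ → Pt → Vel) (τ : ℝ → ℝ) :
    Prop where
  finite : ∫⁻ s in Ioo 0 T, lossRate r ν (τ s) (verticalRadius ν s) (V s) < ⊤
  eq : ∀ t ∈ Icc 0 T,
    τ t = τ₀ - C * (∫⁻ s in Ioo 0 t, lossRate r ν (τ s) (verticalRadius ν s) (V s)).toReal
  lower : ∀ t ∈ Icc 0 T, τ₀ - maxLoss C ν (dataNorm r τ₀ V₀) t ≤ τ t
  half : ∀ t ∈ Icc 0 T, τ₀ / 2 ≤ τ t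

/-- `V` is a solution on `[0,T]` with initial value `V₀` and with radii of analyticity `τ(t)`, `νt/2`. -/
structure IsAnalyticSolution (C r ν Ω τ₀ T : ℝ) (V₀ : Pt → Vel) (V : ℝ → Pt → Vel) (τ : ℝ → ℝ) :
    Prop where
  sol : IsWeakSolution ν Ω T V₀ V
  cont : IsContinuousFrom T V₀ V
  cls : InAnalyticClass r ν T τ V
  radius : IsHorizontalRadius C r ν τ₀ T V₀ V τ

/-- `f` is (up to a null set) real analytic on the torus in all variables, and even in `z`. -/
def IsAnalyticField (f : Pt → Vel) : Prop :=
  ∃ g : Pt → Vel, AnalyticOnNhd ℝ g univ ∧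
    (∀ x y z, g (x + 1, y, z) = g (x, y, z) ∧ g (x, y + 1, z) = g (x, y, z) ∧
      g (x, y, z + 2) = g (x, y, z) ∧ g (x, y, -z) = g (x, y, z)) ∧
    f =ᵐ[cellMeasure] g

end PrimEq

end

noncomputable section

namespace PrimEq
open scoped Real ComplexConjugate
open ENNReal (ofReal ofReal_mul mul_lt_top ofReal_le_ofReal tsum_le_tsum ofReal_lt_top add_lt_top
ofReal_pow ofReal_add ofReal_ne_top toReal_nonneg mul_rpow_of_nonneg tsum_add rpow_le_rpow
ofReal_toReal tendsto_ofReal rpow_lt_top_of_nonneg tsum_prod ofReal_sum_of_nonneg ofReal_one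
div_lt_top toReal_ofReal toReal_mono rpow_mul tsum_comm ofReal_zero ofReal_ofNat ofReal_div_of_pos
div_le_div_right le_tsum)
open Real (exp exp_pos sq_sqrt norm_eq_abs exp_add sqrt_nonneg one_le_exp rpow_nonneg volume_Ioo
sqrt_mul one_le_sqrt one_le_rpow mul_self_sqrt sqrt_eq_rpow sqrt_sq mul_rpow rpow_add dist_eq)
open Complex (I norm_real ofRealCLM conj_ofReal add_re norm_I reCLM I_mul_I zero_re conj_eq_iff_re
continuous_conj coe_smul conj_I)
open EuclideanSpace (proj single norm_sq_eq)
open Finset (sum_nonneg mul_sum sum_congr sum_le_sum)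
open MeasureTheory.Measure (restrict_mono restrict_apply_univ volume_eq_prod prod_prod
prod_restrict)
open intervalIntegral (integral_of_le continuousOn_primitive_interval' integral_congr integral_same
integral_interval_sub_left)
local notation:max "½" => (1 / 2 : ℝ)
local notation "μc" => cellMeasure
local notation "μs" => slabMeasure
local notation "ACOn" => AbsolutelyContinuousOnInterval
local notation "𝕋" => UnitAddCircle
local notation:max "D[" a ", " b "]" => fun k => ‖a k - b k‖ₑ
local notation:max "pos!" => by positivity
local notation:max "num!" => by norm_num
local notation:max "lin!" => by linarith
local notation:max "N[" a "]" => fun k => ‖a k‖ₑ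
local notation:max "vol[" T "]" => Measure.restrict (volume : Measure ℝ) (Ioo 0 T)

/-! ### Wave numbers -/

abbrev Mode := ℤ × ℤ × ℤ

local notation:max "Amp" => Mode → ℝ≥0∞

variable {α E F : Type*} [MeasurableSpace α] {μ : Measure α} [NormedAddCommGroup E] [NormedSpace ℝ E]
  [NormedAddCommGroup F] [NormedSpace ℝ F]
variable {S : Finset Mode} {k j l : Mode} {w : Mode → ℝ} {V₀ : Pt → Vel} {f g : Pt → ℂ} {r x c τ η b
d M R t e K t₀ t₁ C ν Ω T B τ₀ τ' : ℝ} {ψ : ℝ × Pt → ℝ} {V : ℝ → Pt → Vel} {s χ σ ρ : ℝ → ℝ}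

lemma kh_nonneg (k) : 0 ≤ kh k := by unfold kh; positivity

lemma kz_nonneg (k) : 0 ≤ kz k := by unfold kz; positivity

lemma kh_neg (k) : kh (-k) = kh k := by simp [kh]

lemma kz_neg (k) : kz (-k) = kz k := by simp [kz]

lemma kz_add_le (k j) : kz (k + j) ≤ kz k + kz j := by
  unfold kz
  rw [← mul_add]
  gcongr
  push_cast [Prod.snd_add]
  exact abs_add_le _ _

lemma sqrt_sq_add_sq_eq_norm (x y) : √(x ^ 2 + y ^ 2) = ‖(!₂[x, y] : EuclideanSpace ℝ (Fin 2))‖ := by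
  simp [EuclideanSpace.norm_eq]

lemma kh_add_le (k j) : kh (k + j) ≤ kh k + kh j := by
  unfold kh
  rw [← mul_add]
  gcongr
  rw [sqrt_sq_add_sq_eq_norm, sqrt_sq_add_sq_eq_norm, sqrt_sq_add_sq_eq_norm]
  refine le_trans (le_of_eq ?_) (norm_add_le _ _)
  congr 1
  ext i
  fin_cases i <;> simp

lemma kh_le_add (k j) : kh j ≤ kh (k + j) + kh k := by
  have := kh_add_le (k + j) (-k)
  rw [kh_neg] at this
  simpa using this

lemma kh_le_add' (k j) : kh k ≤ kh (k + j) + kh j := by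
  have := kh_le_add j k
  rwa [add_comm j k] at this

lemma abs_fst_le_kh (k) : |(k.1 : ℝ)| ≤ kh k := by
  unfold kh
  have h1 : |(k.1 : ℝ)| ≤ √((k.1 : ℝ) ^ 2 + (k.2.1 : ℝ) ^ 2) :=
    Real.abs_le_sqrt (by nlinarith [sq_nonneg (k.2.1 : ℝ)])
  nlinarith [Real.pi_gt_three, sqrt_nonneg ((k.1 : ℝ) ^ 2 + (k.2.1 : ℝ) ^ 2)]

lemma abs_snd_le_kh (k) : |(k.2.1 : ℝ)| ≤ kh k := by
  unfold kh
  have h1 : |(k.2.1 : ℝ)| ≤ √((k.1 : ℝ) ^ 2 + (k.2.1 : ℝ) ^ 2) :=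
    Real.abs_le_sqrt (by nlinarith [sq_nonneg (k.1 : ℝ)])
  nlinarith [Real.pi_gt_three, sqrt_nonneg ((k.1 : ℝ) ^ 2 + (k.2.1 : ℝ) ^ 2)]

lemma abs_trd_le_kz (k) : |(k.2.2 : ℝ)| ≤ kz k := by
  unfold kz
  nlinarith [Real.pi_gt_three, abs_nonneg (k.2.2 : ℝ)]

lemma one_le_abs_intCast {n : ℤ} (hn : n ≠ 0) : (1 : ℝ) ≤ |(n : ℝ)| := by
  rw [← Int.cast_abs]
  exact_mod_cast Int.one_le_abs hn

lemma kz_eq_zero_iff (k) : kz k = 0 ↔ k.2.2 = 0 := by simp [kz, Real.pi_ne_zero]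

lemma kz_eq_zero_or (k) : kz k = 0 ∨ 1 ≤ kz k := by
  by_cases h : k.2.2 = 0
  · exact Or.inl ((kz_eq_zero_iff k).2 h)
  · exact Or.inr ((one_le_abs_intCast h).trans (abs_trd_le_kz k))

lemma kz_le_sq (k) : kz k ≤ kz k ^ 2 := by
  rcases kz_eq_zero_or k with h | h
  · simp [h]
  · nlinarith

lemma kh_eq_zero_iff (k) : kh k = 0 ↔ k.1 = 0 ∧ k.2.1 = 0 := by
  constructor
  · intro h
    have h1 := abs_fst_le_kh k
    have h2 := abs_snd_le_kh k
    rw [h] at h1 h2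
    simpa using And.intro (abs_nonpos_iff.1 h1) (abs_nonpos_iff.1 h2)
  · rintro ⟨h1, h2⟩
    simp [kh, h1, h2]

lemma kh_eq_zero_or (k) : kh k = 0 ∨ 1 ≤ kh k := by
  by_cases h1 : k.1 = 0
  · by_cases h2 : k.2.1 = 0
    · exact Or.inl ((kh_eq_zero_iff k).2 ⟨h1, h2⟩)
    · exact Or.inr ((one_le_abs_intCast h2).trans (abs_snd_le_kh k))
  · exact Or.inr ((one_le_abs_intCast h1).trans (abs_fst_le_kh k))

/-! ### Summable decay on the lattice -/

/-- Decay in the horizontal wave number, square summable over `ℤ²` for `r > 2`. -/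
def hDecay (r : ℝ) (k : Mode) : ℝ := (1 + kh k) ^ (1 - r)

/-- Decay in the vertical wave number, square summable over `ℤ`. -/
def vDecay (k : Mode) : ℝ := (1 + kz k)⁻¹

lemma hDecay_pos (r) (k) : 0 < hDecay r k := Real.rpow_pos_of_pos (by linarith [kh_nonneg k]) _

lemma vDecay_pos (k) : 0 < vDecay k := inv_pos.2 (by linarith [kz_nonneg k])

def lineDecay (s : ℝ) (n : ℤ) : ℝ≥0∞ := ofReal ((1 + |(n : ℝ)|) ^ (-s))

lemma tsum_lineDecay_lt_top {s} (hs : 1 < s) : ∑' n : ℤ, lineDecay s n < ⊤ := by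
  unfold lineDecay
  have hnat : Summable fun n : ℕ => (1 + (n : ℝ)) ^ (-s) := by
    have := (summable_nat_add_iff 1).2 (Real.summable_nat_rpow.2 (by linarith : -s < -1))
    refine this.congr fun n => ?_
    push_cast
    rw [add_comm]
  have : Summable fun n : ℤ => (1 + |(n : ℝ)|) ^ (-s) := by
    rw [summable_int_iff_summable_nat_and_neg]
    constructor
    · simpa using hnat
    · simpa using hnat
  rw [← ENNReal.ofReal_tsum_of_nonneg (fun n => by positivity) this]
  exact ofReal_lt_top

lemma hDecay_sq_le (hr : 2 < r) (k) :
    ofReal (hDecay r k ^ 2) ≤ lineDecay (r - 1) k.1 * lineDecay (r - 1) k.2.1 := by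
  unfold lineDecay hDecay
  rw [← ofReal_mul pos!]
  apply ofReal_le_ofReal
  rw [pow_two, neg_sub]
  have h1 := abs_fst_le_kh k
  have h2 := abs_snd_le_kh k
  refine mul_le_mul ?_ ?_ (hDecay_pos r k).le pos!
  · exact Real.rpow_le_rpow_of_nonpos pos! lin! lin!
  · exact Real.rpow_le_rpow_of_nonpos pos! lin! lin!

lemma vDecay_sq_le (k) : ofReal (vDecay k ^ 2) ≤ lineDecay 2 k.2.2 := by
  unfold lineDecay vDecay
  apply ofReal_le_ofReal
  rw [Real.rpow_neg pos!, inv_pow]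
  have h := abs_trd_le_kz k
  have : (1 + |(k.2.2 : ℝ)|) ^ (2 : ℝ) = (1 + |(k.2.2 : ℝ)|) ^ 2 := by norm_cast
  rw [this]
  gcongr

/-- The sum over the lattice of the squared decay in both directions. -/
def latticeConst (r : ℝ) : ℝ≥0∞ :=
  (∑' n : ℤ, lineDecay (r - 1) n) * ((∑' n : ℤ, lineDecay (r - 1) n) * ∑' n : ℤ, lineDecay 2 n)

lemma latticeConst_lt_top (hr : 2 < r) : latticeConst r < ⊤ := by
  have h1 := tsum_lineDecay_lt_top (s := r - 1) lin!
  have h2 := tsum_lineDecay_lt_top (s := 2) num!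
  exact mul_lt_top h1 (mul_lt_top h1 h2)

lemma tsum_mode_prod (f g h : ℤ → ℝ≥0∞) :
    ∑' k : Mode, f k.1 * (g k.2.1 * h k.2.2) = (∑' n, f n) * ((∑' n, g n) * ∑' n, h n) := by
  rw [tsum_prod (f := fun (a : ℤ) (b : ℤ × ℤ) => f a * (g b.1 * h b.2))]
  simp_rw [ENNReal.tsum_mul_left]
  rw [ENNReal.tsum_mul_right]
  congr 1
  rw [tsum_prod (f := fun (a : ℤ) (b : ℤ) => g a * h b)]
  simp_rw [ENNReal.tsum_mul_left]
  rw [ENNReal.tsum_mul_right]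

lemma tsum_decay_sq_le (hr : 2 < r) (s t : Mode → Mode)
    (e₁ e₂ e₃ : ℤ ≃ ℤ) (h₁ : ∀ k, (s k).1 = e₁ k.1) (h₂ : ∀ k, (s k).2.1 = e₂ k.2.1)
    (h₃ : ∀ k, (t k).2.2 = e₃ k.2.2) : ∑' k, ofReal ((hDecay r (s k) * vDecay (t k)) ^ 2) ≤ latticeConst r := by
  have : ∀ k, ofReal ((hDecay r (s k) * vDecay (t k)) ^ 2) ≤
    lineDecay (r - 1) (e₁ k.1) * (lineDecay (r - 1) (e₂ k.2.1) * lineDecay 2 (e₃ k.2.2)) := fun k => by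
    rw [mul_pow, ofReal_mul pos!, ← mul_assoc, ← h₁, ← h₂, ← h₃]
    exact mul_le_mul' (hDecay_sq_le hr _) (vDecay_sq_le _)
  refine (tsum_le_tsum this).trans (le_of_eq ?_)
  rw [tsum_mode_prod (fun n => lineDecay (r - 1) (e₁ n)) (fun n => lineDecay (r - 1) (e₂ n))
    (fun n => lineDecay 2 (e₃ n)), e₁.tsum_eq (lineDecay (r - 1)), e₂.tsum_eq (lineDecay (r - 1)),
    e₃.tsum_eq (lineDecay 2)]
  rfl

/-! ### Weighted square sums and the Schur test -/

/-- `(∑ (w_k A_k)²)^{1/2}`. -/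
def wnorm (w : Mode → ℝ) (A : Amp) : ℝ≥0∞ := (∑' k, (ofReal (w k) * A k) ^ 2) ^ ½

lemma tsum_mul_le_sqrt {ι : Type*} (X Y : ι → ℝ≥0∞) :
    ∑' i, X i * Y i ≤ (∑' i, X i ^ 2) ^ ½ * (∑' i, Y i ^ 2) ^ ½ := by
  let _ : MeasurableSpace ι := ⊤
  have := ENNReal.lintegral_mul_le_Lp_mul_Lq (μ := Measure.count)
    (Real.HolderConjugate.two_two) (f := X) (g := Y)
    measurable_from_top.aemeasurable measurable_from_top.aemeasurable
  simpa [lintegral_count] using this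

lemma ennreal_sqrt_mul_self (x : ℝ≥0∞) : x ^ ½ * x ^ ½ = x := by
  rw [← ENNReal.rpow_add_of_nonneg _ _ num! num!]
  norm_num

lemma ennreal_sqrt_sq (x : ℝ≥0∞) : (x ^ ½) ^ 2 = x := by rw [pow_two, ennreal_sqrt_mul_self]

lemma ennreal_sq_sqrt (x : ℝ≥0∞) : (x ^ 2) ^ ½ = x := by
  rw [← ENNReal.rpow_natCast, ← rpow_mul]
  norm_num

/-- Pairs `(k, j)` are pairs `(k, k + j)`. -/
def shearEquiv : Mode × Mode ≃ Mode × Mode where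
  toFun p := (p.1, p.1 + p.2)
  invFun p := (p.1, p.2 - p.1)
  left_inv p := by simp
  right_inv p := by simp

lemma tsum_shear (F : Mode → Amp) : ∑' p : Mode × Mode, F p.1 (p.1 + p.2) = ∑' k, ∑' l, F k l := by
  rw [← tsum_prod]
  exact shearEquiv.tsum_eq (fun p : Mode × Mode => F p.1 p.2)

lemma tsum_pair_mul (F G : Amp) : ∑' p : Mode × Mode, F p.1 * G p.2 = (∑' k, F k) * ∑' k, G k := by
  rw [tsum_prod (f := fun a b => F a * G b)]
  simp_rw [ENNReal.tsum_mul_left]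
  rw [ENNReal.tsum_mul_right]

lemma tsum_pair_mul_shear (F G : Amp) :
    ∑' p : Mode × Mode, F p.1 * G (p.1 + p.2) = (∑' k, F k) * ∑' k, G k := by
  rw [tsum_shear (fun a b => F a * G b)]
  simp_rw [ENNReal.tsum_mul_left]
  rw [ENNReal.tsum_mul_right]

lemma schur_pair (θ : Mode → Amp) (c : ℝ≥0∞) (hθ : ∀ l, ∑' k, θ k (l - k) ^ 2 ≤ c) (X Y Z : Amp) :
    ∑' p : Mode × Mode, θ p.1 p.2 * (X p.1 * Y p.2 * Z (p.1 + p.2)) ≤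
      c ^ ½ * ((∑' k, X k ^ 2) ^ ½ * (∑' k, Y k ^ 2) ^ ½ * (∑' k, Z k ^ 2) ^ ½) := by
  have h1 : ∀ p : Mode × Mode, θ p.1 p.2 * (X p.1 * Y p.2 * Z (p.1 + p.2)) =
    (X p.1 * Y p.2) * (θ p.1 p.2 * Z (p.1 + p.2)) := fun p => by ring
  simp_rw [h1]
  refine (tsum_mul_le_sqrt _ _).trans ?_
  simp_rw [mul_pow]
  rw [tsum_pair_mul (fun k => X k ^ 2) (fun k => Y k ^ 2)]
  have h2 : ∑' p : Mode × Mode, θ p.1 p.2 ^ 2 * Z (p.1 + p.2) ^ 2 ≤ c * ∑' k, Z k ^ 2 := by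
    have := tsum_shear (fun k l => θ k (l - k) ^ 2 * Z l ^ 2)
    simp only [add_sub_cancel_left] at this
    rw [this, tsum_comm, ← ENNReal.tsum_mul_left]
    simp_rw [ENNReal.tsum_mul_right]
    exact tsum_le_tsum fun l => mul_le_mul_left (hθ l) _
  calc _ ≤ ((∑' k, X k ^ 2) * ∑' k, Y k ^ 2) ^ ½ * (c * ∑' k, Z k ^ 2) ^ ½ := by gcongr
    _ = _ := by
      rw [mul_rpow_of_nonneg _ _ num!, mul_rpow_of_nonneg _ _ num!]
      ring

lemma schur_target (θ : Amp) (c : ℝ≥0∞) (hθ : ∑' k, θ k ^ 2 ≤ c) (X Y Z : Amp) :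
    ∑' p : Mode × Mode, θ (p.1 + p.2) * (X p.1 * Y p.2 * Z (p.1 + p.2)) ≤
      c ^ ½ * ((∑' k, X k ^ 2) ^ ½ * (∑' k, Y k ^ 2) ^ ½ * (∑' k, Z k ^ 2) ^ ½) := by
  have h1 : ∀ p : Mode × Mode, θ (p.1 + p.2) * (X p.1 * Y p.2 * Z (p.1 + p.2)) =
    (X p.1 * Z (p.1 + p.2)) * (Y p.2 * θ (p.1 + p.2)) := fun p => by ring
  simp_rw [h1]
  refine (tsum_mul_le_sqrt _ _).trans ?_
  simp_rw [mul_pow]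
  rw [tsum_pair_mul_shear (fun k => X k ^ 2) (fun k => Z k ^ 2)]
  have h2 : ∑' p : Mode × Mode, Y p.2 ^ 2 * θ (p.1 + p.2) ^ 2 ≤ c * ∑' k, Y k ^ 2 := by
    rw [← (Equiv.prodComm Mode Mode).tsum_eq]
    simp only [Equiv.prodComm_apply, Prod.fst_swap, Prod.snd_swap]
    simp_rw [add_comm (Prod.snd _)]
    rw [tsum_pair_mul_shear (fun k => Y k ^ 2) (fun k => θ k ^ 2), mul_comm]
    gcongr
  calc _ ≤ ((∑' k, X k ^ 2) * ∑' k, Z k ^ 2) ^ ½ * (c * ∑' k, Y k ^ 2) ^ ½ := by gcongr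
    _ = _ := by
      rw [mul_rpow_of_nonneg _ _ num!, mul_rpow_of_nonneg _ _ num!]
      ring

/-- The multipliers to which the Schur test applies. -/
def IsSchur (r : ℝ) (θ : Mode → Mode → ℝ) : Prop := (∀ k j, 0 ≤ θ k j) ∧
  ∀ (x y z : Mode → ℝ) (A B C : Amp), (∀ k, 0 ≤ x k) → (∀ k, 0 ≤ y k) → (∀ k, 0 ≤ z k) →
    ∑' p : Mode × Mode, ofReal (θ p.1 p.2 * (x p.1 * y p.2 * z (p.1 + p.2))) *
      (A p.1 * B p.2 * C (p.1 + p.2)) ≤ latticeConst r ^ ½ * (wnorm x A * wnorm y B * wnorm z C)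

lemma ofReal_trilinear_eq {θ y z} (hθ : 0 ≤ θ) (hx : 0 ≤ x) (hy : 0 ≤ y) (A B C) :
    ofReal (θ * (x * y * z)) * (A * B * C) = ofReal θ * ((ofReal x * A) * (ofReal y * B) * (ofReal z * C)) := by
  rw [ofReal_mul hθ, ofReal_mul pos!, ofReal_mul hx]
  ring

lemma IsSchur.of_pair {θ : Mode → Mode → ℝ} (h0 : ∀ k j, 0 ≤ θ k j)
    (h : ∀ l, ∑' k, ofReal (θ k (l - k) ^ 2) ≤ latticeConst r) : IsSchur r θ := by
  refine ⟨h0, fun x y z A B C hx hy hz => ?_⟩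
  simp_rw [fun p : Mode × Mode => ofReal_trilinear_eq (h0 p.1 p.2) (hx p.1) (hy p.2)
    (z := z (p.1 + p.2)) (A p.1) (B p.2) (C (p.1 + p.2))]
  refine schur_pair (fun k j => ofReal (θ k j)) (latticeConst r) (fun l => ?_)
    (fun k => ofReal (x k) * A k) (fun k => ofReal (y k) * B k) (fun k => ofReal (z k) * C k)
  simp_rw [← ofReal_pow (h0 _ _)]
  exact h l

lemma isSchur_left_left (hr : 2 < r) : IsSchur r fun k _ => hDecay r k * vDecay k :=
  .of_pair (fun k _ => mul_nonneg (hDecay_pos r k).le (vDecay_pos k).le) fun _ =>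
    tsum_decay_sq_le hr id id (.refl _) (.refl _) (.refl _) (fun _ => rfl) (fun _ => rfl) fun _ => rfl

lemma isSchur_right_right (hr : 2 < r) : IsSchur r fun _ j => hDecay r j * vDecay j :=
  .of_pair (fun _ j => mul_nonneg (hDecay_pos r j).le (vDecay_pos j).le) fun l =>
    tsum_decay_sq_le hr (fun k => l - k) (fun k => l - k) (.subLeft _) (.subLeft _) (.subLeft _)
      (fun _ => rfl) (fun _ => rfl) fun _ => rfl

lemma isSchur_right_left (hr : 2 < r) : IsSchur r fun k j => hDecay r j * vDecay k :=
  .of_pair (fun k j => mul_nonneg (hDecay_pos r j).le (vDecay_pos k).le) fun l =>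
    tsum_decay_sq_le hr (fun k => l - k) id (.subLeft _) (.subLeft _) (.refl _)
      (fun _ => rfl) (fun _ => rfl) fun _ => rfl

lemma isSchur_left_right (hr : 2 < r) : IsSchur r fun k j => hDecay r k * vDecay j :=
  .of_pair (fun k j => mul_nonneg (hDecay_pos r k).le (vDecay_pos j).le) fun l =>
    tsum_decay_sq_le hr id (fun k => l - k) (.refl _) (.refl _) (.subLeft _)
      (fun _ => rfl) (fun _ => rfl) fun _ => rfl

lemma isSchur_target (hr : 2 < r) : IsSchur r fun k j => hDecay r (k + j) * vDecay (k + j) := by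
  have h0 : ∀ k, 0 ≤ hDecay r k * vDecay k := fun k => mul_nonneg (hDecay_pos r k).le (vDecay_pos k).le
  refine ⟨fun k j => h0 _, fun x y z A B C hx hy hz => ?_⟩
  simp_rw [fun p : Mode × Mode => ofReal_trilinear_eq (h0 (p.1 + p.2)) (hx p.1) (hy p.2)
    (z := z (p.1 + p.2)) (A p.1) (B p.2) (C (p.1 + p.2))]
  refine schur_target (fun k => ofReal (hDecay r k * vDecay k)) (latticeConst r) ?_
    (fun k => ofReal (x k) * A k) (fun k => ofReal (y k) * B k) (fun k => ofReal (z k) * C k)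
  simp_rw [← ofReal_pow (h0 _)]
  exact tsum_decay_sq_le hr id id (.refl _) (.refl _) (.refl _) (fun _ => rfl) (fun _ => rfl) fun _ => rfl


/-! ### Weighted estimates -/

/-- `∑ w_k A_k²`. -/
def wsum (w : Mode → ℝ) (A : Amp) : ℝ≥0∞ := ∑' k, ofReal (w k) * A k ^ 2

lemma wsum_mono {w'} (h : ∀ k, w k ≤ w' k) (A) : wsum w A ≤ wsum w' A :=
  tsum_le_tsum fun k => mul_le_mul_left (ofReal_le_ofReal (h k)) _

lemma wsum_const_mul (hc : 0 ≤ c) (w) (A) : wsum (fun k => c * w k) A = ofReal c * wsum w A := by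
  unfold wsum
  rw [← ENNReal.tsum_mul_left]
  simp_rw [ofReal_mul hc, mul_assoc]

lemma wsum_add {v} (hv : ∀ k, 0 ≤ v k) (hw : ∀ k, 0 ≤ w k) (A) :
    wsum (fun k => v k + w k) A = wsum v A + wsum w A := by
  unfold wsum
  rw [← tsum_add]
  simp_rw [ofReal_add (hv _) (hw _), add_mul]

lemma wnorm_le {x} (hc : 0 ≤ c) (hx : ∀ k, 0 ≤ x k)
    (h : ∀ k, x k ^ 2 ≤ c ^ 2 * w k) (A) : wnorm x A ≤ ofReal c * wsum w A ^ ½ := by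
  have : ∑' k, (ofReal (x k) * A k) ^ 2 ≤ ofReal c ^ 2 * wsum w A := by
    rw [← ofReal_pow hc, ← wsum_const_mul (sq_nonneg c)]
    refine tsum_le_tsum fun k => ?_
    rw [mul_pow, ← ofReal_pow (hx k)]
    exact mul_le_mul_left (ofReal_le_ofReal (h k)) _
  calc wnorm x A ≤ (ofReal c ^ 2 * wsum w A) ^ ½ := by unfold wnorm; gcongr
    _ = _ := by rw [mul_rpow_of_nonneg _ _ num!, ennreal_sq_sqrt]

/-- The symbol `F` gives a trilinear form bounded by `X`. -/
def TrilinearBound (F : Mode → Mode → ℝ) (A B D : Amp) (X : ℝ≥0∞) : Prop := (∀ k j, 0 ≤ F k j) ∧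
    ∑' p : Mode × Mode, ofReal (F p.1 p.2) * (A p.1 * B p.2 * D (p.1 + p.2)) ≤ X

lemma IsSchur.bound {θ : Mode → Mode → ℝ} {x y z} (h : IsSchur r θ) (hx : ∀ k, 0 ≤ x k)
    (hy : ∀ k, 0 ≤ y k) (hz : ∀ k, 0 ≤ z k) (A B D) :
    TrilinearBound (fun k j => θ k j * (x k * y j * z (k + j))) A B D
      (latticeConst r ^ ½ * (wnorm x A * wnorm y B * wnorm z D)) :=
  ⟨fun k j => mul_nonneg (h.1 k j) (mul_nonneg (mul_nonneg (hx k) (hy j)) (hz _)), h.2 x y z A B D hx hy hz⟩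

lemma TrilinearBound.add {F G : Mode → Mode → ℝ} {A B D} {X Y}
    (hF : TrilinearBound F A B D X) (hG : TrilinearBound G A B D Y) :
    TrilinearBound (fun k j => F k j + G k j) A B D (X + Y) := by
  refine ⟨fun k j => add_nonneg (hF.1 k j) (hG.1 k j), le_trans (le_of_eq ?_) (add_le_add hF.2 hG.2)⟩
  simp_rw [← tsum_add, ofReal_add (hF.1 _ _) (hG.1 _ _), add_mul]

/-- `e^{τ|k| + η|k₃|}`. -/
def amp (τ η : ℝ) (k : Mode) : ℝ := exp (τ * kh k + η * kz k)

/-- `(1 + |k|)^r e^{τ|k| + η|k₃|}`. -/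
def pw (r τ η : ℝ) (k : Mode) : ℝ := (1 + kh k) ^ r * amp τ η k

/-- `(|k|^{2r} + 1) e^{2τ|k|} e^{2η|k₃|}`. -/
def core (r τ η : ℝ) (k : Mode) : ℝ := (kh k ^ (2 * r) + 1) * exp (2 * τ * kh k) * exp (2 * η * kz k)

lemma weight_zero (r τ η) (k) : weight r 0 τ η k = 1 + core r τ η k := by simp [weight, core]

lemma amp_pos (τ η) (k) : 0 < amp τ η k := exp_pos _

lemma one_le_amp (hτ : 0 ≤ τ) (hη : 0 ≤ η) (k) : 1 ≤ amp τ η k :=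
  one_le_exp (add_nonneg (mul_nonneg hτ (kh_nonneg k)) (mul_nonneg hη (kz_nonneg k)))

lemma amp_add_le (hτ : 0 ≤ τ) (hη : 0 ≤ η) (k j) : amp τ η (k + j) ≤ amp τ η k * amp τ η j := by
  unfold amp
  rw [← exp_add]
  apply Real.exp_le_exp.2
  nlinarith [mul_le_mul_of_nonneg_left (kh_add_le k j) hτ, mul_le_mul_of_nonneg_left (kz_add_le k j) hη]

lemma amp_sq (τ η) (k) : amp τ η k ^ 2 = exp (2 * τ * kh k) * exp (2 * η * kz k) := by
  unfold amp
  rw [← Real.exp_nat_mul, ← exp_add]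
  congr 1
  push_cast
  ring

lemma pw_pos (r τ η) (k) : 0 < pw r τ η k :=
  mul_pos (Real.rpow_pos_of_pos (by linarith [kh_nonneg k]) _) (amp_pos _ _ _)

lemma core_nonneg (r τ η) (k) : 0 ≤ core r τ η k := by
  have := kh_nonneg k
  unfold core; positivity

lemma one_le_weight (r τ η) (k) : 1 ≤ weight r 0 τ η k := by rw [weight_zero]; linarith [core_nonneg r τ η k]

lemma weight_pos (r τ η) (k) : 0 < weight r 0 τ η k := zero_lt_one.trans_le (one_le_weight r τ η k)

lemma weight_nonneg : 0 ≤ weight r 0 τ η k := (weight_pos r τ η k).le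

lemma core_le_weight (r τ η) (k) : core r τ η k ≤ weight r 0 τ η k := by rw [weight_zero]; linarith

lemma one_add_rpow_le (hx : 0 ≤ x) (hr : 0 ≤ r) : (1 + x) ^ r ≤ 2 ^ r * (x ^ r + 1) := by
  rcases le_total x 1 with h | h
  · calc (1 + x) ^ r ≤ 2 ^ r := by gcongr; linarith
      _ ≤ _ := le_mul_of_one_le_right pos! (by linarith [rpow_nonneg hx r])
  · calc (1 + x) ^ r ≤ (2 * x) ^ r := by gcongr; linarith
      _ = 2 ^ r * x ^ r := mul_rpow num! hx
      _ ≤ _ := by gcongr; linarith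

lemma rpow_two_mul (hx : 0 ≤ x) : x ^ (2 * r) = (x ^ r) ^ 2 := by rw [mul_comm, Real.rpow_mul hx]; norm_cast

lemma pw_sq_le_core (hr : 0 ≤ r) (τ η) (k) : pw r τ η k ^ 2 ≤ (2 ^ r) ^ 2 * core r τ η k := by
  have h := kh_nonneg k
  unfold pw core
  rw [mul_pow, amp_sq, ← rpow_two_mul lin!, ← rpow_two_mul num!, mul_assoc _ (exp _), ← mul_assoc (2 ^ (2 * r))]
  gcongr
  exact one_add_rpow_le h lin!

lemma weight_le_pw_sq (hr : 0 ≤ r) (hτ : 0 ≤ τ) (hη : 0 ≤ η) (k) : weight r 0 τ η k ≤ 3 * pw r τ η k ^ 2 := by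
  have h := kh_nonneg k
  have h1 : 1 ≤ (1 + kh k) ^ (2 * r) := one_le_rpow lin! lin!
  have h2 : kh k ^ (2 * r) ≤ (1 + kh k) ^ (2 * r) := by gcongr; linarith
  have h3 : 1 ≤ amp τ η k ^ 2 := one_le_pow₀ (one_le_amp hτ hη k)
  rw [weight_zero]
  unfold core pw
  rw [mul_pow, ← rpow_two_mul lin!, mul_assoc (_ + _), ← amp_sq]
  nlinarith [mul_le_mul h1 h3 num! lin!]

lemma hDecay_mul_pw (r τ η) (k) : hDecay r k * pw r τ η k = (1 + kh k) * amp τ η k := by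
  have h := kh_nonneg k
  unfold hDecay pw
  rw [← mul_assoc, ← rpow_add lin!]
  simp

lemma vDecay_mul (k) : vDecay k * (1 + kz k) = 1 := by
  have h := kz_nonneg k
  exact inv_mul_cancel₀ lin!

lemma pw_add_le_left (hr : 0 ≤ r) (hτ : 0 ≤ τ) (hη : 0 ≤ η)
    (h : kh k ≤ kh j) : pw r τ η (k + j) ≤ 2 ^ r * (amp τ η k * pw r τ η j) := by
  have h0 := kh_nonneg k
  have h1 := kh_nonneg j
  have h2 := kh_add_le k j
  have h3 := kh_nonneg (k + j)
  have := amp_pos τ η (k + j)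
  unfold pw
  calc _ ≤ (2 * (1 + kh j)) ^ r * (amp τ η k * amp τ η j) := by
        gcongr
        · linarith
        · exact amp_add_le hτ hη k j
    _ = _ := by rw [mul_rpow num! lin!]; ring

/-- The size of `(k + j) · (û_k, ŵ_k)` relative to `|û_k|`. -/
def transport (k j : Mode) : ℝ := kh j + kz j * kh k / kz k

lemma transport_le (k j) : transport k j ≤ kh j + 2 * (vDecay k * kz j * kh k) := by
  unfold transport
  have h0 := kh_nonneg k
  have h1 := kz_nonneg j
  have h2 := vDecay_pos k
  rcases kz_eq_zero_or k with h | h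
  · rw [h, div_zero]; have : 0 ≤ 2 * (vDecay k * kz j * kh k) := by positivity
    linarith
  · have : (kz k)⁻¹ ≤ 2 * vDecay k := by
      unfold vDecay
      rw [← div_eq_mul_inv, inv_eq_one_div, div_le_div_iff₀ lin! lin!]
      linarith
    rw [div_eq_mul_inv]
    nlinarith [mul_le_mul_of_nonneg_left this (mul_nonneg h1 h0)]

lemma transport_nonneg (k j) : 0 ≤ transport k j := by
  have := kh_nonneg k; have := kh_nonneg j; have := kz_nonneg k; have := kz_nonneg j
  unfold transport; positivity

/-- Horizontal multipliers that may be moved to the horizontally larger factor. -/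
structure IsSlow (m : Mode → ℝ) : Prop where
  nonneg : ∀ k, 0 ≤ m k
  mono : ∀ k j, kh k ≤ kh j → m k ≤ m j
  double : ∀ k j, kh k ≤ kh j → m (k + j) ≤ 2 * m j

lemma IsSlow.double' {m} (hm : IsSlow m) (k j) (h : kh j ≤ kh k) :
    m (k + j) ≤ 2 * m k := by rw [add_comm]; exact hm.double j k h

lemma le_sqrt_mul_sqrt {a} (ha : 0 ≤ a) (hb : a ≤ b) (hc : a ≤ c) : a ≤ √b * √c := by
  rw [← sqrt_mul (ha.trans hb)]
  exact Real.le_sqrt_of_sq_le (by nlinarith)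

lemma le_two_sqrt_mul_sqrt {a} (ha : 0 ≤ a) (hb : a ≤ 2 * b) : a ≤ 2 * (√b * √a) := by
  have h := le_sqrt_mul_sqrt ha hb le_rfl
  have h2 : √(2 * b) ≤ 2 * √b := by
    rw [sqrt_mul num!]
    gcongr
    rw [Real.sqrt_le_left num!]; norm_num
  nlinarith [sqrt_nonneg a, sqrt_nonneg b]

lemma pw_mul_le_left (hr : 0 ≤ r) (hτ : 0 ≤ τ) (hη : 0 ≤ η) (h : kh k ≤ kh j) : pw r τ η (k + j) * (1 + kh k) ≤
      2 ^ r * (hDecay r k * pw r τ η k * pw r τ η j) := by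
  have := kh_nonneg k
  rw [hDecay_mul_pw]
  calc _ ≤ 2 ^ r * (amp τ η k * pw r τ η j) * (1 + kh k) := by gcongr; exact pw_add_le_left hr hτ hη h
    _ = _ := by ring

lemma le_sqrt_mul_sqrt_mul {a} (ha : 0 ≤ a) (hb : 1 ≤ b) (hd : 0 ≤ d) (h : a ≤ b + d) :
    a ≤ √a * √b * (1 + d) := by
  have e1 : √a ≤ √b * (1 + d) := by
    rw [Real.sqrt_le_left pos!, mul_pow, sq_sqrt lin!]
    nlinarith [mul_nonneg (sub_nonneg.2 hb) hd, mul_nonneg (zero_le_one.trans hb) (sq_nonneg d)]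
  calc a = √a * √a := (mul_self_sqrt ha).symm
    _ ≤ √a * (√b * (1 + d)) := by gcongr
    _ = _ := by ring

lemma kh_le_sqrt_mul (k) : kh k ≤ √(kh k) * (1 + kh k) := by
  rcases kh_eq_zero_or k with h' | h'
  · rw [h']; simp
  · have : 1 ≤ √(kh k) := one_le_sqrt.2 h'
    nlinarith

lemma symbol_combine {u v X Y Z S} (hR : 0 ≤ R) (hc : 0 ≤ c) (ht : 0 ≤ t)
    (htuv : t ≤ u + 2 * v) (hX : 0 ≤ X) (hZ : 0 ≤ Z) (h1 : R * u ≤ c * X)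
    (h2 : R * v ≤ c * Y) (h3 : M ≤ 2 * Z) (hS : Z * X * R + Z * Y * R ≤ S) : M * R ^ 2 * t ≤ 4 * c * S := by
  have h4 : R * t ≤ c * X + 2 * (c * Y) := by linarith [mul_le_mul_of_nonneg_left htuv hR]
  have h6 := mul_le_mul_of_nonneg_right (mul_le_mul h3 h4 (mul_nonneg hR ht) pos!) hR
  have h8 : 0 ≤ Z * (c * X) * R := pos!
  linarith [mul_le_mul_of_nonneg_left hS hc]

lemma mul_le_mul_mul_of_mul_le {u q X} (hR : 0 ≤ R) (hx : 0 ≤ x) (h : u ≤ x * q)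
    (hq : R * q ≤ c * X) : R * u ≤ c * (X * x) := by
  linarith [mul_le_mul_of_nonneg_left h hR, mul_le_mul_of_nonneg_right hq hx]

lemma mode_pos (r τ η) (k) : 0 ≤ kh k ∧ 0 ≤ kz k ∧ 0 < hDecay r k ∧ 0 < vDecay k ∧
    0 < amp τ η k ∧ 0 < pw r τ η k ∧ vDecay k * (1 + kz k) = 1 :=
  ⟨kh_nonneg k, kz_nonneg k, hDecay_pos r k, vDecay_pos k, amp_pos τ η k, pw_pos r τ η k, vDecay_mul k⟩

lemma sum_six_le_of_three_five {a f y} (hx : x = c) (hy : y = e) (h₁ : 0 ≤ a) (h₂ : 0 ≤ b) (h₄ : 0 ≤ d)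
    (h₆ : 0 ≤ f) : x + y ≤ a + b + c + d + e + f := lin!

lemma sum_six_le_of_one_four {a f y} (hx : x = a) (hy : y = d) (h₂ : 0 ≤ b) (h₃ : 0 ≤ c) (h₅ : 0 ≤ e)
    (h₆ : 0 ≤ f) : x + y ≤ a + b + c + d + e + f := lin!

lemma sum_six_le_of_two_six {a f y} (hx : x = b) (hy : y = f) (h₁ : 0 ≤ a) (h₃ : 0 ≤ c) (h₄ : 0 ≤ d)
    (h₅ : 0 ≤ e) : x + y ≤ a + b + c + d + e + f := lin!

lemma energy_pointwise (hr : 2 < r) (hτ : 0 ≤ τ) (hη : 0 ≤ η) {m}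
    (hm : IsSlow m) (k j) : m (k + j) * pw r τ η (k + j) ^ 2 * transport k j ≤ 4 * 2 ^ r *
      (hDecay r k * vDecay k * ((1 + kz k) * pw r τ η k * (√(kh j) * √(m j) * pw r τ η j) *
          (√(kh (k + j)) * √(m (k + j)) * pw r τ η (k + j))) +
       hDecay r j * vDecay j * (√(kh k) * √(m k) * pw r τ η k * ((1 + kz j) * pw r τ η j) *
          (√(kh (k + j)) * √(m (k + j)) * pw r τ η (k + j))) +
       hDecay r (k + j) * vDecay (k + j) * (√(kh k) * √(m k) * pw r τ η k *
          (√(kh j) * √(m j) * pw r τ η j) * ((1 + kz (k + j)) * pw r τ η (k + j))) +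
       hDecay r k * vDecay k * (pw r τ η k * (kz j * √(m j) * pw r τ η j) *
          (√(kh (k + j)) * √(m (k + j)) * pw r τ η (k + j))) +
       hDecay r k * vDecay k * (√(kh k) * √(m k) * pw r τ η k * (kz j * √(m j) * pw r τ η j) *
          pw r τ η (k + j)) + hDecay r j * vDecay k * (√(kh k) * √(m k) * pw r τ η k * (kz j * pw r τ η j) *
          (√(kh (k + j)) * √(m (k + j)) * pw r τ η (k + j)))) := by
  have hr0 : 0 ≤ r := lin!
  obtain ⟨hk, zk, Dk, vk0, ak, pk, vk⟩ := mode_pos r τ η k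
  obtain ⟨hj, zj, Dj, vj0, aj, pj, vj⟩ := mode_pos r τ η j
  obtain ⟨hl, zl, Dl, vl0, -, pl, vl⟩ := mode_pos r τ η (k + j)
  have hml := hm.nonneg (k + j)
  have t1 := kh_le_add k j
  have t2 := kh_le_add' k j
  have hleft := fun h : kh k ≤ kh j => pw_mul_le_left hr0 hτ hη h
  have hright := fun h : kh j ≤ kh k => pw_mul_le_left hr0 hτ hη h
  rw [add_comm j k] at hright
  have c1 : (1 : ℝ) ≤ 2 ^ r := one_le_rpow num! hr0
  have main := fun X Y Z S => symbol_combine (M := m (k + j)) (X := X) (Y := Y) (Z := Z) (S := S) pl.le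
    (zero_le_one.trans c1) (transport_nonneg k j) (transport_le k j)
  have hRl (h0 : kh (k + j) = 0) : pw r τ η (k + j) ≤ pw r τ η k * pw r τ η j := by
    have : pw r τ η (k + j) = amp τ η (k + j) := by simp [pw, h0]
    refine this.le.trans ((amp_add_le hτ hη k j).trans (mul_le_mul ?_ ?_ aj.le pk.le)) <;>
      exact le_mul_of_one_le_left (amp_pos _ _ _).le (one_le_rpow lin! hr0)
  have hDl (h0 : kh (k + j) = 0) : hDecay r (k + j) = 1 := by simp [hDecay, h0]
  set c : ℝ := 2 ^ r
  set P := pw r τ η k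
  set Q := pw r τ η j
  set R := pw r τ η (k + j)
  set M := m (k + j)
  rcases le_or_gt (kh k) (kh j) with h | h
  · have hL := hleft h
    rcases kh_eq_zero_or (k + j) with h0 | h0
    · have hkj : kh k = kh j := by linarith
      refine main (√(kh k) * √(kh j) * P * Q) (hDecay r k * P * Q * (vDecay k * kz j * √(kh k)))
        (√(m k) * √(m j)) _ pos! pos! ?_ (mul_le_mul_mul_of_mul_le pl.le pos! ?_ hL)
        ((le_sqrt_mul_sqrt hml (hm.mono (k + j) k lin!) (hm.mono (k + j) j lin!)).trans
          (le_mul_of_one_le_left pos! one_le_two)) (sum_six_le_of_three_five ?_ (by ring) ?_ ?_ ?_ ?_)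
      · rw [hkj, mul_self_sqrt hj]
        calc _ ≤ P * Q * kh j := mul_le_mul_of_nonneg_right (hRl h0) hj
          _ ≤ c * (P * Q * kh j) := le_mul_of_one_le_left pos! c1
          _ = _ := by ring
      · rw [mul_assoc (vDecay k * kz j)]
        gcongr
        exact kh_le_sqrt_mul k
      · rw [hDl h0]
        linear_combination (-(√(m k) * √(m j) * (√(kh k) * √(kh j) * P * Q) * R)) * vl
      all_goals positivity
    · have s0 : 1 ≤ √(kh (k + j)) := one_le_sqrt.2 h0
      refine main (hDecay r k * P * Q * (√(kh j) * √(kh (k + j))))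
        (hDecay r k * P * Q * (vDecay k * kz j * √(kh (k + j)))) (√(m j) * √M) _ pos!
        pos! (mul_le_mul_mul_of_mul_le pl.le pos! (le_sqrt_mul_sqrt_mul hj h0 hk t1) hL)
        (mul_le_mul_mul_of_mul_le pl.le pos! ?_ hL) (le_two_sqrt_mul_sqrt hml (hm.double k j h))
        (sum_six_le_of_one_four ?_ (by ring) ?_ ?_ ?_ ?_)
      · rw [mul_assoc (vDecay k * kz j)]
        gcongr
        nlinarith
      · linear_combination (-(√(m j) * √M * (√(kh j) * √(kh (k + j)) * (hDecay r k * P * Q)) * R)) * vk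
      all_goals positivity
  · have hL := hright h.le
    have h0 : 1 ≤ kh (k + j) := (kh_eq_zero_or (k + j)).resolve_left fun h0 => lin!
    have s2 := le_sqrt_mul_sqrt_mul hk h0 hj t2
    refine main (hDecay r j * Q * P * (√(kh k) * √(kh (k + j))))
      (hDecay r j * Q * P * (vDecay k * kz j * (√(kh k) * √(kh (k + j))))) (√(m k) * √M) _ pos!
      pos! (mul_le_mul_mul_of_mul_le pl.le pos! (h.le.trans s2) hL)
      (mul_le_mul_mul_of_mul_le pl.le pos! ?_ hL) (le_two_sqrt_mul_sqrt hml (hm.double' k j h.le))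
      (sum_six_le_of_two_six ?_ (by ring) ?_ ?_ ?_ ?_)
    · rw [mul_assoc (vDecay k * kz j)]
      gcongr
    · linear_combination (-(√(m k) * √M * (√(kh k) * √(kh (k + j)) * (hDecay r j * Q * P)) * R)) * vj
    all_goals positivity


/-! ### Trilinear estimates -/

/-- `∑_{k,j} W_{k+j} |(k + j)·û_k| B_j D_{k+j}`, an upper bound for the weighted transport term. -/
def trilinear (w : Mode → ℝ) (A B D : Amp) : ℝ≥0∞ :=
  ∑' p : Mode × Mode, ofReal (w (p.1 + p.2) * transport p.1 p.2) * (A p.1 * B p.2 * D (p.1 + p.2))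

lemma TrilinearBound.trilinear_le {F : Mode → Mode → ℝ} {A B D} {X}
    (hF : TrilinearBound F A B D X) (hc : 0 ≤ c) (h : ∀ k j, w (k + j) * transport k j ≤ c * F k j) :
    trilinear w A B D ≤ ofReal c * X := by
  refine le_trans ?_ (mul_le_mul_right hF.2 _)
  simp_rw [trilinear, ← ENNReal.tsum_mul_left, ← mul_assoc (ofReal c), ← ofReal_mul hc]
  exact tsum_le_tsum fun p => mul_le_mul_left (ofReal_le_ofReal (h _ _)) _

/-- `‖A‖²`. -/
def energyE (r τ η : ℝ) (A : Amp) : ℝ≥0∞ := wsum (weight r 0 τ η) A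

/-- `‖∂_z A‖²`. -/
def energyF (r τ η : ℝ) (A : Amp) : ℝ≥0∞ := wsum (fun k => kz k ^ 2 * weight r 0 τ η k) A

lemma ennreal_sqrt_add_le (a b : ℝ≥0∞) : (a + b) ^ ½ ≤ a ^ ½ + b ^ ½ :=
  ENNReal.rpow_add_le_add_rpow _ _ num! num!

lemma ennreal_sqrt_mul_sqrt_le (a b) {δ} (hδ : 0 < δ) : a ^ ½ * b ^ ½ ≤ ofReal δ * a + ofReal δ⁻¹ * b := by
  have h1 : a ^ ½ * b ^ ½ = (ofReal δ * a) ^ ½ * (ofReal δ⁻¹ * b) ^ ½ := by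
    rw [← mul_rpow_of_nonneg _ _ num!, ← mul_rpow_of_nonneg _ _ num!,
      mul_mul_mul_comm, ← ofReal_mul hδ.le, mul_inv_cancel₀ hδ.ne']
    simp
  rw [h1]
  calc _ ≤ (ofReal δ * a + ofReal δ⁻¹ * b) ^ ½ * (ofReal δ * a + ofReal δ⁻¹ * b) ^ ½ := by
        gcongr
        · exact le_self_add
        · exact le_add_self
    _ = _ := ennreal_sqrt_mul_self _

lemma wnorm_mul_pw_le {v : Mode → ℝ} (hr : 0 ≤ r) (hv : ∀ k, 0 ≤ v k)
    (h : ∀ k, v k ^ 2 * core r τ η k ≤ 4 * w k) (A) :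
    wnorm (fun k => v k * pw r τ η k) A ≤ ofReal (2 * 2 ^ r) * wsum w A ^ ½ := by
  refine wnorm_le pos! (fun k => mul_nonneg (hv k) (pw_pos _ _ _ k).le) (fun k => ?_) A
  have h1 := mul_le_mul_of_nonneg_left (pw_sq_le_core hr τ η k) (sq_nonneg (v k))
  have h2 := mul_le_mul_of_nonneg_left (h k) (sq_nonneg (2 ^ r))
  generalize (2 : ℝ) ^ r = a at *
  linarith

lemma wnorm_pw_le (hr : 0 ≤ r) (τ η) (A) : wnorm (pw r τ η) A ≤ ofReal (2 * 2 ^ r) * energyE r τ η A ^ ½ := by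
  have h := wnorm_mul_pw_le (w := weight r 0 τ η) (v := fun _ => 1) hr (fun _ => zero_le_one)
    (fun k => by linarith [core_le_weight r τ η k, weight_pos r τ η k]) A
  simp only [one_mul] at h
  exact h

lemma wnorm_kz_pw_le (hr : 0 ≤ r) (τ η) (A) :
    wnorm (fun k => kz k * pw r τ η k) A ≤ ofReal (2 * 2 ^ r) * energyF r τ η A ^ ½ :=
  wnorm_mul_pw_le hr kz_nonneg (fun k => by
    nlinarith [core_le_weight r τ η k, weight_pos r τ η k, sq_nonneg (kz k)]) A

lemma wnorm_add_kz_pw_le (hr : 0 ≤ r) (τ η) (A) : wnorm (fun k => (1 + kz k) * pw r τ η k) A ≤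
      ofReal (2 * 2 ^ r) * (energyE r τ η A ^ ½ + energyF r τ η A ^ ½) := by
  refine (wnorm_mul_pw_le (w := fun k => weight r 0 τ η k + kz k ^ 2 * weight r 0 τ η k) hr
    (fun k => by linarith [kz_nonneg k]) (fun k => ?_) A).trans ?_
  · nlinarith [mul_le_mul_of_nonneg_left (core_le_weight r τ η k) (sq_nonneg (1 + kz k)),
      mul_nonneg (weight_pos r τ η k).le (sq_nonneg (1 - kz k)), weight_pos r τ η k,
      mul_nonneg (weight_pos r τ η k).le (sq_nonneg (kz k))]
  · gcongr
    rw [wsum_add (fun k => weight_nonneg) (fun k => mul_nonneg (sq_nonneg _) weight_nonneg)]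
    exact ennreal_sqrt_add_le _ _

lemma exists_le_ofReal {x} (hx : x < ⊤) : ∃ c, 0 < c ∧ x ≤ ofReal c :=
  ⟨x.toReal + 1, by positivity, (ofReal_toReal hx.ne).ge.trans (ofReal_le_ofReal lin!)⟩

lemma latticeConst_sqrt_ne_top (hr : 2 < r) : latticeConst r ^ ½ ≠ ⊤ :=
  ENNReal.rpow_ne_top_of_nonneg num! (latticeConst_lt_top hr).ne

/-- The transport term against slowly varying multipliers `m`. -/
lemma exists_energy_trilinear (hr : 2 < r) : ∃ c, 0 < c ∧ ∀ τ η : ℝ, 0 ≤ τ → 0 ≤ η →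
    ∀ m : Mode → ℝ, IsSlow m → ∀ A : Amp, trilinear (fun k => m k * weight r 0 τ η k) A A A ≤ ofReal c *
      ((energyE r τ η A ^ ½ + energyF r τ η A ^ ½) * wsum (fun k => m k * (kh k * core r τ η k)) A +
        energyE r τ η A ^ ½ * wsum (fun k => m k * (kz k ^ 2 * weight r 0 τ η k)) A ^ ½ *
          wsum (fun k => m k * (kh k * core r τ η k)) A ^ ½) := by
  have hr0 : 0 ≤ r := lin!
  have hl := latticeConst_sqrt_ne_top hr
  obtain ⟨c, hc, hL⟩ := exists_le_ofReal (x := ofReal (3 * (4 * 2 ^ r)) *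
    (latticeConst r ^ ½ * (4 * ofReal (2 * 2 ^ r) ^ 3))) (by finiteness)
  refine ⟨c, hc, fun τ η hτ hη m hm A => le_trans ?_ (mul_le_mul_left hL _)⟩
  have hp : ∀ k, 0 ≤ pw r τ η k := fun k => (pw_pos r τ η k).le
  have hg : ∀ k, 0 ≤ √(kh k) * √(m k) * pw r τ η k := fun k => mul_nonneg pos! (hp k)
  have hz : ∀ k, 0 ≤ kz k * √(m k) := fun k => mul_nonneg (kz_nonneg k) (sqrt_nonneg _)
  have hf := fun k => mul_nonneg (hz k) (hp k)
  have hf' := fun k => mul_nonneg (kz_nonneg k) (hp k)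
  have hq : ∀ k, 0 ≤ (1 + kz k) * pw r τ η k := fun k => mul_nonneg (by linarith [kz_nonneg k]) (hp k)
  refine ((((((((isSchur_left_left hr).bound hq hg hg A A A).add
    ((isSchur_right_right hr).bound hg hq hg A A A)).add ((isSchur_target hr).bound hg hg hq A A A)).add
    ((isSchur_left_left hr).bound hp hf hg A A A)).add ((isSchur_left_left hr).bound hg hf hp A A A)).add
    ((isSchur_right_left hr).bound hg hf' hg A A A)).trilinear_le (c := 3 * (4 * 2 ^ r)) pos!
    fun k j => ?_).trans ?_
  · linarith [energy_pointwise hr hτ hη hm k j, mul_le_mul_of_nonneg_right (mul_le_mul_of_nonneg_left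
      (weight_le_pw_sq hr0 hτ hη (k + j)) (hm.nonneg (k + j))) (transport_nonneg k j)]
  have b1 := wnorm_pw_le hr0 τ η A
  have b2 := wnorm_add_kz_pw_le hr0 τ η A
  have b3 := (wnorm_kz_pw_le hr0 τ η A).trans (mul_le_mul_right (le_add_self (b := energyE r τ η A ^ ½)) _)
  have b4 := wnorm_mul_pw_le (w := fun k => m k * (kz k ^ 2 * weight r 0 τ η k)) hr0 hz (fun k => by
    rw [mul_pow, sq_sqrt (hm.nonneg k)]
    nlinarith [mul_le_mul_of_nonneg_left (core_le_weight r τ η k)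
      (mul_nonneg (sq_nonneg (kz k)) (hm.nonneg k)), mul_nonneg (mul_nonneg (sq_nonneg (kz k))
      (hm.nonneg k)) (weight_pos r τ η k).le]) A
  have b5 := wnorm_mul_pw_le (τ := τ) (η := η) (w := fun k => m k * (kh k * core r τ η k)) hr0
    (v := fun k => √(kh k) * √(m k)) (fun k => by positivity) (fun k => by
      rw [mul_pow, sq_sqrt (hm.nonneg k), sq_sqrt (kh_nonneg k)]
      nlinarith [mul_nonneg (mul_nonneg (kh_nonneg k) (hm.nonneg k)) (core_nonneg r τ η k)]) A
  have hGG := ennreal_sqrt_mul_self (wsum (fun k => m k * (kh k * core r τ η k)) A)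
  set E := energyE r τ η A ^ ½
  set F := energyF r τ η A ^ ½
  set g := wsum (fun k => m k * (kh k * core r τ η k)) A ^ ½
  set f := wsum (fun k => m k * (kz k ^ 2 * weight r 0 τ η k)) A ^ ½
  rw [← hGG]
  generalize ofReal (2 * 2 ^ r) = u at *
  generalize latticeConst r ^ ½ = L at *
  calc _ ≤ ofReal (3 * (4 * 2 ^ r)) * (L * (u * (E + F) * (u * g) * (u * g)) +
    L * (u * g * (u * (E + F)) * (u * g)) + L * (u * g * (u * g) * (u * (E + F))) +
    L * (u * E * (u * f) * (u * g)) + L * (u * g * (u * f) * (u * E)) +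
    L * (u * g * (u * (E + F)) * (u * g))) := by gcongr
    _ = ofReal (3 * (4 * 2 ^ r)) * (L * (u ^ 3 * (4 * ((E + F) * (g * g)) + 2 * (E * f * g)))) := by ring
    _ ≤ ofReal (3 * (4 * 2 ^ r)) * (L * (u ^ 3 * (4 * ((E + F) * (g * g)) + 4 * (E * f * g)))) := by
      gcongr; norm_num
    _ = _ := by ring


lemma pw_eq_mul_sqrt (r τ η) (k) : pw r τ η k = pw (r - ½) τ η k * √(1 + kh k) := by
  have h := kh_nonneg k
  unfold pw
  rw [sqrt_eq_rpow, mul_right_comm, ← rpow_add lin!]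
  congr 2
  ring

lemma hDecay_mul_pw_half (r τ η) (k) : hDecay r k * pw (r - ½) τ η k = √(1 + kh k) * amp τ η k := by
  have h := kh_nonneg k
  have h1 : 0 < √(1 + kh k) := Real.sqrt_pos.2 lin!
  refine mul_right_cancel₀ h1.ne' ?_
  rw [mul_assoc, ← pw_eq_mul_sqrt, hDecay_mul_pw]
  linear_combination (-amp τ η k) * mul_self_sqrt (show 0 ≤ 1 + kh k by linarith)

lemma one_le_sqrt_one_add (k) : 1 ≤ √(1 + kh k) := one_le_sqrt.2 (by linarith [kh_nonneg k])

lemma kh_le_sqrt_mul_three {a} (ha : 0 ≤ a) (hb : 0 ≤ b) (hd : 0 ≤ d) (h : a ≤ b + d) :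
    a ≤ √(1 + a) * √(1 + b) * √(1 + d) := by
  have h1 : √(1 + a) ≤ √(1 + b) * √(1 + d) := by
    rw [← sqrt_mul lin!]
    exact Real.sqrt_le_sqrt (by nlinarith)
  have h2 := mul_self_sqrt (show 0 ≤ 1 + a by linarith)
  have h3 := mul_le_mul_of_nonneg_left h1 (sqrt_nonneg (1 + a))
  linarith

lemma pw_half_mul_le (hr : 1 ≤ r) (hτ : 0 ≤ τ) (hη : 0 ≤ η) (h : kh k ≤ kh j) :
    pw (r - ½) τ η (k + j) * (1 + kh k) ≤ 2 ^ r * (hDecay r k * pw r τ η k * pw (r - ½) τ η j) ∧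
      pw (r - ½) τ η (k + j) * √(1 + kh k) ≤ 2 ^ r * (hDecay r k * pw (r - ½) τ η k * pw (r - ½) τ η j) := by
  have h0 := kh_nonneg k
  have h1 := amp_pos τ η k
  have h2 := pw_pos (r - ½) τ η j
  have h3 := pw_add_le_left (r := r - ½) lin! hτ hη h
  have h4 : pw (r - ½) τ η (k + j) ≤ 2 ^ r * (amp τ η k * pw (r - ½) τ η j) := h3.trans (by gcongr <;> linarith)
  rw [hDecay_mul_pw, hDecay_mul_pw_half]
  constructor
  · calc _ ≤ 2 ^ r * (amp τ η k * pw (r - ½) τ η j) * (1 + kh k) := by gcongr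
      _ = _ := by ring
  · calc _ ≤ 2 ^ r * (amp τ η k * pw (r - ½) τ η j) * √(1 + kh k) := by gcongr
      _ = _ := by ring

lemma difference_pointwise (hr : 2 < r) (hτ : 0 ≤ τ) (hη : 0 ≤ η) (k j) :
    weight (r - ½) 0 τ η (k + j) * transport k j ≤ 3 * (4 * 2 ^ r * ((hDecay r k + hDecay r j) *
      (pw r τ η k * pw r τ η j * pw r τ η (k + j) +
        vDecay k * kz j * (pw r τ η k * pw (r - ½) τ η j * pw r τ η (k + j))))) := by
  have ht := transport_nonneg k j
  refine (mul_le_mul_of_nonneg_right (weight_le_pw_sq lin! hτ hη _) ht).trans ?_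
  obtain ⟨hk, zk, Dk, vk0, ak, pk, -⟩ := mode_pos r τ η k
  obtain ⟨hj, zj, Dj, vj0, aj, pj, -⟩ := mode_pos r τ η j
  obtain ⟨hl, zl, Dl, vl0, -, pl, -⟩ := mode_pos r τ η (k + j)
  have t1 := kh_le_sqrt_mul_three hj hl hk (kh_le_add k j)
  have t2 := kh_le_sqrt_mul_three hk hl hj (kh_le_add' k j)
  have hleft := fun h : kh k ≤ kh j => pw_half_mul_le (r := r) lin! hτ hη h
  have hright := fun h : kh j ≤ kh k => pw_half_mul_le (r := r) lin! hτ hη h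
  rw [add_comm j k] at hright
  have s1 := one_le_sqrt_one_add k
  have s3 := one_le_sqrt_one_add (k + j)
  have qk := pw_pos (r - ½) τ η k
  have qj := pw_pos (r - ½) τ η j
  have ql := pw_pos (r - ½) τ η (k + j)
  have main := fun X Y S => symbol_combine (M := 1) (X := X) (Y := Y) (Z := 1) (S := S) ql.le
    (by positivity : (0 : ℝ) ≤ 2 ^ r) ht (transport_le k j)
  rw [mul_assoc, ← one_mul (_ ^ 2)]
  refine mul_le_mul_of_nonneg_left ?_ num!
  rw [pw_eq_mul_sqrt r τ η k, pw_eq_mul_sqrt r τ η j, pw_eq_mul_sqrt r τ η (k + j)] at *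
  set P := pw (r - ½) τ η k
  set Q := pw (r - ½) τ η j
  set R := pw (r - ½) τ η (k + j)
  set a := √(1 + kh k)
  set b := √(1 + kh j)
  set d := √(1 + kh (k + j))
  rcases le_total (kh k) (kh j) with h | h
  · obtain ⟨h1, h2⟩ := hleft h
    refine main (hDecay r k * P * Q * (d * b)) (hDecay r k * (P * a) * Q * (vDecay k * kz j)) _
      pos! zero_le_one (mul_le_mul_mul_of_mul_le ql.le pos! lin! h2)
      (mul_le_mul_mul_of_mul_le ql.le pos! (by gcongr; linarith) h1) num! ?_
    calc _ = hDecay r k * (P * 1 * (Q * b) * (R * d) + vDecay k * kz j * (P * a * Q * (R * 1))) := by ring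
      _ ≤ _ := by gcongr; linarith
  · obtain ⟨h1, h2⟩ := hright h
    refine main (hDecay r j * (Q * b) * P * 1) (hDecay r j * Q * P * (vDecay k * kz j * (a * d))) _
      pos! zero_le_one (mul_le_mul_mul_of_mul_le ql.le zero_le_one lin! h1)
      (mul_le_mul_mul_of_mul_le ql.le pos! ((mul_le_mul_of_nonneg_left t2 pos!).trans_eq (by ring)) h2) num! ?_
    calc _ = hDecay r j * (P * 1 * (Q * b) * (R * 1) + vDecay k * kz j * (P * a * Q * (R * d))) := by ring
      _ ≤ _ := by gcongr; linarith

/-- `∑ (1 + |k|) W_k D_k²` with the weight of regularity `r - 1/2`. -/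
def energyP (r τ η : ℝ) (D : Amp) : ℝ≥0∞ := wsum (fun k => (1 + kh k) * weight (r - ½) 0 τ η k) D

lemma wnorm_pw_le_energyP (hr : 1 ≤ r) (τ η) (D) :
    wnorm (pw r τ η) D ≤ ofReal (2 * 2 ^ r) * energyP r τ η D ^ ½ := by
  have h := wnorm_mul_pw_le (r := r - ½) (τ := τ) (η := η) (v := fun k => √(1 + kh k))
    (w := fun k => (1 + kh k) * weight (r - ½) 0 τ η k) lin! (fun k => sqrt_nonneg _) (fun k => by
      have := kh_nonneg k
      rw [sq_sqrt lin!]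
      nlinarith [mul_le_mul_of_nonneg_left (core_le_weight (r - ½) τ η k)
        (by linarith : 0 ≤ 1 + kh k), mul_nonneg (by linarith : 0 ≤ 1 + kh k) (weight_pos (r - ½) τ η k).le]) D
  simp only [mul_comm (√_), ← pw_eq_mul_sqrt] at h
  refine h.trans ?_
  unfold energyP
  gcongr <;> linarith

/-- The transport terms in the equation for the difference of two solutions. -/
lemma exists_difference_trilinear (hr : 2 < r) : ∃ c, 0 < c ∧
    ∀ τ η, 0 ≤ τ → 0 ≤ η → ∀ A D, trilinear (weight (r - ½) 0 τ η) A D D ≤ ofReal c *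
      ((energyE r τ η A ^ ½ + energyF r τ η A ^ ½) * energyP r τ η D + energyE r τ η A ^ ½ *
          (energyF (r - ½) τ η D ^ ½ * energyP r τ η D ^ ½)) ∧
    trilinear (weight (r - ½) 0 τ η) D A D ≤ ofReal c *
      ((energyE r τ η A ^ ½ + energyF r τ η A ^ ½) * energyP r τ η D) := by
  have hr0 : 0 ≤ r := lin!
  have hl := latticeConst_sqrt_ne_top hr
  obtain ⟨c, hc, hL⟩ := exists_le_ofReal (x := ofReal (3 * (4 * 2 ^ r)) *
    (latticeConst r ^ ½ * (4 * ofReal (2 * 2 ^ r) ^ 3))) (by finiteness)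
  refine ⟨c, hc, fun τ η hτ hη A D => ?_⟩
  have hp : ∀ k, 0 ≤ pw r τ η k := fun k => (pw_pos r τ η k).le
  have hf := fun k => mul_nonneg (kz_nonneg k) (pw_pos (r - ½) τ η k).le
  have hf' := fun k => mul_nonneg (kz_nonneg k) (hp k)
  have hq : ∀ k, 0 ≤ (1 + kz k) * pw r τ η k := fun k => mul_nonneg (by linarith [kz_nonneg k]) (hp k)
  have b1 := wnorm_pw_le hr0 τ η A
  have b2 := wnorm_add_kz_pw_le hr0 τ η A
  have b3 := (wnorm_kz_pw_le hr0 τ η A).trans (mul_le_mul_right (le_add_self (b := energyE r τ η A ^ ½)) _)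
  have b4 : _ ≤ ofReal (2 * 2 ^ r) * _ := (wnorm_kz_pw_le (r := r - ½) lin! τ η D).trans
    (by gcongr <;> linarith)
  have b5 := wnorm_pw_le_energyP (r := r) lin! τ η D
  have hPP := ennreal_sqrt_mul_self (energyP r τ η D)
  set E := energyE r τ η A ^ ½
  set F := energyF r τ η A ^ ½
  set g := energyP r τ η D ^ ½
  set f := energyF (r - ½) τ η D ^ ½
  rw [← hPP]
  constructor <;> refine le_trans ?_ (mul_le_mul_left hL _)
  · refine (((((isSchur_left_left hr).bound hq hp hp A D D).add
      ((isSchur_right_left hr).bound hq hp hp A D D)).add ((isSchur_left_left hr).bound hp hf hp A D D)).add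
      ((isSchur_right_left hr).bound hp hf hp A D D)).trilinear_le (c := 3 * (4 * 2 ^ r))
      pos! (fun k j => (difference_pointwise hr hτ hη k j).trans_eq ?_) |>.trans ?_
    · linear_combination (-(12 * 2 ^ r * (hDecay r k + hDecay r j) *
        (pw r τ η k * pw r τ η j * pw r τ η (k + j)))) * vDecay_mul k
    generalize ofReal (2 * 2 ^ r) = u at *
    generalize latticeConst r ^ ½ = L at *
    calc _ ≤ ofReal (3 * (4 * 2 ^ r)) * (L * (u * (E + F) * (u * g) * (u * g)) +
          L * (u * (E + F) * (u * g) * (u * g)) + L * (u * E * (u * f) * (u * g)) +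
          L * (u * E * (u * f) * (u * g))) := by gcongr
      _ = ofReal (3 * (4 * 2 ^ r)) * (L * (u ^ 3 * (2 * ((E + F) * (g * g) + E * (f * g))))) := by ring
      _ ≤ ofReal (3 * (4 * 2 ^ r)) * (L * (u ^ 3 * (4 * ((E + F) * (g * g) + E * (f * g))))) := by
          gcongr; norm_num
      _ = _ := by ring
  · refine (((((isSchur_left_right hr).bound hp hq hp D A D).add
      ((isSchur_right_right hr).bound hp hq hp D A D)).add ((isSchur_left_left hr).bound hp hf' hp D A D)).add
      ((isSchur_right_left hr).bound hp hf' hp D A D)).trilinear_le (c := 3 * (4 * 2 ^ r))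
      pos! (fun k j => (difference_pointwise hr hτ hη k j).trans ?_) |>.trans ?_
    · obtain ⟨hk, zk, Dk, vk0, ak, pk, -⟩ := mode_pos r τ η k
      obtain ⟨hj, zj, Dj, vj0, aj, pj, vj⟩ := mode_pos r τ η j
      have hl := pw_pos r τ η (k + j)
      have h : pw (r - ½) τ η j ≤ pw r τ η j := by unfold pw; gcongr <;> linarith
      calc _ ≤ 3 * (4 * 2 ^ r * ((hDecay r k + hDecay r j) * (pw r τ η k * pw r τ η j *
            pw r τ η (k + j) + vDecay k * kz j * (pw r τ η k * pw r τ η j * pw r τ η (k + j))))) := by gcongr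
        _ = _ := by
            linear_combination (-(12 * 2 ^ r * (hDecay r k + hDecay r j) *
              (pw r τ η k * pw r τ η j * pw r τ η (k + j)))) * vj
    generalize ofReal (2 * 2 ^ r) = u at *
    generalize latticeConst r ^ ½ = L at *
    calc _ ≤ ofReal (3 * (4 * 2 ^ r)) * (L * (u * g * (u * (E + F)) * (u * g)) +
          L * (u * g * (u * (E + F)) * (u * g)) + L * (u * g * (u * (E + F)) * (u * g)) +
          L * (u * g * (u * (E + F)) * (u * g))) := by gcongr
      _ = _ := by ring

/-- The transport term against two vertical derivatives. -/
lemma exists_vertical_trilinear (hr : 2 < r) : ∃ c, 0 < c ∧ ∀ τ η, 0 ≤ τ → 0 ≤ η → ∀ A,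
    trilinear (fun k => kz k ^ 2 * amp τ η k ^ 2) A A A ≤ ofReal c *
      ((energyE r τ η A ^ ½ + energyF r τ η A ^ ½) * energyE r τ η A ^ ½ *
        wsum (fun k => kz k ^ 4 * amp τ η k ^ 2) A ^ ½) := by
  have hr0 : 0 ≤ r := lin!
  have hl := latticeConst_sqrt_ne_top hr
  obtain ⟨c, hc, hL⟩ := exists_le_ofReal (x := ofReal 2 * (latticeConst r ^ ½ *
    (2 * ofReal (2 * 2 ^ r) ^ 2))) (by finiteness)
  refine ⟨c, hc, fun τ η hτ hη A => le_trans ?_ (mul_le_mul_left hL _)⟩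
  have hp : ∀ k, 0 ≤ pw r τ η k := fun k => (pw_pos r τ η k).le
  have hf := fun k => mul_nonneg (kz_nonneg k) (hp k)
  have hq : ∀ k, 0 ≤ (1 + kz k) * pw r τ η k := fun k => mul_nonneg (by linarith [kz_nonneg k]) (hp k)
  have hg : ∀ k, 0 ≤ kz k ^ 2 * amp τ η k := fun k => mul_nonneg (sq_nonneg _) (amp_pos _ _ _).le
  refine (((isSchur_left_left hr).bound hq hp hg A A A).add
    ((isSchur_left_left hr).bound hp hf hg A A A)).trilinear_le zero_le_two (fun k j => ?_) |>.trans ?_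
  · obtain ⟨hk, zk, Dk, vk0, ak, pk, vk⟩ := mode_pos r τ η k
    obtain ⟨hj, zj, Dj, vj0, aj, pj, -⟩ := mode_pos r τ η j
    have al := amp_pos τ η (k + j)
    have hD := hDecay_mul_pw r τ η k
    have h1 : (1 + kh j) * amp τ η j ≤ pw r τ η j := by
      unfold pw
      gcongr
      exact Real.self_le_rpow_of_one_le lin! lin!
    have h2 : kh j * amp τ η j ≤ pw r τ η j := le_trans (by gcongr; linarith) h1
    have h3 : amp τ η j ≤ pw r τ η j := le_trans (le_mul_of_one_le_left aj.le lin!) h1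
    have hT := mul_le_mul (amp_add_le hτ hη k j) (transport_le k j) (transport_nonneg k j) pos!
    have hk1 : amp τ η k ≤ hDecay r k * pw r τ η k := by rw [hD]; nlinarith
    have hk2 : kh k * amp τ η k ≤ hDecay r k * pw r τ η k := by rw [hD]; nlinarith
    calc _ = amp τ η (k + j) * transport k j * (kz (k + j) ^ 2 * amp τ η (k + j)) := by ring
      _ ≤ (amp τ η k * amp τ η j * (kh j + 2 * (vDecay k * kz j * kh k))) *
        (kz (k + j) ^ 2 * amp τ η (k + j)) := mul_le_mul_of_nonneg_right hT (hg _)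
      _ = (1 * (amp τ η k * (kh j * amp τ η j)) + 2 * (vDecay k * (kh k * amp τ η k) *
        (kz j * amp τ η j))) * (kz (k + j) ^ 2 * amp τ η (k + j)) := by ring
      _ ≤ (2 * (hDecay r k * pw r τ η k * pw r τ η j) + 2 * (vDecay k * (hDecay r k * pw r τ η k) *
        (kz j * pw r τ η j))) * (kz (k + j) ^ 2 * amp τ η (k + j)) := by gcongr; norm_num
      _ = _ := by
        linear_combination (-(2 * hDecay r k * pw r τ η k * pw r τ η j *
          (kz (k + j) ^ 2 * amp τ η (k + j)))) * vk
  have b1 := wnorm_pw_le hr0 τ η A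
  have b2 := wnorm_add_kz_pw_le hr0 τ η A
  have b3 := (wnorm_kz_pw_le hr0 τ η A).trans (mul_le_mul_right (le_add_self (b := energyE r τ η A ^ ½)) _)
  have b4 := wnorm_le (w := fun k => kz k ^ 4 * amp τ η k ^ 2) zero_le_one hg (fun k => le_of_eq (by ring)) A
  rw [ofReal_one, one_mul] at b4
  generalize ofReal (2 * 2 ^ r) = u at *
  generalize latticeConst r ^ ½ = L at *
  set E := energyE r τ η A ^ ½
  set F := energyF r τ η A ^ ½
  set Q := wsum (fun k => kz k ^ 4 * amp τ η k ^ 2) A ^ ½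
  calc _ ≤ ofReal 2 * (L * (u * (E + F) * (u * E) * Q) + L * (u * E * (u * (E + F)) * Q)) := by gcongr
    _ = _ := by ring


/-! ### Fourier series on the cell -/

/-- The phase of the exponential with wave vector `k`. -/
def phase (k : Mode) (q : Pt) : ℝ := 2 * π * k.1 * q.1 + 2 * π * k.2.1 * q.2.1 + π * k.2.2 * q.2.2

/-- The exponential with wave vector `k`. -/
def wave (k : Mode) (q : Pt) : ℂ := Complex.exp (I * (phase k q : ℝ))

/-- Fourier coefficients of complex functions. -/
def ccoeff (f : Pt → ℂ) (k : Mode) : ℂ := (1 / 2 : ℂ) * ∫ q, wave (-k) q * f q ∂μc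

lemma phase_add (k j) (q) : phase (k + j) q = phase k q + phase j q := by simp [phase]; ring

lemma phase_neg (k) (q) : phase (-k) q = -phase k q := by simp [phase]; ring

lemma wave_add (k j) (q) : wave (k + j) q = wave k q * wave j q := by
  simp only [wave, phase_add, ← Complex.exp_add]; congr 1; push_cast; ring

lemma norm_wave (k) (q) : ‖wave k q‖ = 1 := by unfold wave; rw [mul_comm]; exact Complex.norm_exp_ofReal_mul_I _

lemma conj_wave (k) (q) : conj (wave k q) = wave (-k) q := by
  simp only [wave, phase_neg, ← Complex.exp_conj, map_mul, conj_I, conj_ofReal]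
  congr 1; push_cast; ring

lemma wave_zero (q) : wave 0 q = 1 := by simp [wave, phase]


lemma continuous_phase (k) : Continuous (phase k) := by unfold phase; fun_prop

lemma continuous_wave (k) : Continuous (wave k) := by
  have := continuous_phase k
  unfold wave; fun_prop

lemma coeff_eq_ccoeff (f : Pt → ℝ) (k) : coeff f k = ccoeff (fun q => (f q)) k := by
  unfold coeff ccoeff
  congr 2
  ext q
  rw [wave, phase_neg, phase]
  congr 2
  push_cast
  ring

instance : IsFiniteMeasure μc := by
  refine ⟨?_⟩
  rw [cellMeasure, restrict_apply_univ, cell, volume_eq_prod, prod_prod, volume_eq_prod, prod_prod]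
  simp [volume_Ioo]

lemma cellMeasure_eq_prod : μc = (volume.restrict (Ioo (0) 1)).prod
    ((volume.restrict (Ioo (0) 1)).prod (volume.restrict (Ioo (-1 : ℝ) 1))) := by
  rw [prod_restrict, prod_restrict]; rfl

local instance : MeasureSpace 𝕋 := ⟨AddCircle.haarAddCircle⟩

local instance : IsProbabilityMeasure (volume : Measure 𝕋) :=
  inferInstanceAs (IsProbabilityMeasure AddCircle.haarAddCircle)

/-- The projection of the cell to the standard torus. -/
def toTorus (q : Pt) : UnitAddTorus (Fin 3) := ![((q.1 : ℝ) : 𝕋), ((q.2.1 : ℝ) : 𝕋), ((q.2.2 / 2 : ℝ) : 𝕋)]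

/-- The point of the closed cell over a point of the standard torus. -/
def ofTorus (p : UnitAddTorus (Fin 3)) : Pt :=
  ((AddCircle.equivIoc 1 0 (p 0)).1, (AddCircle.equivIoc 1 0 (p 1)).1,
    2 * (AddCircle.equivIoc 1 (-1 / 2) (p 2)).1)

lemma measurable_ofTorus : Measurable ofTorus := by
  have h : ∀ a, ∀ i : Fin 3, Measurable fun p : UnitAddTorus (Fin 3) =>
    (AddCircle.equivIoc 1 a (p i)).1 := fun a i =>
    measurable_subtype_coe.comp ((AddCircle.measurableEquivIoc 1 a).measurable.comp (measurable_pi_apply i))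
  exact (h 0 0).prodMk ((h 0 1).prodMk ((h (-1 / 2) 2).const_mul 2))

lemma ofTorus_toTorus {q : Pt} (hq : q ∈ cell) : ofTorus (toTorus q) = q := by
  obtain ⟨h1, h2, h3⟩ := hq
  have e : ∀ (a x : ℝ), x ∈ Ioc a (a + 1) → (AddCircle.equivIoc 1 a (x : 𝕋)).1 = x :=
    fun a x hx => AddCircle.equivIoc_coe_of_mem hx
  have e3 := e (-1 / 2) (q.2.2 / 2) ⟨by linarith [h3.1], by linarith [h3.2]⟩
  refine Prod.ext ?_ (Prod.ext ?_ ?_)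
  · exact e 0 q.1 ⟨h1.1, by linarith [h1.2]⟩
  · exact e 0 q.2.1 ⟨h2.1, by linarith [h2.2]⟩
  · change 2 * (AddCircle.equivIoc 1 (-1 / 2) ((q.2.2 / 2 : ℝ) : 𝕋)).1 = q.2.2
    rw [e3]; ring

lemma measurePreserving_coe (a) : MeasurePreserving (fun x : ℝ => (x : 𝕋))
    (volume.restrict (Ioo a (a + 1))) AddCircle.haarAddCircle := by
  have h := AddCircle.measurePreserving_mk 1 a
  rw [AddCircle.volume_eq_smul_haarAddCircle, ofReal_one, one_smul] at h
  rwa [Measure.restrict_congr_set Ioo_ae_eq_Ioc]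

lemma measurePreserving_coe_half : MeasurePreserving (fun x : ℝ => ((x / 2 : ℝ) : 𝕋))
    ((2⁻¹ : ℝ≥0∞) • volume.restrict (Ioo (-1 : ℝ) 1)) AddCircle.haarAddCircle := by
  have h := measurePreserving_coe (-1 / 2)
  have h2 : MeasurePreserving (fun x : ℝ => x / 2) ((2⁻¹ : ℝ≥0∞) • volume.restrict (Ioo (-1 : ℝ) 1))
    (volume.restrict (Ioo (-1 / 2 : ℝ) (-1 / 2 + 1))) := by
    refine ⟨by fun_prop, ?_⟩
    have h3 : (fun x : ℝ => x / 2) ⁻¹' Ioo (-1 / 2 : ℝ) (-1 / 2 + 1) = Ioo (-1) 1 := by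
      ext x; simp only [mem_preimage, mem_Ioo]; constructor <;> rintro ⟨h1, h2⟩ <;>
        constructor <;> linarith
    rw [Measure.map_smul, ← h3, ← Measure.restrict_map (by fun_prop) measurableSet_Ioo]
    have h4 : Measure.map (fun x : ℝ => x / 2) volume = (2 : ℝ≥0∞) • volume := by
      have := Real.map_volume_mul_left (a := (2 : ℝ)⁻¹) num!
      simp only [inv_inv] at this
      rw [show (fun x : ℝ => x / 2) = fun x => 2⁻¹ * x by ext; ring, this]
      simp
    rw [h4, Measure.restrict_smul, smul_smul, ENNReal.inv_mul_cancel num! num!, one_smul]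
  exact h.comp h2

lemma measurePreserving_toTorus : MeasurePreserving toTorus ((2⁻¹ : ℝ≥0∞) • μc) volume := by
  have h1 : MeasurePreserving (fun q : Pt => (((q.1 : ℝ) : 𝕋), ((q.2.1 : ℝ) : 𝕋),
    ((q.2.2 / 2 : ℝ) : 𝕋))) ((2⁻¹ : ℝ≥0∞) • μc) volume := by
    rw [cellMeasure_eq_prod, ← Measure.prod_smul_right, ← Measure.prod_smul_right]
    have h0 := measurePreserving_coe 0
    rw [zero_add] at h0
    have : SFinite ((2⁻¹ : ℝ≥0∞) • (volume : Measure ℝ).restrict (Ioo (-1 : ℝ) 1)) := inferInstance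
    exact h0.prod (h0.prod measurePreserving_coe_half)
  have h2 := (volume_preserving_piFinSuccAbove (fun _ : Fin 3 => 𝕋) 0).symm
  have h3 := (volume_preserving_piFinTwo (fun _ : Fin 2 => 𝕋)).symm
  have h4 : MeasurePreserving (fun p : 𝕋 × 𝕋 × 𝕋 =>
    (p.1, (MeasurableEquiv.piFinTwo fun _ => 𝕋).symm p.2)) volume volume :=
    (MeasurePreserving.id volume).prod h3
  have h5 := h2.comp (h4.comp h1)
  have h6 : toTorus = (MeasurableEquiv.piFinSuccAbove (fun _ : Fin 3 => 𝕋) 0).symm ∘ ((fun p : 𝕋 × 𝕋 × 𝕋 =>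
      (p.1, (MeasurableEquiv.piFinTwo fun _ => 𝕋).symm p.2)) ∘ fun q : Pt =>
      (((q.1 : ℝ) : 𝕋), ((q.2.1 : ℝ) : 𝕋), ((q.2.2 / 2 : ℝ) : 𝕋))) := by
    funext q i
    fin_cases i <;> rfl
  rw [h6]
  exact h5

/-- The wave vector as a function on `Fin 3`. -/
def modeEquiv : Mode ≃ (Fin 3 → ℤ) where
  toFun k := ![k.1, k.2.1, k.2.2]
  invFun n := (n 0, n 1, n 2)
  left_inv k := by simp
  right_inv n := by ext i; fin_cases i <;> rfl

lemma mFourier_toTorus (k) (q) : UnitAddTorus.mFourier (modeEquiv k) (toTorus q) = wave k q := by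
  simp only [UnitAddTorus.mFourier, ContinuousMap.coe_mk, Fin.prod_univ_three, modeEquiv, toTorus,
    Equiv.coe_fn_mk, Matrix.cons_val, fourier_coe_apply, ← Complex.exp_add, wave, phase]
  congr 1
  push_cast
  ring

lemma exists_torus_function (hf : MemLp f 2 μc) : ∃ g : Lp ℂ 2 (volume : Measure (UnitAddTorus (Fin 3))),
      (fun q => g (toTorus q)) =ᵐ[cellMeasure] f := by
  set f' := hf.1.mk f with hf'
  have h1 : StronglyMeasurable (f' ∘ ofTorus) := hf.1.stronglyMeasurable_mk.comp_measurable measurable_ofTorus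
  have hae : ∀ {p : Pt → Prop}, (∀ᵐ q ∂((2⁻¹ : ℝ≥0∞) • μc), p q) → ∀ᵐ q ∂μc, p q :=
    fun h => (Measure.ae_ennreal_smul_measure_iff (by simp)).1 h
  have h2 : (f' ∘ ofTorus) ∘ toTorus =ᵐ[cellMeasure] f := by
    filter_upwards [hf.1.ae_eq_mk, ae_restrict_mem (measurableSet_Ioo.prod
      (measurableSet_Ioo.prod measurableSet_Ioo))] with q h hq
    simp only [Function.comp_apply, ofTorus_toTorus hq]
    exact h.symm
  have h3 : MemLp (f' ∘ ofTorus) 2 volume := by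
    rw [← measurePreserving_toTorus.map_eq, memLp_map_measure_iff
      h1.aestronglyMeasurable measurePreserving_toTorus.aemeasurable]
    exact ((memLp_congr_ae h2).2 hf).smul_measure (by simp)
  refine ⟨h3.toLp _, ?_⟩
  have h4 : (fun q => h3.toLp _ (toTorus q)) =ᵐ[cellMeasure] fun q => (f' ∘ ofTorus) (toTorus q) :=
    hae (measurePreserving_toTorus.quasiMeasurePreserving.ae_eq_comp h3.coeFn_toLp)
  exact h4.trans h2

lemma integral_torus {g : UnitAddTorus (Fin 3) → ℂ} (hg : AEStronglyMeasurable g volume) :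
    ∫ p, g p = (1 / 2 : ℂ) * ∫ q, g (toTorus q) ∂μc := by
  rw [← measurePreserving_toTorus.map_eq] at hg ⊢
  rw [integral_map measurePreserving_toTorus.aemeasurable hg, integral_smul_measure]
  simp

lemma integral_wave (hk : k ≠ 0) : ∫ q, wave k q ∂μc = 0 := by
  have h := orthonormal_iff_ite.1 (UnitAddTorus.orthonormal_mFourier (d := Fin 3)) 0 (modeEquiv k)
  have h0 : (0 : Fin 3 → ℤ) ≠ modeEquiv k := fun h => hk (modeEquiv.injective
    (h.symm.trans (by ext i; fin_cases i <;> rfl)))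
  rw [if_neg h0, ContinuousMap.inner_toLp] at h
  have hm : AEStronglyMeasurable (fun t => UnitAddTorus.mFourier (modeEquiv k) t) volume :=
    (UnitAddTorus.mFourier (modeEquiv k)).continuous.aestronglyMeasurable
  have h3 : ∫ t, UnitAddTorus.mFourier (modeEquiv k) t = 0 := by simpa [UnitAddTorus.mFourier_zero] using h
  have h2 := integral_torus hm
  rw [h3] at h2
  simpa [mFourier_toTorus] using h2.symm

/-- Parseval's identity on the cell. -/
lemma hasSum_ccoeff (hf : MemLp f 2 μc) (hg : MemLp g 2 μc) :
    HasSum (fun k => conj (ccoeff f k) * ccoeff g k) ((1 / 2 : ℂ) * ∫ q, conj (f q) * g q ∂μc) := by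
  obtain ⟨F, hF⟩ := exists_torus_function hf
  obtain ⟨G, hG⟩ := exists_torus_function hg
  have hc : ∀ {f : Pt → ℂ} {F : Lp ℂ 2 (volume : Measure (UnitAddTorus (Fin 3)))},
    (fun q => F (toTorus q)) =ᵐ[cellMeasure] f → ∀ k,
    UnitAddTorus.mFourierCoeff F (modeEquiv k) = ccoeff f k := fun {f F} h k => by
    unfold UnitAddTorus.mFourierCoeff ccoeff
    have hm : AEStronglyMeasurable (fun t => UnitAddTorus.mFourier (-modeEquiv k) t • F t) volume :=
      (UnitAddTorus.mFourier (-modeEquiv k)).continuous.aestronglyMeasurable.smul (Lp.aestronglyMeasurable F)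
    refine (integral_torus hm).trans ?_
    congr 1
    refine integral_congr_ae ?_
    filter_upwards [h] with q hq
    have : -modeEquiv k = modeEquiv (-k) := by ext i; fin_cases i <;> rfl
    rw [this, mFourier_toTorus, hq, smul_eq_mul]
  have h := (UnitAddTorus.hasSum_prod_mFourierCoeff F G)
  rw [← modeEquiv.hasSum_iff] at h
  simp only [Function.comp_def, hc hF, hc hG] at h
  convert h using 1
  have hm : AEStronglyMeasurable (fun t => conj (F t) * G t) volume :=
    (continuous_conj.comp_aestronglyMeasurable (Lp.aestronglyMeasurable F)).mul (Lp.aestronglyMeasurable G)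
  refine Eq.trans ?_ (integral_torus hm).symm
  congr 1
  refine integral_congr_ae ?_
  filter_upwards [hF, hG] with q h1 h2
  rw [h1, h2]


/-! ### Consequences of Parseval's identity -/

lemma ccoeff_wave_mul (f) (j k) : ccoeff (fun q => wave j q * f q) k = ccoeff f (k - j) := by
  unfold ccoeff
  congr 2; ext q
  rw [← mul_assoc, ← wave_add]; congr 2; abel

lemma ccoeff_conj (f) (k) : ccoeff (fun q => conj (f q)) k = conj (ccoeff f (-k)) := by
  unfold ccoeff
  rw [map_mul, ← integral_conj]
  congr 1
  · rw [map_div₀, map_one]; congr 1; exact (Complex.conj_ofNat 2).symm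
  · congr 1; ext q; rw [map_mul, conj_wave, neg_neg]

lemma memLp_conj {p} {μ : Measure Pt} (hf : MemLp f p μ) : MemLp (fun q => conj (f q)) p μ :=
  hf.congr_norm (continuous_conj.comp_aestronglyMeasurable hf.1) (.of_forall fun q => by simp)

lemma memLp_wave_mul {p} (hf : MemLp f p μc) (j) : MemLp (fun q => wave j q * f q) p μc :=
  hf.congr_norm ((continuous_wave j).aestronglyMeasurable.mul hf.1) (.of_forall fun q => by simp [norm_wave])

/-- The convolution theorem. -/
lemma hasSum_ccoeff_mul (hf : MemLp f 2 μc) (hg : MemLp g 2 μc)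
    (l) : HasSum (fun k => ccoeff f k * ccoeff g (l - k)) (ccoeff (fun q => f q * g q) l) := by
  have h := hasSum_ccoeff (memLp_conj hf) (memLp_wave_mul hg (-l))
  rw [← (Equiv.neg Mode).hasSum_iff] at h
  convert h using 1
  · ext k
    simp only [Function.comp_apply, Equiv.neg_apply, ccoeff_conj, ccoeff_wave_mul, neg_neg,
      RingHomCompTriple.comp_apply, RingHom.id_apply]
    congr 2; abel
  · unfold ccoeff
    congr 2; ext q; simp; ring

lemma hasSum_norm_sq_ccoeff (hf : MemLp f 2 μc) :
    HasSum (fun k => ‖ccoeff f k‖ ^ 2) (1 / 2 * ∫ q, ‖f q‖ ^ 2 ∂μc) := by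
  have h := hasSum_ccoeff hf hf
  rw [← Complex.hasSum_ofReal]
  convert h using 1
  · ext k; rw [Complex.conj_mul']; push_cast; rfl
  · push_cast; congr 1
    rw [← integral_complex_ofReal]
    congr 1; ext q; rw [Complex.conj_mul']; push_cast; rfl

lemma ccoeff_sub (hf : MemLp f 2 μc) (hg : MemLp g 2 μc)
    (k) : ccoeff (fun q => f q - g q) k = ccoeff f k - ccoeff g k := by
  unfold ccoeff
  rw [← mul_sub, ← integral_sub]
  · congr 2; ext q; ring
  · exact (memLp_wave_mul hf _).integrable num!
  · exact (memLp_wave_mul hg _).integrable num!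

lemma ae_eq_of_ccoeff_eq (hf : MemLp f 2 μc) (hg : MemLp g 2 μc)
    (h : ∀ k, ccoeff f k = ccoeff g k) : f =ᵐ[cellMeasure] g := by
  have h1 := hasSum_norm_sq_ccoeff (hf.sub hg)
  have h2 : ∀ k, ccoeff (f - g) k = 0 := fun k => (ccoeff_sub hf hg k).trans (by rw [h k, sub_self])
  simp only [h2, norm_zero, ne_eq, OfNat.ofNat_ne_zero, not_false_eq_true, zero_pow] at h1
  have h3 := h1.unique hasSum_zero
  have h4 : ∫ q, ‖(f - g) q‖ ^ 2 ∂μc = 0 := lin!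
  rw [integral_eq_zero_iff_of_nonneg (fun q => by positivity) (hf.sub hg).integrable_norm_pow'] at h4
  filter_upwards [h4] with q hq
  simpa [sub_eq_zero] using hq

/-! ### Reflection in the vertical variable -/

/-- The reflected wave vector. -/
def flip (k : Mode) : Mode := (k.1, k.2.1, -k.2.2)

lemma flip_flip (k) : flip (flip k) = k := by simp [flip]

lemma flip_neg (k) : flip (-k) = -flip k := by simp [flip]

lemma flip_sub (k j) : flip (k - j) = flip k - flip j := by simp [flip]; ring

lemma wave_reflect (k) (q) : wave k (reflect q) = wave (flip k) q := by
  simp only [wave, phase, reflect, flip]; congr 2; push_cast; ring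

lemma measurePreserving_reflect : MeasurePreserving reflect μc μc := by
  have h : MeasurePreserving (fun x => -x) (volume.restrict (Ioo (-1 : ℝ) 1))
    (volume.restrict (Ioo (-1 : ℝ) 1)) := by
    have := (Measure.measurePreserving_neg (volume : Measure ℝ)).restrict_preimage
      (s := Ioo (-1 : ℝ) 1) measurableSet_Ioo
    simpa using this
  rw [cellMeasure_eq_prod]
  exact (MeasurePreserving.id _).prod ((MeasurePreserving.id _).prod h)

lemma reflect_reflect (q) : reflect (reflect q) = q := by simp [reflect]

lemma measurable_reflect : Measurable reflect := by unfold reflect; fun_prop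

lemma measurableEmbedding_reflect : MeasurableEmbedding reflect :=
  (MeasurableEquiv.mk ⟨reflect, reflect, reflect_reflect, reflect_reflect⟩
    measurable_reflect measurable_reflect).measurableEmbedding

lemma ccoeff_reflect (f) (k) : ccoeff (fun q => f (reflect q)) k = ccoeff f (flip k) := by
  unfold ccoeff
  congr 1
  rw [← measurePreserving_reflect.integral_comp measurableEmbedding_reflect fun q => wave (-flip k) q * f q]
  congr 1; ext q
  rw [wave_reflect, flip_neg, flip_flip]

/-! ### Synthesis -/

lemma ccoeff_wave (j k) : ccoeff (wave j) k = if j = k then 1 else 0 := by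
  unfold ccoeff
  have h : (fun q => wave (-k) q * wave j q) = wave (j - k) := by ext q; rw [← wave_add]; congr 1; abel
  rw [h]
  split_ifs with hjk
  · subst hjk
    rw [sub_self, show wave 0 = fun _ => (1 : ℂ) from funext wave_zero, integral_const]
    have : cellMeasure.real univ = 2 := by
      rw [Measure.real, cellMeasure, restrict_apply_univ, cell, volume_eq_prod,
        prod_prod, volume_eq_prod, prod_prod]
      simp [volume_Ioo]; norm_num
    rw [this]; simp
  · rw [integral_wave (sub_ne_zero.2 hjk), mul_zero]

/-- The sum of a trigonometric series. -/
def synth (a : Mode → ℂ) (q : Pt) : ℂ := ∑' k, a k * wave k q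

lemma norm_mul_wave (a : Mode → ℂ) (k) (q) : ‖a k * wave k q‖ = ‖a k‖ := by rw [norm_mul, norm_wave, mul_one]

lemma continuous_synth {a : Mode → ℂ} (ha : Summable fun k => ‖a k‖) : Continuous (synth a) :=
  continuous_tsum (fun k => continuous_const.mul (continuous_wave k)) ha fun k q => (norm_mul_wave a k q).le

lemma norm_synth_le {a : Mode → ℂ} (ha : Summable fun k => ‖a k‖) (q) : ‖synth a q‖ ≤ ∑' k, ‖a k‖ := by
  have h : Summable fun k => ‖a k * wave k q‖ := by simpa only [norm_mul_wave] using ha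
  exact (norm_tsum_le_tsum_norm h).trans_eq (by simp only [norm_mul_wave])

lemma memLp_synth {a : Mode → ℂ} (ha : Summable fun k => ‖a k‖) (p) :
    MemLp (synth a) p μc := MemLp.of_bound (continuous_synth ha).aestronglyMeasurable _
    (.of_forall (norm_synth_le ha))

lemma ccoeff_synth {a : Mode → ℂ} (ha : Summable fun k => ‖a k‖) (k) : ccoeff (synth a) k = a k := by
  unfold ccoeff
  have h := hasSum_integral_of_dominated_convergence (μ := μc)
    (F := fun j q => wave (-k) q * (a j * wave j q)) (f := fun q => wave (-k) q * synth a q) (fun j _ => ‖a j‖)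
    (fun j => ((continuous_wave _).mul (continuous_const.mul (continuous_wave j))).aestronglyMeasurable)
    (fun j => .of_forall fun q => by rw [norm_mul, norm_wave, norm_mul_wave, one_mul])
    (.of_forall fun q => ha) (integrable_const _) (.of_forall fun q => by
      have : Summable fun j => a j * wave j q := Summable.of_norm (by simpa only [norm_mul_wave] using ha)
      exact this.hasSum.mul_left _)
  have h2 := (h.mul_left (1 / 2 : ℂ))
  refine h2.unique (Eq.mp (congrArg (fun F => HasSum F (a k)) (funext fun j => ?_)) (hasSum_ite_eq k (a k)))
  symm
  have h3 : ∫ q, wave (-k) q * (a j * wave j q) ∂μc = a j * ∫ q, wave (-k) q * wave j q ∂μc := by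
    rw [← integral_const_mul]; congr 1; ext q; ring
  rw [h3, mul_left_comm]
  have h4 := ccoeff_wave j k
  unfold ccoeff at h4
  rw [h4]
  split_ifs with h5
  · rw [h5, mul_one]
  · rw [mul_zero]

lemma wave_periodic (k) (x y z) : wave k (x + 1, y, z) = wave k (x, y, z) ∧
    wave k (x, y + 1, z) = wave k (x, y, z) ∧ wave k (x, y, z + 2) = wave k (x, y, z) := by
  have key : ∀ (q q' : Pt) (n : ℤ), phase k q' = phase k q + n * (2 * π) →
    wave k q' = wave k q := fun q q' n h => by
    unfold wave
    rw [Complex.exp_eq_exp_iff_exists_int]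
    exact ⟨n, by rw [h]; push_cast; ring⟩
  exact ⟨key _ _ k.1 (by simp only [phase]; ring), key _ _ k.2.1 (by simp only [phase]; ring),
    key _ _ k.2.2 (by simp only [phase]; ring)⟩

lemma synth_periodic (a : Mode → ℂ) (x y z) : synth a (x + 1, y, z) = synth a (x, y, z) ∧
    synth a (x, y + 1, z) = synth a (x, y, z) ∧ synth a (x, y, z + 2) = synth a (x, y, z) := by
  simp only [synth, wave_periodic, and_self]

lemma wave_neg_eq (k) (q) : wave (-k) q = conj (wave k q) := (conj_wave k q).symm

lemma conj_synth {a : Mode → ℂ} (h : ∀ k, a (-k) = conj (a k)) (q) : conj (synth a q) = synth a q := by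
  unfold synth
  rw [Complex.conj_tsum, ← (Equiv.neg Mode).tsum_eq]
  refine tsum_congr fun k => ?_
  simp only [Equiv.neg_apply, map_mul, h, wave_neg_eq, Complex.conj_conj]

lemma synth_reflect (a : Mode → ℂ) (q) : synth a (reflect q) = synth (fun k => a (flip k)) q := by
  unfold synth
  rw [← (Equiv.mk flip flip flip_flip flip_flip).tsum_eq]
  refine tsum_congr fun k => ?_
  simp [wave_reflect, flip_flip]

/-! ### Coefficients of vector fields -/

/-- Complex horizontal velocities. -/
abbrev CVel := EuclideanSpace ℂ (Fin 2)

local notation:max "Coef" => Mode → CVel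
variable {a₀ : Coef} {a : ℝ → Coef}

/-- The Fourier coefficients of a vector field. -/
def fc (f : Pt → Vel) (k : Mode) : CVel := WithLp.toLp 2 fun i => ccoeff (fun q => (f q i : ℂ)) k

lemma fc_apply (f) (k) (i) : fc f k i = ccoeff (fun q => (f q i)) k := rfl

lemma coeffSq_eq (f) (k) : coeffSq f k = ‖fc f k‖ₑ ^ 2 := by
  have h : ‖fc f k‖ ^ 2 = ∑ i, ‖fc f k i‖ ^ 2 := norm_sq_eq _
  unfold coeffSq
  rw [← ofReal_norm, ← ofReal_pow (norm_nonneg _), h, ofReal_sum_of_nonneg fun i _ => by positivity]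
  refine sum_congr rfl fun i _ => ?_
  rw [coeff_eq_ccoeff, ofReal_pow (norm_nonneg _), ofReal_norm, fc_apply]

lemma normSq_zero_eq (r τ η) (f) : normSq r 0 τ η f = energyE r τ η N[fc f] := by
  unfold normSq energyE wsum; simp only [coeffSq_eq]

lemma dzNormSq_eq (r τ η) (f) : dzNormSq r τ η f = energyF r τ η N[fc f] := by
  unfold dzNormSq energyF wsum; simp only [coeffSq_eq]

lemma memLp_component {f : Pt → Vel} {μ : Measure Pt} {p : ℝ≥0∞} (hf : MemLp f p μ) (i) :
    MemLp (fun q => ((f q i : ℝ) : ℂ)) p μ := by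
  have h : MemLp (fun q => f q i) p μ := (proj (𝕜 := ℝ) i).comp_memLp' hf
  exact h.ofReal

lemma eLpNorm_sq_eq {f : Pt → Vel} (hf : MemLp f 2 μc) : eLpNorm f 2 μc ^ 2 = 2 * ∑' k, ‖fc f k‖ₑ ^ 2 := by
  have h1 : ∀ i : Fin 2, ∑' k, ‖fc f k i‖ₑ ^ 2
    = ofReal (1 / 2 * ∫ q, ‖((f q i : ℝ) : ℂ)‖ ^ 2 ∂μc) := fun i => by
    have := hasSum_norm_sq_ccoeff (memLp_component hf i)
    rw [← this.tsum_eq, ENNReal.ofReal_tsum_of_nonneg (fun k => by positivity) this.summable]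
    refine tsum_congr fun k => ?_
    rw [ofReal_pow (norm_nonneg _), ofReal_norm, fc_apply]
  have h2 : ∀ k, ‖fc f k‖ₑ ^ 2 = ∑ i, ‖fc f k i‖ₑ ^ 2 := fun k => by
    rw [← coeffSq_eq]; simp only [coeffSq, coeff_eq_ccoeff, fc_apply]
  simp only [h2, Fin.sum_univ_two]
  rw [tsum_add, h1, h1, ← ofReal_add pos! pos!, ← mul_add,
    ← integral_add (memLp_component hf 0).integrable_norm_pow' (memLp_component hf 1).integrable_norm_pow']
  have h3 : ∀ q, ‖((f q 0 : ℝ) : ℂ)‖ ^ 2 + ‖((f q 1 : ℝ) : ℂ)‖ ^ 2 = ‖f q‖ ^ 2 := fun q => by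
    rw [norm_sq_eq, Fin.sum_univ_two]; simp
  simp_rw [h3]
  have h4 : eLpNorm f 2 μc ^ 2 = ofReal (∫ q, ‖f q‖ ^ 2 ∂μc) := by
    rw [hf.eLpNorm_eq_integral_rpow_norm num! num!, ← ofReal_pow pos!]
    congr 1
    simp only [ENNReal.toReal_ofNat, Real.rpow_ofNat]
    rw [← Real.rpow_natCast, ← Real.rpow_mul pos!]
    norm_num
  rw [h4, ofReal_mul num!, ← mul_assoc]
  have : (2 : ℝ≥0∞) * ofReal (1 / 2) = 1 := by
    rw [show (2 : ℝ≥0∞) = ofReal 2 by norm_num, ← ofReal_mul num!]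
    norm_num
  rw [this, one_mul]

lemma fc_sub {f g} (hf : MemLp f 2 μc) (hg : MemLp g 2 μc) (k) : fc (f - g) k = fc f k - fc g k := by
  ext i
  simp only [fc_apply, Pi.sub_apply, PiLp.sub_apply, Complex.ofReal_sub]
  exact ccoeff_sub (memLp_component hf i) (memLp_component hg i) k

lemma ae_eq_of_fc_eq {f g : Pt → Vel} (hf : MemLp f 2 μc) (hg : MemLp g 2 μc)
    (h : ∀ k, fc f k = fc g k) : f =ᵐ[cellMeasure] g := by
  have h1 : ∀ i : Fin 2, ∀ᵐ q ∂μc, ((f q i : ℝ) : ℂ) = (g q i : ℝ) := fun i =>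
    ae_eq_of_ccoeff_eq (memLp_component hf i) (memLp_component hg i) fun k => by
      rw [← fc_apply, ← fc_apply, h k]
  filter_upwards [h1 0, h1 1] with q h0 h1
  ext i
  fin_cases i
  · exact_mod_cast h0
  · exact_mod_cast h1

lemma fc_congr_ae {f g} (h : f =ᵐ[cellMeasure] g) (k) : fc f k = fc g k := by
  ext i
  simp only [fc_apply, ccoeff]
  congr 1
  refine integral_congr_ae ?_
  filter_upwards [h] with q hq
  rw [hq]

lemma fc_neg (f) (k) (i) : fc f (-k) i = conj (fc f k i) := by
  have h := ccoeff_conj (fun q => ((f q i : ℝ) : ℂ)) (-k)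
  simp only [conj_ofReal, neg_neg] at h
  exact h

lemma fc_flip {f} (hf : ∀ᵐ q ∂μc, f (reflect q) = f q) (k) : fc f (flip k) = fc f k := by
  ext i
  simp only [fc_apply]
  rw [← ccoeff_reflect]
  unfold ccoeff
  congr 1
  refine integral_congr_ae ?_
  filter_upwards [hf] with q hq
  rw [hq]


/-! ### The dynamics of the Fourier coefficients -/

/-- `l · a` for the horizontal wave vector of `l`. -/
def hdot (l : Mode) (a : CVel) : ℂ := ((2 * π * l.1 : ℝ) : ℂ) * a 0 + ((2 * π * l.2.1 : ℝ) : ℂ) * a 1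

/-- The horizontal wave vector. -/
def hvec (l : Mode) : CVel := WithLp.toLp 2 ![((2 * π * l.1 : ℝ) : ℂ), ((2 * π * l.2.1 : ℝ) : ℂ)]

/-- The vertical velocity determined by the divergence condition. -/
def om (k : Mode) (a : CVel) : ℂ := -hdot k a / ((π * k.2.2 : ℝ) : ℂ)

/-- `l · (a, om k a)`, the symbol of the transport by the mode `k`. -/
def usym (l k : Mode) (a : CVel) : ℂ := hdot l a + ((π * l.2.2 : ℝ) : ℂ) * om k a

/-- The Fourier coefficients of the transport of `b` by `a`. -/
def conv (a b : Coef) (l : Mode) : CVel := ∑' k, (I * usym l k (a k)) • b (l - k)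

/-- Removal of the pressure gradient. -/
def leray (l : Mode) (b : CVel) : CVel :=
  if l.2.2 = 0 then b - (hdot l b / ((kh l ^ 2 : ℝ) : ℂ)) • hvec l else b

/-- The rotation `(a, b) ↦ (-b, a)`. -/
def cperp (a : CVel) : CVel := WithLp.toLp 2 ![-(a 1), a 0]

/-- The right-hand side of the evolution of the Fourier coefficients. -/
def rhs (ν Ω : ℝ) (a : Coef) (l : Mode) : CVel :=
  -leray l (conv a a l + (Ω : ℂ) • cperp (a l)) - ((ν * kz l ^ 2 : ℝ) : ℂ) • a l

lemma hdot_add (l) (a b) : hdot l (a + b) = hdot l a + hdot l b := by simp [hdot]; ring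

lemma hdot_sub (l) (a b) : hdot l (a - b) = hdot l a - hdot l b := by simp [hdot]; ring

lemma hdot_smul (l) (c) (a) : hdot l (c • a) = c * hdot l a := by simp [hdot]; ring

lemma hdot_add_left (k j) (a) : hdot (k + j) a = hdot k a + hdot j a := by simp [hdot]; ring

lemma kh_sq (l) : kh l ^ 2 = (2 * π * l.1) ^ 2 + (2 * π * l.2.1) ^ 2 := by
  unfold kh; rw [mul_pow, sq_sqrt pos!]; ring

lemma norm_cvel_sq (a : CVel) : ‖a‖ ^ 2 = ‖a 0‖ ^ 2 + ‖a 1‖ ^ 2 := by rw [norm_sq_eq, Fin.sum_univ_two]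

lemma norm_hdot_le (l) (a) : ‖hdot l a‖ ≤ kh l * ‖a‖ := by
  have h0 : ‖hdot l a‖ ≤ |2 * π * l.1| * ‖a 0‖ + |2 * π * l.2.1| * ‖a 1‖ := by
    refine (norm_add_le _ _).trans_eq ?_
    rw [norm_mul, norm_mul, norm_real, norm_real, norm_eq_abs, norm_eq_abs]
  refine h0.trans (abs_le_of_sq_le_sq' ?_ (by have := kh_nonneg l; positivity)).2
  rw [mul_pow, kh_sq, norm_cvel_sq, ← sq_abs (2 * π * l.1), ← sq_abs (2 * π * l.2.1)]
  nlinarith [sq_nonneg (|2 * π * (l.1 : ℝ)| * ‖a 1‖ - |2 * π * (l.2.1 : ℝ)| * ‖a 0‖)]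

lemma hdot_hvec (l) : hdot l (hvec l) = ((kh l ^ 2 : ℝ) : ℂ) := by rw [kh_sq]; simp [hdot, hvec]; ring


lemma hdot_leray (hl : l.2.2 = 0) (b) : hdot l (leray l b) = 0 := by
  unfold leray
  rw [if_pos hl, hdot_sub, hdot_smul, hdot_hvec]
  rcases eq_or_ne (kh l) 0 with h | h
  · have := norm_hdot_le l b
    rw [h, zero_mul, norm_le_zero_iff] at this
    simp [this]
  · rw [div_mul_cancel₀, sub_self]
    exact_mod_cast pow_ne_zero 2 h

lemma leray_eq_self {b} (h : l.2.2 = 0 → hdot l b = 0) : leray l b = b := by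
  unfold leray
  split_ifs with hl
  · rw [h hl]; simp
  · rfl

lemma leray_add (l) (a b) : leray l (a + b) = leray l a + leray l b := by
  unfold leray
  split_ifs
  · rw [hdot_add, add_div, add_smul]; abel
  · rfl

lemma leray_smul (l : Mode) (c : ℂ) (a : CVel) : leray l (c • a) = c • leray l a := by
  unfold leray
  split_ifs
  · rw [hdot_smul, mul_div_assoc, mul_smul, smul_sub]
  · rfl


lemma inner_cvel (a b : CVel) : inner ℝ a b = (conj (a 0) * b 0 + conj (a 1) * b 1).re := by
  rw [PiLp.inner_apply, Fin.sum_univ_two, add_re]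
  simp only [Complex.inner, mul_comm]

lemma inner_hvec {d : CVel} (hd : hdot l d = 0) (c : ℂ) : inner ℝ d (c • hvec l) = 0 := by
  have h : conj (hdot l d) = 0 := by rw [hd, map_zero]
  simp only [hdot, map_add, map_mul, conj_ofReal] at h
  rw [inner_cvel]
  have : conj (d 0) * (c • hvec l) 0 + conj (d 1) * (c • hvec l) 1 =
    c * (((2 * π * l.1 : ℝ) : ℂ) * conj (d 0) + ((2 * π * l.2.1 : ℝ) : ℂ) * conj (d 1)) := by simp [hvec]; ring
  rw [this, h, mul_zero, zero_re]

lemma inner_leray {d} (hd : l.2.2 = 0 → hdot l d = 0) (b) : inner ℝ d (leray l b) = inner ℝ d b := by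
  unfold leray
  split_ifs with hl
  · rw [inner_sub_right, inner_hvec (hd hl), sub_zero]
  · rfl

lemma inner_cperp (a : CVel) (Ω : ℝ) : inner ℝ a ((Ω : ℂ) • cperp a) = 0 := by
  rw [inner_cvel]
  simp [cperp]
  ring

lemma cperp_sub (a b) : cperp (a - b) = cperp a - cperp b := by ext i; fin_cases i <;> simp [cperp]; ring

lemma norm_cperp (a) : ‖cperp a‖ = ‖a‖ := by
  have : ‖cperp a‖ ^ 2 = ‖a‖ ^ 2 := by rw [norm_cvel_sq, norm_cvel_sq]; simp [cperp]; ring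
  exact (sq_eq_sq₀ (norm_nonneg _) (norm_nonneg _)).1 this

lemma om_sub (k) (a b) : om k (a - b) = om k a - om k b := by simp only [om, hdot_sub]; ring

lemma usym_sub (l k) (a b) : usym l k (a - b) = usym l k a - usym l k b := by
  simp only [usym, hdot_sub, om_sub]; ring

lemma norm_pi_mul_int (n : ℤ) : ‖((π * n : ℝ) : ℂ)‖ = π * |(n : ℝ)| := by
  rw [norm_real, norm_eq_abs, abs_mul, abs_of_pos Real.pi_pos]

lemma norm_om_le (k) (a) : ‖om k a‖ ≤ kh k / kz k * ‖a‖ := by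
  unfold om
  rw [norm_div, norm_neg, norm_pi_mul_int, div_mul_eq_mul_div]
  exact div_le_div_of_nonneg_right (norm_hdot_le k a) (kz_nonneg k)

lemma norm_om_le' (k) (a) : ‖om k a‖ ≤ kh k * ‖a‖ := by
  refine (norm_om_le k a).trans ?_
  gcongr
  rcases kz_eq_zero_or k with h | h
  · rw [h, div_zero]; exact kh_nonneg k
  · exact div_le_self (kh_nonneg k) h

/-- The divergence condition makes the transporting symbol independent of the transporting mode. -/
lemma usym_add {a} (h : k.2.2 = 0 → hdot k a = 0) (j) : usym (k + j) k a = usym j k a := by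
  have h1 : hdot k a + ((π * k.2.2 : ℝ) : ℂ) * om k a = 0 := by
    rcases eq_or_ne k.2.2 0 with h0 | h0
    · simp [om, h h0]
    · unfold om
      rw [mul_div_cancel₀, add_neg_cancel]
      have : (k.2.2 : ℝ) ≠ 0 := by exact_mod_cast h0
      exact_mod_cast mul_ne_zero Real.pi_ne_zero this
  unfold usym
  rw [hdot_add_left]
  have h2 : ((π * (k + j).2.2 : ℝ) : ℂ) = ((π * k.2.2 : ℝ) : ℂ) + ((π * j.2.2 : ℝ) : ℂ) := by simp; ring
  rw [h2]
  linear_combination h1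

lemma norm_usym_le (j k) (a) : ‖usym j k a‖ ≤ transport k j * ‖a‖ := by
  unfold usym transport
  calc _ ≤ kh j * ‖a‖ + kz j * (kh k / kz k * ‖a‖) := by
        refine (norm_add_le _ _).trans (add_le_add (norm_hdot_le j a) ?_)
        rw [norm_mul, norm_pi_mul_int]
        exact mul_le_mul_of_nonneg_left (norm_om_le k a) (kz_nonneg j)
    _ = _ := by ring

lemma norm_usym_le' (l k) (a) : ‖usym l k a‖ ≤ (kh l + kz l) * ((1 + kh k) * ‖a‖) := by
  have h1 := kh_nonneg l
  have h2 := kz_nonneg l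
  have h3 := kh_nonneg k
  unfold usym
  calc _ ≤ kh l * ‖a‖ + kz l * (kh k * ‖a‖) := by
        refine (norm_add_le _ _).trans (add_le_add (norm_hdot_le l a) ?_)
        rw [norm_mul, norm_pi_mul_int]
        exact mul_le_mul_of_nonneg_left (norm_om_le' k a) h2
    _ ≤ _ := by
        have h4 := norm_nonneg a
        nlinarith [mul_nonneg h1 (mul_nonneg h3 h4), mul_nonneg h2 h4]

/-- A modewise divergence-free field. -/
def IsSolenoidal (a : Coef) : Prop := ∀ k, k.2.2 = 0 → hdot k (a k) = 0

lemma enorm_conv_le {a} (ha : IsSolenoidal a) (b) (l) :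
    ‖conv a b l‖ₑ ≤ ∑' k, ofReal (transport k (l - k)) * (‖a k‖ₑ * ‖b (l - k)‖ₑ) := by
  refine enorm_tsum_le_tsum_enorm.trans (tsum_le_tsum fun k => ?_)
  have h : usym l k (a k) = usym (l - k) k (a k) := by
    have := usym_add (ha k) (l - k)
    rwa [add_sub_cancel] at this
  rw [h, ← ofReal_norm, norm_smul, norm_mul, norm_I, one_mul, ← ofReal_norm, ← ofReal_norm,
    ← ofReal_mul (norm_nonneg _), ← ofReal_mul (transport_nonneg _ _), ← mul_assoc]
  exact ofReal_le_ofReal (mul_le_mul_of_nonneg_right (norm_usym_le _ _ _) (norm_nonneg _))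

lemma tsum_enorm_conv_le (hw : ∀ k, 0 ≤ w k) {a : Coef} (ha : IsSolenoidal a)
    (b d : Coef) : ∑' l, ofReal (w l) * (‖conv a b l‖ₑ * ‖d l‖ₑ) ≤ trilinear w N[a] N[b] N[d] := by
  have h : trilinear w N[a] N[b] N[d] =
    ∑' k, ∑' l, ofReal (w l * transport k (l - k)) * (‖a k‖ₑ * ‖b (l - k)‖ₑ * ‖d l‖ₑ) := by
    rw [← tsum_shear]
    unfold trilinear
    refine tsum_congr fun p => ?_
    rw [add_sub_cancel_left]
  rw [h, tsum_comm]
  refine tsum_le_tsum fun l => ?_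
  calc _ ≤ ofReal (w l) * ((∑' k, ofReal (transport k (l - k)) *
    (‖a k‖ₑ * ‖b (l - k)‖ₑ)) * ‖d l‖ₑ) := by gcongr; exact enorm_conv_le ha b l
    _ = _ := by
      rw [← ENNReal.tsum_mul_right, ← ENNReal.tsum_mul_left]
      refine tsum_congr fun k => ?_
      rw [ofReal_mul (hw l)]
      ring

/-- `∑ (1 + |k|)² |a_k|²`. -/
def hOne (a : Coef) : ℝ≥0∞ := wsum (fun k => (1 + kh k) ^ 2) N[a]

lemma hOne_le (hr : 1 ≤ r) (hτ : 0 ≤ τ) (hη : 0 ≤ η) (a) :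
    hOne a ≤ ofReal ((2 ^ r) ^ 2) * energyE r τ η N[a] := by
  unfold hOne energyE
  rw [← wsum_const_mul pos!]
  refine wsum_mono (fun k => ?_) _
  have h := kh_nonneg k
  calc (1 + kh k) ^ 2 ≤ pw r τ η k ^ 2 := by
        refine pow_le_pow_left₀ lin! ?_ 2
        unfold pw
        calc 1 + kh k = (1 + kh k) ^ (1 : ℝ) * 1 := by rw [Real.rpow_one, mul_one]
          _ ≤ _ := by
            gcongr
            · linarith
            · exact one_le_amp hτ hη k
    _ ≤ _ := (pw_sq_le_core lin! τ η k).trans (by gcongr; exact core_le_weight _ _ _ _)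

lemma tsum_sq_le_hOne (a) : ∑' k, ‖a k‖ₑ ^ 2 ≤ hOne a := by
  refine tsum_le_tsum fun k => ?_
  have h := kh_nonneg k
  calc ‖a k‖ₑ ^ 2 = ofReal 1 * ‖a k‖ₑ ^ 2 := by simp
    _ ≤ _ := by gcongr; nlinarith

lemma tsum_conv_le (a b) (l) : ∑' k, ‖(I * usym l k (a k)) • b (l - k)‖ₑ ≤
      ofReal (kh l + kz l) * (hOne a ^ ½ * hOne b ^ ½) := by
  have hl : 0 ≤ kh l + kz l := add_nonneg (kh_nonneg l) (kz_nonneg l)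
  calc _ ≤ ∑' k, ofReal (kh l + kz l) * ((ofReal (1 + kh k) * ‖a k‖ₑ) * ‖b (l - k)‖ₑ) := by
        refine tsum_le_tsum fun k => ?_
        have hk : 0 ≤ 1 + kh k := by linarith [kh_nonneg k]
        rw [← mul_assoc, ← ofReal_norm, norm_smul, norm_mul, norm_I, one_mul, ← ofReal_norm,
          ← ofReal_norm, ← ofReal_mul hk, ← ofReal_mul hl, ← ofReal_mul pos!]
        exact ofReal_le_ofReal (mul_le_mul_of_nonneg_right (norm_usym_le' _ _ _) (norm_nonneg _))
    _ ≤ _ := by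
        rw [ENNReal.tsum_mul_left]
        gcongr
        refine (tsum_mul_le_sqrt _ _).trans ?_
        gcongr
        · unfold hOne wsum
          refine tsum_le_tsum fun k => ?_
          rw [mul_pow, ofReal_pow (by linarith [kh_nonneg k])]
        · exact ((Equiv.subLeft l).tsum_eq (N[b] ^ 2)).trans_le (tsum_sq_le_hOne b)

lemma enorm_conv_le_hOne (a b) (l) : ‖conv a b l‖ₑ ≤ ofReal (kh l + kz l) * (hOne a ^ ½ * hOne b ^ ½) :=
  enorm_tsum_le_tsum_enorm.trans (tsum_conv_le a b l)

lemma summable_conv {a b} (ha : hOne a < ⊤) (hb : hOne b < ⊤) (l) :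
    Summable fun k => (I * usym l k (a k)) • b (l - k) := by
  refine Summable.of_enorm ((tsum_conv_le a b l).trans_lt ?_).ne
  exact mul_lt_top ofReal_lt_top (mul_lt_top (rpow_lt_top_of_nonneg num! ha.ne)
    (rpow_lt_top_of_nonneg num! hb.ne))

lemma enorm_sub_sq_le (a b : E) : ‖a - b‖ₑ ^ 2 ≤ 2 * (‖a‖ₑ ^ 2 + ‖b‖ₑ ^ 2) := by
  rw [← ofReal_norm, ← ofReal_norm, ← ofReal_norm, ← ofReal_pow (norm_nonneg _),
    ← ofReal_pow (norm_nonneg _), ← ofReal_pow (norm_nonneg _), ← ofReal_add pos! pos!,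
    show 2 = ofReal 2 by norm_num, ← ofReal_mul num!]
  refine ofReal_le_ofReal ?_
  have h1 := norm_sub_le a b
  nlinarith [norm_nonneg (a - b), sq_nonneg (‖a‖ - ‖b‖)]

lemma wsum_sub_le (w : Mode → ℝ) (a b : Coef) : wsum w D[a, b] ≤ 2 * (wsum w N[a] + wsum w N[b]) := by
  unfold wsum
  rw [← tsum_add, ← ENNReal.tsum_mul_left]
  refine tsum_le_tsum fun k => ?_
  rw [← mul_add, mul_left_comm]
  gcongr
  exact enorm_sub_sq_le (a k) (b k)

lemma hOne_sub_lt_top {a b} (ha : hOne a < ⊤) (hb : hOne b < ⊤) : hOne (a - b) < ⊤ :=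
  (wsum_sub_le _ a b).trans_lt (mul_lt_top num! (add_lt_top.2 ⟨ha, hb⟩))

lemma conv_sub_conv {a b} (ha : hOne a < ⊤) (hb : hOne b < ⊤) (l) :
    conv a a l - conv b b l = conv a (a - b) l + conv (a - b) b l := by
  have hd := hOne_sub_lt_top ha hb
  unfold conv
  rw [← (summable_conv ha ha l).tsum_sub (summable_conv hb hb l),
    ← (summable_conv ha hd l).tsum_add (summable_conv hd hb l)]
  refine tsum_congr fun k => ?_
  simp only [Pi.sub_apply, usym_sub]
  module

/-! ### Symmetries -/

/-- The field is even in `z` and real. -/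
structure IsSymmetric (a : Coef) : Prop where
  flip : ∀ k, a (flip k) = a k
  herm : ∀ k i, a (-k) i = conj (a k i)

lemma hdot_flip (l) (a) : hdot (flip l) a = hdot l a := rfl

lemma om_flip (k) (a) : om (flip k) a = -om k a := by
  simp only [om, hdot_flip]
  simp [flip, div_neg, neg_div]

lemma usym_flip (l k) (a) : usym (flip l) (flip k) a = usym l k a := by
  simp only [usym, hdot_flip, om_flip]
  simp [flip]

lemma hdot_conj {a b} (h : ∀ i, b i = conj (a i)) (l) : hdot (-l) b = -conj (hdot l a) := by
  simp only [hdot, h, map_add, map_mul, conj_ofReal]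
  simp; ring

lemma om_conj {a b} (h : ∀ i, b i = conj (a i)) (l) : om (-l) b = conj (om l a) := by
  simp only [om, hdot_conj h]
  simp [neg_div, div_neg]

lemma usym_conj {a b} (h : ∀ i, b i = conj (a i)) (l k) : usym (-l) (-k) b = -conj (usym l k a) := by
  simp only [usym, hdot_conj h, om_conj h]
  simp; ring


lemma kz_flip (k) : kz (flip k) = kz k := by simp [kz, flip]

def flipEquiv : Mode ≃ Mode := ⟨flip, flip, flip_flip, flip_flip⟩

lemma conv_flip {a b} (ha : ∀ k, a (flip k) = a k) (hb : ∀ k, b (flip k) = b k)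
    (l) : conv a b (flip l) = conv a b l := by
  unfold conv
  rw [← flipEquiv.tsum_eq]
  refine tsum_congr fun k => ?_
  simp only [flipEquiv, Equiv.coe_fn_mk, ← flip_sub, ha, hb, usym_flip]

lemma tsum_cvel_apply {f : Coef} (hf : Summable f) (i) : (∑' k, f k) i = ∑' k, f k i :=
  ((proj (𝕜 := ℂ) i).map_tsum hf)

lemma conv_conj {a b : Coef} (ha : hOne a < ⊤) (hb : hOne b < ⊤)
    (hac : ∀ k i, a (-k) i = conj (a k i)) (hbc : ∀ k i, b (-k) i = conj (b k i))
    (l) (i) : conv a b (-l) i = conj (conv a b l i) := by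
  unfold conv
  rw [tsum_cvel_apply (summable_conv ha hb _), tsum_cvel_apply (summable_conv ha hb _),
    Complex.conj_tsum, ← (Equiv.neg Mode).tsum_eq]
  refine tsum_congr fun k => ?_
  have h : -l - -k = -(l - k) := by abel
  simp only [Equiv.neg_apply, PiLp.smul_apply, smul_eq_mul, h, hbc, usym_conj (hac k), map_mul, conj_I]
  ring

lemma leray_flip (l) (b) : leray (flip l) b = leray l b := by
  have h : (flip l).2.2 = 0 ↔ l.2.2 = 0 := by simp [flip]
  unfold leray
  by_cases hl : l.2.2 = 0
  · rw [if_pos hl, if_pos (h.2 hl)]; rfl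
  · rw [if_neg hl, if_neg (mt h.1 hl)]

lemma leray_conj {a b} (h : ∀ i, b i = conj (a i)) (l) (i) : leray (-l) b i = conj (leray l a i) := by
  have h' : (-l).2.2 = 0 ↔ l.2.2 = 0 := by simp
  unfold leray
  by_cases hl : l.2.2 = 0
  · rw [if_pos hl, if_pos (h'.2 hl), hdot_conj h, kh_neg]
    simp only [PiLp.sub_apply, PiLp.smul_apply, h, map_sub, smul_eq_mul, map_mul, map_div₀, conj_ofReal]
    have : hvec (-l) i = -conj (hvec l i) := by
      fin_cases i
      · change ((2 * π * (-l).1 : ℝ) : ℂ) = -conj ((2 * π * l.1 : ℝ) : ℂ)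
        rw [conj_ofReal]; simp
      · change ((2 * π * (-l).2.1 : ℝ) : ℂ) = -conj ((2 * π * l.2.1 : ℝ) : ℂ)
        rw [conj_ofReal]; simp
    rw [this]; ring
  · rw [if_neg hl, if_neg (mt h'.1 hl), h]

lemma IsSymmetric.rhs {a} (h : IsSymmetric a) (ha : hOne a < ⊤) (ν Ω) : IsSymmetric (rhs ν Ω a) where
  flip l := by simp only [PrimEq.rhs, leray_flip, conv_flip h.flip h.flip, h.flip, kz_flip]
  herm l i := by
    have h1 : ∀ i, (conv a a (-l) + (Ω : ℂ) • cperp (a (-l))) i =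
      conj ((conv a a l + (Ω : ℂ) • cperp (a l)) i) := fun i => by
      simp only [PiLp.add_apply, PiLp.smul_apply, conv_conj ha ha h.herm h.herm, map_add, smul_eq_mul,
        map_mul, conj_ofReal]
      congr 2
      fin_cases i <;> simp [cperp, h.herm]
    simp only [PrimEq.rhs, PiLp.sub_apply, PiLp.neg_apply, PiLp.smul_apply, leray_conj h1, kz_neg,
      h.herm, map_sub, map_neg, smul_eq_mul, map_mul, conj_ofReal]

lemma IsSolenoidal.rhs {a} (h : IsSolenoidal a) (ν Ω) : IsSolenoidal (rhs ν Ω a) := fun l hl => by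
  simp only [PrimEq.rhs, hdot_sub, hdot_smul, h l hl, mul_zero, sub_zero]
  rw [← neg_one_smul ℂ, hdot_smul, hdot_leray hl, mul_zero]

/-- Solutions of the evolution of the Fourier coefficients. -/
structure IsModeSolution (ν Ω T : ℝ) (a : ℝ → Coef) : Prop where
  solenoidal : ∀ t ∈ Icc 0 T, IsSolenoidal (a t)
  integrable : ∀ k, IntervalIntegrable (fun s => rhs ν Ω (a s) k) volume 0 T
  eq : ∀ k, ∀ t ∈ Icc 0 T, a t k = a 0 k + ∫ s in 0..t, rhs ν Ω (a s) k


/-! ### Absolutely continuous functions -/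

lemma absolutelyContinuous_lipschitz_comp {f : ℝ → ℝ} {g : ℝ → ℝ} {a : ℝ} {K : ℝ≥0}
    {s : Set ℝ} (hg : LipschitzOnWith K g s) (hs : ∀ x ∈ uIcc a b, f x ∈ s) (hf : ACOn f a b) :
    ACOn (fun x => g (f x)) a b := by
  rw [absolutelyContinuousOnInterval_iff] at hf ⊢
  intro ε hε
  obtain ⟨δ, hδ, h⟩ := hf (ε / (K + 1)) pos!
  refine ⟨δ, hδ, fun E hE hlt => ?_⟩
  calc _ ≤ ∑ i ∈ Finset.range E.1, K * dist (f (E.2 i).1) (f (E.2 i).2) :=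
    sum_le_sum fun i hi => hg.dist_le_mul _ (hs _ (hE.1 i hi).1) _ (hs _ (hE.1 i hi).2)
    _ = K * ∑ i ∈ Finset.range E.1, dist (f (E.2 i).1) (f (E.2 i).2) := (mul_sum _ _ _).symm
    _ ≤ K * (ε / (K + 1)) := by gcongr; exact (h E hE hlt).le
    _ < (K + 1) * (ε / (K + 1)) := by gcongr; linarith
    _ = ε := by field_simp

lemma absolutelyContinuous_exp {f} {a} (hf : ACOn f a b) : ACOn (fun x => exp (f x)) a b := by
  obtain ⟨M, hM⟩ := hf.exists_bound
  have h1 : ContDiffOn ℝ 1 exp (Icc (-M) M) := Real.contDiff_exp.contDiffOn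
  obtain ⟨K, hK⟩ := h1.exists_lipschitzOnWith (by decide) (convex_Icc _ _) isCompact_Icc
  exact absolutelyContinuous_lipschitz_comp hK (fun x hx => abs_le.1 (hM x hx)) hf

lemma absolutelyContinuous_const (c a b : ℝ) : ACOn (fun _ => c) a b :=
  (LipschitzWith.const c).lipschitzOnWith.absolutelyContinuousOnInterval

lemma absolutelyContinuous_normSq {g : ℝ → CVel} {a : ℝ} (hg : IntervalIntegrable g volume a b)
    (d₀ : CVel) : ACOn (fun t => ‖d₀ + ∫ s in a..t, g s‖ ^ 2) a b := by
  have key : ∀ L : CVel →L[ℝ] ℝ, ACOn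
    (fun t => L (d₀ + ∫ s in a..t, g s) * L (d₀ + ∫ s in a..t, g s)) a b := fun L => by
    have h1 : IntervalIntegrable (fun s => L (g s)) volume a b :=
      ⟨L.integrable_comp hg.1, L.integrable_comp hg.2⟩
    have h2 := (absolutelyContinuous_const (L d₀) a b).fun_add
      (h1.absolutelyContinuousOnInterval_intervalIntegral left_mem_uIcc)
    have h3 : ∀ t ∈ uIcc a b, L d₀ + ∫ s in a..t, L (g s) = L (d₀ + ∫ s in a..t, g s) := fun t ht => by
      rw [map_add, L.intervalIntegral_comp_comm (hg.mono_set (uIcc_subset_uIcc_left ht))]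
    have h4 := h2.fun_mul h2
    rw [absolutelyContinuousOnInterval_iff] at h4 ⊢
    intro ε hε
    obtain ⟨δ, hδ, h⟩ := h4 ε hε
    refine ⟨δ, hδ, fun E hE hlt => ?_⟩
    refine lt_of_eq_of_lt (sum_congr rfl fun i hi => ?_) (h E hE hlt)
    rw [h3 _ (hE.1 i hi).1, h3 _ (hE.1 i hi).2]
  let P : Fin 2 → CVel →L[ℝ] ℂ := fun i => (proj (𝕜 := ℂ) i).restrictScalars ℝ
  have h := ((key (reCLM.comp (P 0))).fun_add (key (Complex.imCLM.comp (P 0)))).fun_add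
    ((key (reCLM.comp (P 1))).fun_add (key (Complex.imCLM.comp (P 1))))
  refine Eq.mp (congrArg (fun F => ACOn F a b) (funext fun t => ?_)) h
  rw [norm_cvel_sq, ← Complex.normSq_eq_norm_sq, ← Complex.normSq_eq_norm_sq, Complex.normSq_apply,
    Complex.normSq_apply]
  rfl

/-- The energy identity for one mode. -/
lemma weighted_energy {d g : ℝ → CVel} {φ φ' : ℝ → ℝ} (h : t₀ ≤ t₁)
    (hg : IntervalIntegrable g volume t₀ t₁) (hd : ∀ t ∈ Icc t₀ t₁, d t = d t₀ + ∫ s in t₀..t, g s)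
    (hφ : ACOn φ t₀ t₁) (hφ' : ∀ᵐ t, t ∈ uIcc t₀ t₁ → HasDerivAt φ (φ' t) t) :
    IntervalIntegrable (fun t => φ' t * ‖d t‖ ^ 2 + φ t * (2 * inner ℝ (d t) (g t))) volume t₀ t₁ ∧
    ∫ t in t₀..t₁, (φ' t * ‖d t‖ ^ 2 + φ t * (2 * inner ℝ (d t) (g t))) =
      φ t₁ * ‖d t₁‖ ^ 2 - φ t₀ * ‖d t₀‖ ^ 2 := by
  set D := fun t => d t₀ + ∫ s in t₀..t, g s with hD
  have h1 : ACOn (fun t => φ t * ‖D t‖ ^ 2) t₀ t₁ := hφ.fun_mul (absolutelyContinuous_normSq hg _)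
  have h2 : ∀ᵐ t, t ∈ uIcc t₀ t₁ → deriv (fun t => φ t * ‖D t‖ ^ 2) t =
    φ' t * ‖d t‖ ^ 2 + φ t * (2 * inner ℝ (d t) (g t)) := by
    filter_upwards [hφ', hg.ae_hasDerivAt_integral] with t ht1 ht2 ht
    have h3 : HasDerivAt D (g t) t := (ht2 ht t₀ left_mem_uIcc).const_add _
    have h4 : d t = D t := hd t (by rwa [uIcc_of_le h] at ht)
    rw [h4]
    exact ((ht1 ht).mul h3.norm_sq).deriv
  have h5 : ∀ᵐ t, t ∈ uIoc t₀ t₁ → deriv (fun t => φ t * ‖D t‖ ^ 2) t =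
    φ' t * ‖d t‖ ^ 2 + φ t * (2 * inner ℝ (d t) (g t)) := by
    filter_upwards [h2] with t ht ht'
    exact ht (uIoc_subset_uIcc ht')
  refine ⟨h1.intervalIntegrable_deriv.congr_ae ((ae_restrict_iff' measurableSet_uIoc).2 h5), ?_⟩
  rw [← intervalIntegral.integral_congr_ae h5, h1.integral_deriv_eq_sub]
  simp only [hD, integral_same, add_zero]
  rw [← hd t₁ (right_mem_Icc.2 h)]

lemma ofReal_integral_le {f : α → ℝ} (hf : Integrable f μ) : ofReal (∫ x, f x ∂μ) ≤ ∫⁻ x, ofReal (f x) ∂μ := by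
  have h1 : ∫ x, f x ∂μ ≤ ∫ x, max (f x) 0 ∂μ := integral_mono hf hf.pos_part fun x => le_max_left _ _
  refine (ofReal_le_ofReal h1).trans_eq ?_
  rw [ofReal_integral_eq_lintegral_ofReal hf.pos_part (.of_forall fun x => le_max_right _ _)]
  refine lintegral_congr fun x => ?_
  rcases le_total (f x) 0 with h | h
  · rw [max_eq_right h, ofReal_zero, ENNReal.ofReal_of_nonpos h]
  · rw [max_eq_left h]

/-- The weight of one mode with decreasing horizontal and growing vertical radius: absolute continuity
and derivative. -/
lemma hasDerivAt_moving_weight {σ₀ : ℝ} {R : ℝ → ℝ} (hR : IntervalIntegrable R volume t₀ t₁) (k : Mode) :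
    ACOn (fun t => exp (-(C * ∫ s in t₀..t, R s)) *
      weight r 0 (σ₀ - C * ∫ s in t₀..t, R s) (ν / 2 * t) k) t₀ t₁ ∧
    ∀ᵐ t, t ∈ uIcc t₀ t₁ → HasDerivAt (fun t => exp (-(C * ∫ s in t₀..t, R s)) *
      weight r 0 (σ₀ - C * ∫ s in t₀..t, R s) (ν / 2 * t) k) (exp (-(C * ∫ s in t₀..t, R s)) *
        (-(C * R t) * (weight r 0 (σ₀ - C * ∫ s in t₀..t, R s) (ν / 2 * t) k +
          2 * (kh k * core r (σ₀ - C * ∫ s in t₀..t, R s) (ν / 2 * t) k)) +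
          ν * kz k * core r (σ₀ - C * ∫ s in t₀..t, R s) (ν / 2 * t) k)) t := by
  have hJ := hR.absolutelyContinuousOnInterval_intervalIntegral left_mem_uIcc
  have ht : ACOn (fun t => t) t₀ t₁ := LipschitzWith.id.lipschitzOnWith.absolutelyContinuousOnInterval
  have hσ := (absolutelyContinuous_const σ₀ t₀ t₁).fun_sub (hJ.const_mul C)
  constructor
  · refine (absolutelyContinuous_exp (hJ.const_mul C).fun_neg).fun_mul ?_
    refine (absolutelyContinuous_const 1 t₀ t₁).fun_add ?_
    refine ((absolutelyContinuous_const _ t₀ t₁).fun_mul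
      (absolutelyContinuous_exp ?_)).fun_mul (absolutelyContinuous_exp ?_)
    · exact (hσ.const_mul 2).fun_mul (absolutelyContinuous_const _ t₀ t₁)
    · exact ((ht.const_mul (ν / 2)).const_mul 2).fun_mul (absolutelyContinuous_const _ t₀ t₁)
  · filter_upwards [hR.ae_hasDerivAt_integral] with t h1 h2
    have h3 := (h1 h2 t₀ left_mem_uIcc).const_mul C
    have h4 := h3.fun_neg.exp
    have h5 : HasDerivAt (fun t => exp (2 * (σ₀ - C * ∫ s in t₀..t, R s) * kh k)) _ t :=
      (((h3.const_sub σ₀).const_mul 2).mul_const (kh k)).exp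
    have h6 : HasDerivAt (fun t => exp (2 * (ν / 2 * t) * kz k)) _ t :=
      ((((hasDerivAt_id t).const_mul (ν / 2)).const_mul 2).mul_const (kz k)).exp
    have h7 := h4.fun_mul (((h5.const_mul (kh k ^ (2 * r) + kz k ^ (2 * 0))).fun_mul h6).const_add 1)
    refine h7.congr_deriv ?_
    simp only [weight, core, id_eq, mul_zero, pow_zero]
    ring


/-! ### Stability of the mode dynamics -/

/-- `∑ |k| (1 + ...)`, the horizontal dissipation created by the shrinking radius. -/
def energyG (r τ η : ℝ) (D : Amp) : ℝ≥0∞ := wsum (fun k => kh k * core r τ η k) D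

lemma one_le_core (hτ : 0 ≤ τ) (hη : 0 ≤ η) (k) : 1 ≤ core r τ η k := by
  have h1 := kh_nonneg k
  have h2 := kz_nonneg k
  have h3 : 1 ≤ kh k ^ (2 * r) + 1 := by
    have := rpow_nonneg h1 (2 * r); linarith
  unfold core
  exact one_le_mul_of_one_le_of_one_le (one_le_mul_of_one_le_of_one_le h3 (one_le_exp pos!)) (one_le_exp pos!)

lemma energyP_le_add (hτ : 0 ≤ τ) (hη : 0 ≤ η) (D) :
    energyP r τ η D ≤ energyE (r - ½) τ η D + 2 * energyG (r - ½) τ η D := by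
  unfold energyP energyE energyG
  rw [show 2 = ofReal 2 by norm_num, ← wsum_const_mul num!, ← wsum_add (fun k => weight_nonneg) fun k => by
      have := kh_nonneg k; have := core_nonneg (r - ½) τ η k; positivity]
  refine wsum_mono (fun k => ?_) D
  have h1 := kh_nonneg k
  have h2 := one_le_core (r := r - ½) hτ hη k
  rw [weight_zero]
  nlinarith [mul_le_mul_of_nonneg_left h2 h1]

lemma one_add_kh_mul_weight_le (hr : 1 ≤ r) (hτ : 0 ≤ τ) (hη : 0 ≤ η) (k) :
    (1 + kh k) * weight (r - ½) 0 τ η k ≤ 3 * (2 ^ r) ^ 2 * weight r 0 τ η k := by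
  have h1 := kh_nonneg k
  have h2 := weight_le_pw_sq (r := r - ½) lin! hτ hη k
  have h3 : pw r τ η k ^ 2 = pw (r - ½) τ η k ^ 2 * (1 + kh k) := by rw [pw_eq_mul_sqrt, mul_pow, sq_sqrt lin!]
  have h4 := pw_sq_le_core (r := r) lin! τ η k
  have h5 := core_le_weight r τ η k
  calc _ ≤ (1 + kh k) * (3 * pw (r - ½) τ η k ^ 2) := by gcongr
    _ = 3 * pw r τ η k ^ 2 := by rw [h3]; ring
    _ ≤ 3 * ((2 ^ r) ^ 2 * weight r 0 τ η k) := by gcongr; exact h4.trans (by gcongr)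
    _ = _ := by ring

lemma energyP_le (hr : 1 ≤ r) (hτ : 0 ≤ τ) (hη : 0 ≤ η) (D) :
    energyP r τ η D ≤ ofReal (3 * (2 ^ r) ^ 2) * energyE r τ η D := by
  unfold energyP energyE
  rw [← wsum_const_mul pos!]
  exact wsum_mono (fun k => one_add_kh_mul_weight_le hr hτ hη k) D

lemma energyF_half_le (hr : 1 ≤ r) (hτ : 0 ≤ τ) (hη : 0 ≤ η) (D) :
    energyF (r - ½) τ η D ≤ ofReal (3 * (2 ^ r) ^ 2) * energyF r τ η D := by
  unfold energyF
  rw [← wsum_const_mul pos!]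
  refine wsum_mono (fun k => ?_) D
  have h1 := kh_nonneg k
  have h2 := (weight_pos (r - ½) τ η k).le
  calc _ ≤ kz k ^ 2 * ((1 + kh k) * weight (r - ½) 0 τ η k) := by gcongr; nlinarith
    _ ≤ kz k ^ 2 * (3 * (2 ^ r) ^ 2 * weight r 0 τ η k) := by
      exact mul_le_mul_of_nonneg_left (one_add_kh_mul_weight_le hr hτ hη k) (sq_nonneg _)
    _ = _ := by ring

/-- `E^{1/2} + F^{1/2} + E / ν`. -/
def loss (r ν τ η : ℝ) (A : Amp) : ℝ≥0∞ :=
  energyE r τ η A ^ ½ + energyF r τ η A ^ ½ + energyE r τ η A / ofReal ν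


/-- The nonlinear term is controlled by dissipation. -/
lemma difference_absorption (hc : 0 < c) (hν : 0 < ν) {Sa Sb Ea FD P R}
    (h1 : Sa + Ea / ofReal ν + Sb ≤ R) : 2 * (ofReal c * (Sa * P + Ea ^ ½ * (FD ^ ½ * P ^ ½)) +
      ofReal c * (Sb * P)) ≤ ofReal ν * FD + ofReal (2 * c + 4 * c ^ 2) * (R * P) := by
  have h2 : Ea ^ ½ * (FD ^ ½ * P ^ ½) = FD ^ ½ * (Ea * P) ^ ½ := by rw [mul_rpow_of_nonneg _ _ num!]; ring
  have h3 := ennreal_sqrt_mul_sqrt_le FD (Ea * P) (δ := ν / (2 * c)) pos!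
  have h4 : Ea = ofReal ν * (Ea / ofReal ν) := (ENNReal.mul_div_cancel (by simpa using hν) ofReal_ne_top).symm
  set X := Ea / ofReal ν
  rw [h2]
  have h5 : 2 = ofReal 2 := num!
  calc _ ≤ 2 * (ofReal c * (Sa * P + (ofReal (ν / (2 * c)) * FD +
    ofReal (ν / (2 * c))⁻¹ * (Ea * P))) + ofReal c * (Sb * P)) := by gcongr
    _ = ofReal ν * FD + (ofReal (2 * c) * ((Sa + Sb) * P) + ofReal (4 * c ^ 2) * (X * P)) := by
      have e1 : 2 * (ofReal c * ofReal (ν / (2 * c))) = ofReal ν := by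
        rw [h5, ← ofReal_mul hc.le, ← ofReal_mul num!]
        congr 1; field_simp
      have e2 : 2 * (ofReal c * (ofReal (ν / (2 * c))⁻¹ * ofReal ν)) = ofReal (4 * c ^ 2) := by
        rw [h5, ← ofReal_mul pos!, ← ofReal_mul hc.le, ← ofReal_mul num!]
        congr 1; field_simp; norm_num
      have e3 : 2 * ofReal c = ofReal (2 * c) := by rw [h5, ← ofReal_mul num!]
      rw [← e1, ← e2, ← e3, h4]
      ring
    _ ≤ ofReal ν * FD + (ofReal (2 * c) * (R * P) + ofReal (4 * c ^ 2) * (R * P)) := by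
      gcongr
      · refine le_trans ?_ h1
        rw [add_right_comm]; exact le_self_add
      · refine le_trans ?_ h1
        rw [add_right_comm]; exact le_add_self
    _ = _ := by rw [← add_mul, ← ofReal_add pos! pos!]

/-- The transport terms of a difference, paired with the difference. -/
lemma tsum_difference_pairing_le (hw : ∀ k, 0 ≤ w k) {a b}
    (ha : IsSolenoidal a) (hb : IsSolenoidal b) (ha1 : hOne a < ⊤) (hb1 : hOne b < ⊤) :
    ∑' l, ofReal (w l) * ‖inner ℝ ((a - b) l) (conv a a l - conv b b l)‖ₑ ≤
      trilinear w N[a] D[a, b] D[a, b] + trilinear w D[a, b] N[b] D[a, b] := by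
  have hd : IsSolenoidal (a - b) := fun k hk => by rw [Pi.sub_apply, hdot_sub, ha k hk, hb k hk, sub_zero]
  refine le_trans ?_ (add_le_add (tsum_enorm_conv_le hw ha (a - b) (a - b))
    (tsum_enorm_conv_le hw hd b (a - b)))
  rw [← tsum_add]
  refine tsum_le_tsum fun l => ?_
  rw [← mul_add, ← add_mul, conv_sub_conv ha1 hb1]
  gcongr
  calc _ ≤ ‖(a - b) l‖ₑ * ‖conv a (a - b) l + conv (a - b) b l‖ₑ := by
        rw [← ofReal_norm, ← ofReal_norm, ← ofReal_norm, ← ofReal_mul (norm_nonneg _)]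
        exact ofReal_le_ofReal (norm_inner_le_norm _ _)
    _ ≤ ‖(a - b) l‖ₑ * (‖conv a (a - b) l‖ₑ + ‖conv (a - b) b l‖ₑ) := by gcongr; exact enorm_add_le _ _
    _ = _ := mul_comm _ _

lemma inner_rhs_sub {a b} (ha : IsSolenoidal a) (hb : IsSolenoidal b) (ν Ω)
    (l) : inner ℝ (a l - b l) (rhs ν Ω a l - rhs ν Ω b l) =
      -inner ℝ (a l - b l) (conv a a l - conv b b l) - ν * kz l ^ 2 * ‖a l - b l‖ ^ 2 := by
  have hd : l.2.2 = 0 → hdot l (a l - b l) = 0 := fun h => by rw [hdot_sub, ha l h, hb l h, sub_zero]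
  have h1 : rhs ν Ω a l - rhs ν Ω b l = -leray l (conv a a l - conv b b l +
    (Ω : ℂ) • cperp (a l - b l)) - ((ν * kz l ^ 2 : ℝ) : ℂ) • (a l - b l) := by
    unfold rhs
    have e : conv a a l - conv b b l + (Ω : ℂ) • cperp (a l - b l) =
      (conv a a l + (Ω : ℂ) • cperp (a l)) + (-1 : ℂ) • (conv b b l + (Ω : ℂ) • cperp (b l)) := by
      rw [cperp_sub]; module
    rw [e]
    generalize conv a a l + (Ω : ℂ) • cperp (a l) = X
    generalize conv b b l + (Ω : ℂ) • cperp (b l) = Y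
    rw [leray_add, leray_smul]
    module
  have h2 : inner ℝ (a l - b l) (((ν * kz l ^ 2 : ℝ) : ℂ) • (a l - b l)) =
    ν * kz l ^ 2 * ‖a l - b l‖ ^ 2 := by rw [coe_smul, inner_smul_right, real_inner_self_eq_norm_sq]
  rw [h1, inner_sub_right, inner_neg_right, inner_leray hd, inner_add_right, inner_cperp, add_zero, h2]


lemma IsModeSolution.continuousOn (h : IsModeSolution ν Ω T a)
    (hT : 0 ≤ T) (k) : ContinuousOn (fun t => a t k) (Icc 0 T) := by
  have h1 := continuousOn_primitive_interval' (h.integrable k) (left_mem_uIcc (a := 0) (b := T))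
  rw [uIcc_of_le hT] at h1
  exact (continuousOn_const.add h1).congr fun t ht => h.eq k t ht

lemma IsModeSolution.eq_of_le (h : IsModeSolution ν Ω T a) (h0 : 0 ≤ t₀) (h1 : t₀ ≤ t) (h2 : t ≤ T) (k) :
    a t k = a t₀ k + ∫ s in t₀..t, rhs ν Ω (a s) k := by
  rw [h.eq k t ⟨h0.trans h1, h2⟩, h.eq k t₀ ⟨h0, h1.trans h2⟩, add_assoc,
    intervalIntegral.integral_add_adjacent_intervals]
  · exact (h.integrable k).mono_set (by
      rw [uIcc_of_le h0, uIcc_of_le (h0.trans (h1.trans h2))]; exact Icc_subset_Icc_right (h1.trans h2))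
  · exact (h.integrable k).mono_set (by
      rw [uIcc_of_le h1, uIcc_of_le (h0.trans (h1.trans h2))]; exact Icc_subset_Icc h0 h2)

/-- The weighted energy inequality for one mode of the difference of two solutions. -/
lemma IsModeSolution.difference_mode (hν : 0 < ν)
    {b} (ha : IsModeSolution ν Ω T a) (hb : IsModeSolution ν Ω T b)
    {σ₀} {R} (h0 : 0 ≤ t₀) (h01 : t₀ ≤ t₁) (h1 : t₁ ≤ T) (hC : 0 ≤ C)
    (hR : IntervalIntegrable R volume t₀ t₁) (hR0 : ∀ t, 0 ≤ R t) (k) :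
    let ψ := fun t => exp (-(C * ∫ s in t₀..t, R s))
    let W := fun t => weight r 0 (σ₀ - C * ∫ s in t₀..t, R s) (ν / 2 * t) k
    let G := fun t => kh k * core r (σ₀ - C * ∫ s in t₀..t, R s) (ν / 2 * t) k
    let q := fun t => inner ℝ (a t k - b t k) (conv (a t) (a t) k - conv (b t) (b t) k)
    let n := fun t => ψ t * (ν * (kz k ^ 2 * W t) + C * R t * (W t + 2 * G t)) * ‖a t k - b t k‖ ^ 2
    AEMeasurable (fun t => ofReal (n t)) (volume.restrict (Ioc t₀ t₁)) ∧
    AEMeasurable (fun t => ofReal (ψ t * (2 * W t)) * ‖q t‖ₑ) (volume.restrict (Ioc t₀ t₁)) ∧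
    ofReal (ψ t₁ * W t₁ * ‖a t₁ k - b t₁ k‖ ^ 2) + ∫⁻ t in Ioc t₀ t₁, ofReal (n t) ≤
      ofReal (ψ t₀ * W t₀ * ‖a t₀ k - b t₀ k‖ ^ 2) + ∫⁻ t in Ioc t₀ t₁, ofReal (ψ t * (2 * W t)) * ‖q t‖ₑ := by
  intro ψ W G q n
  have hT : 0 ≤ T := h0.trans (h01.trans h1)
  have hsub : Icc t₀ t₁ ⊆ Icc 0 T := Icc_subset_Icc h0 h1
  have hsub' : uIcc t₀ t₁ ⊆ uIcc 0 T := by rw [uIcc_of_le h01, uIcc_of_le hT]; exact hsub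
  set d := fun t => a t k - b t k with hd
  set g := fun t => rhs ν Ω (a t) k - rhs ν Ω (b t) k with hg
  have hgi : IntervalIntegrable g volume t₀ t₁ :=
    ((ha.integrable k).mono_set hsub').sub ((hb.integrable k).mono_set hsub')
  have hdc : ContinuousOn d (uIcc t₀ t₁) := by
    rw [uIcc_of_le h01]
    exact ((ha.continuousOn hT k).sub (hb.continuousOn hT k)).mono hsub
  have hde : ∀ t ∈ Icc t₀ t₁, d t = d t₀ + ∫ s in t₀..t, g s := by
    intro t ht
    have hs : uIcc t₀ t ⊆ uIcc 0 T := by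
      rw [uIcc_of_le ht.1, uIcc_of_le hT]; exact Icc_subset_Icc h0 (ht.2.trans h1)
    simp only [hd, hg]
    rw [intervalIntegral.integral_sub ((ha.integrable k).mono_set hs) ((hb.integrable k).mono_set hs),
      ha.eq_of_le h0 ht.1 (ht.2.trans h1), hb.eq_of_le h0 ht.1 (ht.2.trans h1)]
    abel
  obtain ⟨hφ, hφ'⟩ := hasDerivAt_moving_weight (C := C) (ν := ν) (σ₀ := σ₀) (r := r) hR k
  obtain ⟨hI, hE⟩ := weighted_energy h01 hgi hde hφ hφ'
  let H := fun t => core r (σ₀ - C * ∫ s in t₀..t, R s) (ν / 2 * t) k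
  set I := fun t => ψ t * (-(C * R t) * (W t + 2 * G t) + ν * kz k * H t) * ‖d t‖ ^ 2 +
    ψ t * W t * (2 * inner ℝ (d t) (g t)) with hIdef
  have hJc : ContinuousOn (fun t => ∫ s in t₀..t, R s) (uIcc t₀ t₁) :=
    continuousOn_primitive_interval' hR left_mem_uIcc
  have hψc : ContinuousOn ψ (uIcc t₀ t₁) := by
    exact Real.continuous_exp.comp_continuousOn (hJc.const_smul C).neg
  have hexp : ContinuousOn (fun t => exp (2 * (σ₀ - C * ∫ s in t₀..t, R s) * kh k)) (uIcc t₀ t₁) :=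
    Real.continuous_exp.comp_continuousOn
      ((continuousOn_const.mul (continuousOn_const.sub (continuousOn_const.mul hJc))).mul continuousOn_const)
  have hexp' : ContinuousOn (fun t => exp (2 * (ν / 2 * t) * kz k)) (uIcc t₀ t₁) := by fun_prop
  have hcc : ContinuousOn H (uIcc t₀ t₁) := (continuousOn_const.mul hexp).mul hexp'
  have hWc : ContinuousOn W (uIcc t₀ t₁) := by simp only [W, weight_zero]; exact continuousOn_const.add hcc
  have hGc : ContinuousOn G (uIcc t₀ t₁) := continuousOn_const.mul hcc
  have hdn : ContinuousOn (fun t => ‖d t‖ ^ 2) (uIcc t₀ t₁) := hdc.norm.pow 2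
  have hni : IntervalIntegrable n volume t₀ t₁ := by
    have e : n = fun t => ψ t * (ν * (kz k ^ 2 * W t)) * ‖d t‖ ^ 2 +
      R t * (C * (ψ t * (W t + 2 * G t) * ‖d t‖ ^ 2)) := by funext t; simp only [n, hd]; ring
    rw [e]
    refine IntervalIntegrable.add ?_ (hR.mul_continuousOn ?_)
    · exact ((hψc.mul (continuousOn_const.mul (continuousOn_const.mul hWc))).mul hdn).intervalIntegrable
    · exact continuousOn_const.mul ((hψc.mul (hWc.add (continuousOn_const.mul hGc))).mul hdn)
  have hψ0 : ∀ t, 0 ≤ ψ t := fun t => (exp_pos _).le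
  have hW0 : ∀ t, 0 ≤ W t := fun t => weight_nonneg
  have hG0 : ∀ t, 0 ≤ G t := fun t => mul_nonneg (kh_nonneg k) (core_nonneg _ _ _ _)
  have hn0 : ∀ t, 0 ≤ n t := fun t => by
    have := hψ0 t; have := hW0 t; have := hG0 t; have := hR0 t
    positivity
  have hqe : ∀ t ∈ Icc t₀ t₁, q t = -(inner ℝ (d t) (g t) + ν * kz k ^ 2 * ‖d t‖ ^ 2) := by
    intro t ht
    have := inner_rhs_sub (ha.solenoidal t (hsub ht)) (hb.solenoidal t (hsub ht)) ν Ω k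
    simp only [q, hd, hg, this]; ring
  have hbound : ∀ t ∈ Icc t₀ t₁, n t + I t ≤ ψ t * (2 * W t) * ‖q t‖ := by
    intro t ht
    have h5 : ν * kz k * H t ≤ ν * (kz k ^ 2 * W t) := by
      rw [mul_assoc]
      refine mul_le_mul_of_nonneg_left ?_ hν.le
      exact mul_le_mul (kz_le_sq k) (core_le_weight _ _ _ _) (core_nonneg _ _ _ _) (sq_nonneg _)
    have h6 : inner ℝ (d t) (g t) = -q t - ν * kz k ^ 2 * ‖d t‖ ^ 2 := by rw [hqe t ht]; ring
    have h7 : n t + I t = ψ t * (ν * kz k * H t -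
      ν * (kz k ^ 2 * W t)) * ‖d t‖ ^ 2 + ψ t * (2 * W t) * (-q t) := by simp only [hIdef, h6, n]; ring
    rw [h7]
    have h8 : ψ t * (ν * kz k * H t - ν * (kz k ^ 2 * W t)) * ‖d t‖ ^ 2 ≤ 0 := by
      refine mul_nonpos_of_nonpos_of_nonneg (mul_nonpos_of_nonneg_of_nonpos (hψ0 t) lin!) (sq_nonneg _)
    have h9 : ψ t * (2 * W t) * (-q t) ≤ ψ t * (2 * W t) * ‖q t‖ := by
      refine mul_le_mul_of_nonneg_left (neg_le_abs _) ?_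
      have := hψ0 t; have := hW0 t; positivity
    linarith
  have hqm : AEMeasurable q (volume.restrict (Ioc t₀ t₁)) := by
    have h2 : AEStronglyMeasurable d (volume.restrict (Ioc t₀ t₁)) :=
      (hdc.mono (by rw [uIcc_of_le h01]; exact Ioc_subset_Icc_self)).aestronglyMeasurable measurableSet_Ioc
    have h3 : AEStronglyMeasurable g (volume.restrict (Ioc t₀ t₁)) := hgi.1.aestronglyMeasurable
    have h4 : AEStronglyMeasurable (fun t => -(inner ℝ (d t) (g t) + ν * kz k ^ 2 * ‖d t‖ ^ 2))
      (volume.restrict (Ioc t₀ t₁)) := ((h2.inner h3).add ((h2.norm.pow 2).const_mul _)).neg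
    refine h4.aemeasurable.congr ?_
    filter_upwards [ae_restrict_mem measurableSet_Ioc] with t ht
    exact (hqe t (Ioc_subset_Icc_self ht)).symm
  have hWm : AEMeasurable (fun t => ψ t * (2 * W t)) (volume.restrict (Ioc t₀ t₁)) :=
    ((hψc.mul (continuousOn_const.mul hWc)).mono (by
      rw [uIcc_of_le h01]; exact Ioc_subset_Icc_self)).aemeasurable measurableSet_Ioc
  refine ⟨hni.1.aestronglyMeasurable.aemeasurable.ennreal_ofReal, hWm.ennreal_ofReal.mul hqm.enorm, ?_⟩
  have hsum : ψ t₁ * W t₁ * ‖d t₁‖ ^ 2 + ∫ t in Ioc t₀ t₁, n t =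
    ψ t₀ * W t₀ * ‖d t₀‖ ^ 2 + ∫ t in Ioc t₀ t₁, (n t + I t) := by
    rw [← integral_of_le h01, ← integral_of_le h01, intervalIntegral.integral_add hni hI, hE]
    simp only [ψ, W]; ring
  have hp : ∀ t, 0 ≤ ψ t * W t * ‖d t‖ ^ 2 := fun t => by
    have := hψ0 t; have := hW0 t; positivity
  rw [← ofReal_integral_eq_lintegral_ofReal hni.1 (.of_forall hn0),
    ← ofReal_add (hp t₁) (integral_nonneg hn0), hsum]
  refine ENNReal.ofReal_add_le.trans (add_le_add le_rfl ?_)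
  refine (ofReal_integral_le (hni.1.add hI.1)).trans ?_
  refine setLIntegral_mono_ae' measurableSet_Ioc (.of_forall fun t ht => ?_)
  have := hψ0 t; have := hW0 t
  rw [← ofReal_norm, ← ofReal_mul pos!]
  exact ofReal_le_ofReal (hbound t (Ioc_subset_Icc_self ht))

lemma difference_finite (hr : 1 ≤ r) (hτ : 0 ≤ τ) (hη : 0 ≤ η) {a b : Coef}
    {M R : ℝ≥0∞} (hE : energyE r τ η N[a] ≤ M) (hE' : energyE r τ η N[b] ≤ M)
    (hF : energyF r τ η N[a] ^ ½ + energyF r τ η N[b] ^ ½ ≤ R) :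
    energyP r τ η D[a, b] ≤ ofReal (3 * (2 ^ r) ^ 2) * (2 * (M + M)) ∧
    energyF (r - ½) τ η D[a, b] ^ ½ ≤ (ofReal (3 * (2 ^ r) ^ 2) * 2) ^ ½ * R := by
  constructor
  · refine (energyP_le hr hτ hη _).trans ?_
    gcongr
    exact (wsum_sub_le _ a b).trans (by gcongr <;> assumption)
  · calc _ ≤ (ofReal (3 * (2 ^ r) ^ 2) * (2 * (energyF r τ η N[a] + energyF r τ η N[b]))) ^ ½ := by
          gcongr
          exact (energyF_half_le hr hτ hη _).trans (by gcongr; exact wsum_sub_le _ a b)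
      _ = (ofReal (3 * (2 ^ r) ^ 2) * 2) ^ ½ * (energyF r τ η N[a] + energyF r τ η N[b]) ^ ½ := by
          rw [← mul_assoc, mul_rpow_of_nonneg _ _ num!]
      _ ≤ _ := by gcongr; exact (ennreal_sqrt_add_le _ _).trans hF

/-- Stability of the mode dynamics in norms with decreasing horizontal radius. -/
lemma exists_stability (hr : 2 < r) : ∃ C₀, 0 < C₀ ∧ ∀ C ν Ω T : ℝ, C₀ ≤ C → 0 < ν →
    ∀ a b : ℝ → Coef, IsModeSolution ν Ω T a → IsModeSolution ν Ω T b →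
    ∀ (t₀ t₁ σ₀ : ℝ) (R : ℝ → ℝ) (M : ℝ≥0∞), 0 ≤ t₀ → t₀ ≤ t₁ → t₁ ≤ T →
    IntervalIntegrable R volume t₀ t₁ → (∀ t, 0 ≤ R t) → let σ := fun t => σ₀ - C * ∫ s in t₀..t, R s
    (∀ t ∈ Icc t₀ t₁, 0 ≤ σ t) → M < ⊤ → (∀ᵐ t ∂volume.restrict (Ioc t₀ t₁),
      energyE r (σ t) (ν / 2 * t) N[a t] ≤ M ∧ energyE r (σ t) (ν / 2 * t) N[b t] ≤ M ∧
      loss r ν (σ t) (ν / 2 * t) N[a t] + loss r ν (σ t) (ν / 2 * t) N[b t] ≤ ofReal (R t)) →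
    energyE (r - ½) (σ t₁) (ν / 2 * t₁) D[a t₁, b t₁] ≤
      ofReal (exp (C * ∫ s in t₀..t₁, R s)) * energyE (r - ½) σ₀ (ν / 2 * t₀) D[a t₀, b t₀] := by
  obtain ⟨c, hc, hc'⟩ := exists_difference_trilinear hr
  refine ⟨2 * c + 4 * c ^ 2, by positivity, fun C ν Ω T hC hν a b ha hb t₀ t₁ σ₀ R M h0 h01 h1 hR hR0 => ?_⟩
  intro σ hσ hM hae
  have hC0 : 0 ≤ C := le_trans pos! hC
  have hmode := fun k => IsModeSolution.difference_mode (r := r - ½) (σ₀ := σ₀) hν ha hb h0 h01 h1 hC0 hR hR0 k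
  simp only at hmode
  set ψ := fun t => exp (-(C * ∫ s in t₀..t, R s)) with hψ
  have hψ0 : ∀ t, 0 ≤ ψ t := fun t => (exp_pos _).le
  set X := fun t => ofReal (ψ t) * energyE (r - ½) (σ t) (ν / 2 * t) D[a t, b t] with hX
  let N := fun t k => ofReal (ψ t * (ν * (kz k ^ 2 *
    weight (r - ½) 0 (σ t) (ν / 2 * t) k) + C * R t * (weight (r - ½) 0 (σ t) (ν / 2 * t) k +
      2 * (kh k * core (r - ½) (σ t) (ν / 2 * t) k))) * ‖a t k - b t k‖ ^ 2)
  let Q := fun t k =>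
    ofReal (ψ t * (2 * weight (r - ½) 0 (σ t) (ν / 2 * t) k)) *
      ‖inner ℝ (a t k - b t k) (conv (a t) (a t) k - conv (b t) (b t) k)‖ₑ
  have hXe : ∀ t, X t = ∑' k, ofReal (ψ t * weight (r - ½) 0 (σ t) (ν / 2 * t) k *
      ‖a t k - b t k‖ ^ 2) := fun t => by
    simp only [hX, energyE, wsum]
    rw [← ENNReal.tsum_mul_left]
    refine tsum_congr fun k => ?_
    rw [ofReal_mul (mul_nonneg (hψ0 t) weight_nonneg), ofReal_mul (hψ0 t),
      ofReal_pow (norm_nonneg _), ofReal_norm, mul_assoc]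
  have hmain : X t₁ + ∫⁻ t in Ioc t₀ t₁, ∑' k, N t k ≤ X t₀ + ∫⁻ t in Ioc t₀ t₁, ∑' k, Q t k := by
    rw [hXe, hXe, lintegral_tsum fun k => (hmode k).1, lintegral_tsum fun k => (hmode k).2.1,
      ← tsum_add, ← tsum_add]
    exact tsum_le_tsum fun k => (hmode k).2.2
  have hN : ∀ t, ∑' k, N t k = ofReal (ψ t) *
      (ofReal ν * energyF (r - ½) (σ t) (ν / 2 * t) D[a t, b t] + ofReal C * (ofReal (R t) *
          (energyE (r - ½) (σ t) (ν / 2 * t) D[a t, b t] +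
            2 * energyG (r - ½) (σ t) (ν / 2 * t) D[a t, b t]))) := fun t => by
    simp only [energyF, energyE, energyG, wsum, N]
    rw [← ENNReal.tsum_mul_left (a := 2), ← tsum_add, ← ENNReal.tsum_mul_left,
      ← ENNReal.tsum_mul_left, ← ENNReal.tsum_mul_left, ← tsum_add, ← ENNReal.tsum_mul_left]
    refine tsum_congr fun k => ?_
    have e1 := (weight_pos (r - ½) (σ t) (ν / 2 * t) k).le
    have e2 := mul_nonneg (kh_nonneg k) (core_nonneg (r - ½) (σ t) (ν / 2 * t) k)
    have e3 := hR0 t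
    have e4 := hψ0 t
    generalize weight (r - ½) 0 (σ t) (ν / 2 * t) k = w, kh k * core (r - ½) (σ t) (ν / 2 * t) k = g at *
    have f2 : ofReal (C * R t * (w + 2 * g)) = ofReal C * ofReal (R t) * (ofReal w + 2 * ofReal g) := by
      rw [ofReal_mul pos!, ofReal_mul hC0, ofReal_add e1 pos!, ofReal_mul num!, ofReal_ofNat]
    rw [ofReal_mul pos!, ofReal_mul e4, ofReal_add pos! pos!, ofReal_mul hν.le, f2,
      ofReal_pow (norm_nonneg _), ofReal_norm]
    ring
  set c₃ := ofReal (3 * (2 ^ r) ^ 2) with hc₃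
  have hpt : ∀ᵐ t ∂volume.restrict (Ioc t₀ t₁), ∑' k, Q t k ≤ ∑' k, N t k ∧
      ∑' k, Q t k ≤ (2 * (ofReal c * (c₃ * (2 * (M + M)) + M ^ ½ * ((c₃ * 2) ^ ½ * (c₃ * (2 * (M + M))) ^ ½)) +
        ofReal c * (c₃ * (2 * (M + M))))) * ofReal (R t) := by
    filter_upwards [hae, ae_restrict_mem measurableSet_Ioc] with t ⟨hEa, hEb, hl⟩ htm
    have ht : t ∈ Icc t₀ t₁ := Ioc_subset_Icc_self htm
    have htT : t ∈ Icc 0 T := ⟨h0.trans ht.1, ht.2.trans h1⟩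
    have hη : 0 ≤ ν / 2 * t := mul_nonneg lin! htT.1
    have hτ : 0 ≤ σ t := hσ t ht
    have fin1 : ∀ x : Coef, energyE r (σ t) (ν / 2 * t) N[x] ≤ M → hOne x < ⊤ :=
      fun x hx => (hOne_le lin! hτ hη x).trans_lt (mul_lt_top ofReal_lt_top (hx.trans_lt hM))
    have hw : ∀ k, 0 ≤ weight (r - ½) 0 (σ t) (ν / 2 * t) k := fun k => weight_nonneg
    have hpair := tsum_difference_pairing_le hw (ha.solenoidal t htT) (hb.solenoidal t htT)
      (fin1 _ hEa) (fin1 _ hEb)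
    have tri := (hc' (σ t) (ν / 2 * t) hτ hη N[a t] D[a t, b t]).1
    have tri' := (hc' (σ t) (ν / 2 * t) hτ hη N[b t] D[a t, b t]).2
    have hQ : ∑' k, Q t k = ofReal (ψ t) * (2 * ∑' k, ofReal (weight (r - ½) 0 (σ t) (ν / 2 * t) k) *
        ‖inner ℝ ((a t - b t) k) (conv (a t) (a t) k - conv (b t) (b t) k)‖ₑ) := by
      rw [← ENNReal.tsum_mul_left, ← ENNReal.tsum_mul_left]
      refine tsum_congr fun k => ?_
      simp only [Q, Pi.sub_apply]
      rw [ofReal_mul (hψ0 t), ofReal_mul num!, ofReal_ofNat]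
      ring
    have hψ1 : ofReal (ψ t) ≤ 1 := by
      refine ENNReal.ofReal_le_one.2 (Real.exp_le_one_iff.2 (neg_nonpos.2 (mul_nonneg hC0 ?_)))
      exact intervalIntegral.integral_nonneg ht.1 fun s _ => hR0 s
    obtain ⟨hP, hF⟩ := difference_finite lin! hτ hη hEa hEb (R := ofReal (R t))
      (le_trans (add_le_add (by unfold loss; rw [add_right_comm]; exact le_add_self)
        (by unfold loss; rw [add_right_comm]; exact le_add_self)) hl)
    have hPA := energyP_le_add (r := r) hτ hη D[a t, b t]
    unfold loss at hl
    rw [hQ]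
    generalize ∑' k, ofReal (weight (r - ½) 0 (σ t) (ν / 2 * t) k) *
      ‖inner ℝ ((a t - b t) k) (conv (a t) (a t) k - conv (b t) (b t) k)‖ₑ = S at *
    rw [hN]
    generalize energyE r (σ t) (ν / 2 * t) N[a t] = Ea, energyE r (σ t) (ν / 2 * t) N[b t] = Eb,
      energyF r (σ t) (ν / 2 * t) N[a t] ^ ½ = Fa, energyF r (σ t) (ν / 2 * t) N[b t] ^ ½ = Fb,
      energyF (r - ½) (σ t) (ν / 2 * t) D[a t, b t] = FD, energyE (r - ½) (σ t) (ν / 2 * t) D[a t, b t] = ED,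
      energyG (r - ½) (σ t) (ν / 2 * t) D[a t, b t] = GD, energyP r (σ t) (ν / 2 * t) D[a t, b t] = P at *
    have hSa : Ea ^ ½ + Fa ≤ ofReal (R t) := le_trans (le_self_add.trans le_self_add) hl
    have hSb : Eb ^ ½ + Fb ≤ ofReal (R t) := le_trans (le_self_add.trans le_add_self) hl
    have hS : 2 * S ≤ 2 * (ofReal c * ((Ea ^ ½ + Fa) * P + Ea ^ ½ * (FD ^ ½ * P ^ ½)) +
        ofReal c * ((Eb ^ ½ + Fb) * P)) := by
      gcongr
      exact hpair.trans (add_le_add tri tri')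
    constructor
    · gcongr ofReal (ψ t) * ?_
      refine hS.trans ((difference_absorption hc hν (R := ofReal (R t)) ?_).trans ?_)
      · exact le_trans (add_le_add le_rfl le_self_add) hl
      · gcongr
    · calc ofReal (ψ t) * (2 * S) ≤ 1 * (2 * S) := by gcongr
        _ ≤ 2 * (ofReal c * (ofReal (R t) * (c₃ * (2 * (M + M))) +
            M ^ ½ * (((c₃ * 2) ^ ½ * ofReal (R t)) * (c₃ * (2 * (M + M))) ^ ½)) +
            ofReal c * (ofReal (R t) * (c₃ * (2 * (M + M))))) := by
            rw [one_mul]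
            refine hS.trans ?_
            gcongr
        _ = _ := by ring
  have hRi : ∫⁻ t in Ioc t₀ t₁, ofReal (R t) < ⊤ := by
    have := hR.1.2
    simpa [HasFiniteIntegral, Real.enorm_of_nonneg (hR0 _)] using this
  have hQN : ∫⁻ t in Ioc t₀ t₁, ∑' k, Q t k ≤ ∫⁻ t in Ioc t₀ t₁, ∑' k, N t k :=
    lintegral_mono_ae (hpt.mono fun t h => h.1)
  have hQfin : ∫⁻ t in Ioc t₀ t₁, ∑' k, Q t k < ⊤ := by
    refine (lintegral_mono_ae (hpt.mono fun t h => h.2)).trans_lt ?_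
    have := hM.ne
    have : c₃ ≠ ⊤ := ofReal_ne_top
    rw [lintegral_const_mul' _ _ (by finiteness)]
    exact mul_lt_top (by finiteness) hRi
  have hfinal : X t₁ ≤ X t₀ := by
    rcases eq_or_ne (X t₀) ⊤ with h | h
    · rw [h]; exact le_top
    have hNfin : ∫⁻ t in Ioc t₀ t₁, ∑' k, N t k ≠ ⊤ :=
      ((le_add_self.trans hmain).trans_lt (add_lt_top.2 ⟨h.lt_top, hQfin⟩)).ne
    exact (ENNReal.add_le_add_iff_right hNfin).1 (hmain.trans (by gcongr))
  have hX0 : X t₀ = energyE (r - ½) σ₀ (ν / 2 * t₀) D[a t₀, b t₀] := by simp [hX, hψ, σ]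
  rw [hX0] at hfinal
  calc _ = ofReal (exp (C * ∫ s in t₀..t₁, R s)) * X t₁ := by
        simp only [hX, hψ]
        rw [← mul_assoc, ← ofReal_mul (exp_pos _).le, ← exp_add, add_neg_cancel,
          Real.exp_zero, ofReal_one, one_mul]
    _ ≤ _ := by gcongr


/-! ### Energy inequalities for trigonometric polynomials -/

lemma wsum_eq_ofReal {a : Coef} (ha : ∀ k ∉ S, a k = 0) (hw : ∀ k, 0 ≤ w k) :
    wsum w N[a] = ofReal (∑ k ∈ S, w k * ‖a k‖ ^ 2) := by
  unfold wsum
  rw [tsum_eq_sum (s := S) fun k hk => by simp [ha k hk],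
    ofReal_sum_of_nonneg fun k _ => mul_nonneg (hw k) (sq_nonneg _)]
  refine sum_congr rfl fun k _ => ?_
  rw [ofReal_mul (hw k), ofReal_pow (norm_nonneg _), ofReal_norm]

lemma inner_rhs {a} (ha : IsSolenoidal a) (ν Ω) (k) :
    inner ℝ (a k) (rhs ν Ω a k) = -inner ℝ (a k) (conv a a k) - ν * kz k ^ 2 * ‖a k‖ ^ 2 := by
  have h2 : inner ℝ (a k) (((ν * kz k ^ 2 : ℝ) : ℂ) • a k) = ν * kz k ^ 2 * ‖a k‖ ^ 2 := by
    rw [coe_smul, inner_smul_right, real_inner_self_eq_norm_sq]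
  rw [rhs, inner_sub_right, inner_neg_right, inner_leray (ha k), inner_add_right, inner_cperp, add_zero, h2]

lemma ofReal_transport_le {a} (hs : IsSolenoidal a)
    (hw : ∀ k, 0 ≤ w k) : ofReal (∑ k ∈ S, w k * -inner ℝ (a k) (conv a a k)) ≤ trilinear w N[a] N[a] N[a] := by
  refine le_trans ?_ (tsum_enorm_conv_le hw hs a a)
  calc _ ≤ ofReal (∑ k ∈ S, w k * (‖conv a a k‖ * ‖a k‖)) := by
        refine ofReal_le_ofReal (sum_le_sum fun k _ => ?_)
        refine mul_le_mul_of_nonneg_left ?_ (hw k)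
        rw [mul_comm]
        exact (neg_le_abs _).trans (abs_real_inner_le_norm _ _)
    _ = ∑ k ∈ S, ofReal (w k) * (‖conv a a k‖ₑ * ‖a k‖ₑ) := by
        rw [ofReal_sum_of_nonneg fun k _ => mul_nonneg (hw k) pos!]
        refine sum_congr rfl fun k _ => ?_
        rw [ofReal_mul (hw k), ofReal_mul (norm_nonneg _), ofReal_norm, ofReal_norm]
    _ ≤ _ := ENNReal.sum_le_tsum S

lemma le_of_ofReal_le_ofReal {y} (hy : 0 ≤ y) (h : ofReal x ≤ ofReal y) :
    x ≤ y := (ENNReal.ofReal_le_ofReal_iff hy).1 h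

lemma loss_lt_top (hν : 0 < ν) {a : Coef} (ha : ∀ k ∉ S, a k = 0) : loss r ν τ η N[a] < ⊤ := by
  have h1 : energyE r τ η N[a] < ⊤ := by
    unfold energyE
    rw [wsum_eq_ofReal ha fun k => weight_nonneg]; exact ofReal_lt_top
  have h2 : energyF r τ η N[a] < ⊤ := by
    unfold energyF
    rw [wsum_eq_ofReal ha fun k => mul_nonneg (sq_nonneg _) weight_nonneg]
    exact ofReal_lt_top
  exact add_lt_top.2 ⟨add_lt_top.2 ⟨rpow_lt_top_of_nonneg num! h1.ne, rpow_lt_top_of_nonneg num! h2.ne⟩,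
    div_lt_top h1.ne (by simpa using hν)⟩

lemma energy_absorption (hc : 0 < c) (hν : 0 < ν) {S E F G} : 2 * (ofReal c * (S * G + E ^ ½ * F ^ ½ * G ^ ½)) ≤
      ofReal (ν / 2) * F + ofReal (2 * c + 8 * c ^ 2) * ((S + E / ofReal ν) * G) := by
  have h2 : E ^ ½ * F ^ ½ * G ^ ½ = F ^ ½ * (E * G) ^ ½ := by rw [mul_rpow_of_nonneg _ _ num!]; ring
  have h3 := ennreal_sqrt_mul_sqrt_le F (E * G) (δ := ν / (4 * c)) pos!
  have h4 : E = ofReal ν * (E / ofReal ν) := (ENNReal.mul_div_cancel (by simpa using hν) ofReal_ne_top).symm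
  set X := E / ofReal ν
  rw [h2]
  have h5 : 2 = ofReal 2 := num!
  calc _ ≤ 2 * (ofReal c * (S * G + (ofReal (ν / (4 * c)) * F + ofReal (ν / (4 * c))⁻¹ * (E * G)))) := by gcongr
    _ = ofReal (ν / 2) * F + (ofReal (2 * c) * (S * G) + ofReal (8 * c ^ 2) * (X * G)) := by
      have e1 : 2 * (ofReal c * ofReal (ν / (4 * c))) = ofReal (ν / 2) := by
        rw [h5, ← ofReal_mul hc.le, ← ofReal_mul num!]
        congr 1; field_simp; norm_num
      have e2 : 2 * (ofReal c * (ofReal (ν / (4 * c))⁻¹ * ofReal ν)) = ofReal (8 * c ^ 2) := by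
        rw [h5, ← ofReal_mul pos!, ← ofReal_mul hc.le, ← ofReal_mul num!]
        congr 1; field_simp; norm_num
      have e3 : 2 * ofReal c = ofReal (2 * c) := by rw [h5, ← ofReal_mul num!]
      rw [← e1, ← e2, ← e3, h4]
      ring
    _ ≤ ofReal ν * 0 + (ofReal (ν / 2) * F + (ofReal (2 * c) *
      ((S + X) * G) + ofReal (8 * c ^ 2) * ((S + X) * G))) := by
      rw [mul_zero, zero_add]
      gcongr
      · exact le_self_add
      · exact le_add_self
    _ = _ := by rw [mul_zero, zero_add, ← add_mul, ← ofReal_add pos! pos!]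

/-- Dissipation of the weighted energy along the dynamics with shrinking horizontal radius. -/
lemma exists_energy_dissipation (hr : 2 < r) : ∃ C₀, 0 < C₀ ∧
    ∀ C ν Ω τ η : ℝ, C₀ ≤ C → 0 < ν → 0 ≤ τ → 0 ≤ η → ∀ m : Mode → ℝ, IsSlow m →
    ∀ (S : Finset Mode) (a : Coef), (∀ k ∉ S, a k = 0) → IsSolenoidal a →
    ∑ k ∈ S, m k * ((-(2 * C * (loss r ν τ η N[a]).toReal * kh k) + ν * kz k) *
      core r τ η k * ‖a k‖ ^ 2 + weight r 0 τ η k * (2 * inner ℝ (a k) (rhs ν Ω a k))) ≤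
    -(ν / 2 * ∑ k ∈ S, m k * (kz k ^ 2 * weight r 0 τ η k) * ‖a k‖ ^ 2) := by
  obtain ⟨c, hc, hc'⟩ := exists_energy_trilinear hr
  refine ⟨c + 4 * c ^ 2, by positivity, fun C ν Ω τ η hC hν hτ hη m hm S a ha hs => ?_⟩
  set ρ := (loss r ν τ η N[a]).toReal with hρ
  have hρ' : loss r ν τ η N[a] = ofReal ρ := (ofReal_toReal (loss_lt_top hν ha).ne).symm
  have hρ0 : 0 ≤ ρ := toReal_nonneg
  have hw0 : ∀ k, 0 ≤ m k * weight r 0 τ η k := fun k => mul_nonneg (hm.nonneg k) weight_nonneg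
  have hg0 : ∀ k, 0 ≤ m k * (kh k * core r τ η k) := fun k =>
    mul_nonneg (hm.nonneg k) (mul_nonneg (kh_nonneg k) (core_nonneg _ _ _ k))
  have hf0 : ∀ k, 0 ≤ m k * (kz k ^ 2 * weight r 0 τ η k) := fun k =>
    mul_nonneg (hm.nonneg k) (mul_nonneg (sq_nonneg _) weight_nonneg)
  have htri := hc' τ η hτ hη m hm N[a]
  have habs := energy_absorption hc hν (S := energyE r τ η N[a] ^ ½ + energyF r τ η N[a] ^ ½)
    (E := energyE r τ η N[a]) (F := wsum (fun k => m k * (kz k ^ 2 * weight r 0 τ η k)) N[a])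
    (G := wsum (fun k => m k * (kh k * core r τ η k)) N[a])
  have hl : energyE r τ η N[a] ^ ½ + energyF r τ η N[a] ^ ½ + energyE r τ η N[a] / ofReal ν = ofReal ρ := hρ'
  rw [hl, wsum_eq_ofReal ha hf0, wsum_eq_ofReal ha hg0] at habs
  rw [wsum_eq_ofReal ha hf0, wsum_eq_ofReal ha hg0] at htri
  have htr := (ofReal_transport_le (S := S) hs hw0).trans htri
  set F := ∑ k ∈ S, m k * (kz k ^ 2 * weight r 0 τ η k) * ‖a k‖ ^ 2 with hF
  set G := ∑ k ∈ S, m k * (kh k * core r τ η k) * ‖a k‖ ^ 2 with hG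
  set N := ∑ k ∈ S, m k * weight r 0 τ η k * -inner ℝ (a k) (conv a a k) with hN
  have hF0 : 0 ≤ F := sum_nonneg fun k _ => mul_nonneg (hf0 k) (sq_nonneg _)
  have hG0 : 0 ≤ G := sum_nonneg fun k _ => mul_nonneg (hg0 k) (sq_nonneg _)
  have hNle : 2 * N ≤ ν / 2 * F + (2 * c + 8 * c ^ 2) * (ρ * G) := by
    refine le_of_ofReal_le_ofReal pos! ?_
    calc ofReal (2 * N) = 2 * ofReal N := by rw [ofReal_mul num!, ofReal_ofNat]
      _ ≤ _ := (mul_le_mul_right htr 2).trans habs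
      _ = _ := by
        rw [← ofReal_mul hρ0, ← ofReal_mul (p := ν / 2) pos!,
          ← ofReal_mul (p := 2 * c + 8 * c ^ 2) pos!, ← ofReal_add pos! pos!]
  have hsum : ∑ k ∈ S, m k * ((-(2 * C * ρ * kh k) + ν * kz k) * core r τ η k * ‖a k‖ ^ 2 +
    weight r 0 τ η k * (2 * inner ℝ (a k) (rhs ν Ω a k))) ≤ -(2 * C * ρ) * G + 2 * N - ν * F := by
    rw [hF, hG, hN, mul_sum, mul_sum, mul_sum, ← Finset.sum_add_distrib, ← Finset.sum_sub_distrib]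
    refine sum_le_sum fun k _ => ?_
    rw [inner_rhs hs]
    have h1 : kz k * core r τ η k ≤ kz k ^ 2 * weight r 0 τ η k :=
      mul_le_mul (kz_le_sq k) (core_le_weight _ _ _ _) (core_nonneg _ _ _ _) (sq_nonneg _)
    have h2 : 0 ≤ ν * m k * ‖a k‖ ^ 2 := by have := hm.nonneg k; positivity
    linarith [mul_le_mul_of_nonneg_left h1 h2]
  have h3 : (2 * c + 8 * c ^ 2) * (ρ * G) ≤ 2 * C * ρ * G := by
    have : 0 ≤ ρ * G := mul_nonneg hρ0 hG0
    linarith [mul_le_mul_of_nonneg_right hC this]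
  linarith

/-- Vertical smoothing. -/
lemma exists_vertical_dissipation (hr : 2 < r) : ∃ c, 0 < c ∧ ∀ Λ ν Ω τ η : ℝ, 0 ≤ Λ → 0 < ν → 0 ≤ τ → 0 ≤ η →
    ∀ (S : Finset Mode) (a : Coef), (∀ k ∉ S, a k = 0) → IsSolenoidal a →
    ∑ k ∈ S, kz k ^ 2 * ((-(Λ * kh k) + ν * kz k) * amp τ η k ^ 2 * ‖a k‖ ^ 2 +
      amp τ η k ^ 2 * (2 * inner ℝ (a k) (rhs ν Ω a k))) ≤
    -(ν / 2 * ∑ k ∈ S, kz k ^ 4 * amp τ η k ^ 2 * ‖a k‖ ^ 2) + c / ν * ((∑ k ∈ S, weight r 0 τ η k * ‖a k‖ ^ 2 +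
        ∑ k ∈ S, kz k ^ 2 * weight r 0 τ η k * ‖a k‖ ^ 2) * ∑ k ∈ S, weight r 0 τ η k * ‖a k‖ ^ 2) := by
  obtain ⟨c, hc, hc'⟩ := exists_vertical_trilinear hr
  refine ⟨16 * c ^ 2, by positivity, fun Λ ν Ω τ η hΛ hν hτ hη S a ha hs => ?_⟩
  have hw0 : ∀ k, 0 ≤ kz k ^ 2 * amp τ η k ^ 2 := fun k => pos!
  have hz0 : ∀ k, 0 ≤ kz k ^ 4 * amp τ η k ^ 2 := fun k => by have := kz_nonneg k; positivity
  have he0 : ∀ k, 0 ≤ weight r 0 τ η k := fun k => weight_nonneg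
  have hf0 : ∀ k, 0 ≤ kz k ^ 2 * weight r 0 τ η k := fun k => mul_nonneg (sq_nonneg _) (he0 k)
  have htri := (ofReal_transport_le (S := S) hs hw0).trans (hc' τ η hτ hη N[a])
  unfold energyE energyF at htri
  rw [wsum_eq_ofReal ha hz0, wsum_eq_ofReal ha he0, wsum_eq_ofReal ha hf0] at htri
  set Z := ∑ k ∈ S, kz k ^ 4 * amp τ η k ^ 2 * ‖a k‖ ^ 2 with hZ
  set E := ∑ k ∈ S, weight r 0 τ η k * ‖a k‖ ^ 2 with hE
  set F := ∑ k ∈ S, kz k ^ 2 * weight r 0 τ η k * ‖a k‖ ^ 2 with hF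
  set N := ∑ k ∈ S, kz k ^ 2 * amp τ η k ^ 2 * -inner ℝ (a k) (conv a a k) with hN
  have hZ0 : 0 ≤ Z := sum_nonneg fun k _ => mul_nonneg (hz0 k) (sq_nonneg _)
  have hE0 : 0 ≤ E := sum_nonneg fun k _ => mul_nonneg (he0 k) (sq_nonneg _)
  have hF0 : 0 ≤ F := sum_nonneg fun k _ => mul_nonneg (hf0 k) (sq_nonneg _)
  have hroot : ∀ x : ℝ, 0 ≤ x → ofReal x ^ ½ = ofReal (√x) := fun x hx => by
    rw [ENNReal.ofReal_rpow_of_nonneg hx num!, sqrt_eq_rpow]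
  have hN1 : N ≤ c * ((√E + √F) * √E * √Z) := by
    refine le_of_ofReal_le_ofReal pos! (htri.trans_eq ?_)
    rw [hroot _ hE0, hroot _ hF0, hroot _ hZ0, ofReal_mul hc.le, ofReal_mul pos!, ofReal_mul pos!,
      ofReal_add pos! pos!]
  have hN2 : 2 * N ≤ ν / 2 * Z + 16 * c ^ 2 / ν * ((E + F) * E) := by
    set x := √E; set y := √F; set z := √Z
    have ex : x ^ 2 = E := sq_sqrt hE0
    have ey : y ^ 2 = F := sq_sqrt hF0
    have ez : z ^ 2 = Z := sq_sqrt hZ0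
    rw [← ex, ← ey, ← ez]
    have h1 : 2 * (c * ((x + y) * x * z)) ≤ ν / 2 * z ^ 2 + 2 * c ^ 2 / ν * ((x + y) * x) ^ 2 := by
      have h0 : 0 ≤ (ν * z - 2 * c * ((x + y) * x)) ^ 2 / (2 * ν) := pos!
      have e : (ν * z - 2 * c * ((x + y) * x)) ^ 2 / (2 * ν) = ν / 2 * z ^ 2 +
        2 * c ^ 2 / ν * ((x + y) * x) ^ 2 - 2 * (c * ((x + y) * x * z)) := by field_simp; ring
      linarith
    have h2 : ((x + y) * x) ^ 2 ≤ 2 * ((x ^ 2 + y ^ 2) * x ^ 2) := by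
      rw [mul_pow]
      nlinarith [mul_nonneg (sq_nonneg (x - y)) (sq_nonneg x)]
    have h3 : 2 * c ^ 2 / ν * ((x + y) * x) ^ 2 ≤ 2 * c ^ 2 / ν * (2 * ((x ^ 2 + y ^ 2) * x ^ 2)) := by gcongr
    have h4 : 2 * c ^ 2 / ν * (2 * ((x ^ 2 + y ^ 2) * x ^ 2)) ≤ 16 * c ^ 2 / ν * ((x ^ 2 + y ^ 2) * x ^ 2) := by
      have : 0 ≤ c ^ 2 / ν * ((x ^ 2 + y ^ 2) * x ^ 2) := pos!
      have e1 : 2 * c ^ 2 / ν * (2 * ((x ^ 2 + y ^ 2) * x ^ 2)) =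
        4 * (c ^ 2 / ν * ((x ^ 2 + y ^ 2) * x ^ 2)) := by ring
      have e2 : 16 * c ^ 2 / ν * ((x ^ 2 + y ^ 2) * x ^ 2) =
        16 * (c ^ 2 / ν * ((x ^ 2 + y ^ 2) * x ^ 2)) := by ring
      linarith
    linarith
  have hsum : ∑ k ∈ S, kz k ^ 2 * ((-(Λ * kh k) + ν * kz k) * amp τ η k ^ 2 * ‖a k‖ ^ 2 +
    amp τ η k ^ 2 * (2 * inner ℝ (a k) (rhs ν Ω a k))) ≤ 2 * N - ν * Z := by
    rw [hN, hZ, mul_sum, mul_sum, ← Finset.sum_sub_distrib]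
    refine sum_le_sum fun k _ => ?_
    rw [inner_rhs hs]
    have h1 : kz k * (kz k ^ 2 * amp τ η k ^ 2 * ‖a k‖ ^ 2) ≤
      kz k ^ 2 * (kz k ^ 2 * amp τ η k ^ 2 * ‖a k‖ ^ 2) := mul_le_mul_of_nonneg_right (kz_le_sq k) pos!
    have h2 : 0 ≤ Λ * kh k * (kz k ^ 2 * amp τ η k ^ 2 * ‖a k‖ ^ 2) := by
      have := kh_nonneg k; positivity
    linarith [mul_le_mul_of_nonneg_left h1 hν.le]
  linarith


/-! ### Galerkin approximations -/

/-- A cutoff at radius `B`. -/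
def cutoff (B : ℝ) (y : E) : ℝ := max 0 (min 1 (2 - ‖y‖ / B))

lemma cutoff_nonneg (B) (y : E) : 0 ≤ cutoff B y := le_max_left _ _

lemma cutoff_le_one (B) (y : E) : cutoff B y ≤ 1 := max_le zero_le_one (min_le_left _ _)

lemma cutoff_eq_one (hB : 0 < B) {y : E} (h : ‖y‖ ≤ B) : cutoff B y = 1 := by
  have : ‖y‖ / B ≤ 1 := (div_le_one hB).2 h
  unfold cutoff
  rw [min_eq_left lin!, max_eq_right zero_le_one]

lemma locallyLipschitz_smul

    {f : F → ℝ} {g : F → E} (hf : LocallyLipschitz f) (hg : LocallyLipschitz g) :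
    LocallyLipschitz fun x => f x • g x := (ContDiff.locallyLipschitz (𝕂 := ℝ) (f := fun p : ℝ × E => p.1 • p.2)
    (contDiff_fst.smul contDiff_snd)).comp (hf.prodMk hg)

lemma locallyLipschitz_cutoff {Y : Type*} [NormedAddCommGroup Y] [NormedSpace ℝ Y] (B) :
    LocallyLipschitz (cutoff B : Y → ℝ) := by
  have h : LocallyLipschitz fun y : Y => 2 - ‖y‖ / B := by
    have := (ContDiff.locallyLipschitz (𝕂 := ℝ) (f := fun x => 2 - x / B) (by fun_prop)).comp
      (lipschitzWith_one_norm (E := Y)).locallyLipschitz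
    exact this
  exact (h.const_min 1).const_max 0

/-- Global solvability of an ordinary differential equation with a cutoff. -/
lemma exists_cutoff_solution
    [FiniteDimensional ℝ E] {Φ : E → E} (hΦ : LocallyLipschitz Φ) (hB : 0 < B) (y₀ : E) (hT : 0 ≤ T) : ∃ α : ℝ → E, α 0 = y₀ ∧ ∀ t ∈ Icc 0 T,
      HasDerivWithinAt α (cutoff B (α t) • Φ (α t)) (Icc 0 T) t := by
  have : ProperSpace E := FiniteDimensional.proper ℝ E
  have : CompleteSpace E := FiniteDimensional.complete ℝ E
  have h1 : LocallyLipschitz fun y => cutoff B y • Φ y := locallyLipschitz_smul (locallyLipschitz_cutoff B) hΦ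
  obtain ⟨L, hL⟩ : ∃ L, ∀ y, ‖cutoff B y • Φ y‖ ≤ L := by
    obtain ⟨L, hL⟩ := (isCompact_closedBall (0 : E) (2 * B)).exists_bound_of_continuousOn
      h1.continuous.continuousOn
    refine ⟨max L 0, fun y => ?_⟩
    by_cases hy : ‖y‖ ≤ 2 * B
    · exact (hL y (by simpa using hy)).trans (le_max_left _ _)
    · have : cutoff B y = 0 := by
        have : 2 ≤ ‖y‖ / B := (le_div_iff₀ hB).2 (not_le.1 hy).le
        unfold cutoff
        rw [max_eq_left]
        exact (min_le_right _ _).trans lin!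
      rw [this, zero_smul, norm_zero]
      exact le_max_right _ _
  have hL0 : 0 ≤ L := (norm_nonneg _).trans (hL y₀)
  obtain ⟨K, hK⟩ := (h1.locallyLipschitzOn (s := Metric.closedBall y₀ (L * T))).exists_lipschitzOnWith_of_compact
    (isCompact_closedBall y₀ (L * T))
  have hP : IsPicardLindelof (fun _ y => cutoff B y • Φ y) (⟨0, left_mem_Icc.2 hT⟩ : Icc 0 T) y₀
    (⟨L * T, mul_nonneg hL0 hT⟩ : ℝ≥0) 0 ⟨L, hL0⟩ K :=
    IsPicardLindelof.of_time_independent (fun y _ => hL y) hK (by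
      simp only [sub_zero, sub_self, NNReal.coe_zero]
      rw [max_eq_left hT]
      exact le_rfl)
  obtain ⟨α, h0, hα⟩ := hP.exists_eq_forall_mem_Icc_hasDerivWithinAt₀
  exact ⟨α, h0, hα⟩

/-- Extension by zero. -/
def extend {S : Finset Mode} (x : S → CVel) (k : Mode) : CVel := if h : k ∈ S then x ⟨k, h⟩ else 0

lemma extend_of_notMem (x : S → CVel) (h : k ∉ S) : extend x k = 0 := dif_neg h

lemma extend_coe (x : S → CVel) (k : S) : extend x k = x k := dif_pos k.2

lemma extend_restrict (a : Coef) (k : Mode) :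
    extend (fun k : S => a k) k = if k ∈ S then a k else 0 := by unfold extend; split_ifs <;> rfl

/-- Finite sets of modes invariant under the symmetries. -/
def IsSymmetricSet (S : Finset Mode) : Prop := ∀ k, (-k ∈ S ↔ k ∈ S) ∧ (flip k ∈ S ↔ k ∈ S)

lemma IsSymmetric.restrict (hS : IsSymmetricSet S) {a : Coef}
    (ha : IsSymmetric a) : IsSymmetric (extend fun k : S => a k) where
  flip k := by simp only [extend_restrict, (hS k).2, ha.flip]
  herm k i := by
    simp only [extend_restrict, (hS k).1]
    split_ifs
    · exact ha.herm k i
    · simp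

lemma IsSolenoidal.restrict {a : Coef} (ha : IsSolenoidal a) :
    IsSolenoidal (extend fun k : S => a k) := fun k hk => by
  rw [extend_restrict]
  split_ifs
  · exact ha k hk
  · simp [hdot]

lemma extend_add (x y : S → CVel) (k) :
    extend (x + y) k = extend x k + extend y k := by unfold extend; split_ifs <;> simp

lemma extend_smul (c : ℝ) (x : S → CVel) (k : Mode) :
    extend (c • x) k = c • extend x k := by unfold extend; split_ifs <;> simp

lemma hdot_real_smul (l : Mode) (c : ℝ) (a : CVel) : hdot l (c • a) = c * hdot l a := by
  rw [← hdot_smul, coe_smul]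

/-- The phase space of the Galerkin approximation. -/
def phaseSpace (S : Finset Mode) : Submodule ℝ (S → CVel) where
  carrier := {x | IsSymmetric (extend x) ∧ IsSolenoidal (extend x)}
  add_mem' {x y} hx hy := by
    refine ⟨⟨fun k => ?_, fun k i => ?_⟩, fun k hk => ?_⟩
    · simp only [extend_add, hx.1.flip, hy.1.flip]
    · simp only [extend_add, PiLp.add_apply, hx.1.herm, hy.1.herm, map_add]
    · rw [extend_add, hdot_add, hx.2 k hk, hy.2 k hk, add_zero]
  zero_mem' := by
    have h : ∀ k, extend (0 : S → CVel) k = 0 := fun k => by unfold extend; split_ifs <;> rfl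
    refine ⟨⟨fun k => ?_, fun k i => ?_⟩, fun k hk => ?_⟩
    · simp only [h]
    · simp [h]
    · simp [h, hdot]
  smul_mem' c x hx := by
    refine ⟨⟨fun k => ?_, fun k i => ?_⟩, fun k hk => ?_⟩
    · simp only [extend_smul, hx.1.flip]
    · simp only [extend_smul, PiLp.smul_apply, hx.1.herm, Complex.real_smul, map_mul, conj_ofReal]
    · rw [extend_smul, hdot_real_smul, hx.2 k hk, mul_zero]

lemma hOne_extend_lt_top (x : S → CVel) : hOne (extend x) < ⊤ := by
  unfold hOne
  rw [wsum_eq_ofReal (fun k hk => extend_of_notMem x hk) fun k => sq_nonneg _]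
  exact ofReal_lt_top

/-- The Galerkin vector field. -/
def galerkinField {S : Finset Mode} (hS : IsSymmetricSet S) (ν Ω : ℝ) (x : phaseSpace S) : phaseSpace S :=
  ⟨fun k => rhs ν Ω (extend x.1) k, (x.2.1.rhs (hOne_extend_lt_top _) ν Ω).restrict hS,
    (x.2.2.rhs ν Ω).restrict⟩

lemma contDiff_extend (k) : ContDiff ℝ 1 fun x : phaseSpace S => extend x.1 k := by
  by_cases h : k ∈ S
  · have : (fun x : phaseSpace S => extend x.1 k) = fun x => x.1 ⟨k, h⟩ := by ext1 x; exact dif_pos h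
    rw [this]
    exact ((ContinuousLinearMap.proj (R := ℝ) (φ := fun _ : S => CVel) ⟨k, h⟩).comp
      (phaseSpace S).subtypeL).contDiff
  · have : (fun x : phaseSpace S => extend x.1 k) = fun _ => 0 := by ext1 x; exact dif_neg h
    rw [this]; exact contDiff_const

lemma contDiff_hdot {f : E → CVel} (hf : ContDiff ℝ 1 f) (l) : ContDiff ℝ 1 fun x => hdot l (f x) := by
  have h : ∀ i : Fin 2, ContDiff ℝ 1 fun x => f x i := fun i =>
    ((proj (𝕜 := ℂ) i).restrictScalars ℝ).contDiff.comp hf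
  unfold hdot
  exact (contDiff_const.mul (h 0)).add (contDiff_const.mul (h 1))

lemma contDiff_rhs (ν Ω) (k) : ContDiff ℝ 1 fun x : phaseSpace S => rhs ν Ω (extend x.1) k := by
  have hc : ContDiff ℝ 1 fun x : phaseSpace S => conv (extend x.1) (extend x.1) k := by
    have h : ∀ x : phaseSpace S, conv (extend x.1) (extend x.1) k =
      ∑ j ∈ S, (I * usym k j (extend x.1 j)) • extend x.1 (k - j) := fun x =>
      tsum_eq_sum fun j hj => by rw [extend_of_notMem _ hj]; simp [usym, hdot, om]
    simp only [h]
    have hu : ∀ j, ContDiff ℝ 1 fun x : phaseSpace S => usym k j (extend x.1 j) := fun j => by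
      unfold usym om
      exact (contDiff_hdot (contDiff_extend j) k).add
        (contDiff_const.mul ((contDiff_hdot (contDiff_extend j) j).neg.div_const _))
    refine ContDiff.sum fun j _ => ?_
    exact (contDiff_const.mul (hu j)).smul (contDiff_extend (k - j))
  have hp : ContDiff ℝ 1 fun x : phaseSpace S => cperp (extend x.1 k) := by
    have : ∀ a : CVel, cperp a = WithLp.toLp 2 ![-(a 1), a 0] := fun _ => rfl
    have h : ∀ i : Fin 2, ContDiff ℝ 1 fun x : phaseSpace S => extend x.1 k i := fun i =>
      ((proj (𝕜 := ℂ) i).restrictScalars ℝ).contDiff.comp (contDiff_extend k)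
    refine contDiff_piLp' 2 fun i => ?_
    fin_cases i
    · exact (h 1).neg
    · exact h 0
  have hN := hc.add (hp.const_smul (Ω : ℂ))
  have hl : ContDiff ℝ 1 fun x : phaseSpace S =>
    leray k (conv (extend x.1) (extend x.1) k + (Ω : ℂ) • cperp (extend x.1 k)) := by
    unfold leray
    split_ifs
    · exact hN.sub (((contDiff_hdot hN k).div_const _).smul contDiff_const)
    · exact hN
  exact hl.neg.sub ((contDiff_extend k).const_smul _)

lemma locallyLipschitz_galerkinField (hS : IsSymmetricSet S) (ν Ω) :
    LocallyLipschitz (galerkinField hS ν Ω) := by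
  have h : LocallyLipschitz fun x : phaseSpace S => (galerkinField hS ν Ω x).1 :=
    ContDiff.locallyLipschitz (𝕂 := ℝ) (contDiff_pi.2 fun k => contDiff_rhs ν Ω k)
  exact h

lemma energy_sqrt_eq (hw : ∀ k, 0 ≤ w k) (x : S → CVel) : wsum w N[extend x] =
      ofReal (‖WithLp.toLp 2 (fun k : S => √(w k) • x k)‖ ^ 2) := by
  rw [wsum_eq_ofReal (fun k hk => extend_of_notMem x hk) hw, PiLp.norm_sq_eq_of_L2, ← Finset.sum_coe_sort]
  congr 1
  refine sum_congr rfl fun k _ => ?_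
  rw [extend_coe, norm_smul, mul_pow, Real.norm_of_nonneg (sqrt_nonneg _), sq_sqrt (hw k)]

lemma contDiff_weight (r ν) (k) : ContDiff ℝ 1 fun p : ℝ × ℝ =>
    weight r 0 p.1 (ν / 2 * p.2) k := by unfold weight; fun_prop

/-- The rate of loss of the horizontal radius is locally Lipschitz on the phase space. -/
lemma locallyLipschitz_loss (S) (r) (hν : 0 < ν) : LocallyLipschitz fun y : phaseSpace S × ℝ × ℝ =>
      (loss r ν y.2.1 (ν / 2 * y.2.2) fun k => ‖extend y.1.1 k‖ₑ).toReal := by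
  let V : (Mode → ℝ) → phaseSpace S × ℝ × ℝ → PiLp 2 (fun _ : S => CVel) := fun z y =>
    WithLp.toLp 2 fun k : S => (z k * √(weight r 0 y.2.1 (ν / 2 * y.2.2) k)) • y.1.1 k
  have hV : ∀ z, ContDiff ℝ 1 (V z) := fun z => by
    refine contDiff_piLp' 2 fun k => ?_
    have h1 : ContDiff ℝ 1 fun y : phaseSpace S × ℝ × ℝ =>
      √(weight r 0 y.2.1 (ν / 2 * y.2.2) k) :=
      ((contDiff_weight r ν k).comp contDiff_snd).sqrt fun y => (weight_pos _ _ _ _).ne'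
    have h2 : ContDiff ℝ 1 fun y : phaseSpace S × ℝ × ℝ => y.1.1 k :=
      ((ContinuousLinearMap.proj (R := ℝ) (φ := fun _ : S => CVel) k).comp
        (phaseSpace S).subtypeL).contDiff.comp contDiff_fst
    exact (contDiff_const.mul h1).smul h2
  have hE : ∀ y : phaseSpace S × ℝ × ℝ, energyE r y.2.1 (ν / 2 * y.2.2)
    N[extend y.1.1] = ofReal (‖V (fun _ => 1) y‖ ^ 2) := fun y => by
    unfold energyE
    rw [energy_sqrt_eq fun k => weight_nonneg]
    simp only [V, one_mul]
  have hF : ∀ y : phaseSpace S × ℝ × ℝ, energyF r y.2.1 (ν / 2 * y.2.2)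
    N[extend y.1.1] = ofReal (‖V kz y‖ ^ 2) := fun y => by
    unfold energyF
    rw [energy_sqrt_eq fun k => mul_nonneg (sq_nonneg _) weight_nonneg]
    simp only [V]
    have : ∀ k, √(kz k ^ 2 * weight r 0 y.2.1 (ν / 2 * y.2.2) k) =
      kz k * √(weight r 0 y.2.1 (ν / 2 * y.2.2) k) := fun k => by
      rw [sqrt_mul (sq_nonneg _), sqrt_sq (kz_nonneg k)]
    simp only [this]
  have hroot : ∀ x, 0 ≤ x → ofReal (x ^ 2) ^ ½ = ofReal x := fun x hx => by
    rw [ENNReal.ofReal_rpow_of_nonneg (sq_nonneg _) num!, ← sqrt_eq_rpow, sqrt_sq hx]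
  have hl : ∀ y : phaseSpace S × ℝ × ℝ, (loss r ν y.2.1 (ν / 2 * y.2.2) fun k => ‖extend y.1.1 k‖ₑ).toReal =
    ‖V (fun _ => 1) y‖ + ‖V kz y‖ + ‖V (fun _ => 1) y‖ ^ 2 / ν := fun y => by
    unfold loss
    rw [hE, hF, hroot _ (norm_nonneg _), hroot _ (norm_nonneg _), ← ofReal_div_of_pos hν,
      ← ofReal_add (norm_nonneg _) (norm_nonneg _), ← ofReal_add pos! pos!, toReal_ofReal pos!]
  simp only [hl]
  have h1 := fun z => (lipschitzWith_one_norm (E := PiLp 2 (fun _ : S => CVel))).locallyLipschitz.comp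
    (ContDiff.locallyLipschitz (𝕂 := ℝ) (hV z))
  exact (ContDiff.locallyLipschitz (𝕂 := ℝ) (f := fun p : ℝ × ℝ => p.1 + p.2 + p.1 ^ 2 / ν)
    (by fun_prop)).comp ((h1 fun _ => 1).prodMk (h1 kz))

/-- A solution of the Galerkin system, run with speed `χ`. -/
structure IsGalerkinCurve (S : Finset Mode) (C r ν Ω T : ℝ) (χ : ℝ → ℝ) (a : ℝ → Coef)
    (τ s : ℝ → ℝ) : Prop where
  support : ∀ t, ∀ k ∉ S, a t k = 0
  symmetric : ∀ t, IsSymmetric (a t)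
  solenoidal : ∀ t, IsSolenoidal (a t)
  speed_nonneg : ∀ t, 0 ≤ χ t
  speed_le : ∀ t, χ t ≤ 1
  speed_continuousOn : ContinuousOn χ (Icc 0 T)
  rhs_continuousOn : ∀ k, ContinuousOn (fun t => rhs ν Ω (a t) k) (Icc 0 T)
  deriv : ∀ k ∈ S, ∀ t ∈ Icc 0 T, HasDerivWithinAt (fun t => a t k) (χ t • rhs ν Ω (a t) k) (Icc 0 T) t
  loss_continuousOn : ContinuousOn (fun t => (loss r ν (τ t) (ν / 2 * s t) N[a t]).toReal) (Icc 0 T)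
  deriv_radius : ∀ t ∈ Icc 0 T, HasDerivWithinAt τ
    (χ t * -(C * (loss r ν (τ t) (ν / 2 * s t) N[a t]).toReal)) (Icc 0 T) t
  deriv_time : ∀ t ∈ Icc 0 T, HasDerivWithinAt s (χ t) (Icc 0 T) t

lemma exists_galerkinCurve (hS : IsSymmetricSet S) (C r Ω : ℝ)
    (hν : 0 < ν) (hT : 0 ≤ T) (hB : 0 < B) (h1 : IsSymmetric a₀)
    (h2 : IsSolenoidal a₀) : ∃ (χ : ℝ → ℝ) (a : ℝ → Coef) (τ s : ℝ → ℝ),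
      IsGalerkinCurve S C r ν Ω T χ a τ s ∧ (∀ k, a 0 k = if k ∈ S then a₀ k else 0) ∧ τ 0 = τ₀ ∧
      s 0 = 0 ∧ ∀ t, (∀ k, ‖a t k‖ ≤ B) → |τ t| ≤ B → |s t| ≤ B → χ t = 1 := by
  let Φ : phaseSpace S × ℝ × ℝ → phaseSpace S × ℝ × ℝ := fun y =>
    (galerkinField hS ν Ω y.1, -(C * (loss r ν y.2.1 (ν / 2 * y.2.2) fun k => ‖extend y.1.1 k‖ₑ).toReal), 1)
  have hloss := locallyLipschitz_loss S r hν
  have hΦ : LocallyLipschitz Φ := by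
    refine ((locallyLipschitz_galerkinField hS ν Ω).comp LipschitzWith.prod_fst.locallyLipschitz).prodMk
      (LocallyLipschitz.prodMk ?_ (LocallyLipschitz.const 1))
    exact (ContDiff.locallyLipschitz (𝕂 := ℝ) (f := fun x => -(C * x)) (by fun_prop)).comp hloss
  obtain ⟨α, hα0, hα⟩ := exists_cutoff_solution hΦ hB
    ((⟨fun k => a₀ k, h1.restrict hS, h2.restrict⟩ : phaseSpace S), τ₀, 0) hT
  have hc : ContinuousOn α (Icc 0 T) := fun t ht => (hα t ht).continuousWithinAt
  refine ⟨fun t => cutoff B (α t), fun t => extend (α t).1.1, fun t => (α t).2.1, fun t => (α t).2.2,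
    ⟨fun t k hk => extend_of_notMem _ hk, fun t => (α t).1.2.1, fun t => (α t).1.2.2,
      fun t => cutoff_nonneg _ _, fun t => cutoff_le_one _ _,
      (locallyLipschitz_cutoff B).continuous.comp_continuousOn hc,
      fun k => (contDiff_rhs ν Ω k).continuous.comp_continuousOn (continuous_fst.comp_continuousOn hc),
      fun k hk t ht => ?_,
      hloss.continuous.comp_continuousOn hc, fun t ht => ?_, fun t ht => ?_⟩, fun k => ?_, ?_, ?_,
    fun t ht1 ht2 ht3 => cutoff_eq_one hB ?_⟩
  · let L : phaseSpace S × ℝ × ℝ →L[ℝ] CVel :=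
      ((ContinuousLinearMap.proj (R := ℝ) (φ := fun _ : S => CVel) ⟨k, hk⟩).comp
        (phaseSpace S).subtypeL).comp (ContinuousLinearMap.fst ℝ _ _)
    have h : ∀ t, extend (α t).1.1 k = L (α t) := fun t => dif_pos hk
    simp only [h]
    exact L.hasFDerivAt.comp_hasDerivWithinAt t (hα t ht)
  · have h := hasFDerivAt_fst.comp_hasDerivWithinAt t (hasFDerivAt_snd.comp_hasDerivWithinAt t (hα t ht))
    exact h
  · have h := hasFDerivAt_snd.comp_hasDerivWithinAt t (hasFDerivAt_snd.comp_hasDerivWithinAt t (hα t ht))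
    refine h.congr_deriv ?_
    simp [Φ]
  · simp only [hα0]; exact extend_restrict _ _
  · simp only [hα0]
  · simp only [hα0]
  · refine max_le ?_ (max_le ht2 ht3)
    exact (pi_norm_le_iff_of_nonneg hB.le).2 fun k =>
      (congrArg norm (extend_coe (α t).1.1 k)).symm.le.trans (ht1 k)


/-! ### A priori estimates for the Galerkin approximations -/

lemma add_integral_le {f f' g : ℝ → ℝ} (ht₁ : t₁ ∈ Icc 0 T)
    (hf : ∀ t ∈ Icc 0 T, HasDerivWithinAt f (f' t) (Icc 0 T) t) (hg : ContinuousOn g (Icc 0 T))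
    (h : ∀ t ∈ Icc 0 t₁, f' t ≤ -g t) : f t₁ + ∫ s in 0..t₁, g s ≤ f 0 := by
  have hsub : Icc 0 t₁ ⊆ Icc 0 T := Icc_subset_Icc_right ht₁.2
  have hgc : ContinuousOn (fun t => ∫ s in 0..t, g s) (Icc 0 t₁) := by
    have := intervalIntegral.continuousOn_primitive_interval (μ := volume) (a := 0) (b := t₁) (f := g) (by
      rw [uIcc_of_le ht₁.1]; exact (hg.mono hsub).integrableOn_Icc)
    rwa [uIcc_of_le ht₁.1] at this
  have hanti : AntitoneOn (fun t => f t + ∫ s in 0..t, g s) (Icc 0 t₁) := by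
    refine antitoneOn_of_hasDerivWithinAt_nonpos (f' := fun t => f' t + g t) (convex_Icc 0 t₁)
      (ContinuousOn.add (fun t ht => ((hf t (hsub ht)).continuousWithinAt).mono hsub) hgc)
      (fun t ht => ?_) (fun t ht => ?_)
    · rw [interior_Icc] at ht ⊢
      have ht' : t ∈ Ioo 0 T := ⟨ht.1, ht.2.trans_le ht₁.2⟩
      have h1 := ((hf t (Ioo_subset_Icc_self ht')).hasDerivAt (Icc_mem_nhds ht'.1 ht'.2))
      have h2 : HasDerivAt (fun t => ∫ s in 0..t, g s) (g t) t := by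
        have hc := (hg.continuousAt (Icc_mem_nhds ht'.1 ht'.2))
        refine intervalIntegral.integral_hasDerivAt_right ?_ ?_ hc
        · refine ContinuousOn.intervalIntegrable (hg.mono ?_)
          rw [uIcc_of_le ht'.1.le]; exact Icc_subset_Icc_right ht'.2.le
        · exact ContinuousOn.stronglyMeasurableAtFilter isOpen_Ioo (hg.mono Ioo_subset_Icc_self) t ht'
      exact (h1.add h2).hasDerivWithinAt
    · rw [interior_Icc] at ht
      linarith [h t (Ioo_subset_Icc_self ht)]
  have := hanti (left_mem_Icc.2 ht₁.1) (right_mem_Icc.2 ht₁.1) ht₁.1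
  simpa using this

/-- The derivative of a weighted quadratic functional of a Galerkin curve. -/
lemma hasDerivWithinAt_weight {s'} {I : Set ℝ}
    (hτ : HasDerivWithinAt ρ τ' I t) (hs : HasDerivWithinAt s s' I t) (k) :
    HasDerivWithinAt (fun t => weight r 0 (ρ t) (ν / 2 * s t) k)
      ((2 * τ' * kh k + ν * s' * kz k) * core r (ρ t) (ν / 2 * s t) k) I t := by
  have h5 := ((hτ.const_mul 2).mul_const (kh k)).exp
  have h6 := (((hs.const_mul (ν / 2)).const_mul 2).mul_const (kz k)).exp
  have h7 := (((h5.const_mul (kh k ^ (2 * r) + kz k ^ (2 * 0))).mul h6).const_add 1)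
  refine h7.congr_deriv ?_
  simp only [core, mul_zero, pow_zero]
  ring

lemma hasDerivWithinAt_amp_sq {s'} {I : Set ℝ}
    (hτ : HasDerivWithinAt ρ τ' I t) (hs : HasDerivWithinAt s s' I t) (k) :
    HasDerivWithinAt (fun t => amp (ρ t) (ν / 2 * s t) k ^ 2)
      ((2 * τ' * kh k + ν * s' * kz k) * amp (ρ t) (ν / 2 * s t) k ^ 2) I t := by
  simp only [amp_sq]
  have h5 := ((hτ.const_mul 2).mul_const (kh k)).exp
  have h6 := (((hs.const_mul (ν / 2)).const_mul 2).mul_const (kz k)).exp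
  refine (h5.mul h6).congr_deriv ?_
  ring

lemma IsGalerkinCurve.continuousOn_mode (h : IsGalerkinCurve S C r ν Ω T χ a ρ s)
    (hk : k ∈ S) : ContinuousOn (fun t => a t k) (Icc 0 T) := fun t ht => (h.deriv k hk t ht).continuousWithinAt

lemma IsGalerkinCurve.continuousOn_sum (h : IsGalerkinCurve S C r ν Ω T χ a ρ s)
    {f : Mode → ℝ → ℝ} (hf : ∀ k ∈ S, ContinuousOn (f k) (Icc 0 T)) :
    ContinuousOn (fun t => ∑ k ∈ S, f k t * ‖a t k‖ ^ 2) (Icc 0 T) :=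
  continuousOn_finsetSum S fun k hk => (hf k hk).mul ((h.continuousOn_mode hk).norm.pow 2)

lemma IsGalerkinCurve.continuousOn_weight (h : IsGalerkinCurve S C r ν Ω T χ a ρ s) (k) :
    ContinuousOn (fun t => weight r 0 (ρ t) (ν / 2 * s t) k) (Icc 0 T) := fun t ht =>
  (hasDerivWithinAt_weight (h.deriv_radius t ht) (h.deriv_time t ht) k).continuousWithinAt

lemma IsGalerkinCurve.time_mem (h : IsGalerkinCurve S C r ν Ω T χ a ρ s) (h0 : s 0 = 0) (ht : t ∈ Icc 0 T) : 0 ≤ s t ∧ s t ≤ t := by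
  have h1 := add_integral_le (g := fun _ => 0) (f := fun t => -s t) ht
    (fun t ht => (h.deriv_time t ht).neg) continuousOn_const (fun t ht => by simpa using h.speed_nonneg t)
  have h2 := add_integral_le (g := fun _ => 0) (f := fun t => s t - t) ht
    (fun t ht => (h.deriv_time t ht).sub (hasDerivWithinAt_id t _)) continuousOn_const
    (fun t ht => by simpa using h.speed_le t)
  simp only [h0, intervalIntegral.integral_zero] at h1 h2
  constructor <;> linarith

/-- The energy inequality. -/
lemma exists_galerkin_energy (hr : 2 < r) : ∃ C₀, 0 < C₀ ∧
    ∀ C ν Ω T : ℝ, C₀ ≤ C → 0 < ν → ∀ m : Mode → ℝ, IsSlow m → ∀ (S : Finset Mode) (χ : ℝ → ℝ)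
    (a : ℝ → Coef) (τ s : ℝ → ℝ), IsGalerkinCurve S C r ν Ω T χ a τ s → s 0 = 0 →
    ∀ t₁ ∈ Icc 0 T, (∀ t ∈ Icc 0 t₁, 0 ≤ τ t) →
    ∑ k ∈ S, m k * weight r 0 (τ t₁) (ν / 2 * s t₁) k * ‖a t₁ k‖ ^ 2 +
      ∫ t in 0..t₁, χ t * (ν / 2 * ∑ k ∈ S, m k * (kz k ^ 2 * weight r 0 (τ t) (ν / 2 * s t) k) *
        ‖a t k‖ ^ 2) ≤ ∑ k ∈ S, m k * weight r 0 (τ 0) 0 k * ‖a 0 k‖ ^ 2 := by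
  obtain ⟨C₀, hC₀, hd⟩ := exists_energy_dissipation hr
  refine ⟨C₀, hC₀, fun C ν Ω T hC hν m hm S χ a τ s h h0 t₁ ht₁ hτ => ?_⟩
  have key := add_integral_le (f := fun t => ∑ k ∈ S, m k * weight r 0 (τ t) (ν / 2 * s t) k *
    ‖a t k‖ ^ 2) (g := fun t => χ t * (ν / 2 * ∑ k ∈ S, m k * (kz k ^ 2 *
    weight r 0 (τ t) (ν / 2 * s t) k) * ‖a t k‖ ^ 2)) ht₁ (fun t ht => HasDerivWithinAt.fun_sum fun k hk =>
      ((hasDerivWithinAt_weight (h.deriv_radius t ht) (h.deriv_time t ht) k).const_mul (m k)).fun_mul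
        (h.deriv k hk t ht).norm_sq)
    (h.speed_continuousOn.mul (continuousOn_const.mul (h.continuousOn_sum fun k _ =>
      continuousOn_const.mul (continuousOn_const.mul (h.continuousOn_weight k))))) fun t ht => ?_
  · rwa [h0, mul_zero] at key
  · have htT : t ∈ Icc 0 T := ⟨ht.1, ht.2.trans ht₁.2⟩
    have h1 := hd C ν Ω (τ t) (ν / 2 * s t) hC hν (hτ t ht)
      (mul_nonneg pos! (h.time_mem h0 htT).1) m hm S (a t) (h.support t) (h.solenoidal t)
    have h2 := mul_le_mul_of_nonneg_left h1 (h.speed_nonneg t)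
    refine le_trans (le_of_eq ?_) (h2.trans_eq (by ring))
    rw [mul_sum]
    refine sum_congr rfl fun k _ => ?_
    rw [inner_smul_right]
    ring

/-- Vertical smoothing of Galerkin curves run at unit speed. -/
lemma exists_galerkin_smoothing (hr : 2 < r) : ∃ c, 0 < c ∧
    ∀ C ν Ω T : ℝ, 0 ≤ C → 0 < ν → ∀ (S : Finset Mode) (χ : ℝ → ℝ) (a : ℝ → Coef) (τ s : ℝ → ℝ),
    IsGalerkinCurve S C r ν Ω T χ a τ s → (∀ t ∈ Icc 0 T, χ t = 1 ∧ s t = t ∧ 0 ≤ τ t) → 0 ≤ T →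
    ∀ M : ℝ, (∀ t ∈ Icc 0 T, ∑ k ∈ S, weight r 0 (τ t) (ν / 2 * t) k * ‖a t k‖ ^ 2 ≤ M ^ 2) →
    (∫ t in 0..T, ∑ k ∈ S, kz k ^ 2 * weight r 0 (τ t) (ν / 2 * t) k * ‖a t k‖ ^ 2) ≤ 2 * M ^ 2 / ν →
    ν / 2 * (∫ t in 0..T, t * ∑ k ∈ S, kz k ^ 4 * amp (τ t) (ν / 2 * t) k ^ 2 * ‖a t k‖ ^ 2) ≤
      2 * M ^ 2 / ν + c / ν * T * M ^ 2 * (M ^ 2 * T + 2 * M ^ 2 / ν) := by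
  obtain ⟨c, hc, hd⟩ := exists_vertical_dissipation hr
  refine ⟨c, hc, fun C ν Ω T hC hν S χ a τ s h hχ hT M hE hF => ?_⟩
  have hw : ∀ k, ContinuousOn (fun t => weight r 0 (τ t) (ν / 2 * t) k) (Icc 0 T) := fun k =>
    (h.continuousOn_weight k).congr fun t ht => by simp only [(hχ t ht).2.1]
  have ha : ∀ k, ContinuousOn (fun t => amp (τ t) (ν / 2 * t) k ^ 2) (Icc 0 T) := fun k =>
    ContinuousOn.congr (fun t ht => (hasDerivWithinAt_amp_sq (ν := ν) (h.deriv_radius t ht)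
      (h.deriv_time t ht) k).continuousWithinAt) fun t ht => by simp only [(hχ t ht).2.1]
  set F := fun t => ∑ k ∈ S, kz k ^ 2 * weight r 0 (τ t) (ν / 2 * t) k * ‖a t k‖ ^ 2 with hFdef
  set Z := fun t => ∑ k ∈ S, kz k ^ 4 * amp (τ t) (ν / 2 * t) k ^ 2 * ‖a t k‖ ^ 2 with hZdef
  have hFc : ContinuousOn F (Icc 0 T) := h.continuousOn_sum fun k _ => continuousOn_const.mul (hw k)
  have hZc : ContinuousOn Z (Icc 0 T) := h.continuousOn_sum fun k _ => continuousOn_const.mul (ha k)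
  have hTmem : T ∈ Icc 0 T := right_mem_Icc.2 hT
  have key := add_integral_le (f := fun t => t * ∑ k ∈ S, kz k ^ 2 * amp (τ t) (ν / 2 * s t) k ^ 2 *
    ‖a t k‖ ^ 2) (g := fun t => ν / 2 * (t * Z t) - F t - c / ν * T * M ^ 2 * (M ^ 2 + F t)) hTmem
    (fun t ht => (hasDerivWithinAt_id t _).mul (HasDerivWithinAt.fun_sum fun k hk =>
      ((hasDerivWithinAt_amp_sq (h.deriv_radius t ht) (h.deriv_time t ht) k).const_mul
        (kz k ^ 2)).fun_mul (h.deriv k hk t ht).norm_sq))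
    (((continuousOn_const.mul (continuousOn_id.mul hZc)).sub hFc).sub
      (continuousOn_const.mul (continuousOn_const.add hFc))) fun t ht => ?_
  · have hi : ∀ {g : ℝ → ℝ}, ContinuousOn g (Icc 0 T) → IntervalIntegrable g volume 0 T := fun hg =>
      ContinuousOn.intervalIntegrable (by rwa [uIcc_of_le hT])
    have hi1 : IntervalIntegrable (fun t => ν / 2 * (t * Z t)) volume 0 T :=
      hi (continuousOn_const.mul (continuousOn_id.mul hZc))
    have hi2 := hi hFc
    rw [intervalIntegral.integral_sub (hi1.sub hi2) (((intervalIntegrable_const).add hi2).const_mul _),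
      intervalIntegral.integral_sub hi1 hi2, intervalIntegral.integral_const_mul,
      intervalIntegral.integral_const_mul, intervalIntegral.integral_add intervalIntegrable_const hi2,
      intervalIntegral.integral_const, sub_zero, zero_mul, smul_eq_mul] at key
    have hpos : 0 ≤ T * ∑ k ∈ S, kz k ^ 2 * amp (τ T) (ν / 2 * s T) k ^ 2 * ‖a T k‖ ^ 2 :=
      mul_nonneg hT (sum_nonneg fun k _ => by positivity)
    have hc' : 0 ≤ c / ν * T * M ^ 2 := pos!
    nlinarith [mul_le_mul_of_nonneg_left hF hc']
  · have hs := (hχ t ht).2.1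
    have h1 := hd (2 * C * (loss r ν (τ t) (ν / 2 * s t) N[a t]).toReal) ν Ω (τ t) (ν / 2 * t)
      pos! hν (hχ t ht).2.2 (mul_nonneg pos! ht.1) S (a t) (h.support t) (h.solenoidal t)
    have hE' := hE t ht
    have hE0 : 0 ≤ ∑ k ∈ S, weight r 0 (τ t) (ν / 2 * t) k * ‖a t k‖ ^ 2 :=
      sum_nonneg fun k _ => mul_nonneg weight_nonneg (sq_nonneg _)
    have hF0 : 0 ≤ F t :=
      sum_nonneg fun k _ => mul_nonneg (mul_nonneg (sq_nonneg _) weight_nonneg) (sq_nonneg _)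
    have h2 : (∑ k ∈ S, weight r 0 (τ t) (ν / 2 * t) k * ‖a t k‖ ^ 2 + F t) *
      ∑ k ∈ S, weight r 0 (τ t) (ν / 2 * t) k * ‖a t k‖ ^ 2 ≤ M ^ 2 * (M ^ 2 + F t) := by rw [mul_comm]; gcongr
    have h3 : ∑ k ∈ S, kz k ^ 2 * amp (τ t) (ν / 2 * t) k ^ 2 * ‖a t k‖ ^ 2 ≤ F t := by
      refine sum_le_sum fun k _ => ?_
      have : amp (τ t) (ν / 2 * t) k ^ 2 ≤ weight r 0 (τ t) (ν / 2 * t) k := by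
        have e : core r (τ t) (ν / 2 * t) k = (kh k ^ (2 * r) + 1) * amp (τ t) (ν / 2 * t) k ^ 2 := by
          rw [amp_sq, core]; ring
        rw [weight_zero, e]
        nlinarith [mul_nonneg (rpow_nonneg (kh_nonneg k) (2 * r)) (sq_nonneg (amp (τ t) (ν / 2 * t) k))]
      gcongr
    have h4 := mul_le_mul_of_nonneg_left (h1.trans (add_le_add_right
      (mul_le_mul_of_nonneg_left h2 (by positivity : 0 ≤ c / ν)) _)) ht.1
    have h5 : t * (c / ν * (M ^ 2 * (M ^ 2 + F t))) ≤ c / ν * T * M ^ 2 * (M ^ 2 + F t) := by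
      have : 0 ≤ c / ν * (M ^ 2 * (M ^ 2 + F t)) := pos!
      nlinarith [mul_le_mul_of_nonneg_right ht.2 this]
    have h6 : t * ∑ k ∈ S, (kz k ^ 2 * ((2 * (χ t * -(C * (loss r ν (τ t) (ν / 2 * s t) fun k =>
      ‖a t k‖ₑ).toReal)) * kh k + ν * χ t * kz k) * amp (τ t) (ν / 2 * s t) k ^ 2) * ‖a t k‖ ^ 2 +
      kz k ^ 2 * amp (τ t) (ν / 2 * s t) k ^ 2 * (2 * inner ℝ (a t k) (χ t • rhs ν Ω (a t) k))) =
      t * ∑ k ∈ S, kz k ^ 2 * ((-(2 * C * (loss r ν (τ t) (ν / 2 * s t) N[a t]).toReal *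
      kh k) + ν * kz k) * amp (τ t) (ν / 2 * t) k ^ 2 * ‖a t k‖ ^ 2 +
      amp (τ t) (ν / 2 * t) k ^ 2 * (2 * inner ℝ (a t k) (rhs ν Ω (a t) k))) := by
      congr 1
      refine sum_congr rfl fun k _ => ?_
      rw [(hχ t ht).1, one_smul, hs]
      ring
    simp only [id_eq, one_mul]
    rw [h6, hs]
    have hZt : Z t = ∑ k ∈ S, kz k ^ 4 * amp (τ t) (ν / 2 * t) k ^ 2 * ‖a t k‖ ^ 2 := rfl
    rw [← hZt] at h4
    have h7 : ∀ x y : ℝ, t * (-(ν / 2 * x) + y) = -(ν / 2 * (t * x)) + t * y := fun x y => by ring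
    rw [h7, hs] at h4
    linarith


lemma lintegral_sqrt_le {f : α → ℝ≥0∞}
    (hf : AEMeasurable f μ) : ∫⁻ x, f x ^ ½ ∂μ ≤ μ univ ^ ½ * (∫⁻ x, f x ∂μ) ^ ½ := by
  have h := ENNReal.lintegral_mul_le_Lp_mul_Lq μ (p := 2) (q := 2) Real.HolderConjugate.two_two
    (aemeasurable_const (b := 1)) (hf.pow_const ½)
  simp only [Pi.mul_apply, one_mul, ENNReal.one_rpow, lintegral_const, ← rpow_mul] at h
  simpa using h

/-- The loss of radius in terms of the energy bounds. -/
lemma lintegral_loss_le {s : ℝ} (hν : 0 < ν) (hM : 0 ≤ M) (hst : s ≤ t) {E F x : ℝ → ℝ≥0∞}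
    (hx : ∀ u, x u ≤ 1) (hE : ∀ u ∈ Ioo s t, E u ≤ ofReal (M ^ 2))
    (hm : AEMeasurable (fun u => x u * F u) (volume.restrict (Ioo s t)))
    (hF : ∫⁻ u in Ioo s t, x u * F u ≤ ofReal (2 * M ^ 2 / ν)) :
    ∫⁻ u in Ioo s t, x u * (E u ^ ½ + F u ^ ½ + E u / ofReal ν) ≤ ofReal (maxLoss 1 ν M (t - s)) := by
  have hroot : ∀ y : ℝ, 0 ≤ y → ofReal y ^ ½ = ofReal (√y) := fun y hy => by
    rw [ENNReal.ofReal_rpow_of_nonneg hy num!, sqrt_eq_rpow]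
  have hp : ∀ u ∈ Ioo s t, x u * (E u ^ ½ + F u ^ ½ + E u / ofReal ν) ≤
    ofReal (M + M ^ 2 / ν) + (x u * F u) ^ ½ := fun u hu => by
    have h1 : E u ^ ½ ≤ ofReal M := by
      rw [← sqrt_sq hM, ← hroot _ (sq_nonneg _)]
      exact rpow_le_rpow (hE u hu) num!
    have h2 : E u / ofReal ν ≤ ofReal (M ^ 2 / ν) := by
      rw [ofReal_div_of_pos hν]
      exact div_le_div_right (hE u hu) _
    have h3 : x u ≤ x u ^ ½ := by
      conv_lhs => rw [← ENNReal.rpow_one (x u)]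
      exact ENNReal.rpow_le_rpow_of_exponent_ge (hx u) num!
    rw [mul_rpow_of_nonneg _ _ num!, ofReal_add hM pos!]
    calc _ = x u * E u ^ ½ + x u * (E u / ofReal ν) + x u * F u ^ ½ := by ring
      _ ≤ 1 * ofReal M + 1 * ofReal (M ^ 2 / ν) + x u ^ ½ * F u ^ ½ := by gcongr <;> exact hx u
      _ = _ := by rw [one_mul, one_mul]
  refine (setLIntegral_mono' measurableSet_Ioo hp).trans ?_
  rw [lintegral_add_left measurable_const, setLIntegral_const, volume_Ioo]
  have h4 := (lintegral_sqrt_le hm).trans (mul_le_mul_right (rpow_le_rpow hF num!) _)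
  rw [restrict_apply_univ, volume_Ioo, hroot _ (sub_nonneg.2 hst), hroot _ pos!, ← ofReal_mul pos!] at h4
  have hts := sub_nonneg.2 hst
  refine (add_le_add_right h4 _).trans ?_
  rw [← ofReal_mul pos!, ← ofReal_add pos! pos!]
  refine ofReal_le_ofReal (le_of_eq ?_)
  have e : √(t - s) * √(2 * M ^ 2 / ν) = M * √(2 * (t - s) / ν) := by
    rw [← sqrt_mul hts, show (t - s) * (2 * M ^ 2 / ν) = M ^ 2 * (2 * (t - s) / ν) by ring,
      sqrt_mul (sq_nonneg _), sqrt_sq hM]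
  rw [e, maxLoss]
  ring

lemma eq_add_integral [CompleteSpace E]
    {f f' : ℝ → E} (hf : ∀ t ∈ Icc 0 T, HasDerivWithinAt f (f' t) (Icc 0 T) t)
    (hc : ContinuousOn f' (Icc 0 T)) (ht : t ∈ Icc 0 T) : f t = f 0 + ∫ s in 0..t, f' s := by
  have hsub : Icc 0 t ⊆ Icc 0 T := Icc_subset_Icc_right ht.2
  rw [intervalIntegral.integral_eq_sub_of_hasDerivAt_of_le ht.1
    (fun u hu => ((hf u (hsub hu)).continuousWithinAt).mono hsub)
    (fun u hu => (hf u (hsub (Ioo_subset_Icc_self hu))).hasDerivAt (Icc_mem_nhds hu.1 (hu.2.trans_le ht.2)))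
    (ContinuousOn.intervalIntegrable (by rw [uIcc_of_le ht.1]; exact hc.mono hsub))]
  abel

/-- A Galerkin approximation on the modes `S` together with its uniform bounds. -/
structure IsApproximation (C r ν Ω T τ₀ M K : ℝ) (a₀ : Coef) (S : Finset Mode)
    (a : ℝ → Coef) (τ : ℝ → ℝ) : Prop where
  symmetric : ∀ t, IsSymmetric (a t)
  solenoidal : ∀ t, IsSolenoidal (a t)
  initial : ∀ k, a 0 k = if k ∈ S then a₀ k else 0
  support : ∀ k ∉ S, ∀ t ∈ Icc 0 T, a t k = 0
  continuousOn : ∀ k, ContinuousOn (fun t => a t k) (Icc 0 T)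
  radius_continuousOn : ContinuousOn τ (Icc 0 T)
  rhs_continuousOn : ∀ k, ContinuousOn (fun t => rhs ν Ω (a t) k) (Icc 0 T)
  eq : ∀ k ∈ S, ∀ t ∈ Icc 0 T, a t k = a 0 k + ∫ s in 0..t, rhs ν Ω (a s) k
  radius_eq : ∀ t ∈ Icc 0 T, τ t = τ₀ - C * (∫⁻ s in Ioo 0 t, loss r ν (τ s) (ν / 2 * s) N[a s]).toReal
  lower : ∀ t ∈ Icc 0 T, τ₀ - maxLoss C ν M t ≤ τ t
  energy : ∀ m, IsSlow m → ∀ t ∈ Icc 0 T, wsum (fun k => m k * weight r 0 (τ t) (ν / 2 * t) k)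
    N[a t] ≤ wsum (fun k => m k * weight r 0 τ₀ 0 k) N[a₀]
  dissipation : ∀ m, IsSlow m → ofReal (ν / 2) * ∫⁻ t in Ioo 0 T,
    wsum (fun k => m k * (kz k ^ 2 * weight r 0 (τ t) (ν / 2 * t) k)) N[a t] ≤
      wsum (fun k => m k * weight r 0 τ₀ 0 k) N[a₀]
  smoothing : ∫⁻ t in Ioo 0 T, ofReal t *
    wsum (fun k => kz k ^ 4 * amp (τ t) (ν / 2 * t) k ^ 2) N[a t] ≤ ofReal K

lemma isSlow_one : IsSlow fun _ => 1 := ⟨fun _ => zero_le_one, fun _ _ _ => le_rfl, fun _ _ _ => by norm_num⟩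

lemma maxLoss_mono {s} (hC : 0 ≤ C) (hν : 0 < ν) (hM : 0 ≤ M) (h : s ≤ t) :
    maxLoss C ν M s ≤ maxLoss C ν M t := by unfold maxLoss; gcongr

lemma maxLoss_eq (C ν M t) : maxLoss C ν M t = C * maxLoss 1 ν M t := by simp only [maxLoss, one_mul]

lemma ofReal_intervalIntegral {f} (hT : 0 ≤ T) (hf : ContinuousOn f (Icc 0 T))
    (h0 : ∀ t ∈ Icc 0 T, 0 ≤ f t) : ofReal (∫ t in 0..T, f t) = ∫⁻ t in Ioo 0 T, ofReal (f t) := by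
  rw [integral_of_le hT, ← restrict_Ioo_eq_restrict_Ioc]
  refine ofReal_integral_eq_lintegral_ofReal (hf.integrableOn_Icc.mono_set Ioo_subset_Icc_self) ?_
  exact ae_restrict_of_forall_mem measurableSet_Ioo (fun t ht => h0 t (Ioo_subset_Icc_self ht))

lemma IsGalerkinCurve.loss_eq (h : IsGalerkinCurve S C r ν Ω T χ a ρ s) (hν : 0 < ν) (t) :
    ofReal (loss r ν (ρ t) (ν / 2 * s t) N[a t]).toReal = loss r ν (ρ t) (ν / 2 * s t) N[a t] :=
  ofReal_toReal (loss_lt_top hν (h.support t)).ne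

lemma IsGalerkinCurve.le_radius (h : IsGalerkinCurve S C r ν Ω T χ a ρ s) (hν : 0 < ν)
    (hC : 0 ≤ C) (hM : 0 ≤ M) (hτ₀ : 0 < τ₀) (h0 : ρ 0 = τ₀) (hen : ∀ t₁ ∈ Icc 0 T, (∀ t ∈ Icc 0 t₁, 0 ≤ ρ t) →
      ∑ k ∈ S, weight r 0 (ρ t₁) (ν / 2 * s t₁) k * ‖a t₁ k‖ ^ 2 +
        ∫ t in 0..t₁, χ t * (ν / 2 * ∑ k ∈ S, (kz k ^ 2 * weight r 0 (ρ t) (ν / 2 * s t) k) *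
          ‖a t k‖ ^ 2) ≤ M ^ 2) (hmax : maxLoss C ν M T ≤ τ₀ / 2) :
    ∀ t ∈ Icc 0 T, ρ t ≤ τ₀ ∧ τ₀ - maxLoss C ν M t ≤ ρ t ∧ τ₀ / 2 ≤ ρ t := by
  have hF0 : ∀ t, 0 ≤ ∑ k ∈ S, (kz k ^ 2 * weight r 0 (ρ t) (ν / 2 * s t) k) * ‖a t k‖ ^ 2 := fun t =>
    sum_nonneg fun k _ => mul_nonneg (mul_nonneg (sq_nonneg _) weight_nonneg) (sq_nonneg _)
  have hE0 : ∀ t, 0 ≤ ∑ k ∈ S, weight r 0 (ρ t) (ν / 2 * s t) k * ‖a t k‖ ^ 2 := fun t =>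
    sum_nonneg fun k _ => mul_nonneg weight_nonneg (sq_nonneg _)
  have hFc : ContinuousOn (fun t => χ t * ∑ k ∈ S, (kz k ^ 2 * weight r 0 (ρ t) (ν / 2 * s t) k) *
    ‖a t k‖ ^ 2) (Icc 0 T) := h.speed_continuousOn.mul
    (h.continuousOn_sum fun k _ => continuousOn_const.mul (h.continuousOn_weight k))
  have hFe : ∀ t, energyF r (ρ t) (ν / 2 * s t) N[a t] =
    ofReal (∑ k ∈ S, (kz k ^ 2 * weight r 0 (ρ t) (ν / 2 * s t) k) * ‖a t k‖ ^ 2) := fun t =>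
    wsum_eq_ofReal (h.support t) fun k => mul_nonneg (sq_nonneg _) weight_nonneg
  have hEe : ∀ t, energyE r (ρ t) (ν / 2 * s t) N[a t] =
    ofReal (∑ k ∈ S, weight r 0 (ρ t) (ν / 2 * s t) k * ‖a t k‖ ^ 2) := fun t =>
    wsum_eq_ofReal (h.support t) fun k => weight_nonneg
  have hρc : ContinuousOn (fun t => χ t * (loss r ν (ρ t) (ν / 2 * s t) N[a t]).toReal)
    (Icc 0 T) := h.speed_continuousOn.mul h.loss_continuousOn
  have hρ0 : ∀ t, 0 ≤ χ t * (loss r ν (ρ t) (ν / 2 * s t) N[a t]).toReal := fun t =>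
    mul_nonneg (h.speed_nonneg t) toReal_nonneg
  have hτeq : ∀ t ∈ Icc 0 T, ρ t = τ₀ - C * ∫ u in 0..t, χ u *
    (loss r ν (ρ u) (ν / 2 * s u) N[a u]).toReal := fun t ht => by
    rw [eq_add_integral h.deriv_radius (h.speed_continuousOn.mul
      (continuousOn_const.mul h.loss_continuousOn).neg) ht, h0, ← intervalIntegral.integral_const_mul,
      sub_eq_add_neg, ← intervalIntegral.integral_neg]
    congr 1
    exact integral_congr fun u _ => by ring
  have hstep : ∀ t₁ ∈ Icc 0 T, (∀ t ∈ Icc 0 t₁, 0 ≤ ρ t) → τ₀ - maxLoss C ν M t₁ ≤ ρ t₁ := fun t₁ ht₁ hpos => by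
    have hsub : Icc 0 t₁ ⊆ Icc 0 T := Icc_subset_Icc_right ht₁.2
    have h1 := lintegral_loss_le hν hM ht₁.1 (x := fun t => ofReal (χ t))
      (E := fun t => energyE r (ρ t) (ν / 2 * s t) N[a t]) (F := fun t => energyF r (ρ t) (ν / 2 * s t) N[a t])
      (fun t => ENNReal.ofReal_le_one.2 (h.speed_le t)) (fun t ht => ?_) ?_ ?_
    · have h2 : ∫ u in 0..t₁, χ u * (loss r ν (ρ u) (ν / 2 * s u) N[a u]).toReal ≤ maxLoss 1 ν M t₁ := by
        have h0' := ht₁.1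
        refine le_of_ofReal_le_ofReal (by unfold maxLoss; positivity) ?_
        rw [ofReal_intervalIntegral ht₁.1 (hρc.mono hsub) fun t _ => hρ0 t]
        rw [sub_zero] at h1
        refine le_trans (le_of_eq (lintegral_congr fun t => ?_)) h1
        rw [ofReal_mul (h.speed_nonneg t), h.loss_eq hν]
        rfl
      rw [hτeq t₁ ht₁, maxLoss_eq]
      linarith [mul_le_mul_of_nonneg_left h2 hC]
    · have htT : t ∈ Icc 0 T := hsub (Ioo_subset_Icc_self ht)
      have h2 := hen t htT fun u hu => hpos u ⟨hu.1, hu.2.trans ht.2.le⟩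
      have h3 : 0 ≤ ∫ u in 0..t, χ u * (ν / 2 * ∑ k ∈ S, (kz k ^ 2 *
        weight r 0 (ρ u) (ν / 2 * s u) k) * ‖a u k‖ ^ 2) := intervalIntegral.integral_nonneg htT.1 fun u _ =>
          mul_nonneg (h.speed_nonneg u) (mul_nonneg pos! (hF0 u))
      rw [hEe]
      exact ofReal_le_ofReal lin!
    · simp only [hFe, ← ofReal_mul (h.speed_nonneg _)]
      exact ((hFc.mono ((Ioo_subset_Icc_self).trans hsub)).aemeasurable measurableSet_Ioo).ennreal_ofReal
    · simp only [hFe, ← ofReal_mul (h.speed_nonneg _)]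
      rw [← ofReal_intervalIntegral ht₁.1 (hFc.mono hsub) fun t _ => mul_nonneg (h.speed_nonneg t) (hF0 t)]
      refine ofReal_le_ofReal ?_
      have h2 := hen t₁ ht₁ hpos
      have h3 := hE0 t₁
      simp only [mul_left_comm _ (ν / 2)] at h2
      rw [intervalIntegral.integral_const_mul] at h2
      rw [le_div_iff₀ hν]
      linarith
  have hanti : AntitoneOn ρ (Icc 0 T) := fun t ht u hu htu => by
    rw [hτeq t ht, hτeq u hu]
    have : ∫ x in 0..t, χ x * (loss r ν (ρ x) (ν / 2 * s x) N[a x]).toReal ≤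
      ∫ x in 0..u, χ x * (loss r ν (ρ x) (ν / 2 * s x) N[a x]).toReal := by
      refine intervalIntegral.integral_mono_interval le_rfl ht.1 htu (.of_forall hρ0) ?_
      refine ContinuousOn.intervalIntegrable ?_
      rw [uIcc_of_le hu.1]
      exact hρc.mono (Icc_subset_Icc_right hu.2)
    linarith [mul_le_mul_of_nonneg_left this hC]
  have hτc : ContinuousOn ρ (Icc 0 T) := fun t ht => (h.deriv_radius t ht).continuousWithinAt
  have hloss : ∀ t ∈ Icc 0 T, maxLoss C ν M t ≤ τ₀ / 2 := fun t ht => (maxLoss_mono hC hν hM ht.2).trans hmax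
  have hhalf : ∀ t ∈ Icc 0 T, τ₀ / 2 ≤ ρ t := fun t₁ ht₁ => by
    by_contra hlt
    rw [not_le] at hlt
    obtain ⟨t, ht, hte⟩ := intermediate_value_Icc' ht₁.1 (hτc.mono (Icc_subset_Icc_right ht₁.2))
      (show max (ρ t₁) (τ₀ / 4) ∈ Icc (ρ t₁) (ρ 0) from
        ⟨le_max_left _ _, max_le (by rw [h0]; linarith) (by rw [h0]; linarith)⟩)
    have htT : t ∈ Icc 0 T := ⟨ht.1, ht.2.trans ht₁.2⟩
    have h1 := hstep t htT fun u hu => by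
      have h2 := hanti ⟨hu.1, hu.2.trans htT.2⟩ htT hu.2
      have := le_max_right (ρ t₁) (τ₀ / 4)
      linarith
    have h3 : max (ρ t₁) (τ₀ / 4) < τ₀ / 2 := max_lt hlt lin!
    linarith [hloss t htT]
  intro t ht
  have h0T : 0 ∈ Icc 0 T := ⟨le_rfl, ht.1.trans ht.2⟩
  exact ⟨h0 ▸ hanti h0T ht ht.1, hstep t ht fun u hu =>
    (by linarith [hhalf u ⟨hu.1, hu.2.trans ht.2⟩]), hhalf t ht⟩

lemma exists_approximation (hr : 2 < r) : ∃ C₀ c, 0 < C₀ ∧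
    ∀ C ν Ω T τ₀ M, C₀ ≤ C → 0 < ν → 0 ≤ T → 0 < τ₀ → 0 ≤ M → maxLoss C ν M T ≤ τ₀ / 2 →
    ∀ a₀, IsSymmetric a₀ → IsSolenoidal a₀ → energyE r τ₀ 0 N[a₀] ≤ ofReal (M ^ 2) → ∀ S, IsSymmetricSet S →
    ∃ a τ, IsApproximation C r ν Ω T τ₀ M
      (2 / ν * (2 * M ^ 2 / ν + c / ν * T * M ^ 2 * (M ^ 2 * T + 2 * M ^ 2 / ν))) a₀ S a τ := by
  obtain ⟨C₀, hC₀, hen⟩ := exists_galerkin_energy hr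
  obtain ⟨c, hc, hsm⟩ := exists_galerkin_smoothing hr
  refine ⟨C₀, c, hC₀, fun C ν Ω T τ₀ M hC hν hT hτ₀ hM hmax a₀ hsym hsol hE₀ S hS => ?_⟩
  have hC0 : 0 ≤ C := hC₀.le.trans hC
  obtain ⟨χ, a, τ, s, h, ha0, hτ0, hs0, hχ⟩ := exists_galerkinCurve (τ₀ := τ₀) (B := 1 + M + τ₀ + T) hS C r Ω
    hν hT pos! hsym hsol
  have hinit : ∀ m : Mode → ℝ, IsSlow m → ofReal (∑ k ∈ S, m k * weight r 0 (τ 0) 0 k *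
    ‖a 0 k‖ ^ 2) ≤ wsum (fun k => m k * weight r 0 τ₀ 0 k) N[a₀] := fun m hm => by
    rw [hτ0, ← wsum_eq_ofReal (h.support 0) fun k => mul_nonneg (hm.nonneg k) weight_nonneg]
    refine tsum_le_tsum fun k => ?_
    dsimp only
    rw [ha0]
    split_ifs
    · exact le_rfl
    · simp
  have hM0 : ∑ k ∈ S, weight r 0 (τ 0) 0 k * ‖a 0 k‖ ^ 2 ≤ M ^ 2 := by
    have := hinit _ isSlow_one
    simp only [one_mul] at this
    exact le_of_ofReal_le_ofReal (sq_nonneg M) (this.trans hE₀)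
  have hen1 := hen C ν Ω T hC hν _ isSlow_one S χ a τ s h hs0
  simp only [one_mul] at hen1
  have hrad := h.le_radius hν hC0 hM hτ₀ hτ0 (fun t₁ ht₁ hp => (hen1 t₁ ht₁ hp).trans hM0) hmax
  have hpos : ∀ t ∈ Icc 0 T, 0 ≤ τ t := fun t ht => by linarith [(hrad t ht).2.2]
  have hF0 : ∀ m : Mode → ℝ, IsSlow m → ∀ t, 0 ≤ ∑ k ∈ S, m k * (kz k ^ 2 *
    weight r 0 (τ t) (ν / 2 * s t) k) * ‖a t k‖ ^ 2 := fun m hm t =>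
    sum_nonneg fun k _ => mul_nonneg (mul_nonneg (hm.nonneg k)
      (mul_nonneg (sq_nonneg _) weight_nonneg)) (sq_nonneg _)
  have hE1 : ∀ m : Mode → ℝ, IsSlow m → ∀ t ∈ Icc 0 T,
    ∑ k ∈ S, m k * weight r 0 (τ t) (ν / 2 * s t) k * ‖a t k‖ ^ 2 ≤
      ∑ k ∈ S, m k * weight r 0 (τ 0) 0 k * ‖a 0 k‖ ^ 2 := fun m hm t ht => by
    have h1 := hen C ν Ω T hC hν m hm S χ a τ s h hs0 t ht fun u hu => hpos u ⟨hu.1, hu.2.trans ht.2⟩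
    have h3 : 0 ≤ ∫ u in 0..t, χ u * (ν / 2 * ∑ k ∈ S, m k * (kz k ^ 2 *
      weight r 0 (τ u) (ν / 2 * s u) k) * ‖a u k‖ ^ 2) := intervalIntegral.integral_nonneg ht.1 fun u _ =>
        mul_nonneg (h.speed_nonneg u) (mul_nonneg pos! (hF0 m hm u))
    linarith
  have hEM : ∀ t ∈ Icc 0 T, ∑ k ∈ S, weight r 0 (τ t) (ν / 2 * s t) k * ‖a t k‖ ^ 2 ≤ M ^ 2 := fun t ht => by
    have := hE1 _ isSlow_one t ht
    simp only [one_mul] at this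
    exact this.trans hM0
  have hχ1 : ∀ t ∈ Icc 0 T, χ t = 1 := fun t ht => by
    refine hχ t (fun k => ?_) ?_ ?_
    · by_cases hk : k ∈ S
      · have h1 : ‖a t k‖ ^ 2 ≤ M ^ 2 := by
          refine le_trans ?_ ((Finset.single_le_sum (f := fun k => weight r 0 (τ t) (ν / 2 * s t) k *
            ‖a t k‖ ^ 2) (fun k _ => mul_nonneg weight_nonneg (sq_nonneg _)) hk).trans (hEM t ht))
          exact le_mul_of_one_le_left (sq_nonneg _) (one_le_weight _ _ _ _)
        have h2 := abs_le_of_sq_le_sq' h1 hM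
        linarith [h2.2]
      · rw [h.support t k hk, norm_zero]; positivity
    · rw [abs_of_nonneg (hpos t ht)]; linarith [(hrad t ht).1]
    · have := h.time_mem hs0 ht
      rw [abs_of_nonneg this.1]; linarith [ht.2]
  have hst : ∀ t ∈ Icc 0 T, s t = t := fun t ht => by
    rw [eq_add_integral h.deriv_time h.speed_continuousOn ht, hs0, zero_add]
    have : EqOn χ (fun _ => 1) (uIcc 0 t) := fun u hu => by
      rw [uIcc_of_le ht.1] at hu; exact hχ1 u ⟨hu.1, hu.2.trans ht.2⟩
    rw [integral_congr this]
    simp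
  have hwc : ∀ k, ContinuousOn (fun t => weight r 0 (τ t) (ν / 2 * t) k) (Icc 0 T) := fun k =>
    (h.continuousOn_weight k).congr fun t ht => by simp only [hst t ht]
  have hmode : ∀ k, ContinuousOn (fun t => a t k) (Icc 0 T) := fun k => by
    by_cases hk : k ∈ S
    · exact h.continuousOn_mode hk
    · simp only [fun t => h.support t k hk]; exact continuousOn_const
  have hdiss : ∀ m, IsSlow m → ν / 2 * ∫ t in 0..T, ∑ k ∈ S, m k * (kz k ^ 2 *
    weight r 0 (τ t) (ν / 2 * t) k) * ‖a t k‖ ^ 2 ≤ ∑ k ∈ S, m k * weight r 0 (τ 0) 0 k * ‖a 0 k‖ ^ 2 := fun m hm => by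
    have h1 := hen C ν Ω T hC hν m hm S χ a τ s h hs0 T (right_mem_Icc.2 hT) hpos
    have h2 : 0 ≤ ∑ k ∈ S, m k * weight r 0 (τ T) (ν / 2 * s T) k * ‖a T k‖ ^ 2 :=
      sum_nonneg fun k _ => mul_nonneg (mul_nonneg (hm.nonneg k) weight_nonneg) (sq_nonneg _)
    rw [← intervalIntegral.integral_const_mul]
    refine le_trans (le_of_eq (integral_congr fun t ht => ?_)) ((le_add_of_nonneg_left h2).trans h1)
    rw [uIcc_of_le hT] at ht
    simp only [hχ1 t ht, hst t ht, one_mul]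
  refine ⟨a, τ, h.symmetric, h.solenoidal, ha0, fun k hk t _ => h.support t k hk, hmode,
    fun t ht => (h.deriv_radius t ht).continuousWithinAt, h.rhs_continuousOn, fun k hk t ht => ?_,
    fun t ht => ?_, fun t ht => (hrad t ht).2.1, fun m hm t ht => ?_, fun m hm => ?_, ?_⟩
  · refine eq_add_integral (f := fun t => a t k) (fun u hu => (h.deriv k hk u hu).congr_deriv ?_)
      (h.rhs_continuousOn k) ht
    rw [hχ1 u hu, one_smul]
  · rw [eq_add_integral h.deriv_radius (h.speed_continuousOn.mul
      (continuousOn_const.mul h.loss_continuousOn).neg) ht, hτ0, sub_eq_add_neg]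
    congr 1
    have h1 := ofReal_intervalIntegral ht.1 (h.loss_continuousOn.mono (Icc_subset_Icc_right ht.2))
      fun t _ => toReal_nonneg
    have h2 : ∫⁻ u in Ioo 0 t, loss r ν (τ u) (ν / 2 * u) N[a u] = ofReal
      (∫ u in 0..t, (loss r ν (τ u) (ν / 2 * s u) N[a u]).toReal) := by
      rw [h1]
      refine setLIntegral_congr_fun measurableSet_Ioo fun u hu => ?_
      rw [h.loss_eq hν, hst u ⟨hu.1.le, hu.2.le.trans ht.2⟩]
    rw [h2, toReal_ofReal (intervalIntegral.integral_nonneg ht.1 fun _ _ => toReal_nonneg),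
      ← intervalIntegral.integral_const_mul, ← intervalIntegral.integral_neg]
    refine integral_congr fun u hu => ?_
    rw [uIcc_of_le ht.1] at hu
    simp only [hχ1 u ⟨hu.1, hu.2.trans ht.2⟩, one_mul]
  · rw [wsum_eq_ofReal (h.support t) fun k => mul_nonneg (hm.nonneg k) weight_nonneg]
    refine (ofReal_le_ofReal ?_).trans (hinit m hm)
    have := hE1 m hm t ht
    rwa [hst t ht] at this
  · have h1 := hdiss m hm
    refine le_trans (le_of_eq ?_) ((ofReal_le_ofReal h1).trans (hinit m hm))
    have hc : ContinuousOn (fun t => ∑ k ∈ S, m k * (kz k ^ 2 * weight r 0 (τ t) (ν / 2 * t) k) *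
      ‖a t k‖ ^ 2) (Icc 0 T) :=
      h.continuousOn_sum fun k _ => continuousOn_const.mul (continuousOn_const.mul (hwc k))
    rw [ofReal_mul pos!, ofReal_intervalIntegral hT hc]
    · congr 1
      exact lintegral_congr fun t => wsum_eq_ofReal (h.support t) fun k =>
        mul_nonneg (hm.nonneg k) (mul_nonneg (sq_nonneg _) weight_nonneg)
    · intro t ht
      have := hF0 m hm t
      rwa [hst t ht] at this
  · have hz : ∀ t, 0 ≤ ∑ k ∈ S, kz k ^ 4 * amp (τ t) (ν / 2 * t) k ^ 2 * ‖a t k‖ ^ 2 := fun t =>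
      sum_nonneg fun k _ => pos!
    have hd := hdiss _ isSlow_one
    simp only [one_mul] at hd
    have h1 := hsm C ν Ω T hC0 hν S χ a τ s h (fun t ht => ⟨hχ1 t ht, hst t ht, hpos t ht⟩) hT M
      (fun t ht => by have := hEM t ht; rwa [hst t ht] at this) (by
        rw [le_div_iff₀ hν]; linarith [hd.trans hM0])
    have hac : ∀ k, ContinuousOn (fun t => amp (τ t) (ν / 2 * t) k ^ 2) (Icc 0 T) := fun k =>
      ContinuousOn.congr (fun t ht => (hasDerivWithinAt_amp_sq (ν := ν) (h.deriv_radius t ht)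
        (h.deriv_time t ht) k).continuousWithinAt) fun t ht => by simp only [hst t ht]
    have h2 : ∫ t in 0..T, t * ∑ k ∈ S, kz k ^ 4 * amp (τ t) (ν / 2 * t) k ^ 2 * ‖a t k‖ ^ 2 ≤
      2 / ν * (2 * M ^ 2 / ν + c / ν * T * M ^ 2 * (M ^ 2 * T + 2 * M ^ 2 / ν)) := by
      have h3 := mul_le_mul_of_nonneg_left h1 (by positivity : 0 ≤ 2 / ν)
      rwa [← mul_assoc, show 2 / ν * (ν / 2) = 1 by field_simp, one_mul] at h3
    refine le_trans (le_of_eq ?_) (ofReal_le_ofReal h2)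
    have hc : ContinuousOn (fun t => t * ∑ k ∈ S, kz k ^ 4 * amp (τ t) (ν / 2 * t) k ^ 2 * ‖a t k‖ ^ 2)
      (Icc 0 T) := continuousOn_id.mul (h.continuousOn_sum fun k _ => continuousOn_const.mul (hac k))
    rw [ofReal_intervalIntegral hT hc fun t ht => mul_nonneg ht.1 (hz t)]
    refine setLIntegral_congr_fun measurableSet_Ioo fun t ht => ?_
    rw [wsum_eq_ofReal (h.support t) fun k => by have := kz_nonneg k; positivity, ← ofReal_mul ht.1.le]


/-! ### Compactness -/

/-- Uniformly equicontinuous bounded sequences of families of curves have a pointwise convergent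
subsequence. -/
lemma exists_subseq_tendsto {ι X : Type*} [Countable ι] [MetricSpace X] [ProperSpace X]
    (f : ℕ → ι → ℝ → X) (hT : 0 ≤ T) (hb : ∀ i, ∃ K, IsCompact K ∧ ∀ n, ∀ t ∈ Icc 0 T, f n i t ∈ K)
    (he : ∀ i, ∀ ε > 0, ∃ δ > 0, ∀ n, ∀ s ∈ Icc 0 T, ∀ t ∈ Icc 0 T, |s - t| < δ →
      dist (f n i s) (f n i t) ≤ ε) : ∃ φ : ℕ → ℕ, StrictMono φ ∧ ∃ g : ι → ℝ → X, ∀ i, ∀ t ∈ Icc 0 T,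
      Tendsto (fun n => f (φ n) i t) atTop (𝓝 (g i t)) := by
  choose K hK hfK using hb
  have hmem : ∀ x, max 0 (min T x) ∈ Icc 0 T := fun x => ⟨le_max_left _ _, max_le hT (min_le_left _ _)⟩
  obtain ⟨g, -, φ, hφ, hg⟩ := (isCompact_univ_pi fun p : ι × ℚ => hK p.1).tendsto_subseq
    (x := fun n p => f n p.1 (max 0 (min T (p.2 : ℝ)))) fun n p _ => hfK _ _ _ (hmem _)
  have hlim : ∀ i, ∀ t ∈ Icc 0 T, ∃ y, Tendsto (fun n => f (φ n) i t) atTop (𝓝 y) := fun i t ht => by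
    refine cauchySeq_tendsto_of_complete (Metric.cauchySeq_iff'.2 fun ε hε => ?_)
    obtain ⟨δ, hδ, hd⟩ := he i (ε / 4) pos!
    obtain ⟨q, hq1, hq2⟩ := exists_rat_btwn (show t - δ < t by linarith)
    set x := max 0 (min T (q : ℝ)) with hx
    have hxt : |x - t| < δ := by
      rw [hx, abs_lt]
      constructor
      · have : min T (q : ℝ) ≤ max 0 (min T (q : ℝ)) := le_max_right _ _
        rw [min_eq_right (hq2.le.trans ht.2)] at this ⊢
        linarith
      · rw [sub_lt_iff_lt_add]
        refine max_lt (by linarith [ht.1]) ((min_le_right _ _).trans_lt lin!)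
    have hc : CauchySeq fun n => f (φ n) i x := ((tendsto_pi_nhds.1 hg) (i, q)).cauchySeq
    obtain ⟨N, hN⟩ := Metric.cauchySeq_iff'.1 hc (ε / 4) pos!
    refine ⟨N, fun n hn => ?_⟩
    calc _ ≤ dist (f (φ n) i t) (f (φ n) i x) + dist (f (φ n) i x) (f (φ N) i x) +
      dist (f (φ N) i x) (f (φ N) i t) := dist_triangle4 _ _ _ _
      _ ≤ ε / 4 + ε / 4 + ε / 4 := by
        refine add_le_add (add_le_add ?_ (hN n hn).le) (hd _ _ (hmem _) _ ht hxt)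
        rw [dist_comm]; exact hd _ _ (hmem _) _ ht hxt
      _ < ε := lin!
  refine ⟨φ, hφ, fun i t => if ht : t ∈ Icc 0 T then (hlim i t ht).choose else f 0 i t, fun i t ht => ?_⟩
  dsimp only
  rw [dif_pos ht]
  exact (hlim i t ht).choose_spec

lemma wsum_le_liminf {w : ℕ → Mode → ℝ} {v : Mode → ℝ} {a : ℕ → Coef} {b : Coef}
    (hw : ∀ k, Tendsto (fun n => w n k) atTop (𝓝 (v k))) (ha : ∀ k, Tendsto (fun n => a n k) atTop (𝓝 (b k))) :
    wsum v N[b] ≤ liminf (fun n => wsum (w n) N[a n]) atTop := by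
  refine ENNReal.summable.tsum_le_of_sum_le fun Q => ?_
  have h : Tendsto (fun n => ∑ k ∈ Q, ofReal (w n k) * ‖a n k‖ₑ ^ 2) atTop
    (𝓝 (∑ k ∈ Q, ofReal (v k) * ‖b k‖ₑ ^ 2)) := tendsto_finsetSum Q fun k _ =>
    ENNReal.Tendsto.mul (tendsto_ofReal (hw k)) (Or.inr (by finiteness))
      (ENNReal.Tendsto.pow (ha k).enorm) (Or.inr ofReal_ne_top)
  exact h.liminf_eq.symm.le.trans (liminf_le_liminf (.of_forall fun n => ENNReal.sum_le_tsum Q))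

lemma aemeasurable_wsum_of_aemeasurable {w : ℝ → Mode → ℝ} (hw : ∀ k, AEMeasurable (fun t => w t k) vol[T])
    (ha : ∀ k, ContinuousOn (fun t => a t k) (Icc 0 T)) : AEMeasurable (fun t => wsum (w t) N[a t]) vol[T] := by
  unfold wsum
  exact AEMeasurable.tsum fun k => (hw k).ennreal_ofReal.mul
    ((((ha k).mono Ioo_subset_Icc_self).aemeasurable measurableSet_Ioo).enorm.pow_const 2)

lemma aemeasurable_wsum {w : ℝ → Mode → ℝ}
    (hw : ∀ k, ContinuousOn (fun t => w t k) (Icc 0 T)) (ha : ∀ k, ContinuousOn (fun t => a t k) (Icc 0 T)) :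
    AEMeasurable (fun t => wsum (w t) N[a t]) vol[T] :=
  aemeasurable_wsum_of_aemeasurable (fun k => ((hw k).mono Ioo_subset_Icc_self).aemeasurable
    measurableSet_Ioo) ha

lemma wsum_indicator_add (w) (Q : Set Mode) (A) :
    wsum w A = wsum w (Q.indicator A) + wsum w (Qᶜ.indicator A) := by
  unfold wsum
  rw [← tsum_add]
  refine tsum_congr fun k => ?_
  by_cases h : k ∈ Q
  · simp [h]
  · simp [h]

lemma loss_le_indicator (r ν τ η) (Q : Set Mode) (A) : loss r ν τ η A ≤ loss r ν τ η (Q.indicator A) +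
      (2 * wsum (fun k => (1 + kz k ^ 2) * weight r 0 τ η k) (Qᶜ.indicator A) ^ ½ +
        wsum (fun k => (1 + kz k ^ 2) * weight r 0 τ η k) (Qᶜ.indicator A) / ofReal ν) := by
  set X := wsum (fun k => (1 + kz k ^ 2) * weight r 0 τ η k) (Qᶜ.indicator A)
  have hw := fun k => (weight_pos r τ η k).le
  have hE : energyE r τ η A ≤ energyE r τ η (Q.indicator A) + X := by
    unfold energyE
    rw [wsum_indicator_add _ Q]
    gcongr
    exact wsum_mono (fun k => by nlinarith [mul_nonneg (sq_nonneg (kz k)) (hw k)]) _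
  have hF : energyF r τ η A ≤ energyF r τ η (Q.indicator A) + X := by
    unfold energyF
    rw [wsum_indicator_add _ Q]
    gcongr
    exact wsum_mono (fun k => by nlinarith [hw k]) _
  unfold loss
  calc _ ≤ (energyE r τ η (Q.indicator A) ^ ½ + X ^ ½) + (energyF r τ η (Q.indicator A) ^ ½ + X ^ ½) +
        (energyE r τ η (Q.indicator A) + X) / ofReal ν := by
        gcongr
        · exact (rpow_le_rpow hE num!).trans (ennreal_sqrt_add_le _ _)
        · exact (rpow_le_rpow hF num!).trans (ennreal_sqrt_add_le _ _)
    _ = _ := by rw [ENNReal.add_div]; ring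

/-- A horizontal truncation. -/
lemma isSlow_min (hR : 0 < R) : IsSlow fun k => min 1 ((1 + kh k) / R) where
  nonneg k := le_min zero_le_one (div_nonneg (by linarith [kh_nonneg k]) hR.le)
  mono k j h := min_le_min le_rfl (by gcongr)
  double k j h := by
    have h1 := kh_add_le k j
    have h2 := kh_nonneg j
    rw [mul_min_of_nonneg _ _ (by norm_num : (0 : ℝ) ≤ 2)]
    refine min_le_min num! ?_
    rw [← mul_div_assoc]
    gcongr
    linarith

lemma tendsto_wsum_min (hw : ∀ k, 0 ≤ w k) {A} (hA : wsum w A < ⊤) :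
    Tendsto (fun R => wsum (fun k => min 1 ((1 + kh k) / R) * w k) A) atTop (𝓝 0) := by
  have h := tendsto_lintegral_filter_of_dominated_convergence (μ := Measure.count (α := Mode)) (l := atTop)
    (F := fun (R : ℝ) k => ofReal (min 1 ((1 + kh k) / R) * w k) * A k ^ 2) (f := fun _ => 0)
    (fun k => ofReal (w k) * A k ^ 2) (.of_forall fun R => Measurable.of_discrete)
    (.of_forall fun R => .of_forall fun k => ?_) ?_ (.of_forall fun k => ?_)
  · simpa only [lintegral_count, lintegral_zero, wsum] using h
  · gcongr
    exact mul_le_of_le_one_left (hw k) (min_le_left _ _)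
  · rw [lintegral_count]; exact hA.ne
  · have h1 : Tendsto (fun R => min 1 ((1 + kh k) / R) * w k) atTop (𝓝 0) := by
      have := ((tendsto_const_nhds (x := 1)).min (tendsto_const_nhds (x := 1 + kh k).div_atTop
        tendsto_id)).mul_const (w k)
      simpa using this
    have h2 := tendsto_ofReal h1
    rw [ofReal_zero] at h2
    by_cases hk : A k ^ 2 = ⊤
    · have hwk : w k = 0 := by
        by_contra hne
        have : ofReal (w k) * A k ^ 2 = ⊤ := by
          rw [hk]; exact ENNReal.mul_top (by simpa using lt_of_le_of_ne (hw k) (Ne.symm hne))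
        exact hA.ne (ENNReal.tsum_eq_top_of_eq_top ⟨k, this⟩)
      simp [hwk]
    · simpa using ENNReal.Tendsto.mul_const h2 (Or.inr hk)

lemma finite_box (R Z) : {k : Mode | kh k ≤ R ∧ kz k ≤ Z}.Finite := by
  have hf : ∀ c, {n : ℤ | |(n : ℝ)| ≤ c}.Finite := fun c => by
    refine (Set.finite_Icc (-⌈c⌉) ⌈c⌉).subset fun n hn => ?_
    have h := abs_le.1 (hn.trans (Int.le_ceil c) : |(n : ℝ)| ≤ ⌈c⌉)
    exact ⟨by exact_mod_cast h.1, by exact_mod_cast h.2⟩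
  refine ((hf R).prod ((hf R).prod (hf Z))).subset fun k hk => ⟨?_, ?_, ?_⟩
  · exact (abs_fst_le_kh k).trans hk.1
  · exact (abs_snd_le_kh k).trans hk.1
  · exact (abs_trd_le_kz k).trans hk.2

lemma wsum_tail_le {Z} (hr : 0 ≤ r) (hR : 0 < R) (hZ : 1 ≤ Z) (hτ : 0 ≤ τ) (hη : 0 ≤ η) (A) :
    wsum (fun k => (1 + kz k ^ 2) * weight r 0 τ η k) ({k : Mode | kh k ≤ R ∧ kz k ≤ Z}ᶜ.indicator A) ≤
      wsum (fun k => min 1 ((1 + kh k) / R) * weight r 0 τ η k) A +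
      wsum (fun k => min 1 ((1 + kh k) / R) * (kz k ^ 2 * weight r 0 τ η k)) A +
      ofReal (2 * (2 + R ^ (2 * r)) / Z ^ 2) * wsum (fun k => kz k ^ 4 * amp τ η k ^ 2) A := by
  have hm := isSlow_min hR
  have hw := fun k => (weight_pos r τ η k).le
  have hRr : 0 ≤ R ^ (2 * r) := rpow_nonneg hR.le _
  rw [← wsum_add (fun k => mul_nonneg (hm.nonneg k) (hw k))
    fun k => mul_nonneg (hm.nonneg k) (mul_nonneg (sq_nonneg _) (hw k)), ← wsum_const_mul pos!,
    ← wsum_add (fun k => add_nonneg (mul_nonneg (hm.nonneg k) (hw k))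
      (mul_nonneg (hm.nonneg k) (mul_nonneg (sq_nonneg _) (hw k)))) fun k => by positivity]
  refine tsum_le_tsum fun k => ?_
  by_cases hk : k ∈ {k : Mode | kh k ≤ R ∧ kz k ≤ Z}
  · simp [hk]
  rw [indicator_of_mem (mem_compl hk)]
  gcongr
  have h0 := hm.nonneg k
  by_cases hkR : kh k ≤ R
  · have hkZ : Z < kz k := by
      by_contra h
      exact hk ⟨hkR, not_lt.1 h⟩
    have h1 : weight r 0 τ η k ≤ (2 + R ^ (2 * r)) * amp τ η k ^ 2 := by
      have e : core r τ η k = (kh k ^ (2 * r) + 1) * amp τ η k ^ 2 := by rw [amp_sq, core]; ring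
      have h2 : 1 ≤ amp τ η k ^ 2 := one_le_pow₀ (one_le_amp hτ hη k)
      have h3 : kh k ^ (2 * r) ≤ R ^ (2 * r) := Real.rpow_le_rpow (kh_nonneg k) hkR lin!
      rw [weight_zero, e]
      nlinarith
    have h2 : 1 + kz k ^ 2 ≤ 2 * kz k ^ 4 / Z ^ 2 := by
      rw [le_div_iff₀ pos!]
      have h3 : Z ^ 2 ≤ kz k ^ 2 := by gcongr
      have h4 : 1 ≤ kz k ^ 2 := one_le_pow₀ (hZ.trans hkZ.le)
      nlinarith
    have h3 : (1 + kz k ^ 2) * weight r 0 τ η k ≤ 2 * (2 + R ^ (2 * r)) / Z ^ 2 * (kz k ^ 4 * amp τ η k ^ 2) :=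
      (mul_le_mul h2 h1 (hw k) pos!).trans_eq (by ring)
    have h4 : 0 ≤ min 1 ((1 + kh k) / R) * weight r 0 τ η k +
      min 1 ((1 + kh k) / R) * (kz k ^ 2 * weight r 0 τ η k) :=
      add_nonneg (mul_nonneg h0 (hw k)) (mul_nonneg h0 (mul_nonneg (sq_nonneg _) (hw k)))
    linarith
  · have h1 : min 1 ((1 + kh k) / R) = 1 := min_eq_left ((one_le_div hR).2 lin!)
    dsimp only
    rw [h1]
    have : 0 ≤ 2 * (2 + R ^ (2 * r)) / Z ^ 2 * (kz k ^ 4 * amp τ η k ^ 2) := pos!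
    linarith

lemma summable_int_exp (hc : 0 < c) : Summable fun n : ℤ => exp (-(c * |(n : ℝ)|)) := by
  have h : Summable fun n : ℕ => exp (-(c * |((n : ℤ) : ℝ)|)) := by
    have := Real.summable_exp_nat_mul_iff.2 (neg_lt_zero.2 hc)
    refine this.congr fun n => ?_
    rw [Int.cast_natCast, abs_of_nonneg (Nat.cast_nonneg n)]
    ring_nf
  refine Summable.of_nat_of_neg h ?_
  simpa using h

lemma summable_mode_exp {α β} (hα : 0 < α) (hβ : 0 < β) :
    Summable fun k : Mode => exp (-(α * kh k + β * kz k)) := by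
  have h1 := summable_int_exp (half_pos hα)
  have h := (h1.mul_of_nonneg (h1.mul_of_nonneg (summable_int_exp hβ) (fun _ => (exp_pos _).le)
    fun _ => (exp_pos _).le) (fun _ => (exp_pos _).le) fun _ => mul_nonneg (exp_pos _).le (exp_pos _).le)
  refine Summable.of_nonneg_of_le (fun k => (exp_pos _).le) (fun k => ?_) h
  rw [← exp_add, ← exp_add]
  refine Real.exp_le_exp.2 ?_
  nlinarith [abs_fst_le_kh k, abs_snd_le_kh k, abs_trd_le_kz k]

lemma summable_mode_exp_mul {α β} (hα : 0 < α) (hβ : 0 < β) :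
    Summable fun k => (1 + kh k) * exp (-(α * kh k + β * kz k)) := by
  refine Summable.of_nonneg_of_le (fun k => ?_) (fun k => ?_)
    ((summable_mode_exp (half_pos hα) hβ).mul_left (1 + 2 / α))
  · have := kh_nonneg k; positivity
  · have h1 : 1 + kh k ≤ (1 + 2 / α) * exp (α / 2 * kh k) := by
      have h2 := Real.add_one_le_exp (α / 2 * kh k)
      have h3 : 1 ≤ exp (α / 2 * kh k) := one_le_exp (by have := kh_nonneg k; positivity)
      have h4 : kh k ≤ 2 / α * exp (α / 2 * kh k) := by rw [div_mul_eq_mul_div, le_div_iff₀ hα]; linarith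
      linarith
    refine (mul_le_mul_of_nonneg_right h1 (exp_pos _).le).trans_eq ?_
    rw [mul_assoc, ← exp_add]
    ring_nf


/-! ### The limit of the approximations -/

lemma norm_hvec (l) : ‖hvec l‖ = kh l := by
  have h : ‖hvec l‖ ^ 2 = kh l ^ 2 := by
    rw [norm_cvel_sq, kh_sq]
    simp only [hvec, PiLp.toLp_apply, Matrix.cons_val_zero, Matrix.cons_val_one, norm_real, norm_eq_abs, sq_abs]
  exact (sq_eq_sq₀ (norm_nonneg _) (kh_nonneg l)).1 h

lemma norm_leray_le (l) (b) : ‖leray l b‖ ≤ 2 * ‖b‖ := by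
  unfold leray
  split_ifs
  · refine (norm_sub_le _ _).trans ?_
    rw [norm_smul, norm_div, norm_hvec, norm_real, Real.norm_of_nonneg (sq_nonneg _)]
    have h1 : ‖hdot l b‖ / kh l ^ 2 * kh l ≤ ‖b‖ := by
      rcases eq_or_lt_of_le (kh_nonneg l) with h | h
      · rw [← h, mul_zero]; exact norm_nonneg b
      · have := norm_hdot_le l b
        rw [div_mul_eq_mul_div, div_le_iff₀ pos!]
        nlinarith
    linarith
  · linarith [norm_nonneg b]

lemma norm_le_of_energyE_le (hM : 0 ≤ M) {a : Coef}
    (h : energyE r τ η N[a] ≤ ofReal (M ^ 2)) (k) : amp τ η k * ‖a k‖ ≤ M := by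
  have h1 : ofReal (weight r 0 τ η k * ‖a k‖ ^ 2) ≤ ofReal (M ^ 2) := by
    refine le_trans (le_trans (le_of_eq ?_) (le_tsum k)) h
    rw [ofReal_mul weight_nonneg, ofReal_pow (norm_nonneg _), ofReal_norm]
  have h2 := le_of_ofReal_le_ofReal (sq_nonneg M) h1
  have h3 : amp τ η k ^ 2 ≤ weight r 0 τ η k := by
    have e : core r τ η k = (kh k ^ (2 * r) + 1) * amp τ η k ^ 2 := by rw [amp_sq, core]; ring
    rw [weight_zero, e]
    nlinarith [mul_nonneg (rpow_nonneg (kh_nonneg k) (2 * r)) (sq_nonneg (amp τ η k))]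
  have h4 : (amp τ η k * ‖a k‖) ^ 2 ≤ M ^ 2 := by
    rw [mul_pow]
    exact (mul_le_mul_of_nonneg_right h3 (sq_nonneg _)).trans h2
  exact (abs_le_of_sq_le_sq' h4 hM).2

lemma hOne_sqrt_le (hr : 1 ≤ r) (hτ : 0 ≤ τ) (hη : 0 ≤ η) {a}
    (h : energyE r τ η N[a] ≤ ofReal (M ^ 2)) : hOne a ≤ ofReal ((2 ^ r) ^ 2 * M ^ 2) := by
  rw [ofReal_mul pos!]
  exact (hOne_le hr hτ hη a).trans (mul_le_mul_right h _)

lemma norm_conv_le (hr : 1 ≤ r) (hτ : 0 ≤ τ) (hη : 0 ≤ η) {a} (h : energyE r τ η N[a] ≤ ofReal (M ^ 2)) (l) :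
    ‖conv a a l‖ ≤ (kh l + kz l) * ((2 ^ r) ^ 2 * M ^ 2) := by
  have hl := add_nonneg (kh_nonneg l) (kz_nonneg l)
  refine le_of_ofReal_le_ofReal pos! ?_
  rw [ofReal_norm, ofReal_mul hl]
  refine (enorm_conv_le_hOne a a l).trans ?_
  rw [ennreal_sqrt_mul_self]
  exact mul_le_mul_right (hOne_sqrt_le hr hτ hη h) _

lemma norm_rhs_le (hr : 1 ≤ r) (hM : 0 ≤ M) (hτ : 0 ≤ τ) (hη : 0 ≤ η) {a : Coef}
    (h : energyE r τ η N[a] ≤ ofReal (M ^ 2)) (ν Ω) (l) :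
    ‖rhs ν Ω a l‖ ≤ 2 * ((kh l + kz l) * ((2 ^ r) ^ 2 * M ^ 2) + |Ω| * M) + |ν * kz l ^ 2| * M := by
  have h1 : ‖a l‖ ≤ M := (le_mul_of_one_le_left (norm_nonneg _) (one_le_amp hτ hη l)).trans
    (norm_le_of_energyE_le hM h l)
  unfold rhs
  refine (norm_sub_le _ _).trans ?_
  rw [norm_neg, norm_smul, norm_real, norm_eq_abs]
  gcongr
  refine (norm_leray_le _ _).trans ?_
  gcongr
  refine (norm_add_le _ _).trans ?_
  rw [norm_smul, norm_cperp, norm_real, norm_eq_abs]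
  gcongr
  exact norm_conv_le hr hτ hη h l

lemma tendsto_conv {a : ℕ → Coef} {b} (hτ : 0 < τ) (hη : 0 < η)
    (ha : ∀ k, Tendsto (fun n => a n k) atTop (𝓝 (b k))) (hM : ∀ n k, amp τ η k * ‖a n k‖ ≤ M) (l) :
    Tendsto (fun n => conv (a n) (a n) l) atTop (𝓝 (conv b b l)) := by
  have hb : ∀ n k, ‖a n k‖ ≤ M * exp (-(τ * kh k + η * kz k)) := fun n k => by
    rw [Real.exp_neg, ← div_eq_mul_inv, le_div_iff₀ (exp_pos _), mul_comm]
    exact hM n k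
  have hM0 : 0 ≤ M := le_trans (mul_nonneg (amp_pos _ _ 0).le (norm_nonneg _)) (hM 0 0)
  have hl := add_nonneg (kh_nonneg l) (kz_nonneg l)
  have hom : ∀ k, Tendsto (fun n => usym l k (a n k)) atTop (𝓝 (usym l k (b k))) := fun k => by
    have h1 : ∀ j, Tendsto (fun n => hdot j (a n k)) atTop (𝓝 (hdot j (b k))) := fun j =>
      ((contDiff_hdot contDiff_id j).continuous.tendsto (b k)).comp (ha k)
    exact (h1 l).add (tendsto_const_nhds.mul ((h1 k).neg.div_const _))
  refine tendsto_tsum_of_dominated_convergence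
    (((summable_mode_exp_mul hτ hη).mul_left ((kh l + kz l) * M)).mul_right M)
    (fun k => (tendsto_const_nhds.mul (hom k)).smul (ha (l - k))) (.of_forall fun n k => ?_)
  rw [norm_smul, norm_mul, norm_I, one_mul]
  have h1 := kh_nonneg k
  have h2 : ‖a n (l - k)‖ ≤ M := (le_mul_of_one_le_left (norm_nonneg _)
    (one_le_amp hτ.le hη.le _)).trans (hM n _)
  calc _ ≤ (kh l + kz l) * ((1 + kh k) * (M * exp (-(τ * kh k + η * kz k)))) * M := by
        gcongr
        exact (norm_usym_le' l k _).trans (by gcongr; exact hb n k)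
    _ = _ := by ring

lemma tendsto_rhs {a : ℕ → Coef} {b} (ν Ω) (ha : Tendsto (fun n => a n l) atTop (𝓝 (b l)))
    (hc : Tendsto (fun n => conv (a n) (a n) l) atTop (𝓝 (conv b b l))) :
    Tendsto (fun n => rhs ν Ω (a n) l) atTop (𝓝 (rhs ν Ω b l)) := by
  have hp : Continuous cperp := by
    have h : ∀ i : Fin 2, Continuous fun x : CVel => x i := fun i => (proj (𝕜 := ℂ) i).continuous
    exact (PiLp.continuous_toLp 2 _).comp (continuous_pi fun i => by
      fin_cases i
      · exact (h 1).neg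
      · exact h 0)
  have hl : Continuous (leray l) := by
    unfold leray
    split_ifs
    · exact continuous_id.sub ((((contDiff_hdot contDiff_id l).continuous).div_const _).smul continuous_const)
    · exact continuous_id
  exact ((hl.tendsto _).comp (hc.add (((hp.tendsto _).comp ha).const_smul _))).neg.sub (ha.const_smul _)

lemma continuousOn_weight (hτ : ContinuousOn ρ (Icc 0 T)) (k) :
    ContinuousOn (fun t => weight r 0 (ρ t) (ν / 2 * t) k) (Icc 0 T) :=
  (contDiff_weight r ν k).continuous.comp_continuousOn (hτ.prodMk continuousOn_id)

lemma aemeasurable_loss (hτ : AEMeasurable ρ vol[T]) (ha : ∀ k, ContinuousOn (fun t => a t k) (Icc 0 T)) :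
    AEMeasurable (fun t => loss r ν (ρ t) (ν / 2 * t) N[a t]) vol[T] := by
  have hw := fun k => (contDiff_weight r ν k).continuous.measurable.comp_aemeasurable
    (hτ.prodMk aemeasurable_id)
  have h1 := aemeasurable_wsum_of_aemeasurable hw ha
  have h2 := aemeasurable_wsum_of_aemeasurable (fun k => (hw k).const_mul (kz k ^ 2)) ha
  exact ((h1.pow_const _).add (h2.pow_const _)).add (h1.div_const _)

lemma enorm_indicator (Q : Set Mode) (a : Coef) : Q.indicator N[a] = fun k => ‖Q.indicator a k‖ₑ := by
  ext k; rw [enorm_indicator_eq_indicator_enorm]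

lemma continuousOn_indicator {s : Set ℝ} (Q : Set Mode) (ha : ∀ k, ContinuousOn (fun t => a t k) s) (k) :
    ContinuousOn (fun t => Q.indicator (a t) k) s := by
  by_cases hk : k ∈ Q
  · simpa only [indicator_of_mem hk] using ha k
  · simp only [indicator_of_notMem hk]; exact continuousOn_const

lemma tendsto_loss_indicator (hν : 0 < ν) {σ : ℕ → ℝ} {a : ℕ → Coef}
    {b : Coef} {Q : Set Mode} (hQ : Q.Finite) (hσ : Tendsto σ atTop (𝓝 τ))
    (ha : ∀ k, Tendsto (fun n => a n k) atTop (𝓝 (b k))) :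
    Tendsto (fun n => loss r ν (σ n) η (Q.indicator N[a n])) atTop (𝓝 (loss r ν τ η (Q.indicator N[b]))) := by
  have hw : ∀ k, Tendsto (fun n => weight r 0 (σ n) η k) atTop (𝓝 (weight r 0 τ η k)) := fun k => by
    have : Continuous fun x => weight r 0 x η k := by unfold weight; fun_prop
    exact (this.tendsto τ).comp hσ
  have hsum : ∀ {w : ℕ → Mode → ℝ} {v : Mode → ℝ}, (∀ k, Tendsto (fun n => w n k) atTop (𝓝 (v k))) →
    Tendsto (fun n => wsum (w n) (Q.indicator N[a n])) atTop (𝓝 (wsum v (Q.indicator N[b]))) := by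
    intro w v h
    have e : ∀ (w : Mode → ℝ) (a : Coef), wsum w (Q.indicator N[a]) =
      ∑ k ∈ hQ.toFinset, ofReal (w k) * ‖a k‖ₑ ^ 2 := fun w a => by
      unfold wsum
      rw [tsum_eq_sum (s := hQ.toFinset) fun k hk => by rw [indicator_of_notMem (by simpa using hk)]; simp]
      exact sum_congr rfl fun k hk => by rw [indicator_of_mem (by simpa using hk)]
    simp only [e]
    exact tendsto_finsetSum _ fun k _ => ENNReal.Tendsto.mul (tendsto_ofReal (h k))
      (Or.inr (by finiteness)) (ENNReal.Tendsto.pow (ha k).enorm) (Or.inr ofReal_ne_top)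
  have hE : Tendsto (fun n => energyE r (σ n) η (Q.indicator N[a n])) atTop
    (𝓝 (energyE r τ η (Q.indicator N[b]))) := hsum hw
  have hF : Tendsto (fun n => energyF r (σ n) η (Q.indicator N[a n])) atTop
    (𝓝 (energyF r τ η (Q.indicator N[b]))) := hsum fun k => (hw k).const_mul _
  exact ((hE.ennrpow_const _).add (hF.ennrpow_const _)).add
    (ENNReal.Tendsto.div_const hE (Or.inr (by simpa using hν)))

lemma loss_mono {A B} (h : ∀ k, A k ≤ B k) : loss r ν τ η A ≤ loss r ν τ η B := by
  have hw : ∀ w, wsum w A ≤ wsum w B := fun w => tsum_le_tsum fun k => by gcongr; exact h k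
  unfold loss energyE energyF
  gcongr <;> exact hw _

lemma ennreal_liminf_add_le (u v : ℕ → ℝ≥0∞) :
    liminf u atTop + liminf v atTop ≤ liminf (fun n => u n + v n) atTop := by
  simp only [liminf_eq_iSup_iInf_of_nat]
  rw [ENNReal.iSup_add_iSup_of_monotone (fun m n h => biInf_mono fun i hi => le_trans h hi)
    (fun m n h => biInf_mono fun i hi => le_trans h hi)]
  exact iSup_mono fun n => le_iInf₂ fun i hi => add_le_add (iInf₂_le i hi) (iInf₂_le i hi)

lemma loss_le_liminf (hν : 0 < ν) {σ : ℕ → ℝ} {a : ℕ → Coef} {b : Coef}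
    (hσ : Tendsto σ atTop (𝓝 τ)) (ha : ∀ k, Tendsto (fun n => a n k) atTop (𝓝 (b k))) :
    loss r ν τ η N[b] ≤ liminf (fun n => loss r ν (σ n) η N[a n]) atTop := by
  have hw : ∀ k, Tendsto (fun n => weight r 0 (σ n) η k) atTop (𝓝 (weight r 0 τ η k)) := fun k => by
    have : Continuous fun x => weight r 0 x η k := by unfold weight; fun_prop
    exact (this.tendsto τ).comp hσ
  have hE : energyE r τ η N[b] ≤ liminf (fun n => energyE r (σ n) η N[a n]) atTop := wsum_le_liminf hw ha
  have hF : energyF r τ η N[b] ≤ liminf (fun n => energyF r (σ n) η N[a n]) atTop :=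
    wsum_le_liminf (fun k => (hw k).const_mul _) ha
  have hroot : ∀ u : ℕ → ℝ≥0∞, liminf u atTop ^ ½ = liminf (fun n => u n ^ ½) atTop :=
    fun u => (ENNReal.orderIsoRpow (1 / 2) num!).liminf_apply (u := u)
  have hdiv : ∀ u : ℕ → ℝ≥0∞, liminf u atTop / ofReal ν ≤ liminf (fun n => u n / ofReal ν) atTop := fun u => by
    simp only [div_eq_mul_inv, mul_comm _ (ofReal ν)⁻¹]
    rw [ENNReal.liminf_const_mul_of_ne_top (by simpa using hν)]
  unfold loss
  refine le_trans ?_ (ennreal_liminf_add_le _ _)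
  refine add_le_add ((add_le_add ?_ ?_).trans (ennreal_liminf_add_le _ _))
    ((div_le_div_right hE _).trans (hdiv _))
  · rw [← hroot]; exact rpow_le_rpow hE num!
  · rw [← hroot]; exact rpow_le_rpow hF num!


lemma IsApproximation.energy_le (h : IsApproximation C r ν Ω T τ₀ M K a₀ S a ρ)
    (h₀ : energyE r τ₀ 0 N[a₀] ≤ ofReal (M ^ 2)) (ht : t ∈ Icc 0 T) :
    energyE r (ρ t) (ν / 2 * t) N[a t] ≤ ofReal (M ^ 2) := by
  have := h.energy _ isSlow_one t ht
  simp only [one_mul] at this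
  exact this.trans h₀

lemma IsApproximation.half_le (h : IsApproximation C r ν Ω T τ₀ M K a₀ S a ρ)
    (hC : 0 ≤ C) (hν : 0 < ν) (hM : 0 ≤ M) (hmax : maxLoss C ν M T ≤ τ₀ / 2) (ht : t ∈ Icc 0 T) :
    τ₀ / 2 ≤ ρ t := by linarith [h.lower t ht, maxLoss_mono hC hν hM ht.2]

lemma IsApproximation.lintegral_loss_le (h : IsApproximation C r ν Ω T τ₀ M K a₀ S a ρ)
    (hν : 0 < ν) (hM : 0 ≤ M) (h₀ : energyE r τ₀ 0 N[a₀] ≤ ofReal (M ^ 2))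
    {s} (hs : 0 ≤ s) (hst : s ≤ t) (ht : t ≤ T) :
    ∫⁻ u in Ioo s t, loss r ν (ρ u) (ν / 2 * u) N[a u] ≤ ofReal (maxLoss 1 ν M (t - s)) := by
  have hsub : Ioo s t ⊆ Ioo 0 T := Ioo_subset_Ioo hs ht
  have hF : AEMeasurable (fun u => energyF r (ρ u) (ν / 2 * u) N[a u])
    vol[T] := aemeasurable_wsum (fun k => continuousOn_const (c := kz k ^ 2) |>.mul
    (continuousOn_weight h.radius_continuousOn k)) h.continuousOn
  have h1 := PrimEq.lintegral_loss_le hν hM hst (x := fun _ => 1)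
    (E := fun u => energyE r (ρ u) (ν / 2 * u) N[a u])
    (F := fun u => energyF r (ρ u) (ν / 2 * u) N[a u]) (fun _ => le_rfl)
    (fun u hu => h.energy_le h₀ (Ioo_subset_Icc_self (hsub hu)))
    (by simpa only [one_mul] using hF.mono_measure (restrict_mono hsub le_rfl)) ?_
  · simp only [one_mul] at h1
    exact h1
  · have h2 := h.dissipation _ isSlow_one
    simp only [one_mul] at h2 ⊢
    have h3 := h2.trans h₀
    refine (lintegral_mono_set hsub).trans ?_
    have h4 : ofReal (ν / 2) ≠ 0 := by simpa using hν
    rw [mul_comm, ← ENNReal.le_div_iff_mul_le (Or.inl h4) (Or.inl ofReal_ne_top),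
      ← ofReal_div_of_pos pos!] at h3
    refine h3.trans_eq ?_
    congr 1; field_simp

lemma IsApproximation.abs_radius_sub_le (h : IsApproximation C r ν Ω T τ₀ M K a₀ S a ρ) (hC : 0 ≤ C)
    (hν : 0 < ν) (hM : 0 ≤ M) (h₀ : energyE r τ₀ 0 N[a₀] ≤ ofReal (M ^ 2))
    {s} (hs : 0 ≤ s) (hst : s ≤ t) (ht : t ≤ T) : |ρ s - ρ t| ≤ maxLoss C ν M (t - s) := by
  have h1 := h.lintegral_loss_le hν hM h₀ hs hst ht
  have h2 := h.lintegral_loss_le hν hM h₀ le_rfl hs (hst.trans ht)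
  rw [h.radius_eq s ⟨hs, hst.trans ht⟩, h.radius_eq t ⟨hs.trans hst, ht⟩]
  set L := fun u => loss r ν (ρ u) (ν / 2 * u) N[a u]
  have h0 : 0 ≤ maxLoss 1 ν M (t - s) := by have := sub_nonneg.2 hst; unfold maxLoss; positivity
  have h3 : ∫⁻ u in Ioo 0 t, L u ≤ (∫⁻ u in Ioo 0 s, L u) + ∫⁻ u in Ioo s t, L u := by
    rcases eq_or_lt_of_le hst with rfl | hlt
    · simp
    · rcases eq_or_lt_of_le hs with rfl | hs'
      · simp
      · rw [← Ioc_union_Ioo_eq_Ioo hs'.le hlt, restrict_Ioo_eq_restrict_Ioc (a := 0)]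
        exact lintegral_union_le _ _ _
  have h4 : ∫⁻ u in Ioo 0 s, L u ≠ ⊤ := (h2.trans_lt ofReal_lt_top).ne
  have h5 : ∫⁻ u in Ioo s t, L u ≠ ⊤ := (h1.trans_lt ofReal_lt_top).ne
  have h6 : (∫⁻ u in Ioo 0 s, L u).toReal ≤ (∫⁻ u in Ioo 0 t, L u).toReal :=
    toReal_mono (h3.trans_lt (add_lt_top.2 ⟨h4.lt_top, h5.lt_top⟩)).ne
      (lintegral_mono_set (Ioo_subset_Ioo_right hst))
  have h7 : (∫⁻ u in Ioo 0 t, L u).toReal ≤ (∫⁻ u in Ioo 0 s, L u).toReal + maxLoss 1 ν M (t - s) := by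
    rw [← toReal_ofReal h0, ← ENNReal.toReal_add h4 ofReal_ne_top]
    exact toReal_mono (by finiteness) (h3.trans (add_le_add_right h1 _))
  rw [maxLoss_eq, abs_le]
  constructor
  · nlinarith [mul_nonneg hC h0, mul_le_mul_of_nonneg_left h6 hC]
  · nlinarith [mul_le_mul_of_nonneg_left h7 hC]

lemma tendsto_maxLoss (C ν M) : Tendsto (maxLoss C ν M) (𝓝 0) (𝓝 0) := by
  have h : Continuous (maxLoss C ν M) := by unfold maxLoss; fun_prop
  have := h.tendsto 0
  rwa [show maxLoss C ν M 0 = 0 by simp [maxLoss]] at this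

/-- Convergence of a sequence of approximations. -/
structure IsLimit (C r ν Ω T τ₀ M K : ℝ) (a₀ : Coef) (S : ℕ → Finset Mode)
    (a : ℕ → ℝ → Coef) (τ : ℕ → ℝ → ℝ) (b : ℝ → Coef) (σ : ℝ → ℝ) : Prop where
  approx : ∀ n, IsApproximation C r ν Ω T τ₀ M K a₀ (S n) (a n) (τ n)
  exhaust : ∀ k, ∀ᶠ n in atTop, k ∈ S n
  mode : ∀ k, ∀ t ∈ Icc 0 T, Tendsto (fun n => a n t k) atTop (𝓝 (b t k))
  radius : ∀ t ∈ Icc 0 T, Tendsto (fun n => τ n t) atTop (𝓝 (σ t))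

lemma exists_limit (hr : 2 < r) : ∃ C₀, 0 < C₀ ∧
    ∀ C ν Ω T τ₀ M, C₀ ≤ C → 0 < ν → 0 ≤ T → 0 < τ₀ → 0 ≤ M → maxLoss C ν M T ≤ τ₀ / 2 →
    ∀ a₀, IsSymmetric a₀ → IsSolenoidal a₀ → energyE r τ₀ 0 N[a₀] ≤ ofReal (M ^ 2) →
    ∃ K S a τ b σ, IsLimit C r ν Ω T τ₀ M K a₀ S a τ b σ := by
  obtain ⟨C₀, c, hC₀, H⟩ := exists_approximation hr
  refine ⟨C₀, hC₀, fun C ν Ω T τ₀ M hC hν hT hτ₀ hM hmax a₀ hsym hsol h₀ => ?_⟩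
  have hC0 := hC₀.le.trans hC
  set box := fun n => Finset.Icc (-(n : ℤ), -(n : ℤ), -(n : ℤ)) ((n : ℤ), (n : ℤ), (n : ℤ)) with hbox
  have hmem : ∀ n k, k ∈ box n ↔ |k.1| ≤ n ∧ |k.2.1| ≤ n ∧ |k.2.2| ≤ n := fun n k => by
    simp only [hbox, Finset.mem_Icc, Prod.le_def, abs_le]; tauto
  have hS : ∀ n, IsSymmetricSet (box n) := fun n k => by constructor <;> simp [hmem, flip]
  choose a τ h using fun n => H C ν Ω T τ₀ M hC hν hT hτ₀ hM hmax a₀ hsym hsol h₀ (box n) (hS n)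
  have hτlo : ∀ n, ∀ t ∈ Icc 0 T, 0 ≤ τ n t := fun n t ht => by linarith [(h n).half_le hC0 hν hM hmax ht]
  have hτhi : ∀ n, ∀ t ∈ Icc 0 T, τ n t ≤ τ₀ := fun n t ht => by
    rw [(h n).radius_eq t ht]
    linarith [mul_nonneg hC0 (toReal_nonneg (a := ∫⁻ s in Ioo 0 t, loss r ν (τ n s) (ν / 2 * s) N[a n s]))]
  have hη : ∀ t ∈ Icc 0 T, 0 ≤ ν / 2 * t := fun t ht => mul_nonneg pos! ht.1
  have hnorm : ∀ n k, ∀ t ∈ Icc 0 T, ‖a n t k‖ ≤ M := fun n k t ht =>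
    (le_mul_of_one_le_left (norm_nonneg _) (one_le_amp (hτlo n t ht) (hη t ht) k)).trans
      (norm_le_of_energyE_le hM ((h n).energy_le h₀ ht) k)
  set B := fun l => 2 * ((kh l + kz l) * ((2 ^ r) ^ 2 * M ^ 2) + |Ω| * M) + |ν * kz l ^ 2| * M with hB
  have hB0 : ∀ l, 0 ≤ B l := fun l => by
    have := kh_nonneg l; have := kz_nonneg l; positivity
  have hlip : ∀ n k, ∀ s ∈ Icc 0 T, ∀ t ∈ Icc 0 T, ‖a n s k - a n t k‖ ≤ B k * |s - t| := fun n k s hs t ht => by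
    by_cases hk : k ∈ box n
    · have hi : ∀ t ∈ Icc 0 T, IntervalIntegrable (fun s => rhs ν Ω (a n s) k) volume 0 t := fun t ht =>
        ContinuousOn.intervalIntegrable (by
          rw [uIcc_of_le ht.1]; exact ((h n).rhs_continuousOn k).mono (Icc_subset_Icc_right ht.2))
      rw [(h n).eq k hk s hs, (h n).eq k hk t ht, add_sub_add_left_eq_sub,
        integral_interval_sub_left (hi s hs) (hi t ht)]
      refine intervalIntegral.norm_integral_le_of_norm_le_const fun u hu => ?_
      have huT : u ∈ Icc 0 T := by
        have := uIoc_subset_uIcc hu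
        exact (uIcc_subset_Icc ht hs) this
      exact norm_rhs_le lin! hM (hτlo n u huT) (hη u huT) ((h n).energy_le h₀ huT) ν Ω k
    · have : ∀ t ∈ Icc 0 T, a n t k = 0 := fun t ht => (h n).support k hk t ht
      rw [this s hs, this t ht, sub_self, norm_zero]
      exact mul_nonneg (hB0 k) (abs_nonneg _)
  obtain ⟨φ, hφ, g, hg⟩ := exists_subseq_tendsto (X := CVel × ℝ) (fun n k t => (a n t k, τ n t)) hT
    (fun k => ⟨Metric.closedBall 0 M ×ˢ Icc 0 τ₀, (isCompact_closedBall _ _).prod isCompact_Icc,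
      fun n t ht => ⟨by simpa using hnorm n k t ht, hτlo n t ht, hτhi n t ht⟩⟩) (fun k ε hε => by
      obtain ⟨δ, hδ, hd⟩ := Metric.tendsto_nhds_nhds.1 (tendsto_maxLoss C ν M) ε hε
      refine ⟨min δ (ε / (B k + 1)), lt_min hδ (div_pos hε (by linarith [hB0 k])), fun n s hs t ht hst => ?_⟩
      refine max_le ?_ ?_
      · dsimp only
        rw [dist_eq_norm]
        refine (hlip n k s hs t ht).trans ?_
        have h1 : |s - t| ≤ ε / (B k + 1) := hst.le.trans (min_le_right _ _)
        have h2 := hB0 k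
        calc B k * |s - t| ≤ (B k + 1) * (ε / (B k + 1)) := by gcongr; linarith
          _ = ε := by field_simp
      · dsimp only
        have h1 : maxLoss C ν M |s - t| ≤ ε := by
          have := hd (x := |s - t|) (by rw [dist_eq, sub_zero, abs_abs]; exact hst.trans_le (min_le_left _ _))
          rw [dist_eq, sub_zero] at this
          exact (le_abs_self _).trans this.le
        refine le_trans ?_ h1
        rw [dist_eq]
        rcases le_total s t with hle | hle
        · rw [abs_sub_comm s t, abs_of_nonneg (sub_nonneg.2 hle)]
          exact (h n).abs_radius_sub_le hC0 hν hM h₀ hs.1 hle ht.2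
        · rw [abs_of_nonneg (sub_nonneg.2 hle), abs_sub_comm]
          exact (h n).abs_radius_sub_le hC0 hν hM h₀ ht.1 hle hs.2)
  refine ⟨_, fun n => box (φ n), fun n => a (φ n), fun n => τ (φ n), fun t k => (g k t).1,
    fun t => (g 0 t).2, fun n => h (φ n), fun k => ?_, fun k t ht => ?_, fun t ht => ?_⟩
  · refine (eventually_ge_atTop (|k.1| + |k.2.1| + |k.2.2|).toNat).mono fun n hn => ?_
    have h1 := hn.trans hφ.le_apply
    rw [Int.toNat_le] at h1
    have := abs_nonneg k.1; have := abs_nonneg k.2.1; have := abs_nonneg k.2.2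
    exact (hmem _ _).2 ⟨by linarith, by linarith, by linarith⟩
  · exact (continuous_fst.tendsto _).comp (hg k t ht)
  · exact (continuous_snd.tendsto _).comp (hg 0 t ht)


section
variable {S : ℕ → Finset Mode} {a : ℕ → ℝ → Coef} {τ : ℕ → ℝ → ℝ} {b : ℝ → Coef}
local notation "IsLim" => IsLimit C r ν Ω T τ₀ M K a₀ S a τ b σ

lemma IsLimit.lower (h : IsLim) (ht : t ∈ Icc 0 T) : τ₀ - maxLoss C ν M t ≤ σ t :=
  ge_of_tendsto' (h.radius t ht) fun n => (h.approx n).lower t ht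

lemma IsLimit.tendsto_weight (h : IsLim) (ht : t ∈ Icc 0 T) (η) (k) :
    Tendsto (fun n => weight r 0 (τ n t) η k) atTop (𝓝 (weight r 0 (σ t) η k)) := by
  have : Continuous fun x => weight r 0 x η k := by unfold weight; fun_prop
  exact (this.tendsto _).comp (h.radius t ht)

lemma IsLimit.energy_le (h : IsLim) (ht : t ∈ Icc 0 T) :
    energyE r (σ t) (ν / 2 * t) N[b t] ≤ energyE r τ₀ 0 N[a₀] := by
  refine (wsum_le_liminf (h.tendsto_weight ht _) fun k => h.mode k t ht).trans ?_
  refine (liminf_le_liminf (.of_forall fun n => ?_)).trans (liminf_const _).le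
  have := (h.approx n).energy _ isSlow_one t ht
  simp only [one_mul] at this
  exact this

lemma IsLimit.lintegral_energyF_lt_top (h : IsLim) (hν : 0 < ν) (h₀ : energyE r τ₀ 0 N[a₀] ≤ ofReal (M ^ 2)) :
    ∫⁻ t in Ioo 0 T, energyF r (σ t) (ν / 2 * t) N[b t] < ⊤ := by
  have hν' : ofReal (ν / 2) ≠ 0 := by simpa using hν
  calc ∫⁻ t in Ioo 0 T, energyF r (σ t) (ν / 2 * t) N[b t]
    ≤ ∫⁻ t in Ioo 0 T, liminf (fun n => energyF r (τ n t) (ν / 2 * t) N[a n t]) atTop :=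
      setLIntegral_mono' measurableSet_Ioo fun t ht => wsum_le_liminf
        (fun k => (h.tendsto_weight (Ioo_subset_Icc_self ht) _ k).const_mul _)
        fun k => h.mode k t (Ioo_subset_Icc_self ht)
    _ ≤ liminf (fun n => ∫⁻ t in Ioo 0 T, energyF r (τ n t) (ν / 2 * t) N[a n t]) atTop :=
      lintegral_liminf_le' fun n => aemeasurable_wsum (fun k => continuousOn_const (c := kz k ^ 2) |>.mul
        (continuousOn_weight (h.approx n).radius_continuousOn k)) (h.approx n).continuousOn
    _ ≤ ofReal (M ^ 2) / ofReal (ν / 2) := by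
      refine (liminf_le_liminf (.of_forall fun n => ?_)).trans (liminf_const _).le
      have := (h.approx n).dissipation _ isSlow_one
      simp only [one_mul] at this
      rw [ENNReal.le_div_iff_mul_le (Or.inl hν') (Or.inl ofReal_ne_top), mul_comm]
      exact this.trans h₀
    _ < ⊤ := div_lt_top ofReal_ne_top hν'

lemma IsLimit.isModeSolution (h : IsLim) (hr : 1 ≤ r) (hC : 0 ≤ C) (hν : 0 < ν) (hM : 0 ≤ M)
    (hT : 0 ≤ T) (hτ₀ : 0 < τ₀) (h₀ : energyE r τ₀ 0 N[a₀] ≤ ofReal (M ^ 2))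
    (hmax : maxLoss C ν M T ≤ τ₀ / 2) : IsModeSolution ν Ω T b := by
  have hhalf : ∀ n, ∀ t ∈ Icc 0 T, τ₀ / 2 ≤ τ n t := fun n t ht => (h.approx n).half_le hC hν hM hmax ht
  have hη : ∀ t ∈ Icc 0 T, 0 ≤ ν / 2 * t := fun t ht => mul_nonneg pos! ht.1
  set B := fun l => 2 * ((kh l + kz l) * ((2 ^ r) ^ 2 * M ^ 2) + |Ω| * M) + |ν * kz l ^ 2| * M with hB
  have hbd : ∀ n k, ∀ t ∈ Icc 0 T, ‖rhs ν Ω (a n t) k‖ ≤ B k := fun n k t ht =>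
    norm_rhs_le hr hM (by linarith [hhalf n t ht]) (hη t ht) ((h.approx n).energy_le h₀ ht) ν Ω k
  have hlim : ∀ k, ∀ t ∈ Ioc 0 T, Tendsto (fun n => rhs ν Ω (a n t) k) atTop (𝓝 (rhs ν Ω (b t) k)) := fun k t ht => by
    have ht' := Ioc_subset_Icc_self ht
    refine tendsto_rhs ν Ω (h.mode k t ht') (tendsto_conv (half_pos hτ₀)
      (mul_pos (half_pos hν) ht.1) (fun k => h.mode k t ht') (M := M) (fun n k => ?_) k)
    refine le_trans ?_ (norm_le_of_energyE_le hM ((h.approx n).energy_le h₀ ht') k)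
    unfold amp
    have := kh_nonneg k
    gcongr
    exact hhalf n t ht'
  have hmeas : ∀ n k, AEStronglyMeasurable (fun t => rhs ν Ω (a n t) k) (volume.restrict (Ioc 0 T)) :=
    fun n k => (((h.approx n).rhs_continuousOn k).mono Ioc_subset_Icc_self).aestronglyMeasurable
      measurableSet_Ioc
  refine ⟨fun t ht k hk => ?_, fun k => ?_, fun k t ht => ?_⟩
  · have h1 : Tendsto (fun n => hdot k (a n t k)) atTop (𝓝 (hdot k (b t k))) :=
      ((contDiff_hdot contDiff_id k).continuous.tendsto _).comp (h.mode k t ht)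
    exact tendsto_nhds_unique h1 (by
      simp only [fun n => (h.approx n).solenoidal t k hk]; exact tendsto_const_nhds)
  · rw [intervalIntegrable_iff_integrableOn_Ioc_of_le hT]
    refine Integrable.of_bound (C := B k) (aestronglyMeasurable_of_tendsto_ae atTop (hmeas · k)
      ((ae_restrict_iff' measurableSet_Ioc).2 (.of_forall (hlim k)))) ?_
    exact ae_restrict_of_forall_mem measurableSet_Ioc (fun t ht =>
      le_of_tendsto' (hlim k t ht).norm fun n => hbd n k t (Ioc_subset_Icc_self ht))
  · have h1 : Tendsto (fun n => ∫ s in 0..t, rhs ν Ω (a n s) k) atTop (𝓝 (∫ s in 0..t, rhs ν Ω (b s) k)) := by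
      have hsub : uIoc 0 t ⊆ Ioc 0 T := by rw [uIoc_of_le ht.1]; exact Ioc_subset_Ioc_right ht.2
      refine intervalIntegral.tendsto_integral_filter_of_dominated_convergence (fun _ => B k)
        (.of_forall fun n => (hmeas n k).mono_measure (restrict_mono hsub le_rfl))
        (.of_forall fun n => .of_forall fun s hs => hbd n k s
          (Ioc_subset_Icc_self (hsub hs))) intervalIntegrable_const (.of_forall fun s hs => hlim k s (hsub hs))
    have h0T : 0 ∈ Icc 0 T := ⟨le_rfl, hT⟩
    refine tendsto_nhds_unique (h.mode k t ht) (((h.mode k 0 h0T).add h1).congr' ?_)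
    filter_upwards [h.exhaust k] with n hn
    exact ((h.approx n).eq k hn t ht).symm

lemma IsLimit.initial (h : IsLim) (hT : 0 ≤ T) (k) : b 0 k = a₀ k := by
  refine tendsto_nhds_unique (h.mode k 0 ⟨le_rfl, hT⟩) (tendsto_const_nhds.congr' ?_)
  filter_upwards [h.exhaust k] with n hn
  rw [(h.approx n).initial k, if_pos hn]

lemma IsLimit.symmetric (h : IsLim) (ht : t ∈ Icc 0 T) : IsSymmetric (b t) where
  flip k := tendsto_nhds_unique (h.mode (flip k) t ht) (by
    simp only [fun n => ((h.approx n).symmetric t).flip k]; exact h.mode k t ht)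
  herm k i := by
    have hp : Continuous fun x : CVel => x i := (proj (𝕜 := ℂ) i).continuous
    refine tendsto_nhds_unique ((hp.tendsto _).comp (h.mode (-k) t ht)) ?_
    simp only [Function.comp_def, fun n => ((h.approx n).symmetric t).herm k i]
    exact (continuous_conj.tendsto _).comp ((hp.tendsto _).comp (h.mode k t ht))

/-- Uniform smallness of the tails of the approximations away from the initial time. -/
lemma IsLimit.exists_tail (h : IsLim) (hr : 0 ≤ r) (hC : 0 ≤ C) (hν : 0 < ν) (hM : 0 ≤ M)
    (hτ₀ : 0 < τ₀) (h₀ : energyE r τ₀ 0 N[a₀] ≤ ofReal (M ^ 2)) (hmax : maxLoss C ν M T ≤ τ₀ / 2) (hx : 0 < x) :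
    ∃ R Z, 0 < R ∧ 1 ≤ Z ∧ ∀ n, ∫⁻ t in Ioo x T, wsum
      (fun k => (1 + kz k ^ 2) * weight r 0 (τ n t) (ν / 2 * t) k)
      ({k : Mode | kh k ≤ R ∧ kz k ≤ Z}ᶜ.indicator N[a n t]) ≤ ofReal x := by
  have hν' : ofReal (ν / 2) ≠ 0 := by simpa using hν
  have hx2 : 0 < ofReal (x / 2) := by simpa using hx
  have hR : ∀ᶠ R in atTop, (ofReal T + (ofReal (ν / 2))⁻¹) *
      wsum (fun k => min 1 ((1 + kh k) / R) * weight r 0 τ₀ 0 k) N[a₀] < ofReal (x / 2) := by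
    have h1 := ENNReal.Tendsto.const_mul (a := ofReal T + (ofReal (ν / 2))⁻¹)
      (tendsto_wsum_min (fun k => (weight_pos r τ₀ 0 k).le) (h₀.trans_lt ofReal_lt_top))
      (Or.inr (ENNReal.add_ne_top.2 ⟨ofReal_ne_top, ENNReal.inv_ne_top.2 hν'⟩))
    rw [mul_zero] at h1
    exact (tendsto_order.1 h1).2 _ hx2
  obtain ⟨R, hR, hR0⟩ := (hR.and (eventually_gt_atTop 0)).exists
  have hZ : ∀ᶠ Z : ℝ in atTop, ofReal (2 * (2 + R ^ (2 * r)) / Z ^ 2) *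
      (ofReal (1 / x) * ofReal K) < ofReal (x / 2) := by
    have h1 : Tendsto (fun Z => 2 * (2 + R ^ (2 * r)) / Z ^ 2) atTop (𝓝 0) :=
      tendsto_const_nhds.div_atTop (tendsto_pow_atTop num!)
    have h2 := tendsto_ofReal h1
    rw [ofReal_zero] at h2
    have h3 := ENNReal.Tendsto.mul_const (b := ofReal (1 / x) * ofReal K) h2 (Or.inr (by finiteness))
    rw [zero_mul] at h3
    exact (tendsto_order.1 h3).2 _ hx2
  obtain ⟨Z, hZ, hZ1⟩ := (hZ.and (eventually_ge_atTop 1)).exists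
  refine ⟨R, Z, hR0, hZ1, fun n => ?_⟩
  have hA := h.approx n
  have hm := isSlow_min hR0
  have hsub : Ioo x T ⊆ Ioo 0 T := Ioo_subset_Ioo_left hx.le
  have hmeas : ∀ {w : ℝ → Mode → ℝ}, (∀ k, ContinuousOn (fun t => w t k) (Icc 0 T)) →
      AEMeasurable (fun t => wsum (w t) N[a n t]) (volume.restrict (Ioo x T)) := fun hw =>
    (aemeasurable_wsum hw hA.continuousOn).mono_measure (restrict_mono hsub le_rfl)
  have hwc := fun k => continuousOn_weight (r := r) (ν := ν) hA.radius_continuousOn k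
  set δ := wsum (fun k => min 1 ((1 + kh k) / R) * weight r 0 τ₀ 0 k) N[a₀]
  have h1 : ∫⁻ t in Ioo x T, wsum (fun k => min 1 ((1 + kh k) / R) * weight r 0 (τ n t) (ν / 2 * t) k)
      N[a n t] ≤ ofReal T * δ := by
    calc _ ≤ ∫⁻ _ in Ioo x T, δ := setLIntegral_mono' measurableSet_Ioo fun t ht =>
          hA.energy _ hm t (Ioo_subset_Icc_self (hsub ht))
      _ = ofReal (T - x) * δ := by rw [setLIntegral_const, volume_Ioo, mul_comm]
      _ ≤ _ := by gcongr; linarith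
  have h2 : ∫⁻ t in Ioo x T, wsum (fun k => min 1 ((1 + kh k) / R) * (kz k ^ 2 *
      weight r 0 (τ n t) (ν / 2 * t) k)) N[a n t] ≤ (ofReal (ν / 2))⁻¹ * δ := by
    refine (lintegral_mono_set hsub).trans ?_
    rw [mul_comm, ← div_eq_mul_inv, ENNReal.le_div_iff_mul_le (Or.inl hν') (Or.inl ofReal_ne_top), mul_comm]
    exact hA.dissipation _ hm
  have h3 : ∫⁻ t in Ioo x T, wsum (fun k => kz k ^ 4 * amp (τ n t) (ν / 2 * t) k ^ 2)
      N[a n t] ≤ ofReal (1 / x) * ofReal K := by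
    calc _ ≤ ∫⁻ t in Ioo x T, ofReal (1 / x) * (ofReal t *
          wsum (fun k => kz k ^ 4 * amp (τ n t) (ν / 2 * t) k ^ 2) N[a n t]) := by
          refine setLIntegral_mono' measurableSet_Ioo fun t ht => ?_
          rw [← mul_assoc, ← ofReal_mul pos!]
          refine le_mul_of_one_le_left' (ENNReal.one_le_ofReal.2 ?_)
          rw [div_mul_eq_mul_div, one_mul, one_le_div hx]
          exact ht.1.le
      _ ≤ _ := by
          rw [lintegral_const_mul' _ _ ofReal_ne_top]
          gcongr
          exact (lintegral_mono_set hsub).trans hA.smoothing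
  calc _ ≤ ∫⁻ t in Ioo x T, (wsum (fun k => min 1 ((1 + kh k) / R) * weight r 0 (τ n t) (ν / 2 * t) k)
        N[a n t] + wsum (fun k => min 1 ((1 + kh k) / R) * (kz k ^ 2 * weight r 0 (τ n t) (ν / 2 * t) k))
        N[a n t] + ofReal (2 * (2 + R ^ (2 * r)) / Z ^ 2) *
        wsum (fun k => kz k ^ 4 * amp (τ n t) (ν / 2 * t) k ^ 2) N[a n t]) := by
        refine setLIntegral_mono' measurableSet_Ioo fun t ht => ?_
        have ht' := Ioo_subset_Icc_self (hsub ht)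
        exact wsum_tail_le hr hR0 hZ1 (by linarith [hA.half_le hC hν hM hmax ht']) (mul_nonneg pos! ht'.1) _
    _ ≤ ofReal T * δ + (ofReal (ν / 2))⁻¹ * δ +
        ofReal (2 * (2 + R ^ (2 * r)) / Z ^ 2) * (ofReal (1 / x) * ofReal K) := by
        have m1 := hmeas fun k => continuousOn_const (c := min 1 ((1 + kh k) / R)) |>.mul (hwc k)
        have m2 := hmeas fun k => continuousOn_const (c := min 1 ((1 + kh k) / R)) |>.mul
          (continuousOn_const (c := kz k ^ 2) |>.mul (hwc k))
        refine (lintegral_add_left' (m1.add m2) _).trans_le (add_le_add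
          ((lintegral_add_left' m1 _).trans_le (add_le_add h1 h2)) ?_)
        rw [lintegral_const_mul' _ _ ofReal_ne_top]
        gcongr
    _ ≤ ofReal (x / 2) + ofReal (x / 2) := by
        rw [← add_mul]
        exact add_le_add hR.le hZ.le
    _ = ofReal x := by rw [← ofReal_add pos! pos!, add_halves]

/-- Convergence of the accumulated loss of radius. -/
lemma IsLimit.tendsto_lintegral_loss (h : IsLim) (hr : 0 ≤ r) (hC : 0 ≤ C) (hν : 0 < ν) (hM : 0 ≤ M)
    (hτ₀ : 0 < τ₀) (h₀ : energyE r τ₀ 0 N[a₀] ≤ ofReal (M ^ 2))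
    (hmax : maxLoss C ν M T ≤ τ₀ / 2) (ht : t ∈ Icc 0 T) :
    Tendsto (fun n => ∫⁻ s in Ioo 0 t, loss r ν (τ n s) (ν / 2 * s) N[a n s]) atTop
      (𝓝 (∫⁻ s in Ioo 0 t, loss r ν (σ s) (ν / 2 * s) N[b s])) := by
  rcases eq_or_lt_of_le ht.1 with rfl | ht0
  · simp
  have hsub : Ioo 0 t ⊆ Ioo 0 T := Ioo_subset_Ioo_right ht.2
  have hν' : ofReal ν ≠ 0 := by simpa using hν
  set I := ∫⁻ s in Ioo 0 t, loss r ν (σ s) (ν / 2 * s) N[b s] with hI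
  refine tendsto_of_le_liminf_of_limsup_le ?_ ?_
  · calc I ≤ ∫⁻ s in Ioo 0 t, liminf (fun n => loss r ν (τ n s) (ν / 2 * s) N[a n s]) atTop :=
      setLIntegral_mono' measurableSet_Ioo fun s hs =>
        loss_le_liminf hν (h.radius s (Ioo_subset_Icc_self (hsub hs)))
          fun k => h.mode k s (Ioo_subset_Icc_self (hsub hs))
      _ ≤ _ := lintegral_liminf_le' fun n => (aemeasurable_loss ((h.approx n).radius_continuousOn.mono
        Ioo_subset_Icc_self |>.aemeasurable measurableSet_Ioo)
        (h.approx n).continuousOn).mono_measure (restrict_mono hsub le_rfl)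
  set g := fun x => ofReal (maxLoss 1 ν M x) + (2 * (ofReal T ^ ½ * ofReal x ^ ½) + ofReal x / ofReal ν) with hg
  have hglim : Tendsto g (𝓝[>] 0) (𝓝 0) := by
    have hx : Tendsto (fun x => ofReal x) (𝓝 0) (𝓝 0) := by
      simpa using tendsto_ofReal (tendsto_id (α := ℝ) (x := 𝓝 0))
    have h1 : Tendsto (fun x => ofReal (maxLoss 1 ν M x)) (𝓝 0) (𝓝 0) := by
      simpa using tendsto_ofReal (tendsto_maxLoss 1 ν M)
    have h2 : Tendsto (fun x => ofReal x ^ ½) (𝓝 0) (𝓝 0) := by simpa using hx.ennrpow_const (1 / 2)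
    have h3 : Tendsto (fun x => ofReal x / ofReal ν) (𝓝 0) (𝓝 0) := by
      simpa using ENNReal.Tendsto.div_const hx (Or.inr hν')
    have h4 := ENNReal.Tendsto.const_mul (a := 2) (ENNReal.Tendsto.const_mul
      (a := ofReal T ^ ½) h2 (Or.inr (by finiteness))) (Or.inr (by finiteness))
    have := h1.add (h4.add h3)
    simp only [mul_zero, add_zero] at this
    exact this.mono_left nhdsWithin_le_nhds
  have key : ∀ x ∈ Ioo 0 t, limsup (fun n => ∫⁻ s in Ioo 0 t, loss r ν (τ n s) (ν / 2 * s)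
    N[a n s]) atTop ≤ g x + I := fun x hx => by
    obtain ⟨R, Z, hR, hZ, htail⟩ := h.exists_tail hr hC hν hM hτ₀ h₀ hmax hx.1
    set Q := {k : Mode | kh k ≤ R ∧ kz k ≤ Z} with hQ
    have hsub2 : Ioo x t ⊆ Ioo 0 T := Ioo_subset_Ioo hx.1.le ht.2
    set J := fun n => ∫⁻ s in Ioo x t, loss r ν (τ n s) (ν / 2 * s) (Q.indicator N[a n s]) with hJ
    have hJlim : Tendsto J atTop (𝓝 (∫⁻ s in Ioo x t, loss r ν (σ s) (ν / 2 * s) (Q.indicator N[b s]))) := by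
      refine tendsto_lintegral_of_dominated_convergence' (fun _ => ofReal (M ^ 2) ^ ½ +
        (ofReal (Z ^ 2) * ofReal (M ^ 2)) ^ ½ + ofReal (M ^ 2) / ofReal ν) (fun n => ?_) (fun n => ?_) ?_ ?_
      · simp only [enorm_indicator]
        exact (aemeasurable_loss ((h.approx n).radius_continuousOn.mono
          Ioo_subset_Icc_self |>.aemeasurable measurableSet_Ioo) (continuousOn_indicator Q
          (h.approx n).continuousOn)).mono_measure (restrict_mono hsub2 le_rfl)
      · refine ae_restrict_of_forall_mem measurableSet_Ioo (fun s hs => ?_)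
        have hE := (h.approx n).energy_le h₀ (Ioo_subset_Icc_self (hsub2 hs))
        have hQE : energyE r (τ n s) (ν / 2 * s) (Q.indicator N[a n s]) ≤ ofReal (M ^ 2) := le_trans (by
          unfold energyE
          rw [wsum_indicator_add _ Q N[a n s]]
          exact le_self_add) hE
        have hQF : energyF r (τ n s) (ν / 2 * s) (Q.indicator N[a n s]) ≤ ofReal (Z ^ 2) * ofReal (M ^ 2) := by
          refine le_trans ?_ (mul_le_mul_right hQE _)
          unfold energyF energyE
          rw [← wsum_const_mul (sq_nonneg _)]
          refine tsum_le_tsum fun k => ?_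
          by_cases hk : k ∈ Q
          · have hw := (weight_pos r (τ n s) (ν / 2 * s) k).le
            have hkz := kz_nonneg k
            dsimp only
            gcongr
            exact hk.2
          · simp [hk]
        have hroot : ∀ {y z : ℝ≥0∞}, y ≤ z → y ^ ½ ≤ z ^ ½ := fun h => rpow_le_rpow h num!
        exact add_le_add (add_le_add (hroot hQE) (hroot hQF)) (div_le_div_right hQE _)
      · rw [lintegral_const, restrict_apply_univ, volume_Ioo]
        have : ofReal (M ^ 2) / ofReal ν ≠ ⊤ := (div_lt_top ofReal_ne_top hν').ne
        finiteness
      · refine ae_restrict_of_forall_mem measurableSet_Ioo (fun s hs => ?_)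
        exact tendsto_loss_indicator hν (finite_box R Z) (h.radius s (Ioo_subset_Icc_self (hsub2 hs)))
          fun k => h.mode k s (Ioo_subset_Icc_self (hsub2 hs))
    have hle : ∀ n, ∫⁻ s in Ioo 0 t, loss r ν (τ n s) (ν / 2 * s) N[a n s] ≤ g x + J n := fun n => by
      have hA := h.approx n
      have hmT : AEMeasurable (fun s => wsum (fun k => (1 + kz k ^ 2) * weight r 0 (τ n s) (ν / 2 * s) k)
        (Qᶜ.indicator N[a n s])) (volume.restrict (Ioo x T)) := by
        simp only [enorm_indicator]
        exact (aemeasurable_wsum (fun k => continuousOn_const.mul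
          (continuousOn_weight hA.radius_continuousOn k)) (continuousOn_indicator _
          hA.continuousOn)).mono_measure (restrict_mono (Ioo_subset_Ioo_left hx.1.le) le_rfl)
      have hroot := (lintegral_sqrt_le hmT).trans (mul_le_mul' (rpow_le_rpow (show _ ≤ ofReal T by
        rw [restrict_apply_univ, volume_Ioo]; exact ofReal_le_ofReal (by linarith [hx.1]))
        num!) (rpow_le_rpow (htail n) num!))
      have hJm : AEMeasurable (fun s => loss r ν (τ n s) (ν / 2 * s) (Q.indicator N[a n s]))
        (volume.restrict (Ioo x t)) := by
        simp only [enorm_indicator]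
        exact (aemeasurable_loss (hA.radius_continuousOn.mono
          Ioo_subset_Icc_self |>.aemeasurable measurableSet_Ioo) (continuousOn_indicator Q
          hA.continuousOn)).mono_measure (restrict_mono hsub2 le_rfl)
      have hxT : Ioo x t ⊆ Ioo x T := Ioo_subset_Ioo_right ht.2
      have hmT' := hmT.mono_measure (restrict_mono hxT le_rfl)
      rw [← Ioc_union_Ioo_eq_Ioo hx.1.le hx.2]
      refine (lintegral_union_le _ _ _).trans ?_
      rw [← restrict_Ioo_eq_restrict_Ioc, hg, add_assoc, add_comm (2 * _ + _)]
      refine add_le_add ((hA.lintegral_loss_le hν hM h₀ le_rfl hx.1.le (hx.2.le.trans ht.2)).trans_eq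
        (by rw [sub_zero])) ?_
      refine (setLIntegral_mono' measurableSet_Ioo fun s _ => loss_le_indicator r ν _ _ Q _).trans ?_
      refine (lintegral_add_left' hJm _).trans_le (add_le_add le_rfl ?_)
      refine (lintegral_add_left' ((hmT'.pow_const _).const_mul _) _).trans_le (add_le_add ?_ ?_)
      · rw [lintegral_const_mul' _ _ num!]
        gcongr
        exact (lintegral_mono_set hxT).trans hroot
      · simp only [div_eq_mul_inv]
        rw [lintegral_mul_const' _ _ (ENNReal.inv_ne_top.2 hν')]
        gcongr
        exact (lintegral_mono_set hxT).trans (htail n)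
    refine (limsup_le_limsup (.of_forall hle)).trans ?_
    rw [(tendsto_const_nhds.add hJlim).limsup_eq]
    gcongr
    refine (lintegral_mono_set (Ioo_subset_Ioo_left hx.1.le)).trans (lintegral_mono fun s => loss_mono fun k => ?_)
    exact indicator_le_self' (fun _ _ => zero_le) k
  have hlim2 : Tendsto (fun x => g x + I) (𝓝[>] 0) (𝓝 (0 + I)) := hglim.add tendsto_const_nhds
  rw [zero_add] at hlim2
  refine ge_of_tendsto hlim2 ?_
  filter_upwards [Ioo_mem_nhdsGT ht0] with x hx using key x hx

end

/-- Existence of solutions of the mode dynamics. -/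
lemma exists_isModeSolution (hr : 2 < r) : ∃ C₀, 0 < C₀ ∧
    ∀ C ν Ω T τ₀ M : ℝ, C₀ ≤ C → 0 < ν → 0 ≤ T → 0 < τ₀ → 0 ≤ M → maxLoss C ν M T ≤ τ₀ / 2 →
    ∀ a₀ : Coef, IsSymmetric a₀ → IsSolenoidal a₀ → energyE r τ₀ 0 N[a₀] ≤ ofReal (M ^ 2) →
    ∃ (a : ℝ → Coef) (τ : ℝ → ℝ), IsModeSolution ν Ω T a ∧ (∀ k, a 0 k = a₀ k) ∧ (∀ t ∈ Icc 0 T, IsSymmetric (a t)) ∧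
      (∀ t ∈ Icc 0 T, energyE r (τ t) (ν / 2 * t) N[a t] ≤ energyE r τ₀ 0 N[a₀]) ∧
      (∫⁻ t in Ioo 0 T, energyF r (τ t) (ν / 2 * t) N[a t] < ⊤) ∧
      (∫⁻ t in Ioo 0 T, loss r ν (τ t) (ν / 2 * t) N[a t] < ⊤) ∧ (∀ t ∈ Icc 0 T, τ t = τ₀ - C *
        (∫⁻ s in Ioo 0 t, loss r ν (τ s) (ν / 2 * s) N[a s]).toReal) ∧
      ∀ t ∈ Icc 0 T, τ₀ - maxLoss C ν M t ≤ τ t := by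
  obtain ⟨C₀, hC₀, H⟩ := exists_limit hr
  refine ⟨C₀, hC₀, fun C ν Ω T τ₀ M hC hν hT hτ₀ hM hmax a₀ hsym hsol h₀ => ?_⟩
  have hC0 := hC₀.le.trans hC
  obtain ⟨K, S, a, τ, b, σ, h⟩ := H C ν Ω T τ₀ M hC hν hT hτ₀ hM hmax a₀ hsym hsol h₀
  have hlim := fun t (ht : t ∈ Icc 0 T) => h.tendsto_lintegral_loss lin! hC0 hν hM hτ₀ h₀ hmax ht
  have hfin : ∀ t ∈ Icc 0 T, ∫⁻ s in Ioo 0 t, loss r ν (σ s) (ν / 2 * s) N[b s] < ⊤ :=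
    fun t ht => (le_of_tendsto' (hlim t ht) fun n => (h.approx n).lintegral_loss_le hν hM h₀ le_rfl ht.1
      ht.2).trans_lt ofReal_lt_top
  refine ⟨b, σ, h.isModeSolution lin! hC0 hν hM hT hτ₀ h₀ hmax, h.initial hT,
    fun t ht => h.symmetric ht, fun t ht => h.energy_le ht, h.lintegral_energyF_lt_top hν h₀,
    hfin T (right_mem_Icc.2 hT), fun t ht => ?_, fun t ht => h.lower ht⟩
  refine tendsto_nhds_unique (h.radius t ht) ?_
  simp only [fun n => (h.approx n).radius_eq t ht]
  exact tendsto_const_nhds.sub (((ENNReal.tendsto_toReal (hfin t ht).ne).comp (hlim t ht)).const_mul C)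


/-! ### Weak derivatives in time -/

lemma absolutelyContinuous_primitive {g : ℝ → ℂ} {a} (hg : IntervalIntegrable g volume a b) :
    ACOn (fun t => ∫ s in a..t, g s) a b := by
  have hn := hg.norm.absolutelyContinuousOnInterval_intervalIntegral (c := a) left_mem_uIcc
  rw [absolutelyContinuousOnInterval_iff] at hn ⊢
  intro ε hε
  obtain ⟨δ, hδ, h⟩ := hn ε hε
  refine ⟨δ, hδ, fun E hE hlt => lt_of_le_of_lt (sum_le_sum fun i hi => ?_) (h E hE hlt)⟩
  have hm := hE.1 i hi
  have hs : ∀ x ∈ uIcc a b, IntervalIntegrable g volume a x := fun x hx =>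
    hg.mono_set (uIcc_subset_uIcc left_mem_uIcc hx)
  have h1 := hs _ hm.1
  have h2 := hs _ hm.2
  rw [dist_eq_norm, dist_eq_norm, integral_interval_sub_left h1 h2,
    integral_interval_sub_left h1.norm h2.norm, norm_eq_abs]
  exact intervalIntegral.norm_integral_le_abs_integral_norm

/-- Integration by parts against the primitive of an integrable function. -/
lemma integral_primitive_by_parts {χ χ' D g : ℝ → ℂ} (hT : 0 ≤ T)
    (hχ : ∀ t, HasDerivAt χ (χ' t) t) (hχ' : Continuous χ') (hg : IntervalIntegrable g volume 0 T)
    (hD : ∀ t ∈ Icc 0 T, D t = D 0 + ∫ s in (0)..t, g s) :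
    ∫ t in 0..T, (χ' t * D t + χ t * g t) = χ T * D T - χ 0 * D 0 := by
  set P := fun t => D 0 + ∫ s in 0..t, g s with hP
  have hχc : Continuous χ := continuous_iff_continuousAt.2 fun t => (hχ t).continuousAt
  have hac : ACOn P 0 T := (LipschitzWith.const (D 0)).lipschitzOnWith.absolutelyContinuousOnInterval.fun_add
      (absolutelyContinuous_primitive hg)
  have hχac : ACOn χ 0 T := by
    have h1 : ∀ t, χ t = χ 0 + ∫ s in 0..t, χ' s := fun t => by
      rw [intervalIntegral.integral_eq_sub_of_hasDerivAt (fun s _ => hχ s) (hχ'.intervalIntegrable _ _)]; ring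
    rw [funext h1]
    exact (LipschitzWith.const (χ 0)).lipschitzOnWith.absolutelyContinuousOnInterval.fun_add
      (absolutelyContinuous_primitive (hχ'.intervalIntegrable _ _))
  have hi : IntervalIntegrable (fun t => χ' t * P t + χ t * g t) volume 0 T :=
    ((hχ'.continuousOn.mul hac.continuousOn).intervalIntegrable).add (hg.continuousOn_mul hχc.continuousOn)
  have h2 := (hχac.fun_smul hac).fun_sub (absolutelyContinuous_primitive hi)
  obtain ⟨c, hc⟩ := h2.const_of_ae_hasDerivAt_zero (by
    filter_upwards [hg.ae_hasDerivAt_integral, hi.ae_hasDerivAt_integral] with t h3 h4 ht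
    have h5 := ((hχ t).mul ((h3 ht 0 left_mem_uIcc).const_add (D 0))).sub (h4 ht 0 left_mem_uIcc)
    rwa [sub_self] at h5)
  have h0 := hc 0 left_mem_uIcc
  have h1 := hc T right_mem_uIcc
  have hPT : P T = D T := (hD T (right_mem_Icc.2 hT)).symm
  have hP0 : P 0 = D 0 := by simp [hP]
  simp only [smul_eq_mul, integral_same, hPT, hP0] at h0 h1
  have h6 : ∫ t in 0..T, (χ' t * D t + χ t * g t) =
    ∫ t in 0..T, (χ' t * P t + χ t * g t) := integral_congr fun t ht => by
    rw [uIcc_of_le hT] at ht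
    simp only [hP, hD t ht]
  rw [h6]
  linear_combination h0 - h1

lemma integrableOn_continuous_mul {f : ℝ → ℂ} (hf : IntegrableOn f (Ioo 0 T)) {u : ℝ → ℝ}
    (hu : Continuous u) : IntegrableOn (fun t => (u t : ℂ) * f t) (Ioo 0 T) := by
  rw [← integrableOn_Icc_iff_integrableOn_Ioo] at hf ⊢
  exact hf.continuousOn_mul (Complex.continuous_ofReal.comp hu).continuousOn isCompact_Icc

lemma ae_eq_primitive {A g : ℝ → ℂ} {A₀ : ℂ} (hT : 0 < T)
    (hA : IntegrableOn A (Ioo 0 T)) (hg : IntegrableOn g (Ioo 0 T))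
    (h : ∀ χ : ℝ → ℝ, ContDiff ℝ (⊤ : ℕ∞) χ → (∃ T' < T, ∀ t, T' ≤ t → χ t = 0) →
      (∫ t in Ioo 0 T, (((deriv χ t : ℝ) : ℂ) * A t + χ t * g t)) + χ 0 * A₀ = 0) :
    ∀ᵐ t ∂vol[T], A t = A₀ + ∫ s in 0..t, g s := by
  have hgi : IntervalIntegrable g volume 0 T := by rwa [intervalIntegrable_iff_integrableOn_Ioo_of_le hT.le]
  set D := fun t => A₀ + ∫ s in 0..t, g s with hD
  have hDc : ContinuousOn D (Icc 0 T) := by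
    refine continuousOn_const.add ?_
    have := continuousOn_primitive_interval' hgi left_mem_uIcc
    rwa [uIcc_of_le hT.le] at this
  have hDi : IntegrableOn D (Ioo 0 T) := (hDc.integrableOn_compact isCompact_Icc).mono_set Ioo_subset_Icc_self
  have key := isOpen_Ioo.ae_eq_zero_of_integral_contDiff_smul_eq_zero
    (f := fun t => A t - D t) (μ := volume) (hA.sub hDi).locallyIntegrableOn fun θ hθ hc hs => ?_
  · refine (ae_restrict_iff' measurableSet_Ioo).2 ?_
    filter_upwards [key] with t ht ht'
    exact sub_eq_zero.1 (ht ht')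
  -- the primitive of the test function which vanishes near `T`
  have hθi : ∀ a b, IntervalIntegrable θ volume a b := hθ.continuous.intervalIntegrable
  set χ := fun t => -∫ s in t..T, θ s with hχ
  have hd : ∀ t, HasDerivAt χ (θ t) t := fun t => by
    have := (intervalIntegral.integral_hasDerivAt_left (hθi t T)
      hθ.continuous.stronglyMeasurable.stronglyMeasurableAtFilter hθ.continuous.continuousAt).neg
    rwa [neg_neg] at this
  have hdχ : deriv χ = θ := funext fun t => (hd t).deriv
  have hsm : ContDiff ℝ (⊤ : ℕ∞) χ := contDiff_infty_iff_deriv.2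
    ⟨fun t => (hd t).differentiableAt, by rw [hdχ]; exact hθ⟩
  have hθ0 : ∀ t, t ∉ Ioo 0 T → θ t = 0 := fun t ht => image_eq_zero_of_notMem_tsupport fun h' => ht (hs h')
  have hvan : ∃ T' < T, ∀ t, T' ≤ t → χ t = 0 := by
    obtain ⟨M, hM1, hM2⟩ : ∃ M < T, ∀ t ∈ tsupport θ, t ≤ M := by
      rcases (tsupport θ).eq_empty_or_nonempty with he | hne
      · exact ⟨0, hT, by simp [he]⟩
      · obtain ⟨M, hM, hM'⟩ := (show IsCompact (tsupport θ) from hc).exists_isGreatest hne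
        exact ⟨M, (hs hM).2, fun t ht => hM' ht⟩
    refine ⟨(M + T) / 2, by linarith, fun t ht => ?_⟩
    rw [hχ]
    dsimp only
    rw [neg_eq_zero]
    refine intervalIntegral.integral_zero_ae (.of_forall fun s hs' => ?_)
    refine image_eq_zero_of_notMem_tsupport fun h' => ?_
    have h1 := hM2 s h'
    have h2 := (hs h').2
    rcases le_total t T with h3 | h3
    · rw [uIoc_of_le h3] at hs'; linarith [hs'.1]
    · rw [uIoc_of_ge h3] at hs'; linarith [hs'.1]
  have h1 := h χ hsm hvan
  rw [hdχ] at h1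
  have h2 := integral_primitive_by_parts (χ := fun t => (χ t : ℂ)) (D := D) hT.le
    (fun t => (hd t).ofReal_comp) (by have := hθ.continuous; fun_prop) hgi fun t _ => by simp [hD]
  have hχT : χ T = 0 := by simp [hχ]
  rw [integral_of_le hT.le, integral_Ioc_eq_integral_Ioo] at h2
  have e1 : ∫ t, θ t • (A t - D t) = ∫ t in Ioo 0 T, θ t • (A t - D t) := by
    rw [← integral_indicator measurableSet_Ioo]
    refine integral_congr_ae (.of_forall fun t => ?_)
    by_cases ht : t ∈ Ioo 0 T
    · simp [ht]
    · simp [ht, hθ0 t ht]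
  have hχc := hsm.continuous
  rw [e1]
  rw [integral_add (integrableOn_continuous_mul hA hθ.continuous) (integrableOn_continuous_mul hg hχc)] at h1
  rw [integral_add (integrableOn_continuous_mul hDi hθ.continuous) (integrableOn_continuous_mul hg hχc)] at h2
  have e2 : ∫ t in Ioo 0 T, θ t • (A t - D t) =
    (∫ t in Ioo 0 T, (θ t : ℂ) * A t) - ∫ t in Ioo 0 T, (θ t : ℂ) * D t := by
    rw [← integral_sub (integrableOn_continuous_mul hA hθ.continuous) (integrableOn_continuous_mul hDi hθ.continuous)]
    congr 1; ext t; rw [Complex.real_smul, mul_sub]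
  rw [e2]
  have hD0 : D 0 = A₀ := by simp [hD]
  rw [hχT, hD0] at h2
  push_cast at h2
  linear_combination h1 - h2

/-! ### Oscillating test functions -/

/-- The real test function with the given complex amplitude. -/
def waveTest (c : ℂ) (χ : ℝ → ℝ) (l : Mode) (p : ℝ × Pt) : ℝ := (c * χ p.1 * wave l p.2).re

lemma fderiv_waveTest (c) (hχ : ContDiff ℝ (⊤ : ℕ∞) χ) (l) (p v : ℝ × Pt) :
    fderiv ℝ (waveTest c χ l) p v = waveTest (c * v.1) (deriv χ) l p +
      waveTest (c * (I * phase l v.2)) χ l p := by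
  have h1 : HasFDerivAt (fun p => (χ p.1 : ℂ))
    (ofRealCLM.comp ((deriv χ p.1) • ContinuousLinearMap.fst ℝ ℝ Pt)) p := by
    have h := ((hχ.differentiable (by simp)).differentiableAt (x := p.1)).hasDerivAt
    exact ofRealCLM.hasFDerivAt.comp p (h.comp_hasFDerivAt p (ContinuousLinearMap.fst ℝ ℝ Pt).hasFDerivAt)
  let L : Pt →ₗ[ℝ] ℝ := ⟨⟨phase l, fun a b => by simp [phase]; ring⟩, fun a b => by simp [phase]; ring⟩
  have h2 : HasFDerivAt (fun p => wave l p.2) (wave l p.2 • (I •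
    (ofRealCLM.comp (L.toContinuousLinearMap.comp (ContinuousLinearMap.snd ℝ ℝ Pt))))) p := by
    have h3 : HasFDerivAt (fun p => ((phase l p.2 : ℝ) : ℂ)) (ofRealCLM.comp
      (L.toContinuousLinearMap.comp (ContinuousLinearMap.snd ℝ ℝ Pt))) p :=
      (ofRealCLM.comp (L.toContinuousLinearMap.comp (ContinuousLinearMap.snd ℝ ℝ Pt))).hasFDerivAt
    exact (h3.const_mul I).cexp
  have h4 := reCLM.hasFDerivAt.comp p ((h1.const_mul c).mul h2)
  have h5 : (reCLM ∘ fun p => c * χ p.1 * wave l p.2) = waveTest c χ l := rfl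
  have h6 := h4.fderiv
  change fderiv ℝ (waveTest c χ l) p = _ at h6
  rw [h6]
  have h7 : L v.2 = phase l v.2 := rfl
  simp only [ContinuousLinearMap.comp_apply, add_apply,
    smul_apply, ContinuousLinearMap.coe_fst', ContinuousLinearMap.coe_snd',
    Complex.ofRealCLM_apply, Complex.reCLM_apply, LinearMap.coe_toContinuousLinearMap', h7,
    waveTest, smul_eq_mul, ← add_re]
  congr 1
  push_cast
  ring

lemma contDiff_phase (l) : ContDiff ℝ (⊤ : ℕ∞) (phase l) := by unfold phase; fun_prop

lemma isTest_waveTest (c) (hχ : ContDiff ℝ (⊤ : ℕ∞) χ) (l) : IsTest (waveTest c χ l) where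
  smooth := by
    have h1 : ContDiff ℝ (⊤ : ℕ∞) fun p : ℝ × Pt => ((χ p.1 : ℝ) : ℂ) :=
      ofRealCLM.contDiff.comp (hχ.comp contDiff_fst)
    have h2 : ContDiff ℝ (⊤ : ℕ∞) fun p : ℝ × Pt => ((phase l p.2 : ℝ) : ℂ) :=
      ofRealCLM.contDiff.comp ((contDiff_phase l).comp contDiff_snd)
    exact reCLM.contDiff.comp ((contDiff_const.mul h1).mul (contDiff_const.mul h2).cexp)
  periodic t x y z := by
    have := wave_periodic l x y z
    simp only [waveTest, this.1, this.2.1, this.2.2, and_self]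


/-! ### From weak solutions to Fourier coefficients -/

lemma slabMeasure_eq_prod (T) : μs T = (volume.restrict (Ioo 0 T)).prod μc := by
  rw [cellMeasure, prod_restrict]; rfl

instance (T : ℝ) : IsFiniteMeasure (μs T) := by rw [slabMeasure_eq_prod]; infer_instance

lemma eq_zero_of_re_mul {F : α → ℂ} (hF : Integrable F μ) {s} (h : ∀ z, ∫ p, (z * F p).re ∂μ + (z * s).re = 0) :
    ∫ p, F p ∂μ + s = 0 := by
  have h1 : ∀ z, (z * (∫ p, F p ∂μ + s)).re = 0 := fun z => by
    rw [mul_add, add_re, ← integral_const_mul, ← h z]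
    congr 1
    exact (integral_re (hF.const_mul z)).symm
  have h2 := h1 1
  have h3 := h1 (-I)
  apply Complex.ext <;> simp_all

lemma integral_slab_wave {f : ℝ × Pt → ℂ} (hf : Integrable f (μs T)) (l) :
    IntegrableOn (fun t => ccoeff (fun q => f (t, q)) l) (Ioo 0 T) ∧ ∀ u : ℝ → ℝ, Continuous u →
      Integrable (fun p : ℝ × Pt => u p.1 * wave (-l) p.2 * f p) (μs T) ∧
      ∫ p : ℝ × Pt, u p.1 * wave (-l) p.2 * f p ∂μs T =
        2 * ∫ t in Ioo 0 T, u t * ccoeff (fun q => f (t, q)) l := by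
  have hw : Continuous fun p : ℝ × Pt => wave (-l) p.2 := (continuous_wave _).comp continuous_snd
  have h1 : ∀ u : ℝ → ℝ, Continuous u →
    Integrable (fun p : ℝ × Pt => u p.1 * wave (-l) p.2 * f p) (μs T) := fun u hu => by
    obtain ⟨B, hB⟩ := (isCompact_Icc (a := 0) (b := T)).exists_bound_of_continuousOn hu.continuousOn
    refine hf.bdd_mul (c := B) (by fun_prop) ?_
    have : ∀ᵐ p ∂μs T, p ∈ Ioo 0 T ×ˢ cell := ae_restrict_mem
      (measurableSet_Ioo.prod (measurableSet_Ioo.prod (measurableSet_Ioo.prod measurableSet_Ioo)))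
    filter_upwards [this] with p hp
    rw [norm_mul, norm_wave, mul_one, norm_real]
    exact hB _ (Ioo_subset_Icc_self hp.1)
  have h2 := h1 (fun _ => 1) continuous_const
  rw [slabMeasure_eq_prod] at h1 h2
  refine ⟨?_, fun u hu => ⟨by rw [slabMeasure_eq_prod]; exact h1 u hu, ?_⟩⟩
  · have := h2.integral_prod_left.const_mul (1 / 2 : ℂ)
    simpa only [ccoeff, Complex.ofReal_one, one_mul, IntegrableOn] using this
  · rw [slabMeasure_eq_prod, integral_prod _ (h1 u hu), ← integral_const_mul]
    congr 1; ext t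
    unfold ccoeff
    simp only [mul_assoc]
    rw [integral_const_mul]
    ring

lemma ae_slice_memLp {f : ℝ × Pt → E}
    (hf : MemLp f 2 (μs T)) : ∀ᵐ t ∂vol[T], MemLp (fun q => f (t, q)) 2 μc := by
  rw [slabMeasure_eq_prod] at hf
  filter_upwards [hf.1.prodMk_left, hf.integrable_norm_pow'.prod_right_ae] with t h1 h2
  exact (memLp_two_iff_integrable_sq_norm h1).2 (by simpa using h2)

lemma ae_slice {p : ℝ × Pt → Prop} (h : ∀ᵐ x ∂μs T, p x) : ∀ᵐ t ∂vol[T], ∀ᵐ q ∂μc, p (t, q) := by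
  rw [slabMeasure_eq_prod] at h
  exact Measure.ae_ae_of_ae_prod h

lemma ccoeff_eq_zero_of_odd (hf : ∀ᵐ q ∂μc, f (reflect q) = -f q) (hk : k.2.2 = 0) : ccoeff f k = 0 := by
  have h1 := ccoeff_reflect f k
  have h2 : flip k = k := by
    obtain ⟨a, b, c⟩ := k
    simp_all [flip]
  have h3 : ccoeff (fun q => f (reflect q)) k = -ccoeff f k := by
    unfold ccoeff
    rw [← mul_neg, ← integral_neg]
    congr 1
    refine integral_congr_ae ?_
    filter_upwards [hf] with q hq
    rw [hq, mul_neg]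
  rw [h2, h3] at h1
  linear_combination (-1 / 2 : ℂ) * h1

lemma ccoeff_eq_zero_of_horizontal (f : ℝ × ℝ → ℂ) (hk : k.2.2 ≠ 0) :
    ccoeff (fun q => f (q.1, q.2.1)) k = 0 := by
  have hz : ∀ x y, ∫ z in Ioo (-1 : ℝ) 1, wave (0, 0, -k.2.2) (x, y, z) = 0 := fun x y => by
    have h := integral_wave (k := (0, 0, -k.2.2)) (by simpa using hk)
    have e : ∀ q : Pt, wave (0, 0, -k.2.2) q = wave (0, 0, -k.2.2) (x, y, q.2.2) := fun q => by
      simp [wave, phase]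
    simp only [e] at h
    rw [cellMeasure_eq_prod, integral_fun_snd (fun p : ℝ × ℝ => wave (0, 0, -k.2.2) (x, y, p.2)),
      integral_fun_snd (fun z => wave (0, 0, -k.2.2) (x, y, z))] at h
    simpa using h
  have key : ∀ x, ∫ p : ℝ × ℝ, wave (-k) (x, p.1, p.2) * f (x, p.1)
    ∂((volume.restrict (Ioo 0 1)).prod (volume.restrict (Ioo (-1 : ℝ) 1))) = 0 := fun x => by
    by_cases hi : Integrable (fun p : ℝ × ℝ => wave (-k) (x, p.1, p.2) * f (x, p.1))
      ((volume.restrict (Ioo 0 1)).prod (volume.restrict (Ioo (-1 : ℝ) 1)))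
    · rw [integral_prod _ hi]
      refine integral_eq_zero_of_ae (.of_forall fun y => ?_)
      have e : ∀ z, wave (-k) (x, y, z) * f (x, y) =
        wave (-k.1, -k.2.1, 0) (x, y, 0) * f (x, y) * wave (0, 0, -k.2.2) (x, y, z) := fun z => by
        rw [mul_right_comm]
        congr 1
        simp only [wave, ← Complex.exp_add, phase]
        congr 1
        simp
        ring
      simp only [e]
      rw [integral_const_mul, hz, mul_zero]; rfl
    · exact integral_undef hi
  unfold ccoeff
  rw [cellMeasure_eq_prod]
  by_cases hi : Integrable (fun q => wave (-k) q * f (q.1, q.2.1))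
    ((volume.restrict (Ioo 0 1)).prod ((volume.restrict (Ioo 0 1)).prod (volume.restrict (Ioo (-1 : ℝ) 1))))
  · rw [integral_prod _ hi]
    simp only [key, integral_zero, mul_zero]
  · rw [integral_undef hi, mul_zero]

lemma hasSum_cvel {f : Coef} {v : CVel} (h : ∀ i, HasSum (fun k => f k i) (v i)) : HasSum f v :=
  (EuclideanSpace.equiv (Fin 2) ℂ).hasSum'.1 (Pi.hasSum.2 h)

/-- The transport term in terms of the products of the velocities. -/
lemma conv_fc_apply {f : Pt → Vel} {w : Pt → ℝ} (hf : MemLp f 2 μc) (hw : MemLp w 2 μc)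
    (hom : ∀ k, om k (fc f k) = ccoeff (fun q => (w q)) k) (l) (i) : conv (fc f) (fc f) l i = I *
      (((2 * π * l.1 : ℝ) : ℂ) * ccoeff (fun q => (f q 0 : ℂ) * f q i) l +
        ((2 * π * l.2.1 : ℝ) : ℂ) * ccoeff (fun q => (f q 1 : ℂ) * f q i) l +
        ((π * l.2.2 : ℝ) : ℂ) * ccoeff (fun q => (w q : ℂ) * f q i) l) := by
  have h : HasSum (fun k => (I * usym l k (fc f k)) • fc f (l - k)) (WithLp.toLp 2 fun i =>
    I * (((2 * π * l.1 : ℝ) : ℂ) * ccoeff (fun q => (f q 0 : ℂ) * f q i) l +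
      ((2 * π * l.2.1 : ℝ) : ℂ) * ccoeff (fun q => (f q 1 : ℂ) * f q i) l +
      ((π * l.2.2 : ℝ) : ℂ) * ccoeff (fun q => (w q : ℂ) * f q i) l)) := by
    refine hasSum_cvel fun i => ?_
    have h0 := hasSum_ccoeff_mul (memLp_component hf 0) (memLp_component hf i) l
    have h1 := hasSum_ccoeff_mul (memLp_component hf 1) (memLp_component hf i) l
    have h2 := hasSum_ccoeff_mul (show MemLp (fun q => (w q : ℂ)) 2 μc from hw.ofReal) (memLp_component hf i) l
    refine (((h0.mul_left ((2 * π * l.1 : ℝ) : ℂ)).add (h1.mul_left ((2 * π * l.2.1 : ℝ) : ℂ))).add (h2.mul_left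
        ((π * l.2.2 : ℝ) : ℂ))).mul_left I |>.congr_fun fun k => ?_
    simp only [PiLp.smul_apply, smul_eq_mul, usym, hom, hdot, fc_apply]
    ring
  exact congrArg (fun v => v i) h.tsum_eq

/-- The bilinear pairing of complex velocities. -/
def cpair (c b : CVel) : ℂ := c 0 * b 0 + c 1 * b 1

lemma cpair_leray (l) (c b) : cpair (leray l c) b = cpair c (leray l b) := by
  unfold leray cpair hdot hvec
  split_ifs
  · simp
    ring
  · rfl


lemma dt_waveTest (c) (hχ : ContDiff ℝ (⊤ : ℕ∞) χ) (l) : dt (waveTest c χ l) = waveTest c (deriv χ) l := by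
  ext p
  simp [dt, fderiv_waveTest c hχ, waveTest, phase]

lemma dh_waveTest (c) (hχ : ContDiff ℝ (⊤ : ℕ∞) χ) (l) (j) :
    dh j (waveTest c χ l) = waveTest (c * (I * hvec l j)) χ l := by
  ext p
  fin_cases j <;> simp [dh, fderiv_waveTest c hχ, waveTest, phase, hvec]

lemma dz_waveTest (c) (hχ : ContDiff ℝ (⊤ : ℕ∞) χ) (l) :
    dz (waveTest c χ l) = waveTest (c * (I * ((π * l.2.2 : ℝ) : ℂ))) χ l := by
  ext p
  simp [dz, fderiv_waveTest c hχ, waveTest, phase]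

lemma hvec_neg (l) : hvec (-l) = -hvec l := by ext i; fin_cases i <;> simp [hvec]

lemma ofReal_mul_re (a : ℝ) (z : ℂ) : a * z.re = ((a : ℂ) * z).re := (Complex.re_ofReal_mul a z).symm

lemma integrable_wave_mul (hf : Integrable f μc) (l) : Integrable (fun q => wave l q * f q) μc :=
  hf.bdd_mul (c := 1) (continuous_wave l).aestronglyMeasurable (.of_forall fun q => (norm_wave l q).le)

/-- The function is integrable with the given Fourier coefficient. -/
def HasCoeff (l : Mode) (f : Pt → ℂ) (z : ℂ) : Prop := Integrable f μc ∧ ccoeff f l = z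

lemma HasCoeff.add {y z} (hf : HasCoeff l f y) (hg : HasCoeff l g z) :
    HasCoeff l (fun q => f q + g q) (y + z) := by
  refine ⟨hf.1.add hg.1, ?_⟩
  rw [← hf.2, ← hg.2]
  unfold ccoeff
  rw [← mul_add, ← integral_add (integrable_wave_mul hf.1 _) (integrable_wave_mul hg.1 _)]
  simp only [mul_add]

lemma HasCoeff.const_mul {z} (hf : HasCoeff l f z) (c) : HasCoeff l (fun q => c * f q) (c * z) := by
  refine ⟨hf.1.const_mul c, ?_⟩
  rw [← hf.2]
  unfold ccoeff
  simp only [mul_left_comm _ c]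
  rw [integral_const_mul]
  ring

lemma MemLp.hasCoeff (hf : MemLp f 2 μc) (l) : HasCoeff l f (ccoeff f l) := ⟨hf.integrable num!, rfl⟩

/-- The continuity equation in terms of Fourier coefficients. -/
lemma WeakContinuity.modes {w : ℝ → Pt → ℝ} (hT : 0 < T) (hV : MemLp (fun p => V p.1 p.2) 2 (μs T))
    (hw : MemLp (fun p => w p.1 p.2) 2 (μs T))
    (hodd : ∀ᵐ p ∂μs T, w p.1 (reflect p.2) = -w p.1 p.2) (h : WeakContinuity T V w) :
    ∀ᵐ t ∂vol[T], IsSolenoidal (fc (V t)) ∧ ∀ k, om k (fc (V t) k) = ccoeff (fun q => (w t q : ℂ)) k := by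
  have hVi : ∀ i, Integrable (fun p => (V p.1 p.2 i : ℂ)) (μs T) := fun i =>
    MemLp.integrable (by norm_num : (1 : ℝ≥0∞) ≤ 2) (((proj (𝕜 := ℝ) i).comp_memLp' hV).ofReal)
  have hwi : Integrable (fun p => (w p.1 p.2 : ℂ)) (μs T) :=
    MemLp.integrable (by norm_num : (1 : ℝ≥0∞) ≤ 2) hw.ofReal
  have key : ∀ l : Mode, ∀ᵐ t ∂vol[T],
    hdot l (fc (V t) l) + ((π * l.2.2 : ℝ) : ℂ) * ccoeff (fun q => (w t q : ℂ)) l = 0 := fun l => by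
    set f : ℝ × Pt → ℂ := fun p => (((2 * π * l.1 : ℝ) : ℂ) * V p.1 p.2 0 +
      ((2 * π * l.2.1 : ℝ) : ℂ) * V p.1 p.2 1) + ((π * l.2.2 : ℝ) : ℂ) * w p.1 p.2 with hf
    have hfi : Integrable f (μs T) := (((hVi 0).const_mul _).add ((hVi 1).const_mul _)).add (hwi.const_mul _)
    obtain ⟨h1, h2⟩ := integral_slab_wave hfi l
    have h3 : ∀ χ : ℝ → ℝ, ContDiff ℝ (⊤ : ℕ∞) χ →
      ∫ t in Ioo 0 T, χ t * ccoeff (fun q => f (t, q)) l = 0 := fun χ hχ => by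
      obtain ⟨h4, h5⟩ := h2 χ hχ.continuous
      have h6 := eq_zero_of_re_mul h4 (s := 0) fun z => by
        rw [mul_zero, zero_re, add_zero, ← h _ (isTest_waveTest (z * I) hχ (-l))]
        congr 1; ext p
        simp only [dh_waveTest _ hχ, dz_waveTest _ hχ, hvec_neg, waveTest, Fin.sum_univ_two,
          ofReal_mul_re, ← add_re, hf]
        congr 1
        simp [hvec]
        linear_combination (z * χ p.1 * wave (-l) p.2 * (2 * π * l.1 * V p.1 p.2 0 +
          2 * π * l.2.1 * V p.1 p.2 1 + π * l.2.2 * w p.1 p.2)) * I_mul_I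
      rw [h5, add_zero] at h6
      simpa using h6
    have h4 := ae_eq_primitive (A₀ := 0) hT h1 (g := fun _ => 0) integrableOn_zero fun χ hχ _ => by
      have := h3 (deriv χ) (contDiff_infty_iff_deriv.1 hχ).2
      simpa using this
    filter_upwards [h4, ae_slice_memLp hV, ae_slice_memLp hw] with t ht hVt hwt
    have hVc := fun i => MemLp.hasCoeff (memLp_component hVt i) l
    have hwc := MemLp.hasCoeff (show MemLp (fun q => (w t q : ℂ)) 2 μc from hwt.ofReal) l
    rw [((((hVc 0).const_mul ((2 * π * l.1 : ℝ) : ℂ)).add ((hVc 1).const_mul ((2 * π * l.2.1 : ℝ) : ℂ))).add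
      (hwc.const_mul ((π * l.2.2 : ℝ) : ℂ))).2] at ht
    simpa [hdot, fc_apply] using ht
  filter_upwards [ae_all_iff.2 key, ae_slice hodd] with t ht hodd
  refine ⟨fun k hk => by simpa [hk] using ht k, fun k => ?_⟩
  unfold om
  rcases eq_or_ne k.2.2 0 with hk | hk
  · rw [ccoeff_eq_zero_of_odd (hodd.mono fun q hq => by
      rw [show w t (reflect q) = _ from hq]; push_cast; rfl) hk]
    simp [hk]
  · have hne : ((π * k.2.2 : ℝ) : ℂ) ≠ 0 := by exact_mod_cast mul_ne_zero Real.pi_ne_zero (by exact_mod_cast hk)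
    rw [div_eq_iff hne]
    linear_combination -(ht k)


/-- The momentum equation tested with one wave. -/
lemma WeakMomentum.modes {w : ℝ → Pt → ℝ} {P : ℝ → ℝ × ℝ → ℝ} (hT : 0 < T) (hV₀ : MemLp V₀ 2 μc)
    (hV : MemLp (fun p => V p.1 p.2) 2 (μs T)) (hw : MemLp (fun p => w p.1 p.2) 2 (μs T))
    (hP : Integrable (fun p => P p.1 (p.2.1, p.2.2.1)) (μs T))
    (hom : ∀ᵐ t ∂vol[T], ∀ k, om k (fc (V t) k) = ccoeff (fun q => (w t q : ℂ)) k)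
    (h : WeakMomentum ν Ω T V₀ V w P) {c : CVel} (hc : l.2.2 = 0 → hdot l c = 0) :
    ∃ g : ℝ → ℂ, IntegrableOn g (Ioo 0 T) ∧ (∀ᵐ t ∂vol[T], g t =
      cpair c (-(conv (fc (V t)) (fc (V t)) l + (Ω : ℂ) • cperp (fc (V t) l)) -
        ((ν * kz l ^ 2 : ℝ) : ℂ) • fc (V t) l)) ∧ ∀ᵐ t ∂vol[T],
      cpair c (fc (V t) l) = cpair c (fc V₀ l) + ∫ s in 0..t, g s := by
  have hVc : ∀ i, MemLp (fun p => (V p.1 p.2 i : ℂ)) 2 (μs T) := fun i =>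
    ((proj (𝕜 := ℝ) i).comp_memLp' hV).ofReal
  have hwc : MemLp (fun p => (w p.1 p.2 : ℂ)) 2 (μs T) := hw.ofReal
  have hVi := fun i => (hVc i).integrable num!
  set κ₀ : ℂ := ((2 * π * l.1 : ℝ) : ℂ) with hκ₀
  set κ₁ : ℂ := ((2 * π * l.2.1 : ℝ) : ℂ) with hκ₁
  set κ₃ : ℂ := ((π * l.2.2 : ℝ) : ℂ) with hκ₃
  set f₁ : ℝ × Pt → ℂ := fun p => c 0 * V p.1 p.2 0 + c 1 * V p.1 p.2 1 with hf₁
  let N : Fin 2 → (ℝ × Pt → ℂ) := fun i p => -I * (κ₀ * ((V p.1 p.2 0 : ℂ) * V p.1 p.2 i) +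
    κ₁ * ((V p.1 p.2 1 : ℂ) * V p.1 p.2 i) + κ₃ * ((w p.1 p.2 : ℂ) * V p.1 p.2 i)) + -(ν * κ₃ ^ 2) * V p.1 p.2 i
  set f₂ : ℝ × Pt → ℂ := fun p => c 0 * (N 0 p + Ω * V p.1 p.2 1) +
    c 1 * (N 1 p + -(Ω : ℂ) * V p.1 p.2 0) + -(I * hdot l c) * P p.1 (p.2.1, p.2.2.1) with hf₂
  have hN : ∀ i, Integrable (N i) (μs T) := fun i =>
    ((((((hVc 0).integrable_mul (hVc i)).const_mul κ₀).add (((hVc 1).integrable_mul (hVc i)).const_mul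
      κ₁)).add ((hwc.integrable_mul (hVc i)).const_mul κ₃)).const_mul _).add ((hVi i).const_mul _)
  have hi₁ : Integrable f₁ (μs T) := ((hVi 0).const_mul _).add ((hVi 1).const_mul _)
  have hi₂ : Integrable f₂ (μs T) := ((((hN 0).add ((hVi 1).const_mul _)).const_mul _).add
    (((hN 1).add ((hVi 0).const_mul _)).const_mul _)).add (hP.ofReal.const_mul _)
  obtain ⟨a1, a2⟩ := integral_slab_wave hi₁ l
  obtain ⟨b1, b2⟩ := integral_slab_wave hi₂ l
  have hpair : ∀ {f : Pt → Vel}, MemLp f 2 μc →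
    HasCoeff l (fun q => c 0 * f q 0 + c 1 * f q 1) (cpair c (fc f l)) := fun hf =>
    ((MemLp.hasCoeff (memLp_component hf 0) l).const_mul _).add
      ((MemLp.hasCoeff (memLp_component hf 1) l).const_mul _)
  have hκ : kz l ^ 2 = (π * l.2.2) ^ 2 := by rw [kz, mul_pow, sq_abs, mul_pow]
  have key := ae_eq_primitive (A₀ := cpair c (fc V₀ l)) hT a1 b1 fun χ hχ hvan => by
    have hdχ := (contDiff_infty_iff_deriv.1 hχ).2
    obtain ⟨a3, a4⟩ := a2 (deriv χ) hdχ.continuous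
    obtain ⟨b3, b4⟩ := b2 χ hχ.continuous
    have hm := eq_zero_of_re_mul (a3.add b3) (s := χ 0 * (2 * cpair c (fc V₀ l))) fun z => by
      have h1 := h (fun i => waveTest (z * c i) χ (-l)) (fun i => isTest_waveTest _ hχ _) (by
        obtain ⟨T', hT', hz⟩ := hvan
        exact ⟨T', hT', fun i t q ht => by simp [waveTest, hz t ht]⟩)
      refine Eq.trans ?_ h1
      congr 1
      · congr 1; ext p
        simp only [dt_waveTest _ hχ, dh_waveTest _ hχ, dz_waveTest _ hχ, hvec_neg, waveTest,
          Fin.sum_univ_two, Pi.add_apply]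
        simp only [mul_assoc ν, mul_assoc Ω, ofReal_mul_re, ← add_re, ← Complex.sub_re]
        congr 1
        simp only [hf₁, hf₂, N, perp, hdot, PiLp.neg_apply, hvec, hκ₀, hκ₁, hκ₃]
        simp
        linear_combination (-ν * (π * l.2.2) ^ 2 * z * χ p.1 * wave (-l) p.2 *
          (c 0 * V p.1 p.2 0 + c 1 * V p.1 p.2 1)) * I_mul_I
      · rw [← (hpair hV₀).2, ccoeff, ← mul_assoc 2, mul_one_div_cancel two_ne_zero, one_mul,
          ← integral_const_mul, ← integral_const_mul]
        have hi := ((integrable_wave_mul (hpair hV₀).1 (-l)).const_mul (χ 0 : ℂ)).const_mul z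
        refine (integral_re hi).symm.trans ?_
        congr 1; ext q
        simp only [waveTest, Fin.sum_univ_two, ofReal_mul_re, ← add_re]
        change Complex.re _ = _
        congr 1
        ring
    simp only [Pi.add_apply] at hm
    rw [integral_add a3 b3, a4, b4, ← mul_add, ← integral_add
      (integrableOn_continuous_mul a1 hdχ.continuous) (integrableOn_continuous_mul b1 hχ.continuous)] at hm
    linear_combination (1 / 2 : ℂ) * hm
  refine ⟨_, b1, ?_, ?_⟩
  · rw [slabMeasure_eq_prod] at hP
    filter_upwards [hom, ae_slice_memLp hV, ae_slice_memLp hw, hP.prod_right_ae] with t ht hVt hwt hPt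
    have v := fun i => MemLp.hasCoeff (memLp_component hVt i) l
    have hwt' : MemLp (fun q => (w t q : ℂ)) 2 μc := hwt.ofReal
    have vv : ∀ j i : Fin 2, HasCoeff l (fun q => (V t q j : ℂ) * V t q i) _ := fun j i =>
      ⟨(memLp_component hVt j).integrable_mul (memLp_component hVt i), rfl⟩
    have wv : ∀ i : Fin 2, HasCoeff l (fun q => (w t q : ℂ) * V t q i) _ := fun i =>
      ⟨hwt'.integrable_mul (memLp_component hVt i), rfl⟩
    have hn := fun i => ((((((vv 0 i).const_mul κ₀).add ((vv 1 i).const_mul κ₁)).add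
      ((wv i).const_mul κ₃)).const_mul (-I)).add ((v i).const_mul (-(ν * κ₃ ^ 2))))
    have hp : HasCoeff l (fun q => (P t (q.1, q.2.1) : ℂ)) _ := ⟨hPt.ofReal, rfl⟩
    have := (((((hn 0).add ((v 1).const_mul (Ω : ℂ))).const_mul (c 0)).add
      (((hn 1).add ((v 0).const_mul (-(Ω : ℂ)))).const_mul (c 1))).add (hp.const_mul (-(I * hdot l c)))).2
    refine Eq.trans this ?_
    have hz : hdot l c * ccoeff (fun q => (P t (q.1, q.2.1) : ℂ)) l = 0 := by
      rcases eq_or_ne l.2.2 0 with hl | hl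
      · rw [hc hl, zero_mul]
      · rw [ccoeff_eq_zero_of_horizontal (fun x => (P t x : ℂ)) hl, mul_zero]
    simp only [cpair, PiLp.sub_apply, PiLp.neg_apply, PiLp.add_apply, PiLp.smul_apply,
      conv_fc_apply hVt hwt ht, smul_eq_mul, cperp, hκ, fc_apply]
    simp only [← hκ₀, ← hκ₁, ← hκ₃]
    simp [hκ₃]
    linear_combination (-I) * hz
  · filter_upwards [key, ae_slice_memLp hV] with t ht hVt
    rw [← ht]
    exact (hpair hVt).2.symm


/-- The Fourier coefficients of a weak solution solve the mode equations. -/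
lemma IsWeakSolution.exists_modes (hT : 0 < T)
    (h : IsWeakSolution ν Ω T V₀ V) (hV₀ : MemLp V₀ 2 μc) (hs : IsSolenoidal (fc V₀)) :
    ∃ a, IsModeSolution ν Ω T a ∧ a 0 = fc V₀ ∧ ∀ᵐ t ∂vol[T], a t = fc (V t) := by
  obtain ⟨w, P, hw, hodd, hP, hcont, hmom⟩ := h.equations
  have hdiv := hcont.modes hT h.memLp hw hodd
  set R := fun s => rhs ν Ω (fc (V s)) with hR
  have hsingle : ∀ (i : Fin 2) (b : CVel), cpair (single i 1) b = b i := fun i b => by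
    fin_cases i <;> simp [cpair]
  have key : ∀ (l : Mode) (i : Fin 2), IntegrableOn (fun s => R s l i) (Ioo 0 T) ∧
    ∀ᵐ t ∂vol[T], fc (V t) l i = fc V₀ l i + ∫ s in 0..t, R s l i := fun l i => by
    obtain ⟨g, hg, hgR, hgV⟩ := hmom.modes hT hV₀ h.memLp hw hP (hdiv.mono fun t ht => ht.2)
      (l := l) (c := leray l (single i 1)) fun hl => hdot_leray hl _
    have hgR' : ∀ᵐ t ∂vol[T], g t = R t l i := by
      filter_upwards [hgR, hdiv] with t ht hd
      rw [ht, cpair_leray, hsingle, sub_eq_add_neg, leray_add, ← neg_smul, leray_smul,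
        ← neg_one_smul ℂ (conv _ _ _ + _), leray_smul, leray_eq_self (hd.1 l), neg_one_smul, neg_smul,
        ← sub_eq_add_neg]
      rfl
    refine ⟨hg.congr_fun_ae hgR', ?_⟩
    filter_upwards [hgV, hdiv, ae_restrict_mem measurableSet_Ioo] with t ht hd htm
    rw [cpair_leray, cpair_leray, hsingle, hsingle, leray_eq_self (hd.1 l), leray_eq_self (hs l)] at ht
    rw [ht]
    congr 1
    refine intervalIntegral.integral_congr_ae ?_
    filter_upwards [(ae_restrict_iff' measurableSet_Ioo).1 hgR'] with s hs hst
    rw [uIoc_of_le htm.1.le] at hst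
    exact hs ⟨hst.1, hst.2.trans_lt htm.2⟩
  have hRi : ∀ l, IntervalIntegrable (fun s => R s l) volume 0 T := fun l => by
    rw [intervalIntegrable_iff_integrableOn_Ioo_of_le hT.le]
    have e : (fun s => R s l) = fun s => R s l 0 • single (0 : Fin 2) 1 +
      R s l 1 • single (1 : Fin 2) 1 := by ext s i; fin_cases i <;> simp
    rw [e]
    exact ((key l 0).1.smul_const _).add ((key l 1).1.smul_const _)
  set a := fun t l => fc V₀ l + ∫ s in 0..t, R s l with ha
  have h0 : a 0 = fc V₀ := by ext l : 1; simp [ha]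
  have hae : ∀ᵐ t ∂vol[T], a t = fc (V t) := by
    filter_upwards [ae_all_iff.2 fun l => ae_all_iff.2 fun i => (key l i).2,
      ae_restrict_mem measurableSet_Ioo] with t ht htm
    ext l i
    have h1 : IntervalIntegrable (fun s => R s l) volume 0 t :=
      (hRi l).mono_set (uIcc_subset_uIcc left_mem_uIcc (by
        rw [uIcc_of_le hT.le]; exact Ioo_subset_Icc_self htm))
    rw [ht l i]
    have h2 := (proj (𝕜 := ℂ) i).restrictScalars ℝ |>.intervalIntegral_comp_comm h1
    exact congrArg (fc V₀ l i + ·) h2.symm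
  have hrhs : ∀ k, ∀ᵐ s ∂vol[T], rhs ν Ω (a s) k = R s k := fun k => by
    filter_upwards [hae] with s hs
    rw [hs]
  refine ⟨a, ⟨fun t ht k hk => ?_, fun k => ?_, fun k t ht => ?_⟩, h0, hae⟩
  · have h1 : ContinuousOn (fun t => hdot k (a t k)) (Icc 0 T) := by
      have h2 := continuousOn_primitive_interval' (hRi k) left_mem_uIcc
      rw [uIcc_of_le hT.le] at h2
      exact (show Continuous (hdot k) by unfold hdot; fun_prop).comp_continuousOn (continuousOn_const.add h2)
    refine Measure.eqOn_Icc_of_ae_eq (μ := volume) hT.ne ?_ h1 continuousOn_const ht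
    rw [restrict_Ioo_eq_restrict_Icc.symm]
    filter_upwards [hae, hdiv] with t h3 h4
    rw [h3]
    exact h4.1 k hk
  · have := hRi k
    rw [intervalIntegrable_iff_integrableOn_Ioo_of_le hT.le] at this ⊢
    exact this.congr_fun_ae ((hrhs k).mono fun s hs => hs.symm)
  · rw [h0]
    change fc V₀ k + _ = _
    congr 1
    refine intervalIntegral.integral_congr_ae ?_
    have : ∀ᵐ s ∂(volume : Measure ℝ), s ≠ T := Measure.ae_ne volume T
    filter_upwards [(ae_restrict_iff' measurableSet_Ioo).1 (hrhs k), this] with s hs hsT hst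
    rw [uIoc_of_le ht.1] at hst
    exact (hs ⟨hst.1, lt_of_le_of_ne (hst.2.trans ht.2) hsT⟩).symm


/-! ### Uniqueness and continuous dependence -/

lemma weight_le_weight (h : τ ≤ τ') (s) (k) : weight r s τ η k ≤ weight r s τ' η k := by
  have h1 := kh_nonneg k
  have h2 := kz_nonneg k
  unfold weight
  gcongr

lemma loss_le_loss (h : τ ≤ τ') (A) : loss r ν τ η A ≤ loss r ν τ' η A := by
  have h1 := wsum_mono (fun k => weight_le_weight (r := r) (η := η) h 0 k) A
  have h2 : energyF r τ η A ≤ energyF r τ' η A :=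
    wsum_mono (fun k => mul_le_mul_of_nonneg_left (weight_le_weight h 0 k) (sq_nonneg _)) A
  unfold loss energyE
  gcongr

lemma normSq_eq (r) (s) (τ η) (f) : normSq r s τ η f = wsum (weight r s τ η) N[fc f] := by
  unfold normSq wsum; simp only [coeffSq_eq]

lemma lossRate_eq (r ν τ η) (f) : lossRate r ν τ η f = loss r ν τ η N[fc f] := by
  unfold lossRate loss; rw [normSq_zero_eq, dzNormSq_eq]

/-- A smaller horizontal radius absorbs the horizontal derivatives. -/
lemma exists_energyF_le {δ} (hr : 0 < r) (hδ : 0 < δ) : ∃ c, 0 < c ∧ ∀ σ τ η, 0 ≤ σ →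
    0 ≤ η → σ + δ ≤ τ → ∀ A, energyF r σ η A ≤ ofReal c * wsum (weight r 1 τ η) A := by
  set c := (r / δ) ^ (2 * r) with hc
  have hc0 : 0 < c := pos!
  have key : ∀ x, 0 ≤ x → x ^ (2 * r) ≤ c * exp (2 * δ * x) := fun x hx => by
    have h1 : x ≤ r / δ * exp (δ * x / r) := by
      have h2 := Real.add_one_le_exp (δ * x / r)
      calc x = r / δ * (δ * x / r) := by field_simp
        _ ≤ _ := by gcongr; linarith
    calc x ^ (2 * r) ≤ (r / δ * exp (δ * x / r)) ^ (2 * r) := by gcongr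
      _ = _ := by
        rw [mul_rpow pos! pos!, ← Real.exp_mul]
        congr 2; field_simp
  refine ⟨c + 2, by positivity, fun σ τ η hσ hη hστ A => ?_⟩
  rw [← wsum_const_mul pos!]
  refine wsum_mono (fun k => ?_) A
  have h1 := kh_nonneg k
  have h2 := kz_nonneg k
  have h3 : 1 ≤ exp (2 * η * kz k) := one_le_exp pos!
  have h4 : exp (2 * σ * kh k) * exp (2 * δ * kh k) ≤ exp (2 * τ * kh k) := by rw [← exp_add]; gcongr; nlinarith
  have h5 : 1 ≤ exp (2 * σ * kh k) := one_le_exp pos!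
  have h6 : 1 ≤ exp (2 * δ * kh k) := one_le_exp pos!
  have h7 := key (kh k) h1
  have h8 : kh k ^ (2 * r) * exp (2 * σ * kh k) ≤ c * exp (2 * τ * kh k) := by
    calc _ ≤ c * exp (2 * δ * kh k) * exp (2 * σ * kh k) := by gcongr
      _ = c * (exp (2 * σ * kh k) * exp (2 * δ * kh k)) := by ring
      _ ≤ _ := by gcongr
  have h9 : exp (2 * σ * kh k) ≤ exp (2 * τ * kh k) := by nlinarith
  have h10 := rpow_nonneg h1 (2 * r)
  unfold weight
  simp only [mul_zero, pow_zero, mul_one]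
  set X := exp (2 * τ * kh k)
  set Y := exp (2 * η * kz k)
  set Z := kz k ^ 2
  have hZ : 0 ≤ Z := sq_nonneg _
  have hX : 1 ≤ X := h5.trans h9
  calc Z * (1 + (kh k ^ (2 * r) + 1) * exp (2 * σ * kh k) * Y)
    = Z * (1 + (kh k ^ (2 * r) * exp (2 * σ * kh k) + exp (2 * σ * kh k)) * Y) := by ring
    _ ≤ Z * (X * Y + (c * X + X) * Y) := by
      gcongr
      nlinarith
    _ = (c + 2) * (Z * X * Y) := by ring
    _ ≤ (c + 2) * (1 + (kh k ^ (2 * r) + Z) * X * Y) := by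
      gcongr
      have : 0 ≤ kh k ^ (2 * r) * X * Y := pos!
      nlinarith

/-- Mode solutions with the same initial value and square integrable analytic norm coincide. -/
lemma IsModeSolution.unique (hr : 2 < r) (hν : 0 < ν) (hT : 0 < T) (hτ₀ : 0 < τ₀)
    {b : ℝ → Coef} (ha : IsModeSolution ν Ω T a) (hb : IsModeSolution ν Ω T b)
    (h0 : a 0 = b 0) {M : ℝ≥0} (haM : ∀ᵐ t ∂vol[T], energyE r τ₀ (ν / 2 * t) N[a t] ≤ M)
    (hbM : ∀ᵐ t ∂vol[T], energyE r τ₀ (ν / 2 * t) N[b t] ≤ M)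
    (haN : ∫⁻ t in Ioo 0 T, wsum (weight r 1 τ₀ (ν / 2 * t)) N[a t] < ⊤)
    (hbN : ∫⁻ t in Ioo 0 T, wsum (weight r 1 τ₀ (ν / 2 * t)) N[b t] < ⊤) : ∀ t ∈ Icc 0 T, a t = b t := by
  obtain ⟨C, hC, hstab⟩ := exists_stability hr
  obtain ⟨c, hc, hF⟩ := exists_energyF_le (r := r) (δ := τ₀ / 2) lin! pos!
  set N : (ℝ → Coef) → ℝ → ℝ≥0∞ := fun a t => wsum (weight r 1 τ₀ (ν / 2 * t)) N[a t] with hN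
  set K : ℝ≥0∞ := (M : ℝ≥0∞) ^ ½ + 1 + M / ofReal ν with hK
  have hKt : K < ⊤ := by
    have h1 : (M : ℝ≥0∞) ^ ½ < ⊤ := rpow_lt_top_of_nonneg num! ENNReal.coe_ne_top
    have h2 : (M : ℝ≥0∞) / ofReal ν < ⊤ := div_lt_top ENNReal.coe_ne_top (by simpa using hν)
    exact add_lt_top.2 ⟨add_lt_top.2 ⟨h1, ENNReal.one_lt_top⟩, h2⟩
  have hloss : ∀ {a : ℝ → Coef} {t σ : ℝ}, 0 ≤ t → 0 ≤ σ → σ ≤ τ₀ / 2 → energyE r τ₀ (ν / 2 * t) N[a t] ≤ M →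
      loss r ν σ (ν / 2 * t) N[a t] ≤ K + ofReal c * N a t := by
    intro a t σ ht h1 h2 h3
    have h4 := (wsum_mono (fun k => weight_le_weight (r := r) (η := ν / 2 * t)
      (show σ ≤ τ₀ by linarith) 0 k) N[a t]).trans h3
    have h5 := hF σ τ₀ (ν / 2 * t) h1 pos! lin! N[a t]
    have h6 : ∀ x : ℝ≥0∞, x ^ ½ ≤ 1 + x := fun x => by
      rcases le_total x 1 with h | h
      · exact (ENNReal.rpow_le_one h num!).trans le_self_add
      · calc x ^ ½ ≤ x ^ 1 := ENNReal.rpow_le_rpow_of_exponent_le h num!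
          _ ≤ _ := by rw [ENNReal.rpow_one]; exact le_add_self
    unfold loss
    calc _ ≤ (M : ℝ≥0∞) ^ ½ + (1 + ofReal c * N a t) + M / ofReal ν := by
          gcongr
          · exact h4
          · exact (h6 _).trans (by gcongr)
          · exact h4
      _ = _ := by rw [hK]; ring
  set R' : ℝ → ℝ≥0∞ := fun t => 2 * K + ofReal c * (N a t + N b t) with hR'
  have hm : ∀ {a : ℝ → Coef}, IsModeSolution ν Ω T a → AEMeasurable (N a) vol[T] := fun ha =>
    aemeasurable_wsum (fun k => by unfold weight; fun_prop) (ha.continuousOn hT.le)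
  have hRm : AEMeasurable R' vol[T] := ((hm ha).add (hm hb)).const_mul _ |>.const_add _
  have hRt : ∫⁻ t in Ioo 0 T, R' t < ⊤ := by
    rw [hR', lintegral_add_left measurable_const, lintegral_const,
      lintegral_const_mul' _ _ ofReal_ne_top, lintegral_add_left' (hm ha)]
    exact add_lt_top.2 ⟨mul_lt_top (mul_lt_top num! hKt) (by simp),
      mul_lt_top ofReal_lt_top (add_lt_top.2 ⟨haN, hbN⟩)⟩
  set R : ℝ → ℝ := fun t => (R' t).toReal with hR
  have hRi : IntervalIntegrable R volume 0 T := by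
    rw [intervalIntegrable_iff_integrableOn_Ioo_of_le hT.le]
    exact integrable_toReal_of_lintegral_ne_top hRm hRt.ne
  have hRfin : ∀ᵐ t ∂vol[T], ofReal (R t) = R' t := (ae_lt_top' hRm hRt.ne).mono fun t ht => ofReal_toReal ht.ne
  have hR0 : ∀ t, 0 ≤ R t := fun t => toReal_nonneg
  have hcl : IsClosed ({t | ∀ k, a t k = b t k} ∩ Icc 0 T) := by
    have : {t | ∀ k, a t k = b t k} ∩ Icc 0 T = ⋂ k, Icc 0 T ∩ (fun t => a t k - b t k) ⁻¹' {0} := by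
      ext t
      simp [sub_eq_zero, forall_and, and_comm]
    rw [this]
    exact isClosed_iInter fun k => ((ha.continuousOn hT.le k).sub
      (hb.continuousOn hT.le k)).preimage_isClosed_of_isClosed isClosed_Icc isClosed_singleton
  have hsub := hcl.Icc_subset_of_forall_exists_gt (by simp [h0]) fun x hx y hy => ?_
  · exact fun t ht => funext (hsub ht)
  have hxT : x ∈ Icc 0 T := Ico_subset_Icc_self hx.2
  have hI : ∀ t ∈ Icc 0 T, IntervalIntegrable R volume x t := fun t ht =>
    hRi.mono_set (uIcc_subset_uIcc (by rwa [uIcc_of_le hT.le]) (by rwa [uIcc_of_le hT.le]))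
  have hcont := continuousOn_primitive_interval' hRi (a := x) (by rwa [uIcc_of_le hT.le])
  rw [uIcc_of_le hT.le] at hcont
  have h1 := ((hcont x hxT).mono_left (nhdsWithin_le_of_mem (Icc_mem_nhdsGT_of_mem hx.2))).const_mul C
  simp only [integral_same, mul_zero] at h1
  obtain ⟨t₁, ht₁, ht₁'⟩ := ((h1.eventually (gt_mem_nhds (show 0 < τ₀ / 2 by positivity))).and
    (Ioc_mem_nhdsGT (lt_min hy hx.2.2))).exists
  have ht₁T : t₁ ∈ Icc 0 T := ⟨hxT.1.trans ht₁'.1.le, ht₁'.2.trans (min_le_right _ _)⟩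
  refine ⟨t₁, fun k => ?_, ht₁'.1, ht₁'.2.trans (min_le_left _ _)⟩
  have hint : ∀ t ∈ Icc x t₁, 0 ≤ C * ∫ s in x..t, R s ∧ C * ∫ s in x..t, R s ≤ τ₀ / 2 := by
    intro t ht
    refine ⟨mul_nonneg hC.le (intervalIntegral.integral_nonneg ht.1 fun s _ => hR0 s), ?_⟩
    refine le_trans ?_ ht₁.le
    exact mul_le_mul_of_nonneg_left (intervalIntegral.integral_mono_interval le_rfl ht.1 ht.2
      (.of_forall hR0) (hI t₁ ht₁T)) hC.le
  have key := hstab C ν Ω T le_rfl hν a b ha hb x t₁ (τ₀ / 2) R M hxT.1 ht₁'.1.le ht₁T.2 (hI t₁ ht₁T) hR0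
    (fun t ht => by linarith [(hint t ht).2]) ENNReal.coe_lt_top (by
      have hT' : ∀ᵐ t ∂volume.restrict (Ioc x t₁), t ∈ Ioo 0 T → energyE r τ₀ (ν / 2 * t) N[a t] ≤ M ∧
          energyE r τ₀ (ν / 2 * t) N[b t] ≤ M ∧ ofReal (R t) = R' t :=
        ae_restrict_of_ae ((ae_restrict_iff' measurableSet_Ioo).1 (haM.and (hbM.and hRfin)))
      filter_upwards [hT', ae_restrict_mem measurableSet_Ioc,
        ae_restrict_of_ae (Measure.ae_ne volume T)] with t h2 h3 h4
      obtain ⟨h5, h6, h7⟩ := h2 ⟨hxT.1.trans_lt h3.1, lt_of_le_of_ne (h3.2.trans ht₁T.2) h4⟩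
      obtain ⟨h8, h9⟩ := hint t (Ioc_subset_Icc_self h3)
      have h10 : 0 ≤ t := hxT.1.trans h3.1.le
      have hE := fun A : Amp => wsum_mono (fun k => weight_le_weight (r := r) (η := ν / 2 * t)
        (show τ₀ / 2 - C * ∫ s in x..t, R s ≤ τ₀ by linarith) 0 k) A
      refine ⟨(hE _).trans h5, (hE _).trans h6, ?_⟩
      rw [h7]
      refine (add_le_add (hloss h10 lin! lin! h5) (hloss h10 lin! lin! h6)).trans_eq ?_
      rw [hR']; ring)
  have h2 : energyE (r - ½) (τ₀ / 2) (ν / 2 * x) D[a x, b x] = 0 := by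
    have : ∀ k, a x k - b x k = 0 := fun k => sub_eq_zero.2 (hx.1 k)
    simp [energyE, wsum, this]
  rw [h2, mul_zero, nonpos_iff_eq_zero] at key
  have h3 := ENNReal.tsum_eq_zero.1 key k
  have h4 := weight_pos (r - ½) (τ₀ / 2 - C * ∫ s in x..t₁, R s) (ν / 2 * t₁) k
  rcases mul_eq_zero.1 h3 with h | h
  · exact absurd (ENNReal.ofReal_eq_zero.1 h) h4.not_ge
  · simpa [sub_eq_zero] using h


lemma IsInitialDatum.isSolenoidal (h : IsInitialDatum r τ₀ V₀) : IsSolenoidal (fc V₀) := fun k hk => by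
  have hc := fun i => MemLp.hasCoeff (memLp_component h.memS.memLp i) k
  have hs := ((hc 0).const_mul ((2 * π * k.1 : ℝ) : ℂ)).add ((hc 1).const_mul ((2 * π * k.2.1 : ℝ) : ℂ))
  have key := eq_zero_of_re_mul (integrable_wave_mul hs.1 (-k)) (s := 0) fun z => by
    let L : ℝ × ℝ →L[ℝ] ℝ × Pt := (0 : ℝ × ℝ →L[ℝ] ℝ).prod ((ContinuousLinearMap.fst ℝ ℝ ℝ).prod
      ((ContinuousLinearMap.snd ℝ ℝ ℝ).prod 0))
    have hone : ContDiff ℝ (⊤ : ℕ∞) fun _ : ℝ => (1 : ℝ) := contDiff_const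
    have ht := isTest_waveTest (z * I) hone (-k)
    have hd := h.div_free (fun x => waveTest (z * I) (fun _ => 1) (-k) (L x))
      (ht.smooth.comp L.contDiff) fun x y => ⟨(ht.periodic 0 x y 0).1, (ht.periodic 0 x y 0).2.1⟩
    rw [mul_zero, zero_re, add_zero]
    refine Eq.trans ?_ hd
    congr 1; ext q
    have hf : ∀ x v, fderiv ℝ (fun x => waveTest (z * I) (fun _ => 1) (-k) (L x)) x v =
      fderiv ℝ (waveTest (z * I) (fun _ => 1) (-k)) (L x) (L v) := fun x v => by
      have := fderiv_comp x ((ht.smooth.differentiable (by simp)) (L x)) L.differentiableAt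
      rw [L.fderiv] at this
      exact congrArg (fun f => f v) this
    have hw : wave (-k) (q.1, q.2.1, 0) = wave (-k) q := by simp [wave, phase, hk]
    have hL : ∀ x y, L (x, y) = (0, x, y, 0) := fun x y => rfl
    simp only [hf]
    simp only [hL, fderiv_waveTest _ hone, waveTest, hw, ofReal_mul_re, ← add_re]
    congr 1
    simp [phase, hk]
    linear_combination (z * wave (-k) q * (2 * π * k.1 * V₀ q 0 + 2 * π * k.2.1 * V₀ q 1)) * I_mul_I
  rw [add_zero] at key
  have := hs.2
  rw [ccoeff, key, mul_zero] at this
  exact this.symm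

lemma IsWeakSolution.unique (hr : 2 < r) (hν : 0 < ν) (hT : 0 < T) (hτ₀ : 0 < τ₀) (hV₀ : MemLp V₀ 2 μc) (hs : IsSolenoidal (fc V₀)) {τ}
    (hτ : ∀ t ∈ Ioo 0 T, τ₀ ≤ τ t) {V'} (h : IsWeakSolution ν Ω T V₀ V)
    (h' : IsWeakSolution ν Ω T V₀ V') (hc : InAnalyticClass r ν T τ V)
    (hc' : InAnalyticClass r ν T τ V') : ∀ᵐ t ∂vol[T], V' t =ᵐ[cellMeasure] V t := by
  have key : ∀ {V : ℝ → Pt → Vel}, IsWeakSolution ν Ω T V₀ V → InAnalyticClass r ν T τ V →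
    ∃ (a : ℝ → Coef) (M : ℝ≥0), IsModeSolution ν Ω T a ∧ a 0 = fc V₀ ∧
      (∀ᵐ t ∂vol[T], a t = fc (V t)) ∧ (∀ᵐ t ∂vol[T], energyE r τ₀ (ν / 2 * t) N[a t] ≤ M) ∧
      ∫⁻ t in Ioo 0 T, wsum (weight r 1 τ₀ (ν / 2 * t)) N[a t] < ⊤ := by
    intro V h hc
    obtain ⟨a, ha, h0, hae⟩ := h.exists_modes hT hV₀ hs
    obtain ⟨M, hM⟩ := hc.bounded
    have hle : ∀ s, ∀ᵐ t ∂vol[T], wsum (weight r s τ₀ (ν / 2 * t)) N[a t] ≤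
      normSq r s (τ t) (verticalRadius ν t) (V t) := fun s => by
      filter_upwards [hae, ae_restrict_mem measurableSet_Ioo] with t h1 h2
      rw [h1, normSq_eq]
      exact wsum_mono (fun k => weight_le_weight (hτ t h2) s k) _
    refine ⟨a, M, ha, h0, hae, ?_, (lintegral_mono_ae (hle 1)).trans_lt hc.square_integrable⟩
    filter_upwards [hle 0, hM] with t h1 h2
    exact h1.trans h2
  obtain ⟨a, M, ha, ha0, hae, haM, haN⟩ := key h hc
  obtain ⟨b, M', hb, hb0, hbe, hbM, hbN⟩ := key h' hc'
  have hu := ha.unique hr hν hT hτ₀ hb (ha0.trans hb0.symm) (M := max M M')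
    (haM.mono fun t ht => ht.trans (by exact_mod_cast le_max_left M M'))
    (hbM.mono fun t ht => ht.trans (by exact_mod_cast le_max_right M M')) haN hbN
  filter_upwards [hae, hbe, ae_slice_memLp h.memLp, ae_slice_memLp h'.memLp,
    ae_restrict_mem measurableSet_Ioo] with t h1 h2 h3 h4 h5
  refine ae_eq_of_fc_eq h4 h3 fun k => ?_
  rw [← h1, ← h2, hu t (Ioo_subset_Icc_self h5)]

lemma IsContinuousFrom.continuousOn_fc
    (h : IsContinuousFrom T V₀ V) (k) : ContinuousOn (fun t => fc (V t) k) (Icc 0 T) := fun t ht => by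
  rw [ContinuousWithinAt, tendsto_iff_edist_tendsto_0]
  refine tendsto_of_tendsto_of_tendsto_of_le_of_le' tendsto_const_nhds (h.tendsto t ht)
    (.of_forall fun _ => zero_le) ?_
  filter_upwards [self_mem_nhdsWithin] with s hs
  rw [edist_eq_enorm_sub, ← fc_sub (h.memLp s hs) (h.memLp t ht)]
  have h1 := eLpNorm_sq_eq ((h.memLp s hs).sub (h.memLp t ht))
  refine (ENNReal.pow_le_pow_left_iff two_ne_zero).1 ?_
  rw [h1]
  exact (le_tsum k).trans (le_mul_of_one_le_left zero_le num!)

lemma IsAnalyticSolution.exists_modes (hT : 0 < T) {τ} (hV₀ : IsInitialDatum r τ₀ V₀)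
    (h : IsAnalyticSolution C r ν Ω τ₀ T V₀ V τ) :
    ∃ a, IsModeSolution ν Ω T a ∧ ∀ t ∈ Icc 0 T, a t = fc (V t) := by
  obtain ⟨a, ha, -, hae⟩ := h.sol.exists_modes hT hV₀.memS.memLp hV₀.isSolenoidal
  refine ⟨a, ha, fun t ht => funext fun k => ?_⟩
  refine Measure.eqOn_Icc_of_ae_eq (μ := volume) hT.ne ?_ (ha.continuousOn hT.le k)
    (h.cont.continuousOn_fc k) ht
  rw [restrict_Ioo_eq_restrict_Icc.symm]
  exact hae.mono fun t ht => congrFun ht k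

lemma aemeasurable_radius (hC : 0 ≤ C) {τ : ℝ → ℝ} {f : ℝ → ℝ≥0∞}
    (hf : ∫⁻ s in Ioo 0 T, f s < ⊤) (h : ∀ t ∈ Icc 0 T, τ t = τ₀ - C * (∫⁻ s in Ioo 0 t, f s).toReal) :
    AEMeasurable τ vol[T] := aemeasurable_restrict_of_antitoneOn measurableSet_Ioo fun s hs u hu hsu => by
    rw [h s (Ioo_subset_Icc_self hs), h u (Ioo_subset_Icc_self hu)]
    have := toReal_mono (ne_top_of_le_ne_top hf.ne (lintegral_mono_set (Ioo_subset_Ioo_right hu.2.le)))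
      (lintegral_mono_set (Ioo_subset_Ioo_right hsu) (μ := volume) (f := f))
    gcongr

/-- Continuous dependence on the initial data. -/
lemma exists_continuous_dependence (hr : 2 < r) : ∃ C₀, 0 < C₀ ∧ ∀ C ν Ω τ₀ T : ℝ, C₀ ≤ C → 0 < ν → 0 < T →
    ∀ (V₀₁ V₀₂ : Pt → Vel) (V₁ V₂ : ℝ → Pt → Vel) (τ₁ τ₂ : ℝ → ℝ),
    IsInitialDatum r τ₀ V₀₁ → IsInitialDatum r τ₀ V₀₂ →
    IsAnalyticSolution C r ν Ω τ₀ T V₀₁ V₁ τ₁ → IsAnalyticSolution C r ν Ω τ₀ T V₀₂ V₂ τ₂ →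
    ∀ t ∈ Icc 0 T, normSq (r - ½) 0 (τ₁ t + τ₂ t - τ₀) (verticalRadius ν t) (V₁ t - V₂ t) ≤
      ofReal (exp τ₀) * normSq (r - ½) 0 τ₀ 0 (V₀₁ - V₀₂) := by
  obtain ⟨C₀, hC₀, hstab⟩ := exists_stability hr
  refine ⟨C₀, hC₀, fun C ν Ω τ₀ T hC hν hT V₀₁ V₀₂ V₁ V₂ τ₁ τ₂ hd₁ hd₂ h₁ h₂ t ht => ?_⟩
  have hCpos : 0 < C := hC₀.trans_le hC
  obtain ⟨a, ha, hav⟩ := h₁.exists_modes hT hd₁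
  obtain ⟨b, hb, hbv⟩ := h₂.exists_modes hT hd₂
  have hrate : ∀ {V₀ : Pt → Vel} {V : ℝ → Pt → Vel} {τ : ℝ → ℝ} {a : ℝ → Coef},
    IsAnalyticSolution C r ν Ω τ₀ T V₀ V τ → IsModeSolution ν Ω T a → (∀ t ∈ Icc 0 T, a t = fc (V t)) →
    AEMeasurable (fun s => loss r ν (τ s) (ν / 2 * s) N[a s]) vol[T] ∧
    (∫⁻ s in Ioo 0 T, loss r ν (τ s) (ν / 2 * s) N[a s]) < ⊤ ∧
    (∀ t ∈ Icc 0 T, τ t = τ₀ - C * (∫⁻ s in Ioo 0 t, loss r ν (τ s) (ν / 2 * s) N[a s]).toReal) ∧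
    ∃ M : ℝ≥0, ∀ᵐ s ∂vol[T], energyE r (τ s) (ν / 2 * s) N[a s] ≤ M := by
    intro V₀ V τ a h ha hav
    have he : ∀ t ≤ T, ∫⁻ s in Ioo 0 t, lossRate r ν (τ s) (verticalRadius ν s) (V s) =
      ∫⁻ s in Ioo 0 t, loss r ν (τ s) (ν / 2 * s) N[a s] := fun t ht =>
      setLIntegral_congr_fun measurableSet_Ioo fun s hs => by
        rw [lossRate_eq, hav s ⟨hs.1.le, hs.2.le.trans ht⟩]; rfl
    have hfin := h.radius.finite
    rw [he T le_rfl] at hfin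
    have heq : ∀ t ∈ Icc 0 T, τ t = τ₀ - C * (∫⁻ s in Ioo 0 t, loss r ν (τ s) (ν / 2 * s) fun k =>
      ‖a s k‖ₑ).toReal := fun t ht => by rw [h.radius.eq t ht, he t ht.2]
    obtain ⟨M, hM⟩ := h.cls.bounded
    refine ⟨aemeasurable_loss (aemeasurable_radius hCpos.le hfin heq) (ha.continuousOn hT.le), hfin, heq, M, ?_⟩
    filter_upwards [hM, ae_restrict_mem measurableSet_Ioo] with s h1 h2
    rwa [hav s (Ioo_subset_Icc_self h2), ← normSq_zero_eq]
  obtain ⟨ma, fa, ea, Ma, hMa⟩ := hrate h₁ ha hav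
  obtain ⟨mb, fb, eb, Mb, hMb⟩ := hrate h₂ hb hbv
  set ρa := fun s => loss r ν (τ₁ s) (ν / 2 * s) N[a s] with hρa
  set ρb := fun s => loss r ν (τ₂ s) (ν / 2 * s) N[b s] with hρb
  set R := fun s => (ρa s + ρb s).toReal with hR
  have hRm := ma.add mb
  have hRf : ∫⁻ s in Ioo 0 T, (ρa s + ρb s) < ⊤ := by rw [lintegral_add_left' ma]; exact add_lt_top.2 ⟨fa, fb⟩
  have hae := ae_lt_top' hRm hRf.ne
  have hRi : IntervalIntegrable R volume 0 T := by
    rw [intervalIntegrable_iff_integrableOn_Ioo_of_le hT.le]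
    exact integrable_toReal_of_lintegral_ne_top hRm hRf.ne
  have hRt : ∀ s ∈ Icc 0 T, τ₀ - C * ∫ u in 0..s, R u = τ₁ s + τ₂ s - τ₀ := by
    intro s hs
    have hsub : Ioo 0 s ⊆ Ioo 0 T := Ioo_subset_Ioo_right hs.2
    have hfin : ∀ {ρ : ℝ → ℝ≥0∞}, ∫⁻ s in Ioo 0 T, ρ s < ⊤ → ∫⁻ s in Ioo 0 s, ρ s ≠ ⊤ := fun h =>
      ((lintegral_mono_set hsub).trans_lt h).ne
    have h2 : ∫ u in Ioo 0 s, R u = (∫⁻ u in Ioo 0 s, (ρa u + ρb u)).toReal :=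
      integral_toReal (hRm.mono_measure (restrict_mono hsub le_rfl)) (ae_mono (restrict_mono hsub le_rfl) hae)
    rw [integral_of_le hs.1, integral_Ioc_eq_integral_Ioo, h2]
    have h3 := lintegral_add_left' (ma.mono_measure (restrict_mono hsub le_rfl)) ρb
    rw [ea s hs, eb s hs]
    refine (congrArg (fun x => τ₀ - C * ENNReal.toReal x) h3).trans ?_
    rw [ENNReal.toReal_add (hfin fa) (hfin fb)]
    ring
  have hsub : Ioo 0 t ⊆ Ioo 0 T := Ioo_subset_Ioo_right ht.2
  have hle : ∀ {τ : ℝ → ℝ} {x : ℝ≥0∞} {s : ℝ}, τ s = τ₀ - C * x.toReal → τ s ≤ τ₀ := fun {_ x _} h => by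
    have := mul_nonneg hCpos.le (toReal_nonneg (a := x))
    rw [h]; linarith
  have hle₁ : ∀ s ∈ Icc 0 T, τ₁ s ≤ τ₀ := fun s hs => hle (ea s hs)
  have hle₂ : ∀ s ∈ Icc 0 T, τ₂ s ≤ τ₀ := fun s hs => hle (eb s hs)
  have key := hstab C ν Ω T hC hν a b ha hb 0 t τ₀ R (max Ma Mb : ℝ≥0) le_rfl ht.1 ht.2
    (hRi.mono_set (uIcc_subset_uIcc left_mem_uIcc (by rwa [uIcc_of_le hT.le])))
    (fun s => toReal_nonneg) (fun s hs => by
      have hs' : s ∈ Icc 0 T := ⟨hs.1, hs.2.trans ht.2⟩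
      simp only [hRt s hs']
      linarith [h₁.radius.half s hs', h₂.radius.half s hs']) ENNReal.coe_lt_top (by
      rw [← restrict_Ioo_eq_restrict_Ioc]
      filter_upwards [ae_mono (restrict_mono hsub le_rfl) (hMa.and (hMb.and hae)),
        ae_restrict_mem measurableSet_Ioo] with s h3 hs
      have hs' : s ∈ Icc 0 T := Ioo_subset_Icc_self (hsub hs)
      simp only [hRt s hs']
      have h4 := hle₁ s hs'
      have h5 := hle₂ s hs'
      refine ⟨(wsum_mono (fun k => weight_le_weight lin! 0 k) _).trans (h3.1.trans (by
        exact_mod_cast le_max_left Ma Mb)), (wsum_mono (fun k => weight_le_weight lin! 0 k)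
        _).trans (h3.2.1.trans (by exact_mod_cast le_max_right Ma Mb)), ?_⟩
      exact (add_le_add (loss_le_loss lin! _) (loss_le_loss lin! _)).trans (ofReal_toReal h3.2.2.ne).ge)
  simp only [hRt t ht, mul_zero] at key
  have e : ∀ s ∈ Icc 0 T, ∀ k, a s k - b s k = fc (V₁ s - V₂ s) k := fun s hs k => by
    rw [fc_sub (h₁.cont.memLp s hs) (h₂.cont.memLp s hs), hav s hs, hbv s hs]
  have h0 : 0 ∈ Icc 0 T := left_mem_Icc.2 hT.le
  simp only [e t ht, e 0 h0, fc_congr_ae (h₁.cont.initial.sub h₂.cont.initial)] at key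
  rw [normSq_zero_eq, normSq_zero_eq]
  refine key.trans ?_
  gcongr
  have := hRt t ht
  linarith [h₁.radius.half t ht, h₂.radius.half t ht]


/-! ### Families of Fourier coefficients -/

/-- Fourier coefficients `c t` for which the `m`-th power of `∑ ‖c t l‖` is integrable in time. -/
structure IsFamily (T : ℝ) (m : ℕ) (c : ℝ → Mode → ℂ) : Prop where
  meas : ∀ l, AEMeasurable (fun t => c t l) vol[T]
  fin : ∫⁻ t in Ioo 0 T, (∑' l, ‖c t l‖ₑ) ^ m < ⊤

/-- The convolution of two families. -/
def cmul (c d : ℝ → Mode → ℂ) (t : ℝ) (l : Mode) : ℂ := ∑' k, c t k * d t (l - k)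

lemma IsFamily.aemeasurable {m} {c} (h : IsFamily T m c) :
    AEMeasurable (fun t => ∑' l, ‖c t l‖ₑ) vol[T] := AEMeasurable.tsum fun l => (h.meas l).enorm

lemma IsFamily.ae_summable {m} (hm : m ≠ 0) {c} (h : IsFamily T m c) :
    ∀ᵐ t ∂vol[T], Summable fun l => ‖c t l‖ := by
  filter_upwards [ae_lt_top' (h.aemeasurable.pow_const m) h.fin.ne] with t ht
  refine (summable_norm_iff.2 (Summable.of_enorm (f := c t) ?_))
  rintro h'
  rw [h', ENNReal.top_pow hm] at ht
  exact ht.ne rfl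

lemma tsum_conv_enorm (c d : Mode → ℂ) : ∑' l, ∑' k, ‖c k * d (l - k)‖ₑ = (∑' k, ‖c k‖ₑ) * ∑' l, ‖d l‖ₑ := by
  rw [tsum_comm, ← ENNReal.tsum_mul_right]
  refine tsum_congr fun k => ?_
  simp only [enorm_mul, ENNReal.tsum_mul_left]
  exact congrArg _ ((Equiv.subRight k).tsum_eq fun l => ‖d l‖ₑ)

lemma IsFamily.mul {c d} (hc : IsFamily T 2 c) (hd : IsFamily T 2 d) : IsFamily T 1 (cmul c d) where
  meas l := AEMeasurable.tsum fun k => (hc.meas k).mul (hd.meas _)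
  fin := by
    calc _ ≤ ∫⁻ t in Ioo 0 T, ((∑' l, ‖c t l‖ₑ) ^ 2 + (∑' l, ‖d t l‖ₑ) ^ 2) := by
          refine lintegral_mono fun t => ?_
          rw [pow_one]
          refine ((tsum_le_tsum fun l => enorm_tsum_le_tsum_enorm).trans_eq (tsum_conv_enorm _ _)).trans ?_
          rcases le_total (∑' l, ‖c t l‖ₑ) (∑' l, ‖d t l‖ₑ) with h | h
          · exact (mul_le_mul_left h _).trans (by rw [← sq]; exact le_add_self)
          · exact (mul_le_mul_right h _).trans (by rw [← sq]; exact le_self_add)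
      _ = _ := lintegral_add_left' (hc.aemeasurable.pow_const 2) _
      _ < ⊤ := add_lt_top.2 ⟨hc.fin, hd.fin⟩

lemma IsFamily.one {c} (hc : IsFamily T 2 c) : IsFamily T 1 c where
  meas := hc.meas
  fin := by
    calc _ ≤ ∫⁻ t in Ioo 0 T, (1 + (∑' l, ‖c t l‖ₑ) ^ 2) := by
          refine lintegral_mono fun t => ?_
          rw [pow_one]
          rcases le_total (∑' l, ‖c t l‖ₑ) 1 with h | h
          · exact h.trans le_self_add
          · exact (le_self_pow₀ h two_ne_zero).trans le_add_self
      _ = _ := lintegral_add_left measurable_const _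
      _ < ⊤ := add_lt_top.2 ⟨by simp, hc.fin⟩

lemma summable_cmul {c d : Mode → ℂ} (hc : Summable fun l => ‖c l‖) (hd : Summable fun l => ‖d l‖) :
    (∀ l, Summable fun k => c k * d (l - k)) ∧ Summable fun l => ‖∑' k, c k * d (l - k)‖ := by
  have h : ∑' l, ∑' k, ‖c k * d (l - k)‖ₑ ≠ ⊤ := by
    rw [tsum_conv_enorm]
    simp only [← ofReal_norm]
    exact ENNReal.mul_ne_top hc.tsum_ofReal_ne_top hd.tsum_ofReal_ne_top
  refine ⟨fun l => Summable.of_enorm (ENNReal.ne_top_of_tsum_ne_top h l), ?_⟩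
  refine summable_norm_iff.2 (Summable.of_enorm (ne_top_of_le_ne_top h ?_))
  exact tsum_le_tsum fun l => enorm_tsum_le_tsum_enorm

/-- The product of trigonometric series. -/
lemma synth_mul {c d : Mode → ℂ} (hc : Summable fun l => ‖c l‖) (hd : Summable fun l => ‖d l‖)
    {q : Pt} (hq : q ∈ cell) : synth c q * synth d q = synth (fun l => ∑' k, c k * d (l - k)) q := by
  have h1 := continuous_synth hc
  have h2 := continuous_synth hd
  have h3 := (summable_cmul hc hd).2
  have h4 : MemLp (fun q => synth c q * synth d q) 2 μc := (memLp_synth hd 2).mul (memLp_synth hc ⊤)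
  exact Measure.eqOn_open_of_ae_eq (ae_eq_of_ccoeff_eq h4 (memLp_synth h3 2) fun l => by
    rw [ccoeff_synth h3, ← (hasSum_ccoeff_mul (memLp_synth hc 2) (memLp_synth hd 2) l).tsum_eq]
    simp only [ccoeff_synth hc, ccoeff_synth hd])
    (isOpen_Ioo.prod (isOpen_Ioo.prod isOpen_Ioo)) (h1.mul h2).continuousOn
    (continuous_synth h3).continuousOn hq

lemma cell_subset : cell ⊆ Icc 0 1 ×ˢ Icc 0 1 ×ˢ Icc (-1 : ℝ) 1 :=
  prod_mono Ioo_subset_Icc_self (prod_mono Ioo_subset_Icc_self Ioo_subset_Icc_self)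

lemma measurableSet_cell : MeasurableSet cell :=
  measurableSet_Ioo.prod (measurableSet_Ioo.prod measurableSet_Ioo)

lemma exists_slab_bound (s t) {ψ : ℝ × Pt → E}
    (h : Continuous ψ) : ∃ B, ∀ x ∈ Icc s t, ∀ q ∈ cell, ‖ψ (x, q)‖ ≤ B := by
  obtain ⟨B, hB⟩ := ((isCompact_Icc (a := s) (b := t)).prod ((isCompact_Icc (a := 0) (b := 1)).prod
    ((isCompact_Icc (a := 0) (b := 1)).prod
      (isCompact_Icc (a := (-1 : ℝ)) (b := 1))))).exists_bound_of_continuousOn h.continuousOn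
  exact ⟨B, fun x hx q hq => hB _ ⟨hx, cell_subset hq⟩⟩

/-- The pairing of a function on space-time with a wave. -/
def tcoef (ψ : ℝ × Pt → ℝ) (l : Mode) (t : ℝ) : ℂ := ∫ q, wave l q * (ψ (t, q) : ℂ) ∂μc

lemma ae_mem_slab (T) : ∀ᵐ p ∂μs T, p.1 ∈ Ioo 0 T ∧ p.2 ∈ cell :=
  ae_restrict_mem (measurableSet_Ioo.prod measurableSet_cell)

/-- The function is integrable and the integral is the sum of the time integrals of `h`. -/
structure HasPairing (T : ℝ) (f : ℝ × Pt → ℂ) (h : Mode → ℝ → ℂ) : Prop where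
  integrable : Integrable f (μs T)
  integrableOn : ∀ l, IntegrableOn (h l) (Ioo 0 T)
  hasSum : HasSum (fun l => ∫ t in Ioo 0 T, h l t) (∫ p, f p ∂μs T)

lemma HasPairing.add {f g : ℝ × Pt → ℂ} {h j : Mode → ℝ → ℂ} (hf : HasPairing T f h)
    (hg : HasPairing T g j) : HasPairing T (fun p => f p + g p) fun l t => h l t + j l t where
  integrable := hf.1.add hg.1
  integrableOn l := (hf.2 l).add (hg.2 l)
  hasSum := by
    rw [integral_add hf.1 hg.1]
    exact (hf.3.add hg.3).congr_fun fun l => integral_add (hf.2 l) (hg.2 l)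

lemma HasPairing.const_mul {f : ℝ × Pt → ℂ} {h : Mode → ℝ → ℂ} (hf : HasPairing T f h)
    (c) : HasPairing T (fun p => c * f p) fun l t => c * h l t where
  integrable := hf.1.const_mul c
  integrableOn l := (hf.2 l).const_mul c
  hasSum := by
    rw [integral_const_mul]
    exact (hf.3.mul_left c).congr_fun fun l => integral_const_mul _ _

lemma IsFamily.hasPairing {c} (hc : IsFamily T 1 c) (hψ : Continuous ψ) :
    HasPairing T (fun p => synth (c p.1) p.2 * ψ p) fun l t => c t l * tcoef ψ l t := by
  obtain ⟨B, hB⟩ := exists_slab_bound 0 T hψ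
  have hm : ∀ l, AEStronglyMeasurable (fun p : ℝ × Pt => c p.1 l * wave l p.2 * ψ p) (μs T) := fun l => by
    have h1 : AEMeasurable (fun p : ℝ × Pt => c p.1 l) (μs T) := by
      rw [slabMeasure_eq_prod]
      exact (hc.meas l).comp_quasiMeasurePreserving Measure.quasiMeasurePreserving_fst
    have h2 : Continuous fun p : ℝ × Pt => wave l p.2 := (continuous_wave l).comp continuous_snd
    exact ((h1.mul h2.aemeasurable).mul (Complex.continuous_ofReal.comp hψ).aemeasurable).aestronglyMeasurable
  have hB' : ∀ᵐ p ∂μs T, ‖((ψ p : ℝ) : ℂ)‖ₑ ≤ ofReal B := by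
    filter_upwards [ae_mem_slab T] with p hp
    rw [← ofReal_norm, norm_real]
    exact ofReal_le_ofReal (hB p.1 (Ioo_subset_Icc_self hp.1) p.2 hp.2)
  have hfin : ∫⁻ p, ∑' l, ‖c p.1 l * wave l p.2 * ψ p‖ₑ ∂μs T < ⊤ := by
    calc _ ≤ ∫⁻ p, (fun t => ∑' l, ‖c t l‖ₑ) p.1 * ofReal B ∂μs T := by
          refine lintegral_mono_ae ?_
          filter_upwards [hB'] with p hp
          rw [← ENNReal.tsum_mul_right]
          refine tsum_le_tsum fun l => ?_
          rw [enorm_mul, ← ofReal_norm (c p.1 l * _), norm_mul_wave, ofReal_norm]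
          gcongr
      _ = ∫⁻ t in Ioo 0 T, (∑' l, ‖c t l‖ₑ) * ofReal B * μc univ := by
          rw [slabMeasure_eq_prod, lintegral_prod]
          · simp only [lintegral_const]
          · exact (hc.aemeasurable.comp_quasiMeasurePreserving Measure.quasiMeasurePreserving_fst).mul_const _
      _ < ⊤ := by
          simp only [mul_assoc]
          have h := hc.fin
          simp only [pow_one] at h
          rw [lintegral_mul_const'' _ hc.aemeasurable]
          exact mul_lt_top h (mul_lt_top ofReal_lt_top (measure_lt_top _ _))
  have hfin' := hfin
  rw [lintegral_tsum fun l => (hm l).enorm] at hfin'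
  have hint : ∀ l, Integrable (fun p : ℝ × Pt => c p.1 l * wave l p.2 * ψ p) (μs T) := fun l =>
    ⟨hm l, (le_tsum l).trans_lt hfin'⟩
  have hS : (fun p : ℝ × Pt => synth (c p.1) p.2 * ψ p) =
      fun p => ∑' l, c p.1 l * wave l p.2 * ψ p := by ext p; rw [synth, tsum_mul_right]
  have hterm : ∀ l, IntegrableOn (fun t => c t l * tcoef ψ l t) (Ioo 0 T) ∧
      ∫ p, c p.1 l * wave l p.2 * ψ p ∂μs T = ∫ t in Ioo 0 T, c t l * tcoef ψ l t := fun l => by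
    have h := hint l
    rw [slabMeasure_eq_prod] at h ⊢
    have h1 : (fun t => c t l * tcoef ψ l t) = fun t => ∫ q, c t l * wave l q * ψ (t, q) ∂μc := by
      ext t
      simp only [tcoef, mul_assoc]
      rw [integral_const_mul]
    rw [h1]
    exact ⟨h.integral_prod_left, integral_prod _ h⟩
  rw [hS]
  refine ⟨⟨(AEMeasurable.tsum fun l => (hm l).aemeasurable).aestronglyMeasurable,
    (lintegral_mono fun p => enorm_tsum_le_tsum_enorm).trans_lt hfin⟩, fun l => (hterm l).1, ?_⟩
  refine (hasSum_integral_of_summable_integral_norm hint ?_).congr_fun fun l => (hterm l).2.symm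
  refine (ENNReal.summable_toReal hfin'.ne).congr fun l => ?_
  rw [integral_norm_eq_lintegral_enorm (hm l)]


/-! ### Test functions against waves -/

lemma integrable_of_continuous {f : Pt → E} (hf : Continuous f) : Integrable f μc :=
  (hf.continuousOn.integrableOn_compact (isCompact_Icc.prod (isCompact_Icc.prod isCompact_Icc))).mono_set
    cell_subset

lemma integral_deriv_eq_zero {a} (hab : a ≤ b) {g g' : ℝ → ℂ} (hd : ∀ x, HasDerivAt g (g' x) x)
    (hc : Continuous g') (hp : g b = g a) : ∫ x in Ioo a b, g' x = 0 := by
  rw [← integral_Ioc_eq_integral_Ioo, ← integral_of_le hab,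
    intervalIntegral.integral_eq_sub_of_hasDerivAt (fun x _ => hd x) (hc.intervalIntegrable _ _), hp, sub_self]

/-- The integral over the torus of a partial derivative vanishes. -/
lemma integral_fderiv_eq_zero {G : Pt → ℂ} (hG : ContDiff ℝ 1 G)
    (hp : ∀ x y z, G (x + 1, y, z) = G (x, y, z) ∧ G (x, y + 1, z) = G (x, y, z) ∧
      G (x, y, z + 2) = G (x, y, z)) (v) : ∫ q, fderiv ℝ G q v ∂μc = 0 := by
  have hd := hG.differentiable num!
  have hc : ∀ v, Continuous fun q => fderiv ℝ G q v := fun v =>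
    (hG.continuous_fderiv num!).clm_apply continuous_const
  have hi := fun v => integrable_of_continuous (hc v)
  have hdir : ∀ (v : Pt) (γ : ℝ → Pt) (x : ℝ), HasDerivAt γ v x →
    HasDerivAt (fun x => G (γ x)) (fderiv ℝ G (γ x) v) x := fun v γ x h =>
    (hd (γ x)).hasFDerivAt.comp_hasDerivAt x h
  have h1 : ∫ q, fderiv ℝ G q (1, 0, 0) ∂μc = 0 := by
    have h := hi (1, 0, 0)
    rw [cellMeasure_eq_prod] at h ⊢
    rw [integral_prod_symm _ h]
    refine (integral_congr_ae (.of_forall fun q => ?_)).trans (integral_zero _ _)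
    refine integral_deriv_eq_zero (g := fun x => G (x, q)) zero_le_one
      (fun x => hdir _ (fun x => (x, q)) x ((hasDerivAt_id x).prodMk (hasDerivAt_const x q)))
      ((hc _).comp (by fun_prop)) ?_
    have := (hp 0 q.1 q.2).1
    rwa [zero_add] at this
  have h2 : ∫ q, fderiv ℝ G q (0, 1, 0) ∂μc = 0 := by
    have h := hi (0, 1, 0)
    rw [cellMeasure_eq_prod] at h ⊢
    rw [integral_prod _ h]
    refine (integral_congr_ae ?_).trans (integral_zero _ _)
    filter_upwards [h.prod_right_ae] with x hx
    rw [integral_prod_symm _ hx]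
    refine (integral_congr_ae (.of_forall fun z => ?_)).trans (integral_zero _ _)
    refine integral_deriv_eq_zero (g := fun y => G (x, y, z)) zero_le_one
      (fun y => hdir _ (fun y => (x, y, z)) y ((hasDerivAt_const y x).prodMk
        ((hasDerivAt_id y).prodMk (hasDerivAt_const y z)))) ((hc _).comp (by fun_prop)) ?_
    have := (hp x 0 z).2.1
    rwa [zero_add] at this
  have h3 : ∫ q, fderiv ℝ G q (0, 0, 1) ∂μc = 0 := by
    have h := hi (0, 0, 1)
    rw [cellMeasure_eq_prod] at h ⊢
    rw [integral_prod _ h]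
    refine (integral_congr_ae ?_).trans (integral_zero _ _)
    filter_upwards [h.prod_right_ae] with x hx
    rw [integral_prod _ hx]
    refine (integral_congr_ae (.of_forall fun y => ?_)).trans (integral_zero _ _)
    refine integral_deriv_eq_zero (g := fun z => G (x, y, z)) num!
      (fun z => hdir _ (fun z => (x, y, z)) z ((hasDerivAt_const z x).prodMk
        ((hasDerivAt_const z y).prodMk (hasDerivAt_id z)))) ((hc _).comp (by fun_prop)) ?_
    have := (hp x y (-1)).2.2
    norm_num at this
    exact this
  have hv : v = v.1 • ((1, 0, 0) : Pt) + v.2.1 • ((0, 1, 0) : Pt) + v.2.2 • ((0, 0, 1) : Pt) := by ext <;> simp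
  have key : ∀ v, ∫ q, fderiv ℝ G q v ∂μc = (∫ q, fderiv ℝ G q ∂μc) v := fun v =>
    (ContinuousLinearMap.integral_apply (integrable_of_continuous (hG.continuous_fderiv num!)) v).symm
  rw [key] at h1 h2 h3
  rw [key, hv]
  simp only [map_add, map_smul, h1, h2, h3, smul_zero, add_zero]

lemma hasFDerivAt_wave (l) (q v) :
    DifferentiableAt ℝ (wave l) q ∧ fderiv ℝ (wave l) q v = I * phase l v * wave l q := by
  let L : Pt →ₗ[ℝ] ℝ := ⟨⟨phase l, fun a b => by simp [phase]; ring⟩, fun a b => by simp [phase]; ring⟩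
  have h := ((ofRealCLM.comp L.toContinuousLinearMap).hasFDerivAt (x := q).const_mul I).cexp
  have h' : HasFDerivAt (wave l) _ q := h
  refine ⟨h'.differentiableAt, ?_⟩
  rw [h'.fderiv]
  have h7 : L v = phase l v := rfl
  have h8 : L q = phase l q := rfl
  simp [h7, h8, wave]
  ring

lemma contDiff_wave (l) : ContDiff ℝ (⊤ : ℕ∞) (wave l) :=
  (contDiff_const.mul (ofRealCLM.contDiff.comp (contDiff_phase l))).cexp

lemma IsTest.contDiff_fderiv (h : IsTest ψ) (v : ℝ × Pt) : ContDiff ℝ (⊤ : ℕ∞) fun p => fderiv ℝ ψ p v :=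
  (h.smooth.fderiv_right (m := (⊤ : ℕ∞)) (by simp)).clm_apply contDiff_const

lemma IsTest.fderiv (h : IsTest ψ) (v : ℝ × Pt) : IsTest fun p => _root_.fderiv ℝ ψ p v where
  smooth := h.contDiff_fderiv v
  periodic t x y z := by
    have key : ∀ a : ℝ × Pt, (∀ p, ψ (p + a) = ψ p) → ∀ p,
      _root_.fderiv ℝ ψ (p + a) v = _root_.fderiv ℝ ψ p v := fun a ha p => by
      rw [← fderiv_comp_add_right, funext ha]
    have k1 := key (0, 1, 0, 0) (fun p => by
      have := (h.periodic p.1 p.2.1 p.2.2.1 p.2.2.2).1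
      rwa [show p + (0, 1, 0, 0) = (p.1 + 0, p.2.1 + 1, p.2.2.1 + 0, p.2.2.2 + 0) from rfl, add_zero, add_zero, add_zero]) (t, x, y, z)
    have k2 := key (0, 0, 1, 0) (fun p => by
      have := (h.periodic p.1 p.2.1 p.2.2.1 p.2.2.2).2.1
      rwa [show p + (0, 0, 1, 0) = (p.1 + 0, p.2.1 + 0, p.2.2.1 + 1, p.2.2.2 + 0) from rfl, add_zero, add_zero, add_zero]) (t, x, y, z)
    have k3 := key (0, 0, 0, 2) (fun p => by
      have := (h.periodic p.1 p.2.1 p.2.2.1 p.2.2.2).2.2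
      rwa [show p + (0, 0, 0, 2) = (p.1 + 0, p.2.1 + 0, p.2.2.1 + 0, p.2.2.2 + 2) from rfl, add_zero, add_zero, add_zero]) (t, x, y, z)
    simp only [Prod.mk_add_mk, add_zero] at k1 k2 k3
    exact ⟨k1, k2, k3⟩

/-- Integration by parts on the torus. -/
lemma tcoef_fderiv (h : IsTest ψ) (v) (l) (t) :
    tcoef (fun p => fderiv ℝ ψ p (0, v)) l t = -(I * phase l v) * tcoef ψ l t := by
  have hψ : ContDiff ℝ (⊤ : ℕ∞) fun q => ψ (t, q) := h.smooth.comp (by fun_prop)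
  have hψc : ContDiff ℝ (⊤ : ℕ∞) fun q => (ψ (t, q) : ℂ) := ofRealCLM.contDiff.comp hψ
  have h0 := integral_fderiv_eq_zero (G := fun q => wave l q * ψ (t, q))
    (((contDiff_wave l).mul hψc).of_le (by simp)) (fun x y z => by
      have h1 := wave_periodic l x y z
      have h2 := h.periodic t x y z
      simp only [h1.1, h1.2.1, h1.2.2, h2.1, h2.2.1, h2.2.2, and_self]) v
  have h1 : ∀ q, fderiv ℝ (fun q => wave l q * (ψ (t, q) : ℂ)) q v =
    wave l q * (fderiv ℝ ψ (t, q) (0, v) : ℝ) + I * phase l v * (wave l q * ψ (t, q)) := fun q => by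
    obtain ⟨w1, w2⟩ := hasFDerivAt_wave l q v
    have e1 : HasFDerivAt (fun q => ψ (t, q)) ((fderiv ℝ ψ (t, q)).comp (ContinuousLinearMap.inr ℝ ℝ Pt)) q :=
      ((h.smooth.differentiable (by simp)) (t, q)).hasFDerivAt.comp q (hasFDerivAt_prodMk_right t q)
    have e2 : HasFDerivAt (fun q => (ψ (t, q) : ℂ)) _ q := ofRealCLM.hasFDerivAt.comp q e1
    have e3 : HasFDerivAt (fun q => wave l q * (ψ (t, q) : ℂ)) _ q := w1.hasFDerivAt.mul e2
    rw [e3.fderiv]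
    simp [w2]
    ring
  have hc := (h.contDiff_fderiv (0, v)).continuous
  have hw := continuous_wave l
  simp only [h1] at h0
  have hψc' := hψc.continuous
  rw [integral_add (integrable_of_continuous (by fun_prop)) (integrable_of_continuous (by fun_prop)),
    integral_const_mul] at h0
  unfold tcoef
  linear_combination h0

lemma IsTest.hasDerivAt_tcoef (h : IsTest ψ) (l) (t) : HasDerivAt (tcoef ψ l) (tcoef (dt ψ) l t) t := by
  have hc := (h.contDiff_fderiv (1, 0, 0, 0)).continuous
  have hψ := h.smooth.continuous
  have hw := continuous_wave l
  obtain ⟨B, hB⟩ := exists_slab_bound (t - 1) (t + 1) hc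
  refine (hasDerivAt_integral_of_dominated_loc_of_deriv_le (F := fun t q => wave l q * (ψ (t, q) : ℂ))
    (F' := fun t q => wave l q * (dt ψ (t, q) : ℂ)) (bound := fun _ => B)
    (Metric.ball_mem_nhds t one_pos) (.of_forall fun s => ?_)
    (integrable_of_continuous (by fun_prop)) ?_ ?_ (integrable_const _) ?_).2
  · exact (show Continuous fun q => wave l q * (ψ (s, q) : ℂ) by fun_prop).aestronglyMeasurable
  · unfold dt
    exact (show Continuous fun q => wave l q * ((_root_.fderiv ℝ ψ (t, q) (1, 0, 0, 0) : ℝ) : ℂ) by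
      fun_prop).aestronglyMeasurable
  · refine ae_restrict_of_forall_mem measurableSet_cell (fun q hq s hs => ?_)
    rw [norm_mul, norm_wave, one_mul, norm_real]
    rw [Real.ball_eq_Ioo] at hs
    exact hB s (Ioo_subset_Icc_self hs) q hq
  · refine .of_forall fun q s _ => ?_
    have h1 : HasDerivAt (fun s => ψ (s, q)) (dt ψ (s, q)) s :=
      ((h.smooth.differentiable (by simp)) (s, q)).hasFDerivAt.comp_hasDerivAt s
        ((hasDerivAt_id s).prodMk (hasDerivAt_const s q))
    exact (h1.ofReal_comp).const_mul (wave l q)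

lemma IsTest.dt (h : IsTest ψ) : IsTest (dt ψ) := h.fderiv _

lemma IsTest.dz (h : IsTest ψ) : IsTest (dz ψ) := h.fderiv _

lemma IsTest.dh (h : IsTest ψ) (j) : IsTest (dh j ψ) := h.fderiv _

lemma IsTest.continuous_tcoef (h : IsTest ψ) (l) : Continuous (tcoef ψ l) :=
  continuous_iff_continuousAt.2 fun t => (h.hasDerivAt_tcoef l t).continuousAt

lemma IsTest.tcoef_dz (h : IsTest ψ) (l) (t) :
    tcoef (PrimEq.dz ψ) l t = -(I * ((π * l.2.2 : ℝ) : ℂ)) * tcoef ψ l t := by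
  have := tcoef_fderiv h (0, 0, 1) l t
  simp only [phase, mul_zero, zero_add, mul_one] at this
  exact this

lemma IsTest.tcoef_dh (h : IsTest ψ) (j) (l) (t) :
    tcoef (PrimEq.dh j ψ) l t = -(I * hvec l j) * tcoef ψ l t := by
  fin_cases j
  · have := tcoef_fderiv h (1, 0, 0) l t
    simp only [phase, mul_zero, add_zero, mul_one] at this
    exact this
  · have := tcoef_fderiv h (0, 1, 0) l t
    simp only [phase, mul_zero, zero_add, add_zero, mul_one] at this
    exact this


/-! ### From Fourier coefficients to weak solutions -/

/-- The velocity with the given Fourier coefficients. -/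
def velocity (a : Coef) (q : Pt) : Vel := WithLp.toLp 2 fun i => (synth (fun k => a k i) q).re

/-- The Fourier coefficients of the pressure. -/
def pcoef (Ω : ℝ) (a : Coef) (l : Mode) : ℂ := if l.2.2 = 0 then
  I * (hdot l (conv a a l + (Ω : ℂ) • cperp (a l)) / ((kh l ^ 2 : ℝ) : ℂ)) else 0

lemma norm_cvel_apply_le (a : CVel) (i : Fin 2) : ‖a i‖ ≤ ‖a‖ := PiLp.norm_apply_le a i

lemma summable_apply {a : Coef} (h : Summable fun k => ‖a k‖) (i) : Summable fun k => ‖a k i‖ :=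
  Summable.of_nonneg_of_le (fun _ => norm_nonneg _) (fun _ => norm_cvel_apply_le _ i) h

lemma velocity_apply {a} (hs : IsSymmetric a) (q) (i) :
    (velocity a q i) = synth (fun k => a k i) q := conj_eq_iff_re.1 (conj_synth (hs.herm · i) q)

lemma velocity_reflect {a} (hs : IsSymmetric a) (q) :
    velocity a (reflect q) = velocity a q := by simp only [velocity, synth_reflect, hs.flip]

lemma memLp_velocity {a} (h : Summable fun k => ‖a k‖) (p) : MemLp (velocity a) p μc :=
  MemLp.of_eval_piLp fun i => (memLp_synth (summable_apply h i) p).re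

lemma fc_velocity {a : Coef} (hs : IsSymmetric a) (h : Summable fun k => ‖a k‖) : fc (velocity a) = a := by
  ext k i
  rw [fc_apply, ← ccoeff_synth (summable_apply h i) k]
  simp only [velocity_apply hs]

lemma synth_pcoef (Ω) (a) (q) : synth (pcoef Ω a) (q.1, q.2.1, 0) = synth (pcoef Ω a) q := by
  refine tsum_congr fun l => ?_
  unfold pcoef
  split_ifs with h
  · simp [wave, phase, h]
  · simp

lemma conv_apply {a : Coef} (hs : IsSymmetric a)
    (h : Summable fun k => ‖a k‖) (ho : Summable fun k => ‖om k (a k)‖) (l) (i) :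
    conv a a l i = I * (hvec l 0 * (∑' k, a k 0 * a (l - k) i) + hvec l 1 * (∑' k, a k 1 * a (l - k) i) +
      ((π * l.2.2 : ℝ) : ℂ) * ∑' k, om k (a k) * a (l - k) i) := by
  have hw : ∀ q, (((synth (fun k => om k (a k)) q).re : ℝ) : ℂ) = synth (fun k => om k (a k)) q :=
    fun q => conj_eq_iff_re.1 (conj_synth (fun k => om_conj (hs.herm k) k) q)
  have hm := memLp_synth ho 2
  have := conv_fc_apply (memLp_velocity h 2) (w := fun q => (synth (fun k => om k (a k)) q).re) hm.re
    (fun k => by simp only [hw, fc_velocity hs h, ccoeff_synth ho]) l i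
  have hA := fun i => memLp_synth (summable_apply h i) 2
  simp only [fc_velocity hs h, velocity_apply hs, hw, ← (hasSum_ccoeff_mul (hA _) (hA i) l).tsum_eq,
    ← (hasSum_ccoeff_mul hm (hA i) l).tsum_eq, ccoeff_synth ho, ccoeff_synth (summable_apply h _)] at this
  exact this

lemma norm_pcoef_le (Ω) (a) (l) :
    ‖pcoef Ω a l‖ₑ ≤ ∑' k, ‖(‖a k‖ : ℂ) * (‖a (l - k)‖ : ℂ)‖ₑ + ofReal |Ω| * ‖a l‖ₑ := by
  unfold pcoef
  split_ifs with hl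
  swap
  · simp
  rcases kh_eq_zero_or l with h0 | h0
  · simp [h0]
  have hpos : 0 < kh l := lin!
  have h1 : ∀ b : CVel, ‖I * (hdot l b / ((kh l ^ 2 : ℝ) : ℂ))‖ ≤ (kh l)⁻¹ * ‖b‖ := fun b => by
    rw [norm_mul, norm_I, one_mul, norm_div, norm_real, norm_eq_abs, abs_of_nonneg pos!]
    calc _ ≤ kh l * ‖b‖ / kh l ^ 2 := by gcongr; exact norm_hdot_le l b
      _ = _ := by field_simp
  have h2 : ∀ b : CVel, ‖I * (hdot l b / ((kh l ^ 2 : ℝ) : ℂ))‖ₑ ≤ ofReal (kh l)⁻¹ * ‖b‖ₑ := fun b => by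
    rw [← ofReal_norm, ← ofReal_norm, ← ofReal_mul pos!]
    exact ofReal_le_ofReal (h1 b)
  rw [hdot_add, add_div, mul_add]
  refine (enorm_add_le _ _).trans (add_le_add ((h2 _).trans ?_) ((h2 _).trans ?_))
  · refine (mul_le_mul_right enorm_tsum_le_tsum_enorm _).trans ?_
    rw [← ENNReal.tsum_mul_left]
    refine tsum_le_tsum fun k => ?_
    have h3 : ‖usym l k (a k)‖ ≤ kh l * ‖a k‖ := by
      rw [usym, hl]
      simpa using norm_hdot_le l (a k)
    rw [← ofReal_norm, ← ofReal_norm, ← ofReal_mul pos!]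
    refine ofReal_le_ofReal ?_
    simp only [norm_smul, norm_mul, norm_I, one_mul, norm_real, norm_norm]
    calc _ ≤ (kh l)⁻¹ * (kh l * ‖a k‖ * ‖a (l - k)‖) := by gcongr
      _ = _ := by field_simp
  · rw [← ofReal_norm, ← ofReal_norm, ← ofReal_mul pos!, ← ofReal_mul pos!]
    refine ofReal_le_ofReal ?_
    rw [norm_smul, norm_cperp, norm_real, norm_eq_abs]
    exact mul_le_of_le_one_left pos! (inv_le_one_of_one_le₀ h0)


/-- The curve of symmetric Fourier coefficients has a horizontal derivative which is summable, with a
square integrable sum. -/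
structure IsRegularCurve (T : ℝ) (a : ℝ → Coef) : Prop where
  cont : ∀ k, ContinuousOn (fun t => a t k) (Icc 0 T)
  symm : ∀ t ∈ Icc 0 T, IsSymmetric (a t)
  fin : ∫⁻ t in Ioo 0 T, (∑' k, ofReal (1 + kh k) * ‖a t k‖ₑ) ^ 2 < ⊤

lemma IsRegularCurve.meas (h : IsRegularCurve T a) (k) : AEMeasurable (fun t => a t k) vol[T] :=
  ((h.cont k).mono Ioo_subset_Icc_self).aemeasurable measurableSet_Ioo

lemma IsRegularCurve.meas_apply (h : IsRegularCurve T a) (k) (i) : AEMeasurable (fun t => a t k i) vol[T] :=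
  (proj (𝕜 := ℂ) i).continuous.measurable.comp_aemeasurable (h.meas k)

lemma IsRegularCurve.isFamily (h : IsRegularCurve T a) {c} (hm : ∀ l, AEMeasurable (fun t => c t l) vol[T])
    (hc : ∀ t l, ‖c t l‖ ≤ (1 + kh l) * ‖a t l‖) : IsFamily T 2 c where
  meas := hm
  fin := by
    refine (lintegral_mono fun t => ?_).trans_lt h.fin
    refine pow_le_pow_left' (tsum_le_tsum fun l => ?_) 2
    rw [← ofReal_norm, ← ofReal_norm, ← ofReal_mul (by have := kh_nonneg l; positivity)]
    exact ofReal_le_ofReal (hc t l)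

lemma le_one_add_kh_mul (l : Mode) (b : CVel) : ‖b‖ ≤ (1 + kh l) * ‖b‖ :=
  le_mul_of_one_le_left (norm_nonneg _) (by linarith [kh_nonneg l])

lemma IsRegularCurve.isFamily_apply (h : IsRegularCurve T a)
    (i) : IsFamily T 2 fun t l => a t l i := h.isFamily (fun l => h.meas_apply l i) fun _ l =>
    (norm_cvel_apply_le _ i).trans (le_one_add_kh_mul l _)

lemma IsRegularCurve.isFamily_norm (h : IsRegularCurve T a) : IsFamily T 2 fun t l => (‖a t l‖ : ℂ) :=
  h.isFamily (fun l => Complex.measurable_ofReal.comp_aemeasurable (h.meas l).norm) fun t l => by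
    rw [norm_real, norm_norm]; exact le_one_add_kh_mul l _

lemma IsRegularCurve.isFamily_om (h : IsRegularCurve T a) : IsFamily T 2 fun t l => om l (a t l) := by
  refine h.isFamily (fun l => ?_) fun t l => (norm_om_le' l _).trans ?_
  · have := h.meas_apply l
    unfold om hdot
    exact (((this 0).const_mul _).add ((this 1).const_mul _)).neg.div_const _
  · gcongr; linarith

lemma IsRegularCurve.isFamily_cperp (h : IsRegularCurve T a)
    (i : Fin 2) : IsFamily T 2 fun t l => cperp (a t l) i := by
  refine h.isFamily (fun l => ?_) fun t l =>
    ((norm_cvel_apply_le _ i).trans_eq (norm_cperp _)).trans (le_one_add_kh_mul l _)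
  have := h.meas_apply l
  fin_cases i
  · exact (this 1).neg
  · exact this 0

lemma IsRegularCurve.isFamily_pcoef (h : IsRegularCurve T a) (Ω) : IsFamily T 1 fun t l => pcoef Ω (a t) l where
  meas l := by
    have h1 := fun k => h.meas_apply k
    have h2 : AEMeasurable (fun t => conv (a t) (a t) l) vol[T] := by
      refine AEMeasurable.tsum fun k => ?_
      have h2 : AEMeasurable (fun t => I * usym l k (a t k)) vol[T] := by
        unfold usym om hdot
        have := h1 k
        fun_prop
      exact h2.smul (h.meas _)
    have h3 : ∀ i, AEMeasurable (fun t => conv (a t) (a t) l i) vol[T] := fun i =>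
      (proj (𝕜 := ℂ) i).continuous.measurable.comp_aemeasurable h2
    have h4 := fun i => (h.isFamily_cperp i).meas l
    unfold pcoef hdot
    split_ifs
    · simp only [PiLp.add_apply, PiLp.smul_apply]
      fun_prop
    · fun_prop
  fin := by
    have h1 := (h.isFamily_norm.mul h.isFamily_norm)
    have h2 := h.isFamily_norm.one.fin
    have h3 : ∫⁻ t in Ioo 0 T, (∑' l, ∑' k, ‖(‖a t k‖ : ℂ) * (‖a t (l - k)‖ : ℂ)‖ₑ) < ⊤ := by
      have := h.isFamily_norm.fin
      exact (lintegral_congr fun t => (tsum_conv_enorm (fun k => (‖a t k‖ : ℂ)) _).trans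
        (sq _).symm).trans_lt this
    calc _ ≤ ∫⁻ t in Ioo 0 T, ((∑' l, ∑' k, ‖(‖a t k‖ : ℂ) * (‖a t (l - k)‖ : ℂ)‖ₑ) +
          ofReal |Ω| * ∑' l, ‖((‖a t l‖ : ℝ) : ℂ)‖ₑ) := by
          refine lintegral_mono fun t => ?_
          rw [pow_one, ← ENNReal.tsum_mul_left, ← tsum_add]
          refine tsum_le_tsum fun l => (norm_pcoef_le Ω (a t) l).trans_eq ?_
          rw [← ofReal_norm ((‖a t l‖ : ℝ) : ℂ), norm_real, norm_norm, ofReal_norm]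
      _ = _ := lintegral_add_right' _ (h.isFamily_norm.aemeasurable.const_mul _)
      _ < ⊤ := by
          rw [lintegral_const_mul'' _ h.isFamily_norm.aemeasurable]
          simp only [pow_one] at h2
          exact add_lt_top.2 ⟨h3, mul_lt_top ofReal_lt_top h2⟩

lemma ae_fst {p : ℝ → Prop} (h : ∀ᵐ t ∂vol[T], p t) : ∀ᵐ x ∂μs T, p x.1 := by
  rw [slabMeasure_eq_prod]
  exact Measure.quasiMeasurePreserving_fst.ae h


lemma IsFamily.integrable {c} (hc : IsFamily T 1 c) : Integrable (fun p => synth (c p.1) p.2) (μs T) := by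
  simpa using (hc.hasPairing (ψ := fun _ => 1) continuous_const).integrable

lemma IsFamily.ae_mul {c d} (hc : IsFamily T 2 c) (hd : IsFamily T 2 d) :
    ∀ᵐ p ∂μs T, synth (c p.1) p.2 * synth (d p.1) p.2 = synth (cmul c d p.1) p.2 := by
  filter_upwards [ae_mem_slab T, ae_fst (hc.ae_summable two_ne_zero), ae_fst (hd.ae_summable two_ne_zero)]
    with p hp h1 h2
  exact synth_mul h1 h2 hp.2

lemma IsFamily.memLp_re {c} (hc : IsFamily T 2 c)
    (hr : ∀ t ∈ Ioo 0 T, ∀ q, ((synth (c t) q).re : ℂ) = synth (c t) q) :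
    MemLp (fun p => (synth (c p.1) p.2).re) 2 (μs T) := by
  refine (memLp_two_iff_integrable_sq hc.one.integrable.re.1).2 ?_
  refine (hc.mul hc).integrable.re.congr ?_
  filter_upwards [ae_mem_slab T, hc.ae_mul hc] with p hp h
  rw [← h, ← hr _ hp.1, ← Complex.ofReal_mul, sq]
  rfl

lemma IsModeSolution.momentum (hT : 0 < T)
    (h : IsModeSolution ν Ω T a) (ha : IsRegularCurve T a) (hV₀ : MemLp V₀ 2 μc)
    (h0 : ∀ k, a 0 k = fc V₀ k) {φ : ℝ × Pt → ℝ} (hφ : IsTest φ) (hφT : ∀ q, φ (T, q) = 0) (i) :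
    ∃ f : ℝ × Pt → ℂ, Integrable f (μs T) ∧ (∀ᵐ p ∂μs T, (f p).re =
      velocity (a p.1) p.2 i * dt φ p + (∑ j : Fin 2, velocity (a p.1) p.2 i *
        velocity (a p.1) p.2 j * dh j φ p) + (synth (fun l => om l (a p.1 l)) p.2).re *
        velocity (a p.1) p.2 i * dz φ p + ν * velocity (a p.1) p.2 i * dz (dz φ) p -
        Ω * perp (velocity (a p.1) p.2) i * φ p + (synth (pcoef Ω (a p.1)) p.2).re * dh i φ p) ∧
  ∫ p, f p ∂μs T + ((∫ q, V₀ q i * φ (0, q) ∂μc : ℝ) : ℂ) = 0 := by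
  have hA := ha.isFamily_apply
  have hW := ha.isFamily_om
  have P1 := (hA i).one.hasPairing hφ.dt.smooth.continuous
  have P2 := fun j => ((hA j).mul (hA i)).hasPairing (hφ.dh j).smooth.continuous
  have P3 := (hW.mul (hA i)).hasPairing hφ.dz.smooth.continuous
  have P4 := ((hA i).one.hasPairing hφ.dz.dz.smooth.continuous).const_mul ν
  have P5 := ((ha.isFamily_cperp i).one.hasPairing hφ.smooth.continuous).const_mul (-Ω)
  have P6 := (ha.isFamily_pcoef Ω).hasPairing (hφ.dh i).smooth.continuous
  have P := ((((P1.add ((P2 0).add (P2 1))).add P3).add P4).add P5).add P6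
  refine ⟨_, P.integrable, ?_, ?_⟩
  · filter_upwards [ae_mem_slab T, (hA 0).ae_mul (hA i), (hA 1).ae_mul (hA i), hW.ae_mul (hA i)]
      with p hp e1 e2 e3
    have hs := ha.symm p.1 (Ioo_subset_Icc_self hp.1)
    have hv := velocity_apply hs p.2
    have hw : (((synth (fun l => om l (a p.1 l)) p.2).re : ℝ) : ℂ) = synth (fun l => om l (a p.1 l)) p.2 :=
      conj_eq_iff_re.1 (conj_synth (fun k => om_conj (hs.herm k) k) p.2)
    have hp : synth (fun l => cperp (a p.1 l) i) p.2 = (perp (velocity (a p.1) p.2) i : ℝ) := by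
      fin_cases i
      · have : synth (fun l => cperp (a p.1 l) 0) p.2 = -synth (fun l => a p.1 l 1) p.2 := by
          simp [synth, cperp, tsum_neg]
        simp [this, ← hv, perp]
      · exact (hv 0).symm
    rw [← e1, ← e2, ← e3, hp, ← hv, ← hv, ← hv, ← hw, Fin.sum_univ_two]
    simp only [← Complex.ofReal_mul, ← Complex.ofReal_add, ← Complex.ofReal_neg, add_re,
      Complex.ofReal_re, Complex.re_mul_ofReal]
    ring
  · have hterm : ∀ l, ∫ t in Ioo 0 T, (a t l i * tcoef (dt φ) l t + (cmul (fun t l => a t l 0)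
      (fun t l => a t l i) t l * tcoef (dh 0 φ) l t + cmul (fun t l => a t l 1)
      (fun t l => a t l i) t l * tcoef (dh 1 φ) l t) + cmul (fun t l => om l (a t l))
      (fun t l => a t l i) t l * tcoef (dz φ) l t + ν * (a t l i * tcoef (dz (dz φ)) l t) +
      -Ω * (cperp (a t l) i * tcoef φ l t) + pcoef Ω (a t) l * tcoef (dh i φ) l t) =
      -(tcoef φ l 0 * fc V₀ l i) := fun l => by
      have hc := h.integrable l
      have e0 := integral_primitive_by_parts (D := fun t => a t l i) (g := fun t => rhs ν Ω (a t) l i)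
        hT.le (hφ.hasDerivAt_tcoef l) (hφ.dt.continuous_tcoef l)
        ((proj (𝕜 := ℂ) i).integrable_comp hc.1 |> fun h1 => ⟨h1,
          (proj (𝕜 := ℂ) i).integrable_comp hc.2⟩) fun t ht => by
          have e1 := congrArg (fun b => b i) (h.eq l t ht)
          rw [PiLp.add_apply] at e1
          refine e1.trans (congrArg _ ?_)
          exact ((proj (𝕜 := ℂ) i).intervalIntegral_comp_comm
            (hc.mono_set (uIcc_subset_uIcc_left (by rwa [uIcc_of_le hT.le])))).symm
      have e2 : tcoef φ l T = 0 := by simp [tcoef, hφT]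
      rw [e2, zero_mul, zero_sub, h0, integral_of_le hT.le, integral_Ioc_eq_integral_Ioo] at e0
      rw [← e0]
      refine integral_congr_ae ?_
      filter_upwards [ae_restrict_mem measurableSet_Ioo, ha.isFamily_norm.ae_summable two_ne_zero,
        hW.ae_summable two_ne_zero] with t ht s1 s2
      simp only [norm_real, norm_norm] at s1
      have e3 := conv_apply (ha.symm t (Ioo_subset_Icc_self ht)) s1 s2 l i
      have e4 : (leray l (conv (a t) (a t) l + (Ω : ℂ) • cperp (a t l))) i = conv (a t) (a t) l i +
        Ω * cperp (a t l) i + I * pcoef Ω (a t) l * hvec l i := by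
        unfold leray pcoef
        split_ifs
        · simp only [PiLp.sub_apply, PiLp.add_apply, PiLp.smul_apply, smul_eq_mul]
          linear_combination (-(hdot l (conv (a t) (a t) l + (Ω : ℂ) • cperp (a t l)) /
            ((kh l ^ 2 : ℝ) : ℂ)) * hvec l i) * I_mul_I
        · simp
      have e5 : ((ν * kz l ^ 2 : ℝ) : ℂ) = ν * ((π * l.2.2 : ℝ) : ℂ) ^ 2 := by
        rw [kz, mul_pow, sq_abs]; push_cast; ring
      simp only [hφ.tcoef_dh, hφ.tcoef_dz, hφ.dz.tcoef_dz, rhs, PiLp.sub_apply, PiLp.neg_apply,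
        PiLp.smul_apply, smul_eq_mul, e4, e3, e5, cmul]
      linear_combination (ν * ((π * l.2.2 : ℝ) : ℂ) ^ 2 * a t l i * tcoef φ l t) * I_mul_I
    have h1 := P.hasSum
    simp only [hterm] at h1
    have hφ0 : Continuous fun q => (φ (0, q) : ℂ) := by
      have := hφ.smooth.continuous
      fun_prop
    have hφm : MemLp (fun q => (φ (0, q) : ℂ)) 2 μc :=
      (memLp_two_iff_integrable_sq_norm hφ0.aestronglyMeasurable).2 (integrable_of_continuous (by fun_prop))
    have h2 := (hasSum_ccoeff hφm (memLp_component hV₀ i)).mul_left 2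
    have h3 : ∀ l, 2 * (conj (ccoeff (fun q => (φ (0, q) : ℂ)) l) *
      ccoeff (fun q => (V₀ q i : ℂ)) l) = tcoef φ l 0 * fc V₀ l i := fun l => by
      have h4 := ccoeff_conj (fun q => (φ (0, q) : ℂ)) (-l)
      simp only [conj_ofReal, neg_neg] at h4
      rw [← h4, ccoeff, neg_neg, tcoef, fc_apply]
      ring
    simp only [h3] at h2
    have h4 := h1.unique h2.neg
    rw [h4, ← integral_complex_ofReal]
    simp [mul_comm]


lemma IsRegularCurve.velocity_ae
    (hV : ∀ t ∈ Ioo 0 T, V t = velocity (a t)) : ∀ᵐ p ∂μs T, V p.1 = velocity (a p.1) :=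
  (ae_mem_slab T).mono fun p hp => hV p.1 hp.1

lemma IsModeSolution.weakContinuity (h : IsModeSolution ν Ω T a)
    (ha : IsRegularCurve T a) (hV : ∀ t ∈ Ioo 0 T, V t = velocity (a t)) :
    WeakContinuity T V fun t q => (synth (fun l => om l (a t l)) q).re := fun ψ hψ => by
  have P := (((ha.isFamily_apply 0).one.hasPairing (hψ.dh 0).smooth.continuous).add
    ((ha.isFamily_apply 1).one.hasPairing (hψ.dh 1).smooth.continuous)).add
    (ha.isFamily_om.one.hasPairing hψ.dz.smooth.continuous)
  have h1 := P.hasSum.unique ((hasSum_zero (α := ℂ) (β := Mode)).congr_fun fun l => by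
    refine (setIntegral_congr_fun (g := fun _ => 0) measurableSet_Ioo fun t ht => ?_).trans (by simp)
    have := usym_add (h.solenoidal t (Ioo_subset_Icc_self ht) l) 0
    simp only [add_zero, usym, hdot] at this
    simp only [hψ.tcoef_dh, hψ.tcoef_dz, hvec]
    simp at this ⊢
    linear_combination (-I * tcoef ψ l t) * this)
  have h2 := integral_re P.integrable
  rw [h1] at h2
  refine Eq.trans (integral_congr_ae ?_) h2
  filter_upwards [IsRegularCurve.velocity_ae hV] with p hp
  rw [hp, Fin.sum_univ_two]
  simp [velocity]

/-- A regular curve of Fourier coefficients which solves the evolution equation is a weak solution. -/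
lemma IsModeSolution.isWeakSolution (hT : 0 < T)
    (h : IsModeSolution ν Ω T a) (ha : IsRegularCurve T a) (hV₀ : MemLp V₀ 2 μc)
    (h0 : ∀ k, a 0 k = fc V₀ k) (hV : ∀ t ∈ Ioo 0 T, V t = velocity (a t)) : IsWeakSolution ν Ω T V₀ V where
  memLp := by
    refine MemLp.ae_eq ((IsRegularCurve.velocity_ae hV).mono fun p hp => (congrFun hp p.2).symm)
      (MemLp.of_eval_piLp fun i => ?_)
    exact (ha.isFamily_apply i).memLp_re fun t ht q => velocity_apply (ha.symm t (Ioo_subset_Icc_self ht)) q i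
  even := by
    filter_upwards [ae_mem_slab T, IsRegularCurve.velocity_ae hV] with p hp h
    rw [h, velocity_reflect (ha.symm _ (Ioo_subset_Icc_self hp.1))]
  equations := by
    refine ⟨fun t q => (synth (fun l => om l (a t l)) q).re,
      fun t q => (synth (pcoef Ω (a t)) (q.1, q.2, 0)).re, ?_, ?_, ?_, h.weakContinuity ha hV, ?_⟩
    · exact ha.isFamily_om.memLp_re fun t ht q => conj_eq_iff_re.1
        (conj_synth (fun k => om_conj ((ha.symm t (Ioo_subset_Icc_self ht)).herm k) k) q)
    · filter_upwards [ae_mem_slab T] with p hp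
      rw [synth_reflect]
      have h1 := (ha.symm _ (Ioo_subset_Icc_self hp.1)).flip
      simp only [h1, om_flip, synth, neg_mul, tsum_neg, Complex.neg_re]
    · simp only [synth_pcoef]
      exact (ha.isFamily_pcoef Ω).integrable.re
    · rintro φ hφ ⟨T', hT', hφT⟩
      choose f hfi hfe hf using fun i => h.momentum hT ha hV₀ h0 (hφ i) (fun q => hφT i T q hT'.le) i
      have h1 := integral_re ((hfi 0).add (hfi 1))
      simp only [Pi.add_apply] at h1
      rw [integral_add (hfi 0) (hfi 1)] at h1
      have h2 : ∀ i, Integrable (fun q => V₀ q i * φ i (0, q)) μc := fun i => by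
        have hc : Continuous fun q => φ i (0, q) := by
          have := (hφ i).smooth.continuous
          fun_prop
        exact ((proj (𝕜 := ℝ) i).comp_memLp' hV₀).integrable_mul
          ((memLp_two_iff_integrable_sq hc.aestronglyMeasurable).2 (integrable_of_continuous (hc.pow 2)))
      simp only [Fin.sum_univ_two] at *
      rw [integral_add (h2 0) (h2 1)]
      have h3 := congrArg Complex.re (congrArg₂ (· + ·) (hf 0) (hf 1))
      simp only [add_re, Complex.ofReal_re, zero_re, add_zero] at h3
      refine Eq.trans ?_ h3
      simp only [RCLike.re_eq_complex_re, add_re] at h1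
      rw [add_add_add_comm]
      refine congrArg (· + _) (Eq.trans (integral_congr_ae ?_) h1)
      filter_upwards [IsRegularCurve.velocity_ae hV, hfe 0, hfe 1] with p hp e0 e1
      rw [hp, e0, e1]
      simp only [synth_pcoef]


/-! ### Analyticity -/

/-- The phase as a continuous linear map, times the imaginary unit. -/
def iphase (k : Mode) : Pt →L[ℝ] ℂ := I • ofRealCLM.comp
  (LinearMap.toContinuousLinearMap (⟨⟨phase k, fun a b => by simp [phase]; ring⟩,
    fun a b => by simp [phase]; ring⟩ : Pt →ₗ[ℝ] ℝ))

lemma iphase_apply (k) (q) : iphase k q = I * phase k q := rfl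

lemma wave_add_right (k) (q v) : wave k (q + v) = wave k q * Complex.exp (iphase k v) := by
  rw [iphase_apply, wave, wave, ← Complex.exp_add, ← mul_add, ← Complex.ofReal_add]
  congr 3
  simp [phase]; ring

lemma norm_iphase_le (k) : ‖iphase k‖ ≤ 2 * kh k + kz k := by
  have hk := kh_nonneg k
  have hz := kz_nonneg k
  refine ContinuousLinearMap.opNorm_le_bound _ pos! fun v => ?_
  rw [iphase_apply, norm_mul, norm_I, one_mul, norm_real]
  have h1 : |2 * π * (k.1 : ℝ)| ≤ kh k :=
    abs_le_of_sq_le_sq (by rw [kh_sq]; nlinarith [sq_nonneg (2 * π * (k.2.1 : ℝ))]) hk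
  have h2 : |2 * π * (k.2.1 : ℝ)| ≤ kh k :=
    abs_le_of_sq_le_sq (by rw [kh_sq]; nlinarith [sq_nonneg (2 * π * (k.1 : ℝ))]) hk
  have h3 : |π * (k.2.2 : ℝ)| = kz k := by rw [abs_mul, abs_of_pos Real.pi_pos, kz]
  have n1 := norm_fst_le v
  have n2 := (norm_fst_le v.2).trans (norm_snd_le v)
  have n3 := (norm_snd_le v.2).trans (norm_snd_le v)
  rw [norm_eq_abs] at n1 n2 n3 ⊢
  calc |phase k v| ≤ |2 * π * (k.1 : ℝ)| * |v.1| + |2 * π * (k.2.1 : ℝ)| * |v.2.1| +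
        |π * (k.2.2 : ℝ)| * |v.2.2| := by rw [← abs_mul, ← abs_mul, ← abs_mul]; exact abs_add_three _ _ _
    _ ≤ kh k * ‖v‖ + kh k * ‖v‖ + kz k * ‖v‖ := by rw [h3]; gcongr
    _ = _ := by ring

/-- A series of power series which converges absolutely on a ball is a power series. -/
lemma hasFPowerSeriesOnBall_tsum {ι E F : Type*} [NormedAddCommGroup E] [NormedSpace ℝ E]
    [NormedAddCommGroup F] [NormedSpace ℝ F] [CompleteSpace F] {f : ι → E → F}
    {p : ι → FormalMultilinearSeries ℝ E F} {q : E} {ρ} (hρ : 0 < ρ)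
    (hf : ∀ k y, HasSum (fun n => p k n fun _ => y) (f k (q + y)))
    (h : Summable fun x : ℕ × ι => ‖p x.2 x.1‖ * ρ ^ x.1) :
    HasFPowerSeriesOnBall (fun x => ∑' k, f k x) (fun n => ∑' k, p k n) q (ofReal ρ) := by
  have hn : ∀ n, Summable fun k => ‖p k n‖ := fun n => by
    have h1 : Summable fun k => ‖p k n‖ * ρ ^ n := h.prod_factor n
    exact (summable_mul_right_iff (pow_ne_zero n hρ.ne')).1 h1
  refine ⟨?_, by simpa using hρ, fun {y} hy => ?_⟩
  · refine FormalMultilinearSeries.le_radius_of_bound _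
      (r := ρ.toNNReal) (∑' x : ℕ × ι, ‖p x.2 x.1‖ * ρ ^ x.1) fun n => ?_
    rw [Real.coe_toNNReal _ hρ.le]
    calc _ ≤ (∑' k, ‖p k n‖) * ρ ^ n := by gcongr; exact norm_tsum_le_tsum_norm (hn n)
      _ = ∑' k, ‖p k n‖ * ρ ^ n := tsum_mul_right.symm
      _ ≤ ∑' n, ∑' k, ‖p k n‖ * ρ ^ n := h.prod.le_tsum n fun _ _ => tsum_nonneg fun k => pos!
      _ = _ := (h.tsum_prod).symm
  · have hy' : ‖y‖ < ρ := by rw [Metric.eball_ofReal] at hy; simpa using hy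
    have hs : Summable fun x : ℕ × ι => p x.2 x.1 fun _ => y := by
      refine Summable.of_norm_bounded h fun x => ((p x.2 x.1).le_opNorm _).trans ?_
      rw [Finset.prod_const, Finset.card_univ, Fintype.card_fin]
      gcongr
    have h1 := hs.hasSum.prod_fiberwise fun n =>
      (hn n).of_norm.hasSum.mapL (ContinuousMultilinearMap.apply ℝ (fun _ : Fin n => E) F fun _ => y)
    have h2 := ((Equiv.prodComm ι ℕ).hasSum_iff.2 hs.hasSum).prod_fiberwise fun k => hf k y
    rwa [← h2.tsum_eq] at h1

/-- Trigonometric series with exponentially decaying coefficients are real analytic. -/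
lemma analyticOnNhd_synth {c : Mode → ℂ} {α β : ℝ} (hα : 0 < α) (hβ : 0 < β)
    (hc : ∀ k, ‖c k‖ ≤ M * exp (-(α * kh k + β * kz k))) : AnalyticOnNhd ℝ (synth c) univ := fun q _ => by
  set ρ := min (α / 4) (β / 2) with hρ
  have hρ0 : 0 < ρ := lt_min lin! lin!
  have hsum : Summable fun k => ‖c k‖ * exp (‖iphase k‖ * ρ) := by
    refine Summable.of_nonneg_of_le (fun k => by positivity) (fun k => ?_)
      ((summable_mode_exp (half_pos hα) (half_pos hβ)).mul_left M)
    have hM : 0 ≤ M := nonneg_of_mul_nonneg_left ((norm_nonneg _).trans (hc 0)) (exp_pos _)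
    calc _ ≤ M * exp (-(α * kh k + β * kz k)) * exp ((2 * kh k + kz k) * ρ) := by
          gcongr
          · exact hc k
          · exact norm_iphase_le k
      _ ≤ _ := by
          rw [mul_assoc, ← exp_add]
          gcongr
          nlinarith [mul_le_mul_of_nonneg_left (min_le_left (α / 4) (β / 2)) (kh_nonneg k),
            mul_le_mul_of_nonneg_left (min_le_right (α / 4) (β / 2)) (kz_nonneg k)]
  have hexp : ∀ x : ℝ, HasSum (fun n => x ^ n / n.factorial) (exp x) := fun x => by
    rw [Real.exp_eq_exp_ℝ]; exact NormedSpace.expSeries_div_hasSum_exp x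
  refine (hasFPowerSeriesOnBall_tsum (p := fun k n => (c k * wave k q) •
    ((NormedSpace.expSeries ℝ ℂ n).compContinuousLinearMap fun _ => iphase k)) hρ0 (fun k y => ?_)
    (Summable.of_nonneg_of_le (fun x => by positivity) (fun x => ?_) (?_ : Summable fun x : ℕ × Mode =>
      ‖c x.2‖ * ((‖iphase x.2‖ * ρ) ^ x.1 / x.1.factorial)))).analyticAt
  · rw [wave_add_right, ← mul_assoc, Complex.exp_eq_exp_ℂ]
    refine ((NormedSpace.expSeries_div_hasSum_exp (iphase k y)).mul_left _).congr_fun fun n => ?_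
    simp [NormedSpace.expSeries, div_eq_inv_mul]
  · obtain ⟨n, k⟩ := x
    have h1 := ContinuousMultilinearMap.norm_compContinuousLinearMap_le (NormedSpace.expSeries ℝ ℂ n)
      fun _ => iphase k
    have h2 : ‖NormedSpace.expSeries ℝ ℂ n‖ ≤ (n.factorial : ℝ)⁻¹ := by
      rw [NormedSpace.expSeries, norm_smul, ContinuousMultilinearMap.norm_mkPiAlgebraFin, mul_one]
      simp
    rw [Finset.prod_const, Finset.card_univ, Fintype.card_fin] at h1
    calc _ ≤ ‖c k‖ * ((n.factorial : ℝ)⁻¹ * ‖iphase k‖ ^ n) * ρ ^ n := by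
          rw [norm_smul, norm_mul_wave]
          gcongr
          exact h1.trans (by gcongr)
      _ = _ := by rw [mul_pow]; ring
  · refine (Equiv.prodComm Mode ℕ).summable_iff.1 ((summable_prod_of_nonneg fun x => ?_).2
      ⟨fun k => ((hexp (‖iphase k‖ * ρ)).mul_left ‖c k‖).summable, hsum.congr fun k =>
        (((hexp (‖iphase k‖ * ρ)).mul_left ‖c k‖).tsum_eq).symm⟩)
    dsimp; positivity

lemma isAnalyticField_velocity {a} {α β} (hα : 0 < α) (hβ : 0 < β)
    (hs : IsSymmetric a) (h : ∀ k, ‖a k‖ ≤ M * exp (-(α * kh k + β * kz k))) :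
    IsAnalyticField (velocity a) := by
  refine ⟨velocity a, fun q _ => ?_, fun x y z => ?_, EventuallyEq.rfl⟩
  · have h1 : ∀ i, AnalyticAt ℝ (fun q => (synth (fun k => a k i) q).re) q := fun i =>
      (reCLM.analyticAt _).comp (analyticOnNhd_synth hα hβ
        (fun k => (norm_cvel_apply_le _ i).trans (h k)) q trivial)
    exact ((PiLp.continuousLinearEquiv 2 ℝ fun _ : Fin 2 => ℝ).symm.toContinuousLinearMap.analyticAt
      _).comp (AnalyticAt.pi h1)
  · have h1 := fun i => synth_periodic (fun k => a k i) x y z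
    refine ⟨?_, ?_, ?_, velocity_reflect hs (x, y, z)⟩ <;> simp only [velocity, h1]


/-! ### Existence of solutions -/

lemma tsum_one_add_kh_mul_sq_le (hr : 2 < r) (hτ : 0 ≤ τ) (hη : 0 ≤ η)
    (A) : (∑' k, ofReal (1 + kh k) * A k) ^ 2 ≤
      latticeConst r * (ofReal (2 * (2 ^ r) ^ 2) * (energyE r τ η A + energyF r τ η A)) := by
  have h1 : ∀ k, ofReal (1 + kh k) * A k = ofReal (hDecay r k * vDecay k) *
      (ofReal ((1 + kh k) ^ r * (1 + kz k)) * A k) := fun k => by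
    have hk : 0 < 1 + kh k := by linarith [kh_nonneg k]
    have hz : 0 < 1 + kz k := by linarith [kz_nonneg k]
    have e : (1 + kh k) ^ (1 - r) * (1 + kh k) ^ r = 1 + kh k := by
      rw [← rpow_add hk, sub_add_cancel, Real.rpow_one]
    rw [← mul_assoc, ← ofReal_mul (mul_pos (hDecay_pos r k) (vDecay_pos k)).le, hDecay, vDecay,
      mul_mul_mul_comm, e, inv_mul_cancel₀ hz.ne', mul_one]
  simp only [h1]
  refine (pow_le_pow_left' (tsum_mul_le_sqrt _ _) 2).trans ?_
  rw [mul_pow, ennreal_sqrt_sq, ennreal_sqrt_sq]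
  refine mul_le_mul' ?_ ?_
  · have := tsum_decay_sq_le hr id id (Equiv.refl ℤ) (Equiv.refl ℤ) (Equiv.refl ℤ) (fun _ => rfl)
      (fun _ => rfl) fun _ => rfl
    refine le_trans (tsum_le_tsum fun k => ?_) this
    rw [← ofReal_pow (mul_pos (hDecay_pos r k) (vDecay_pos k)).le, id]
  · unfold energyE energyF
    rw [← wsum_add (fun k => weight_nonneg) (fun k => by have := weight_pos r τ η k; positivity),
      ← wsum_const_mul pos!]
    refine tsum_le_tsum fun k => ?_
    have hk := kh_nonneg k
    have hz := kz_nonneg k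
    rw [mul_pow, ← ofReal_pow pos!]
    gcongr
    have h2 : ((1 + kh k) ^ r) ^ 2 ≤ (2 ^ r) ^ 2 * weight r 0 τ η k := by
      calc _ ≤ pw r τ η k ^ 2 := by
            unfold pw
            gcongr
            exact le_mul_of_one_le_right pos! (one_le_amp hτ hη k)
        _ ≤ _ := (pw_sq_le_core lin! τ η k).trans (by gcongr; exact core_le_weight r τ η k)
    calc _ = ((1 + kh k) ^ r) ^ 2 * (1 + kz k) ^ 2 := mul_pow _ _ _
      _ ≤ (2 ^ r) ^ 2 * weight r 0 τ η k * (2 * (1 + kz k ^ 2)) := by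
          have := weight_pos r τ η k
          gcongr
          nlinarith [sq_nonneg (1 - kz k)]
      _ = _ := by ring

lemma weight_one_le (r τ η) (k) : weight r 1 τ η k ≤ weight r 0 τ η k + kz k ^ 2 * weight r 0 τ η k := by
  have h : 0 ≤ kh k ^ (2 * r) := rpow_nonneg (kh_nonneg k) _
  have h1 := exp_pos (2 * τ * kh k)
  have h2 := exp_pos (2 * η * kz k)
  have h3 : 0 ≤ kz k ^ 2 * (1 + kh k ^ (2 * r) * exp (2 * τ * kh k) * exp (2 * η * kz k)) +
    exp (2 * τ * kh k) * exp (2 * η * kz k) := pos!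
  unfold weight
  simp only [mul_zero, pow_zero, mul_one]
  linarith

/-- Termwise convergence and an upper bound for the weighted norms give convergence in `ℓ²`. -/
lemma tendsto_tsum_norm_sub_sq {ι α E : Type*} [NormedAddCommGroup E] {l : Filter α} {w : α → ι → ℝ}
    {w₀ : ι → ℝ} {a : α → ι → E} {b : ι → E} (hw : ∀ k, Tendsto (w · k) l (𝓝 (w₀ k)))
    (hw1 : ∀ s k, 1 ≤ w s k) (hw0 : ∀ k, 1 ≤ w₀ k) (ha : ∀ k, Tendsto (a · k) l (𝓝 (b k)))
    (hb : Summable fun k => w₀ k * ‖b k‖ ^ 2) (h : ∀ᶠ s in l, Summable (fun k => w s k * ‖a s k‖ ^ 2) ∧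
      ∑' k, w s k * ‖a s k‖ ^ 2 ≤ ∑' k, w₀ k * ‖b k‖ ^ 2) :
    Tendsto (fun s => ∑' k, ‖a s k - b k‖ ^ 2) l (𝓝 0) := by
  set f := fun s k => w s k * ‖a s k‖ ^ 2 with hf
  set g := fun k => w₀ k * ‖b k‖ ^ 2 with hg
  have hft : ∀ k, Tendsto (f · k) l (𝓝 (g k)) := fun k => (hw k).mul ((ha k).norm.pow 2)
  set u := fun s k => 4 * max (g k - f s k) 0 + max (‖a s k - b k‖ ^ 2 - 2 * |f s k - g k|) 0 with hu
  have hsq : ∀ s k, ‖a s k - b k‖ ^ 2 ≤ 2 * f s k + 2 * g k := fun s k => by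
    have h1 := norm_sub_le (a s k) (b k)
    have h2 : ‖a s k‖ ^ 2 ≤ f s k := le_mul_of_one_le_left pos! (hw1 s k)
    have h3 : ‖b k‖ ^ 2 ≤ g k := le_mul_of_one_le_left pos! (hw0 k)
    nlinarith [norm_nonneg (a s k - b k), sq_nonneg (‖a s k‖ - ‖b k‖)]
  have hf0 : ∀ s k, 0 ≤ f s k := fun s k => mul_nonneg (by linarith [hw1 s k]) pos!
  have hg0 : ∀ k, 0 ≤ g k := fun k => mul_nonneg (by linarith [hw0 k]) pos!
  have hu0 : ∀ s k, 0 ≤ u s k := fun s k => pos!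
  have hub : ∀ s k, u s k ≤ 8 * g k := fun s k => by
    have h1 : max (g k - f s k) 0 ≤ g k := max_le (by linarith [hf0 s k]) (hg0 k)
    have h2 : max (‖a s k - b k‖ ^ 2 - 2 * |f s k - g k|) 0 ≤ 4 * g k :=
      max_le (by linarith [hsq s k, le_abs_self (f s k - g k)]) (by linarith [hg0 k])
    linarith
  have hlim : Tendsto (fun s => ∑' k, u s k) l (𝓝 (∑' k : ι, 0)) := by
    refine tendsto_tsum_of_dominated_convergence (hb.mul_left 8) (fun k => ?_)
      (.of_forall fun s k => by rw [Real.norm_of_nonneg (hu0 s k)]; exact hub s k)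
    have h1 := (tendsto_const_nhds (x := g k)).sub (hft k)
    have h2 := (((ha k).sub_const (b k)).norm.pow 2).sub (((hft k).sub_const (g k)).abs.const_mul 2)
    have := ((h1.max (tendsto_const_nhds (x := 0))).const_mul 4).add (h2.max (tendsto_const_nhds (x := 0)))
    simpa using this
  rw [tsum_zero] at hlim
  refine tendsto_of_tendsto_of_tendsto_of_le_of_le' tendsto_const_nhds hlim
    (.of_forall fun s => tsum_nonneg fun k => by positivity) ?_
  filter_upwards [h] with s ⟨h1, h2⟩
  have hus : Summable (u s) := Summable.of_nonneg_of_le (hu0 s) (hub s) (hb.mul_left 8)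
  have hd : Summable fun k => ‖a s k - b k‖ ^ 2 :=
    Summable.of_nonneg_of_le (fun k => by positivity) (hsq s) ((h1.mul_left 2).add (hb.mul_left 2))
  have h3 : ∀ k, ‖a s k - b k‖ ^ 2 ≤ u s k + 2 * (f s k - g k) := fun k => by
    have h4 := le_max_left (‖a s k - b k‖ ^ 2 - 2 * |f s k - g k|) 0
    have h5 : |f s k - g k| = 2 * max (g k - f s k) 0 + (f s k - g k) := by
      rcases le_total (f s k) (g k) with h | h
      · rw [abs_of_nonpos lin!, max_eq_left lin!]; ring
      · rw [abs_of_nonneg lin!, max_eq_right lin!]; ring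
    simp only [hu]
    linarith
  refine (hd.tsum_le_tsum h3 (hus.add ((h1.sub hb).mul_left 2))).trans ?_
  rw [hus.tsum_add ((h1.sub hb).mul_left 2), tsum_mul_left, h1.tsum_sub hb]
  linarith

lemma toReal_wsum (hw : ∀ k, 0 ≤ w k) {a : Coef} (h : wsum w N[a] < ⊤) : Summable (fun k => w k * ‖a k‖ ^ 2) ∧
      wsum w N[a] = ofReal (∑' k, w k * ‖a k‖ ^ 2) := by
  have e : wsum w N[a] = ∑' k, ofReal (w k * ‖a k‖ ^ 2) := tsum_congr fun k => by
    rw [ofReal_mul (hw k), ofReal_pow (norm_nonneg _), ofReal_norm]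
  have h0 : ∀ k, 0 ≤ w k * ‖a k‖ ^ 2 := fun k => mul_nonneg (hw k) pos!
  rw [e] at h ⊢
  have hs := (ENNReal.summable_toReal h.ne).congr fun k => toReal_ofReal (h0 k)
  exact ⟨hs, (ENNReal.ofReal_tsum_of_nonneg h0 hs).symm⟩

lemma tendsto_eLpNorm_of_fc {S : Set ℝ} (ht : t ∈ S)
    (hV : ∀ s ∈ S, MemLp (V s) 2 μc) (ha : ∀ s ∈ S, fc (V s) = a s)
    (h : Tendsto (fun s => ∑' k, ‖a s k - a t k‖ ^ 2) (𝓝[S] t) (𝓝 0)) :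
    Tendsto (fun s => eLpNorm (V s - V t) 2 μc) (𝓝[S] t) (𝓝 0) := by
  have h1 : Tendsto (fun s => (2 * ofReal (∑' k, ‖a s k - a t k‖ ^ 2)) ^ ½) (𝓝[S] t) (𝓝 0) := by
    have := (ENNReal.continuous_rpow_const (y := 1 / 2)).tendsto _ |>.comp
      (ENNReal.Tendsto.const_mul (tendsto_ofReal h) (Or.inr ENNReal.ofNat_ne_top) (a := 2))
    simpa [Function.comp_def] using this
  refine h1.congr' ?_
  filter_upwards [self_mem_nhdsWithin] with s hs
  have h2 := (hV s hs).sub (hV t ht)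
  have h3 := eLpNorm_sq_eq h2
  have h4 := toReal_wsum (w := fun _ => 1) (a := fc (V s - V t)) (fun _ => zero_le_one) (by
    have : ∑' k, ‖fc (V s - V t) k‖ₑ ^ 2 ≠ ⊤ := fun h' => by
      rw [h', ENNReal.mul_top two_ne_zero] at h3
      exact ENNReal.pow_ne_top h2.2.ne h3
    simpa [wsum, lt_top_iff_ne_top] using this)
  simp only [wsum, ofReal_one, one_mul] at h4
  rw [h4.2] at h3
  simp only [fc_sub (hV s hs) (hV t ht), ha s hs, ha t ht] at h3
  rw [← h3, ← ENNReal.rpow_natCast, ← rpow_mul]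
  norm_num


/-- Continuity at the initial time. -/
lemma tendsto_initial {τ} (ha : ∀ k, Tendsto (fun s => a s k) (𝓝[Icc 0 T] 0) (𝓝 (a 0 k)))
    (hτ : Tendsto τ (𝓝[Icc 0 T] 0) (𝓝 τ₀)) (h0 : energyE r τ₀ 0 N[a 0] < ⊤)
    (hE : ∀ s ∈ Icc 0 T, energyE r (τ s) (ν / 2 * s) N[a s] ≤ energyE r τ₀ 0 N[a 0]) :
    Tendsto (fun s => ∑' k, ‖a s k - a 0 k‖ ^ 2) (𝓝[Icc 0 T] 0) (𝓝 0) := by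
  obtain ⟨h1, h2⟩ := toReal_wsum (fun k => (weight_pos r τ₀ 0 k).le) h0
  refine tendsto_tsum_norm_sub_sq (w := fun s => weight r 0 (τ s) (ν / 2 * s)) (fun k => ?_)
    (fun s => one_le_weight _ _ _) (one_le_weight _ _ _) ha h1 (eventually_mem_nhdsWithin.mono fun s hs => ?_)
  · have h3 := (contDiff_weight r ν k).continuous.tendsto (τ₀, 0)
    have h4 : Tendsto (fun s => (τ s, s)) (𝓝[Icc 0 T] 0) (𝓝 (τ₀, 0)) := hτ.prodMk_nhds nhdsWithin_le_nhds
    have h5 := h3.comp h4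
    simp only [mul_zero] at h5
    exact h5
  · obtain ⟨h3, h4⟩ := toReal_wsum (fun k => (weight_pos r (τ s) (ν / 2 * s) k).le) ((hE s hs).trans_lt h0)
    have h5 := hE s hs
    rw [energyE, h4, energyE, h2] at h5
    exact ⟨h3, (ENNReal.ofReal_le_ofReal_iff (tsum_nonneg fun k => mul_nonneg weight_nonneg pos!)).1 h5⟩

/-- Continuity at positive times. -/
lemma tendsto_positive {S : Set ℝ} {α β} (hα : 0 < α) (hβ : 0 < β)
    (ha : ∀ k, Tendsto (fun s => a s k) (𝓝[S] t) (𝓝 (a t k)))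
    (h : ∀ᶠ s in 𝓝[S] t, ∀ k, ‖a s k‖ ≤ M * exp (-(α * kh k + β * kz k)))
    (ht : ∀ k, ‖a t k‖ ≤ M * exp (-(α * kh k + β * kz k))) :
    Tendsto (fun s => ∑' k, ‖a s k - a t k‖ ^ 2) (𝓝[S] t) (𝓝 0) := by
  have h1 := tendsto_tsum_of_dominated_convergence (𝓕 := 𝓝[S] t)
    (f := fun s k => ‖a s k - a t k‖ ^ 2) (g := fun _ => 0)
    ((summable_mode_exp (mul_pos two_pos hα) (mul_pos two_pos hβ)).mul_left ((2 * M) ^ 2)) (fun k => by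
      have := (((ha k).sub_const (a t k)).norm.pow 2)
      simpa using this) (by
      filter_upwards [h] with s hs k
      have h5 := (norm_sub_le (a s k) (a t k)).trans (add_le_add (hs k) (ht k))
      rw [norm_pow, norm_norm]
      refine (pow_le_pow_left₀ (norm_nonneg _) h5 2).trans_eq ?_
      rw [← two_mul, ← mul_assoc, mul_pow, ← Real.exp_nat_mul]
      congr 2
      push_cast; ring)
  simpa using h1

/-- Existence of analytic solutions. -/
lemma exists_analyticSolution (hr : 2 < r) : ∃ C₀ : ℝ, 0 < C₀ ∧
    ∀ C ν Ω T τ₀ : ℝ, C₀ ≤ C → 0 < ν → 0 < T → 0 < τ₀ → ∀ V₀ : Pt → Vel, IsInitialDatum r τ₀ V₀ →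
    maxLoss C ν (dataNorm r τ₀ V₀) T ≤ τ₀ / 2 → ∃ (V : ℝ → Pt → Vel) (τ : ℝ → ℝ),
      IsAnalyticSolution C r ν Ω τ₀ T V₀ V τ ∧ ∀ t ∈ Ioc 0 T, IsAnalyticField (V t) := by
  obtain ⟨C₀, hC₀, H⟩ := exists_isModeSolution hr
  refine ⟨C₀, hC₀, fun C ν Ω T τ₀ hC hν hT hτ₀ V₀ hV₀ hmax => ?_⟩
  set M := dataNorm r τ₀ V₀ with hM
  have hM0 : 0 ≤ M := sqrt_nonneg _
  have hC0 : 0 ≤ C := hC₀.le.trans hC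
  have h₀ : energyE r τ₀ 0 N[fc V₀] = ofReal (M ^ 2) := by
    rw [hM, dataNorm, sq_sqrt toReal_nonneg, ofReal_toReal hV₀.memS.norm_lt_top.ne, normSq_zero_eq]
  obtain ⟨a, τ, ha, ha0, hsym, hE, hF, hloss, hτ, hlow⟩ := H C ν Ω T τ₀ M hC hν hT.le hτ₀ hM0 hmax (fc V₀)
    ⟨fc_flip hV₀.memS.even, fc_neg V₀⟩ hV₀.isSolenoidal h₀.le
  have hhalf : ∀ t ∈ Icc 0 T, τ₀ / 2 ≤ τ t := fun t ht => by linarith [hlow t ht, maxLoss_mono hC0 hν hM0 ht.2]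
  have hcont := ha.continuousOn hT.le
  have hdec : ∀ u, 0 ≤ u → ∀ t ∈ Icc 0 T, u ≤ t → ∀ k,
      ‖a t k‖ ≤ M * exp (-(τ₀ / 2 * kh k + ν / 2 * u * kz k)) := fun u hu t ht hut k => by
    have h1 := norm_le_of_energyE_le hM0 ((hE t ht).trans h₀.le) k
    have h2 : exp (τ₀ / 2 * kh k + ν / 2 * u * kz k) ≤ amp (τ t) (ν / 2 * t) k := by
      have := kh_nonneg k
      have := kz_nonneg k
      unfold amp
      gcongr
      exact hhalf t ht
    rw [Real.exp_neg, ← div_eq_mul_inv, le_div_iff₀ (exp_pos _), mul_comm]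
    exact (mul_le_mul_of_nonneg_right h2 (norm_nonneg _)).trans h1
  have hsum : ∀ t ∈ Ioc 0 T, Summable fun k => ‖a t k‖ := fun t ht =>
    Summable.of_nonneg_of_le (fun _ => norm_nonneg _) (hdec t ht.1.le t ⟨ht.1.le, ht.2⟩ le_rfl)
      ((summable_mode_exp (half_pos hτ₀) (mul_pos (half_pos hν) ht.1)).mul_left M)
  have hreg : IsRegularCurve T a := by
    refine ⟨hcont, hsym, ?_⟩
    calc _ ≤ ∫⁻ t in Ioo 0 T, latticeConst r * ofReal (2 * (2 ^ r) ^ 2) *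
          (ofReal (M ^ 2) + energyF r (τ t) (ν / 2 * t) N[a t]) := by
          refine setLIntegral_mono' measurableSet_Ioo fun t ht => ?_
          have ht' := Ioo_subset_Icc_self ht
          refine (tsum_one_add_kh_mul_sq_le hr ((half_pos hτ₀).le.trans (hhalf t ht'))
            (mul_pos (half_pos hν) ht.1).le _).trans ?_
          rw [mul_assoc]
          gcongr
          exact (hE t ht').trans h₀.le
      _ < ⊤ := by
          have hne := (mul_lt_top (latticeConst_lt_top hr) (ofReal_lt_top (r := 2 * (2 ^ r) ^ 2)))
          rw [lintegral_const_mul' _ _ hne.ne, lintegral_add_left measurable_const]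
          exact mul_lt_top hne (add_lt_top.2 ⟨by simp [mul_lt_top], hF⟩)
  set V := fun t => if 0 < t then velocity (a t) else V₀ with hV
  have hVpos : ∀ t, 0 < t → V t = velocity (a t) := fun t ht => if_pos ht
  have hV0 : V 0 = V₀ := if_neg (lt_irrefl 0)
  have hVm : ∀ t ∈ Icc 0 T, MemLp (V t) 2 μc ∧ fc (V t) = a t := fun t ht => by
    rcases ht.1.eq_or_lt with h | h
    · rw [← h, hV0]; exact ⟨hV₀.memS.memLp, (funext ha0).symm⟩
    · rw [hVpos t h]
      have := hsum t ⟨h, ht.2⟩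
      exact ⟨memLp_velocity this 2, fc_velocity (hsym t ht) this⟩
  have hEfin : ∀ t ∈ Icc 0 T, energyE r (τ t) (ν / 2 * t) N[a t] < ⊤ := fun t ht =>
    ((hE t ht).trans h₀.le).trans_lt ofReal_lt_top
  have hns : ∀ t ∈ Icc 0 T, ∀ s, normSq r s (τ t) (verticalRadius ν t) (V t) =
      wsum (weight r s (τ t) (ν / 2 * t)) N[a t] := fun t ht s => by rw [normSq_eq, (hVm t ht).2]; rfl
  have hN1 : ∀ t ∈ Icc 0 T, normSq r 1 (τ t) (verticalRadius ν t) (V t) ≤ ofReal (M ^ 2) +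
      energyF r (τ t) (ν / 2 * t) N[a t] := fun t ht => by
    rw [hns t ht]
    refine (wsum_mono (weight_one_le r (τ t) (ν / 2 * t)) _).trans ?_
    rw [wsum_add (fun k => weight_nonneg) fun k => by
      have := weight_pos r (τ t) (ν / 2 * t) k; positivity]
    exact add_le_add_left ((hE t ht).trans h₀.le) _
  have he : ∀ t ≤ T, ∫⁻ s in Ioo 0 t, lossRate r ν (τ s) (verticalRadius ν s) (V s) =
      ∫⁻ s in Ioo 0 t, loss r ν (τ s) (ν / 2 * s) N[a s] := fun t ht =>
    setLIntegral_congr_fun measurableSet_Ioo fun s hs => by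
      rw [lossRate_eq, (hVm s ⟨hs.1.le, hs.2.le.trans ht⟩).2]; rfl
  have hae : ∀ᵐ t ∂vol[T], energyF r (τ t) (ν / 2 * t) N[a t] < ⊤ := by
    filter_upwards [ae_lt_top' (aemeasurable_loss (aemeasurable_radius hC0 hloss hτ) hcont) hloss.ne] with t ht
    refine lt_top_iff_ne_top.2 fun h => ?_
    simp [loss, h] at ht
  refine ⟨V, τ, ⟨ha.isWeakSolution hT hreg hV₀.memS.memLp ha0 fun t ht => hVpos t ht.1, ?_, ?_, ?_⟩, ?_⟩
  · refine ⟨fun t ht => (hVm t ht).1, fun t ht => ?_, by rw [hV0]⟩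
    refine tendsto_eLpNorm_of_fc ht (fun s hs => (hVm s hs).1) (fun s hs => (hVm s hs).2) ?_
    rcases ht.1.eq_or_lt with h | h
    · subst h
      refine tendsto_initial (r := r) (τ₀ := τ₀) (ν := ν) (τ := τ) (fun k => hcont k 0 ht) ?_ ?_ ?_
      · refine tendsto_of_tendsto_of_tendsto_of_le_of_le' (g := fun s => τ₀ - maxLoss C ν M s) ?_
          tendsto_const_nhds (eventually_mem_nhdsWithin.mono hlow)
          (eventually_mem_nhdsWithin.mono fun s hs => ?_)
        · have := (tendsto_maxLoss C ν M).mono_left (nhdsWithin_le_nhds (s := Icc 0 T))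
          simpa using this.const_sub τ₀
        · rw [hτ s hs]
          exact sub_le_self _ (mul_nonneg hC0 toReal_nonneg)
      · rw [funext ha0, h₀]; exact ofReal_lt_top
      · rw [funext ha0]; exact hE
    · refine tendsto_positive (half_pos hτ₀) (mul_pos (half_pos hν) (half_pos h))
        (fun k => hcont k t ht) ?_ (hdec (t / 2) lin! t ht lin!)
      have h2 : ∀ᶠ s in 𝓝[Icc 0 T] t, t / 2 ≤ s := nhdsWithin_le_nhds (eventually_ge_nhds lin!)
      filter_upwards [self_mem_nhdsWithin, h2] with s hs h2
      exact hdec (t / 2) lin! s hs h2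
  · refine ⟨?_, ⟨(M ^ 2).toNNReal, ?_⟩, ?_⟩
    · filter_upwards [hae, ae_restrict_mem measurableSet_Ioo] with t h1 ht
      have ht' := Ioo_subset_Icc_self ht
      have hev : ∀ᵐ q ∂μc, V t (reflect q) = V t q := .of_forall fun q => by
        rw [hVpos t ht.1, velocity_reflect (hsym t ht')]
      refine ⟨⟨(hVm t ht').1, hev, by rw [hns t ht']; exact hEfin t ht'⟩, ⟨(hVm t ht').1, hev,
        (hN1 t ht').trans_lt (add_lt_top.2 ⟨ofReal_lt_top, h1⟩)⟩⟩
    · filter_upwards [ae_restrict_mem measurableSet_Ioo] with t ht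
      have ht' := Ioo_subset_Icc_self ht
      rw [hns t ht']
      exact (hE t ht').trans h₀.le
    · refine (setLIntegral_mono' measurableSet_Ioo fun t ht => hN1 t (Ioo_subset_Icc_self ht)).trans_lt ?_
      rw [lintegral_add_left measurable_const]
      exact add_lt_top.2 ⟨by simp [mul_lt_top], hF⟩
  · exact ⟨by rw [he T le_rfl]; exact hloss, fun t ht => by rw [he t ht.2]; exact hτ t ht, hlow, hhalf⟩
  · intro t ht
    rw [hVpos t ht.1]
    exact isAnalyticField_velocity (half_pos hτ₀) (mul_pos (half_pos hν) ht.1) (hsym t ⟨ht.1.le, ht.2⟩)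
      (hdec t ht.1.le t ⟨ht.1.le, ht.2⟩ le_rfl)

end PrimEq

end

theorem theorem3p3 (r : ℝ) (hr : 2 < r) :
    ∃ C : ℝ, 0 < C ∧ ∀ ν τ₀ : ℝ, 0 < ν → 0 < τ₀ → ∃ K : ℝ, 0 < K ∧ ∀ Ω T : ℝ, 0 < T →
      -- existence, uniqueness and analyticity
      (∀ V₀ : PrimEq.Pt → PrimEq.Vel, PrimEq.IsInitialDatum r τ₀ V₀ →
        PrimEq.maxLoss C ν (PrimEq.dataNorm r τ₀ V₀) T ≤ τ₀ / 2 →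
        ∃ (V : ℝ → PrimEq.Pt → PrimEq.Vel) (τ : ℝ → ℝ),
          PrimEq.IsAnalyticSolution C r ν Ω τ₀ T V₀ V τ ∧
          (∀ V' : ℝ → PrimEq.Pt → PrimEq.Vel, PrimEq.IsWeakSolution ν Ω T V₀ V' →
            PrimEq.InAnalyticClass r ν T τ V' →
            ∀ᵐ t ∂volume.restrict (Ioo 0 T), V' t =ᵐ[PrimEq.cellMeasure] V t) ∧
          (∀ t ∈ Ioc 0 T, PrimEq.IsAnalyticField (V t))) ∧
      -- continuous dependence on the initial data
      (∀ (V₀₁ V₀₂ : PrimEq.Pt → PrimEq.Vel) (V₁ V₂ : ℝ → PrimEq.Pt → PrimEq.Vel) (τ₁ τ₂ : ℝ → ℝ),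
        PrimEq.IsInitialDatum r τ₀ V₀₁ → PrimEq.IsInitialDatum r τ₀ V₀₂ →
        PrimEq.maxLoss C ν (PrimEq.dataNorm r τ₀ V₀₁) T ≤ τ₀ / 2 →
        PrimEq.maxLoss C ν (PrimEq.dataNorm r τ₀ V₀₂) T ≤ τ₀ / 2 →
        PrimEq.IsAnalyticSolution C r ν Ω τ₀ T V₀₁ V₁ τ₁ →
        PrimEq.IsAnalyticSolution C r ν Ω τ₀ T V₀₂ V₂ τ₂ →
        ∀ t ∈ Icc 0 T,
          PrimEq.normSq (r - 1 / 2) 0 (τ₁ t + τ₂ t - τ₀) (PrimEq.verticalRadius ν t) (V₁ t - V₂ t) ≤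
            ENNReal.ofReal K * PrimEq.normSq (r - 1 / 2) 0 τ₀ 0 (V₀₁ - V₀₂)) := by
  obtain ⟨C₁, hC₁, hex⟩ := PrimEq.exists_analyticSolution hr
  obtain ⟨C₂, hC₂, hdep⟩ := PrimEq.exists_continuous_dependence hr
  refine ⟨max C₁ C₂, lt_max_of_lt_left hC₁, fun ν τ₀ hν hτ₀ => ⟨Real.exp τ₀, Real.exp_pos _,
    fun Ω T hT => ⟨fun V₀ hV₀ hmax => ?_, fun V₀₁ V₀₂ V₁ V₂ τ₁ τ₂ h₁ h₂ _ _ hs₁ hs₂ =>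
      hdep _ ν Ω τ₀ T (le_max_right _ _) hν hT V₀₁ V₀₂ V₁ V₂ τ₁ τ₂ h₁ h₂ hs₁ hs₂⟩⟩⟩
  obtain ⟨V, τ, hV, han⟩ := hex _ ν Ω T τ₀ (le_max_left _ _) hν hT hτ₀ V₀ hV₀ hmax
  exact ⟨V, τ, hV, fun V' h' hc' => hV.sol.unique hr hν hT (half_pos hτ₀) hV₀.memS.memLp hV₀.isSolenoidal
    (fun t ht => hV.radius.half t (Ioo_subset_Icc_self ht)) h' hV.cls hc', han⟩
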